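/- Let $X$ be a complex manifold (Hausdorff, second countable) with a holomorphic symplectic form $\omega$, i.e. a closed nondegenerate holomorphic $2$-form. Let $T_X^\vee$ be its holomorphic cotangent bundle, with local frame $\delta_z^i$ dual to $\partial_{z^i}$ for local holomorphic coordinates $z$, and let $\mathcal W=\mathcal A_X^*\otimes_{\mathcal O_X}\widehat{\mathrm{Sym}}(T_X^\vee)[[\hbar]]$ be the holomorphic Weyl bundle, where $\mathcal A_X^*$ are the smooth complex differential forms. Elements of $\mathcal A_X^{*}\otimes\mathrm{Sym}^r(T_X^\vee)$ have weight $r$, and $\hbar$ has weight $2$. Let $$a\circ b=\sum_{m\ge 0}\frac{\hbar^m}{m!}\,\omega^{i_1j_1}\cdots\omega^{i_mj_m}\,\frac{\partial^m a}{\partial\delta_z^{i_1}\cdots\partial\delta_z^{i_m}}\wedge\frac{\partial^m b}{\partial\delta_z^{j_1}\cdots\partial\delta_z^{j_m}}$$ be the Weyl product, $(\omega^{ij})$ being the inverse matrix of $(\omega_{ij})$, let $[-,-]_{\mathcal W}$ be its graded commutator (graded by the form degree), and put $\delta a=dz^i\wedge\partial a/\partial\delta_z^i$. (0) There is a smooth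 torsion-free connection $\nabla$ on $T_X$ that is compatible with the complex structure and satisfies $\nabla\omega=0$. For every such $\nabla$ (which induces an exterior covariant derivative $\nabla$ on $\mathcal W$): (1) There is a smooth global $1$-form $I$ with values in $\mathcal W$, of weight $\ge 3$, such that $D=\nabla-\delta+\frac1\hbar[I,-]_{\mathcal W}$ is flat modulo $\hbar$, i.e. $D^2\equiv 0 \pmod\hbar$. (2) For every smooth global $\mathcal W$-valued $1$-form $I$ of weight $\ge 3$, the bracket $[I,-]_{\mathcal W}$ is divisible by $\hbar$, the operator $D=\nabla-\delta+\frac1\hbar[I,-]_{\mathcal W}$ is a connection on $\mathcal W$ (a $\mathbb C$-linear morphism of sheaves with $D(fs)=df\wedge s+fDs$ for smooth functions $f$), and it induces an operator on $\mathcal W/\hbar\mathcal W=\mathcal A_X^*\otimes_{\mathcal O_X}\widehat{\mathrm{Sym}}(T_X^\vee)$. (3) If such a $D$ is flat modulo $\hbar$, then the projection $\pi_0$ onto the component of form type $(0,*)$ and weight $0$ is a morphism of cochain complexes of sheaves of complex vector spaces $$\pi_0:(\mathcal W/\hbar\mathcal W,\,D)\longrightarrow(\mathcal A_X^{0,*},\,\bar\partial)$$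 to the Dolbeault complex of $\mathcal O_X$, and it is a quasi-isomorphism. -/

import Mathlib

set_option linter.unusedSectionVars false
open CategoryTheory TopologicalSpace Opposite
open scoped Topology Manifold ContDiff

namespace HolWeyl

/-! ### Sheaves of functions given by local conditions -/

/-- A condition at the points of `X` on functions with values in a vector space `V` which is local
and compatible with linear combinations. The sections over an open set `U` of the associated sheaf
are the functions on `U` that satisfy the condition at every point of `U`. -/
structure LocalCondition (X : Type) [TopologicalSpace X] (V : Type) [AddCommGroup V]
    [Module ℂ V] where
  Holds : (X → V) → X → Prop
  congr : ∀ {s t : X → V} {x : X}, s =ᶠ[𝓝 x] t → Holds s x → Holds t x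
  zero : ∀ x, Holds 0 x
  add : ∀ {s t : X → V} {x : X}, Holds s x → Holds t x → Holds (s + t) x
  smul : ∀ (c : ℂ) {s : X → V} {x : X}, Holds s x → Holds (c • s) x

section Sheaves

variable {X : Type} [TopologicalSpace X] {V V' V'' : Type} [AddCommGroup V] [Module ℂ V]
  [AddCommGroup V'] [Module ℂ V'] [AddCommGroup V''] [Module ℂ V'']

open Classical in
/-- Extension of a function on `U` by zero. -/
noncomputable def extendZero (U : Set X) (s : U → V) : X → V :=
  fun x => if h : x ∈ U then s ⟨x, h⟩ else 0

theorem extendZero_apply {U : Set X} (s : U → V) (x : U) : extendZero U s x = s x := by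
  simp [extendZero]

theorem extendZero_add {U : Set X} (s t : U → V) :
    extendZero U (s + t) = extendZero U s + extendZero U t := by
  funext x
  by_cases h : x ∈ U <;> simp [extendZero, h]

theorem extendZero_smul {U : Set X} (c : ℂ) (s : U → V) :
    extendZero U (c • s) = c • extendZero U s := by
  funext x
  by_cases h : x ∈ U <;> simp [extendZero, h]

theorem extendZero_zero {U : Set X} : extendZero U (0 : U → V) = 0 := by
  funext x
  simp [extendZero]

theorem extendZero_eventuallyEq {U W : Set X} (hW : IsOpen W)
    (s : U → V) (t : W → V) (h : ∀ x (hU : x ∈ U) (hW : x ∈ W), s ⟨x, hU⟩ = t ⟨x, hW⟩)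
    (hWU : W ⊆ U) {x : X} (hx : x ∈ W) : extendZero U s =ᶠ[𝓝 x] extendZero W t := by
  filter_upwards [hW.mem_nhds hx] with y hy
  simp [extendZero, hy, hWU hy, h y (hWU hy) hy]

/-- The `ℂ`-vector space of sections over `U`. -/
def LocalCondition.sections (P : LocalCondition X V) (U : Opens X) : Submodule ℂ (U → V) where
  carrier := {s | ∀ x : U, P.Holds (extendZero (U : Set X) s) x}
  zero_mem' x := by
    change P.Holds (extendZero (U : Set X) 0) x
    rw [extendZero_zero]; exact P.zero _
  add_mem' {a b} ha hb x := by
    rw [extendZero_add]; exact P.add (ha x) (hb x)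
  smul_mem' c a ha x := by
    rw [extendZero_smul]; exact P.smul c (ha x)

/-- Restriction of sections to a smaller open set. -/
def LocalCondition.restrict (P : LocalCondition X V) {U W : Opens X} (h : W ≤ U) :
    P.sections U →ₗ[ℂ] P.sections W where
  toFun s := ⟨fun x => s.1 ⟨x.1, h x.2⟩, fun x =>
    P.congr (extendZero_eventuallyEq W.isOpen s.1 _ (fun _ _ _ => rfl) h x.2)
      (s.2 ⟨x.1, h x.2⟩)⟩
  map_add' _ _ := rfl
  map_smul' _ _ := rfl

/-- The presheaf of sections. -/
noncomputable def LocalCondition.presheaf (P : LocalCondition X V) :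
    TopCat.Presheaf (ModuleCat.{0} ℂ) (TopCat.of X) where
  obj U := ModuleCat.of ℂ (P.sections U.unop)
  map f := ModuleCat.ofHom (P.restrict f.unop.le)
  map_id _ := rfl
  map_comp _ _ := rfl

theorem LocalCondition.isSheaf (P : LocalCondition X V) : P.presheaf.IsSheaf := by
  rw [TopCat.Presheaf.isSheaf_iff_isSheafUniqueGluing]
  intro ι U sf hsf
  have key : ∀ (i j : ι) (x : X) (hi : x ∈ U i) (hj : x ∈ U j),
      (sf i).1 ⟨x, hi⟩ = (sf j).1 ⟨x, hj⟩ := by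
    intro i j x hi hj
    have := congrArg (fun s => s.1 ⟨x, ⟨hi, hj⟩⟩) (hsf i j)
    exact this
  have hmem : ∀ x : ↥(iSup U : Opens X), ∃ i, x.1 ∈ U i := fun x => Opens.mem_iSup.1 x.2
  choose idx hidx using hmem
  let g : ↥(iSup U : Opens X) → V := fun x => (sf (idx x)).1 ⟨x.1, hidx x⟩
  have hg : ∀ i (x : X) (hi : x ∈ U i) (hx : x ∈ iSup U), g ⟨x, hx⟩ = (sf i).1 ⟨x, hi⟩ :=
    fun i x hi hx => key _ _ _ _ _
  refine ⟨⟨g, fun x => ?_⟩, ?_, ?_⟩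
  · refine P.congr (extendZero_eventuallyEq (U (idx x)).isOpen g (sf (idx x)).1 ?_ ?_
      (hidx x)).symm ((sf (idx x)).2 ⟨x.1, hidx x⟩)
    · exact fun y hU hW => hg _ _ _ _
    · exact le_iSup U (idx x)
  · intro i
    apply Subtype.ext
    funext x
    exact hg i x.1 x.2 _
  · intro t ht
    apply Subtype.ext
    funext x
    have := congrArg (fun s => s.1 ⟨x.1, hidx x⟩) (ht (idx x))
    exact this

/-- The sheaf of sections. -/
noncomputable def LocalCondition.sheaf (P : LocalCondition X V) :
    TopCat.Sheaf (ModuleCat.{0} ℂ) (TopCat.of X) := ⟨P.presheaf, P.isSheaf⟩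

/-- `T` defines a morphism of sheaves of complex vector spaces: `T s x` depends only on the germ of
`s` at `x`, `T` maps sections to sections, and is linear on sections. -/
structure IsLocalOperator (P : LocalCondition X V) (Q : LocalCondition X V')
    (T : (X → V) → X → V') : Prop where
  congr : ∀ {s t : X → V} {x : X}, s =ᶠ[𝓝 x] t → T s x = T t x
  holds : ∀ {s : X → V} {x : X}, (∀ᶠ y in 𝓝 x, P.Holds s y) → Q.Holds (T s) x
  add : ∀ {s t : X → V} {x : X}, P.Holds s x → P.Holds t x → T (s + t) x = T s x + T t x
  smul : ∀ (c : ℂ) {s : X → V} {x : X}, P.Holds s x → T (c • s) x = c • T s x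

theorem LocalCondition.eventually (P : LocalCondition X V) {U : Opens X} (s : P.sections U)
    (x : U) : ∀ᶠ y in 𝓝 (x : X), P.Holds (extendZero (U : Set X) s.1) y := by
  filter_upwards [U.isOpen.mem_nhds x.2] with y hy
  exact s.2 ⟨y, hy⟩

variable {P : LocalCondition X V} {Q : LocalCondition X V'} {R : LocalCondition X V''}
  {T : (X → V) → X → V'} {S : (X → V') → X → V''}

theorem extendZero_apply_eventuallyEq {U : Opens X} (t : X → V) {x : X} (hx : x ∈ U) :
    extendZero (U : Set X) (fun y : U => t y) =ᶠ[𝓝 x] t := by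
  filter_upwards [U.isOpen.mem_nhds hx] with y hy
  have hy' : y ∈ (U : Set X) := hy
  simp [extendZero, hy]

/-- The linear map on sections over `U` defined by a local operator. -/
noncomputable def IsLocalOperator.onSections (hT : IsLocalOperator P Q T) (U : Opens X) :
    P.sections U →ₗ[ℂ] Q.sections U where
  toFun s := ⟨fun x => T (extendZero (U : Set X) s.1) x, fun x =>
    Q.congr (extendZero_apply_eventuallyEq _ x.2).symm (hT.holds (P.eventually s x))⟩
  map_add' s t := by
    apply Subtype.ext
    funext x
    change T (extendZero (U : Set X) (s.1 + t.1)) x = _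
    rw [extendZero_add, hT.add (s.2 x) (t.2 x)]
    rfl
  map_smul' c s := by
    apply Subtype.ext
    funext x
    change T (extendZero (U : Set X) (c • s.1)) x = _
    rw [extendZero_smul, hT.smul c (s.2 x)]
    rfl

/-- The morphism of sheaves defined by a local operator. -/
noncomputable def IsLocalOperator.sheafHom (hT : IsLocalOperator P Q T) : P.sheaf ⟶ Q.sheaf :=
  ObjectProperty.homMk
    { app := fun U => ModuleCat.ofHom (hT.onSections U.unop)
      naturality := by
        intro U W f
        apply ModuleCat.hom_ext
        apply LinearMap.ext
        intro s
        apply Subtype.ext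
        funext x
        exact hT.congr (extendZero_eventuallyEq W.unop.isOpen s.1 _ (fun _ _ _ => rfl)
          f.unop.le x.2).symm }

theorem IsLocalOperator.sheafHom_comp_eq (hT : IsLocalOperator P Q T)
    (hS : IsLocalOperator Q R S) {V₃ : Type} [AddCommGroup V₃] [Module ℂ V₃]
    {Q' : LocalCondition X V₃} {T' : (X → V) → X → V₃} {S' : (X → V₃) → X → V''}
    (hT' : IsLocalOperator P Q' T') (hS' : IsLocalOperator Q' R S')
    (h : ∀ (s : X → V) (x : X), (∀ᶠ y in 𝓝 x, P.Holds s y) → S (T s) x = S' (T' s) x) :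
    hT.sheafHom ≫ hS.sheafHom = hT'.sheafHom ≫ hS'.sheafHom := by
  apply ObjectProperty.hom_ext
  apply NatTrans.ext
  funext U
  apply ModuleCat.hom_ext
  apply LinearMap.ext
  intro s
  apply Subtype.ext
  funext x
  have h1 := hS.congr (extendZero_apply_eventuallyEq (U := U.unop)
    (T (extendZero (U.unop : Set X) s.1)) x.2)
  have h2 := hS'.congr (extendZero_apply_eventuallyEq (U := U.unop)
    (T' (extendZero (U.unop : Set X) s.1)) x.2)
  exact (h1.trans (h _ _ (P.eventually s x))).trans h2.symm

theorem IsLocalOperator.sheafHom_comp_eq_zero (hT : IsLocalOperator P Q T)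
    (hS : IsLocalOperator Q R S)
    (h : ∀ (s : X → V) (x : X), (∀ᶠ y in 𝓝 x, P.Holds s y) → S (T s) x = 0) :
    hT.sheafHom ≫ hS.sheafHom = 0 := by
  apply ObjectProperty.hom_ext
  apply NatTrans.ext
  funext U
  apply ModuleCat.hom_ext
  apply LinearMap.ext
  intro s
  apply Subtype.ext
  funext x
  have h1 := hS.congr (extendZero_apply_eventuallyEq (U := U.unop)
    (T (extendZero (U.unop : Set X) s.1)) x.2)
  have h3 : (0 : P.sheaf ⟶ R.sheaf).hom = 0 :=
    (TopCat.Sheaf.forget (ModuleCat.{0} ℂ) (TopCat.of X)).map_zero _ _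
  rw [h3]
  exact h1.trans (h _ _ (P.eventually s x))

end Sheaves

section Complexes

variable {X : Type} [TopologicalSpace X] {V V' : ℕ → Type} [∀ k, AddCommGroup (V k)]
  [∀ k, Module ℂ (V k)] [∀ k, AddCommGroup (V' k)] [∀ k, Module ℂ (V' k)]

/-- `T ∘ T = 0` on local sections. -/
def SquaresToZero (P : ∀ k, LocalCondition X (V k)) (T : ∀ k, (X → V k) → X → V (k + 1)) : Prop :=
  ∀ (k : ℕ) (s : X → V k) (x : X), (∀ᶠ x' in 𝓝 x, (P k).Holds s x') → T (k + 1) (T k s) x = 0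

/-- `T' ∘ p = p ∘ T` on local sections. -/
def Intertwines (P : ∀ k, LocalCondition X (V k)) (T : ∀ k, (X → V k) → X → V (k + 1))
    (T' : ∀ k, (X → V' k) → X → V' (k + 1)) (p : ∀ k, (X → V k) → X → V' k) : Prop :=
  ∀ (k : ℕ) (s : X → V k) (x : X), (∀ᶠ x' in 𝓝 x, (P k).Holds s x') →
    T' k (p k s) x = p (k + 1) (T k s) x

variable {P : ∀ k, LocalCondition X (V k)} {T : ∀ k, (X → V k) → X → V (k + 1)}
  {P' : ∀ k, LocalCondition X (V' k)} {T' : ∀ k, (X → V' k) → X → V' (k + 1)}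
  {p : ∀ k, (X → V k) → X → V' k}

/-- The cochain complex of sheaves of complex vector spaces given by operators of square zero. -/
noncomputable def complexOf (hT : ∀ k, IsLocalOperator (P k) (P (k + 1)) (T k))
    (hTT : SquaresToZero P T) :
    CochainComplex (TopCat.Sheaf (ModuleCat.{0} ℂ) (TopCat.of X)) ℕ :=
  CochainComplex.of (fun k => (P k).sheaf) (fun k => (hT k).sheafHom)
    fun k => (hT k).sheafHom_comp_eq_zero (hT (k + 1)) (hTT k)

/-- The morphism of complexes of sheaves given by operators that commute with the differentials. -/
noncomputable def complexHomOf (hT : ∀ k, IsLocalOperator (P k) (P (k + 1)) (T k))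
    (hTT : SquaresToZero P T) (hT' : ∀ k, IsLocalOperator (P' k) (P' (k + 1)) (T' k))
    (hTT' : SquaresToZero P' T') (hp : ∀ k, IsLocalOperator (P k) (P' k) (p k))
    (hpT : Intertwines P T T' p) : complexOf hT hTT ⟶ complexOf hT' hTT' :=
  CochainComplex.ofHom (fun k => (hp k).sheafHom) (by
    intro k
    simpa [complexOf] using IsLocalOperator.sheafHom_comp_eq _ _ _ _ (hpT k))

end Complexes

/-! ### Differential forms at a point -/

section Forms

variable {E : Type} [NormedAddCommGroup E] [NormedSpace ℂ E]

/-- The complex valued differential `k`-forms at a point with tangent space `E`. The type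
decomposition comes from the complex structure of `E`. -/
abbrev CForm (E : Type) [NormedAddCommGroup E] [NormedSpace ℂ E] (k : ℕ) : Type :=
  E [⋀^Fin k]→L[ℝ] ℂ

/-- Transport of a form along an equality of degrees. -/
noncomputable def CForm.cast {k l : ℕ} (h : k = l) (a : CForm E k) : CForm E l :=
  { a.toAlternatingMap.domDomCongr (finCongr h) with
    cont := a.cont.comp (by fun_prop) }

/-- The pull-back of a form by a complex linear map. -/
noncomputable def CForm.pullback (J : E →L[ℂ] E) {k : ℕ} (a : CForm E k) : CForm E k :=
  a.compContinuousLinearMap (J.restrictScalars ℝ)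

/-- The wedge product, as a sum over shuffles. -/
noncomputable def CForm.wedgeAlg {k l : ℕ} (a : CForm E k) (b : CForm E l) :
    E [⋀^Fin (k + l)]→ₗ[ℝ] ℂ :=
  ((LinearMap.mul' ℝ ℂ).compAlternatingMap
    (a.toAlternatingMap.domCoprod b.toAlternatingMap)).domDomCongr finSumFinEquiv

theorem CForm.wedgeAlg_continuous {k l : ℕ} (a : CForm E k) (b : CForm E l) :
    Continuous (a.wedgeAlg b) := by
  have h : ∀ v, a.wedgeAlg b v = ∑ σ : Equiv.Perm.ModSumCongr (Fin k) (Fin l),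
      LinearMap.mul' ℝ ℂ (AlternatingMap.domCoprod.summand a.toAlternatingMap b.toAlternatingMap σ
        (v ∘ finSumFinEquiv)) := by
    intro v
    simp only [CForm.wedgeAlg, AlternatingMap.domDomCongr_apply,
      LinearMap.compAlternatingMap_apply, AlternatingMap.domCoprod_apply, sum_apply, map_sum]
  rw [show (⇑(a.wedgeAlg b)) = _ from funext h]
  refine continuous_finsetSum _ fun σ _ => ?_
  induction σ using Quotient.inductionOn' with
  | h σ =>
    have hc : Continuous fun v : Fin (k + l) → E =>
        a (fun i => v (finSumFinEquiv (σ (Sum.inl i)))) *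
          b (fun i => v (finSumFinEquiv (σ (Sum.inr i)))) :=
      (a.cont.comp (by fun_prop)).mul (b.cont.comp (by fun_prop))
    rcases Int.units_eq_one_or (Equiv.Perm.sign σ) with h1 | h1
    · convert! hc using 2 with v
      simp [AlternatingMap.domCoprod.summand_mk'', h1]
    · convert! hc.neg using 2 with v
      simp [AlternatingMap.domCoprod.summand_mk'', h1]

/-- The wedge product of two forms. -/
noncomputable def CForm.wedge {k l : ℕ} (a : CForm E k) (b : CForm E l) : CForm E (k + l) :=
  { a.wedgeAlg b with cont := a.wedgeAlg_continuous b }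

/-- The vectors `v` with those in positions `S` multiplied by `i`. -/
noncomputable def CForm.rotate {k : ℕ} (S : Finset (Fin k)) (v : Fin k → E) : Fin k → E :=
  fun i => if i ∈ S then Complex.I • v i else v i

theorem CForm.rotate_update {k : ℕ} (S : Finset (Fin k)) (v : Fin k → E) (i : Fin k) (w : E) :
    rotate S (Function.update v i w) =
      Function.update (rotate S v) i (if i ∈ S then Complex.I • w else w) := by
  funext j
  by_cases h : j = i
  · subst h; simp [rotate]
  · simp [rotate, h]

/-- The component of type `(0,k)` of a `k`-form: the projection `v ↦ (a(v) + i a(i v)) / 2` onto the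
antilinear part is applied in each of the `k` arguments. -/
noncomputable def CForm.antiholPart {k : ℕ} (a : CForm E k) : CForm E k where
  toFun v := (1 / 2 : ℂ) ^ k * ∑ S : Finset (Fin k),
    Complex.I ^ S.card * a (rotate S v)
  map_update_add' := by
    intro _ v i x y
    have : ‹DecidableEq (Fin k)› = instDecidableEqFin k := Subsingleton.elim _ _
    subst this
    rw [← mul_add, ← Finset.sum_add_distrib]
    congr 1
    refine Finset.sum_congr rfl fun S _ => ?_
    change Complex.I ^ S.card * a (rotate S _) =
      Complex.I ^ S.card * a (rotate S _) + Complex.I ^ S.card * a (rotate S _)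
    rw [rotate_update, rotate_update, rotate_update, ← mul_add]
    congr 1
    split_ifs
    · rw [smul_add, a.map_update_add]
    · rw [a.map_update_add]
  map_update_smul' := by
    intro _ v i c x
    have : ‹DecidableEq (Fin k)› = instDecidableEqFin k := Subsingleton.elim _ _
    subst this
    rw [← mul_smul_comm, Finset.smul_sum]
    congr 1
    refine Finset.sum_congr rfl fun S _ => ?_
    change Complex.I ^ S.card * a (rotate S _) = c • (Complex.I ^ S.card * a (rotate S _))
    rw [rotate_update, rotate_update, ← mul_smul_comm]
    congr 1
    split_ifs
    · rw [smul_comm, a.map_update_smul]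
    · rw [a.map_update_smul]
  map_eq_zero_of_eq' := by
    intro v i j hv hij
    have key : ∀ S : Finset (Fin k), (i ∈ S ↔ j ∈ S) → a (rotate S v) = 0 := by
      intro S h
      refine a.map_eq_zero_of_eq _ ?_ hij
      simp only [rotate, h, hv]
    have hsw : ∀ S : Finset (Fin k), rotate (S.map (Equiv.swap i j).toEmbedding) v =
        rotate S v ∘ Equiv.swap i j := by
      intro S
      funext t
      have hvt : v (Equiv.swap i j t) = v t := by
        by_cases h1 : t = i
        · subst h1; simp [hv]
        by_cases h2 : t = j
        · subst h2; simp [hv]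
        rw [Equiv.swap_apply_of_ne_of_ne h1 h2]
      simp [rotate, hvt]
    refine mul_eq_zero_of_right _ ?_
    refine Finset.sum_involution (fun S _ => S.map (Equiv.swap i j).toEmbedding) ?_ ?_
      (fun _ _ => Finset.mem_univ _) ?_
    · intro S _
      change Complex.I ^ S.card * a (rotate S v) +
        Complex.I ^ (S.map (Equiv.swap i j).toEmbedding).card *
          a (rotate (S.map (Equiv.swap i j).toEmbedding) v) = 0
      rw [hsw, Finset.card_map]
      have := a.toAlternatingMap.map_swap (rotate S v) hij
      change a (rotate S v ∘ Equiv.swap i j) = - a (rotate S v) at this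
      rw [this]; ring
    · intro S _ h0 hS
      apply h0
      have : i ∈ S ↔ j ∈ S := by
        conv_lhs => rw [← hS]
        simp
      exact mul_eq_zero_of_right _ (key S this)
    · intro S _
      ext t
      simp
  cont := by
    refine continuous_const.mul (continuous_finsetSum _ fun S _ => continuous_const.mul ?_)
    refine a.cont.comp (continuous_pi fun i => ?_)
    by_cases h : i ∈ S
    · simp only [rotate, h, if_true]; fun_prop
    · simp only [rotate, h, if_false]; fun_prop

/-- The `k`-form `a` is of type `(0,k)`, that is, complex antilinear in each argument. -/
def CForm.IsAntiholomorphic {k : ℕ} (a : CForm E k) : Prop :=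
  ∀ (v : Fin k → E) (i : Fin k) (c : ℂ),
    a (Function.update v i (c • v i)) = (starRingEnd ℂ) c * a v

/-- The fibre of `𝒜^k ⊗ Sym^ T^∨` at a point with tangent space `E`. The completed symmetric algebra
is the product over all weights `r` of `Sym^r T^∨`, and an element of `Λ^k ⊗ Sym^r T^∨` is a
homogeneous polynomial `E → Λ^k` of degree `r`; its variable `y` is the one that has the
`δ_z^i` as coordinates. (Homogeneity is imposed on sections below.) -/
abbrev WeylFibre (E : Type) [NormedAddCommGroup E] [NormedSpace ℂ E] (k : ℕ) : Type :=
  ℕ → E → CForm E k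

/-- The fibre of the form degree `k` part `𝒜^k ⊗ Sym^ T^∨ [[ħ]]` of the Weyl bundle: `a j r` is the
coefficient of `ħ^j`, of weight `r` in the `δ_z^i`. -/
abbrev QuantumWeylFibre (E : Type) [NormedAddCommGroup E] [NormedSpace ℂ E] (k : ℕ) : Type :=
  ℕ → WeylFibre E k

/-- `P` is a complex homogeneous polynomial map of degree `r`. -/
def IsHomogeneousPoly {F : Type} [NormedAddCommGroup F] [NormedSpace ℂ F] (r : ℕ) (P : E → F) :
    Prop :=
  ∃ f : ContinuousMultilinearMap ℂ (fun _ : Fin r => E) F, ∀ y, P y = f fun _ => y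

theorem IsHomogeneousPoly.zero {F : Type} [NormedAddCommGroup F] [NormedSpace ℂ F] (r : ℕ) :
    IsHomogeneousPoly r (0 : E → F) := ⟨0, fun _ => rfl⟩

theorem IsHomogeneousPoly.add {F : Type} [NormedAddCommGroup F] [NormedSpace ℂ F] {r : ℕ}
    {P Q : E → F} (hP : IsHomogeneousPoly r P) (hQ : IsHomogeneousPoly r Q) :
    IsHomogeneousPoly r (P + Q) := by
  obtain ⟨f, hf⟩ := hP
  obtain ⟨g, hg⟩ := hQ
  exact ⟨f + g, fun y => by simp [hf, hg]⟩

theorem IsHomogeneousPoly.smul {F : Type} [NormedAddCommGroup F] [NormedSpace ℂ F] {r : ℕ}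
    {P : E → F} (c : ℂ) (hP : IsHomogeneousPoly r P) : IsHomogeneousPoly r (c • P) := by
  obtain ⟨f, hf⟩ := hP
  exact ⟨c • f, fun y => by simp [hf]⟩

end Forms

section Manifold

variable {E : Type} [NormedAddCommGroup E] [NormedSpace ℂ E]
  {X : Type} [TopologicalSpace X] [ChartedSpace E X]

variable (E X) in
/-- A complex manifold is in particular a smooth real manifold. -/
theorem isManifold_real [IsManifold 𝓘(ℂ, E) ω X] : IsManifold 𝓘(ℝ, E) ∞ X := by
  apply isManifold_of_contDiffOn
  intro e e' he he'
  have h : e.symm ≫ₕ e' ∈ contDiffGroupoid ω 𝓘(ℂ, E) :=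
    (contDiffGroupoid ω 𝓘(ℂ, E)).compatible he he'
  have h1 : e.symm ≫ₕ e' ∈ contDiffGroupoid ∞ 𝓘(ℂ, E) := contDiffGroupoid_le le_top h
  exact ((mem_groupoid_of_pregroupoid.1 h1).1 : ContDiffOn ℂ ∞ _ _).restrict_scalars ℝ

instance [IsManifold 𝓘(ℂ, E) ω X] : IsManifold 𝓘(ℝ, E) ∞ X := isManifold_real E X

variable [IsManifold 𝓘(ℂ, E) ω X]

/-! ### Local coordinates

The tangent space of `X` at `x` is, by definition in Mathlib, the model space `E`: a vector of `E`
stands for the tangent vector with these components in the coordinates `chartAt E x`. An object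
at `x` is therefore given by its components in the coordinates `chartAt E x`. -/

/-- The Jacobian at `x` of the change from the coordinates `chartAt E x₀` to `chartAt E x`. -/
noncomputable def jac (x₀ x : X) : E →L[ℂ] E := tangentCoordChange 𝓘(ℂ, E) x₀ x x

/-- The expression of a differential form in the coordinates `chartAt E x₀`. -/
noncomputable def formInChart {k : ℕ} (s : X → CForm E k) (x₀ : X) (z : E) : CForm E k :=
  (s ((chartAt E x₀).symm z)).pullback (jac x₀ ((chartAt E x₀).symm z))

/-- The expression of the weight `r` part of a (classical) section of the Weyl bundle in the
coordinates `chartAt E x₀`: `z` is the point, `y` the fibre variable. -/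
noncomputable def weylInChart {k : ℕ} (s : X → WeylFibre E k) (x₀ : X) (r : ℕ) (z y : E) :
    CForm E k :=
  (s ((chartAt E x₀).symm z) r (jac x₀ ((chartAt E x₀).symm z) y)).pullback
    (jac x₀ ((chartAt E x₀).symm z))

/-- `s` is a smooth differential form at `x`. -/
def IsSmoothFormAt {k : ℕ} (s : X → CForm E k) (x : X) : Prop :=
  ContDiffAt ℝ ∞ (formInChart s x) (chartAt E x x)

/-- `s` is a smooth section of `𝒜^k ⊗ Sym^ T^∨` at `x`. -/
def IsWeylSectionAt {k : ℕ} (s : X → WeylFibre E k) (x : X) : Prop :=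
  ∀ r, IsHomogeneousPoly r (s x r) ∧
    ∀ y, ContDiffAt ℝ ∞ (fun p : E × E => weylInChart s x r p.1 p.2) (chartAt E x x, y)

theorem tendsto_chart_symm (x : X) :
    Filter.Tendsto (chartAt E x).symm (𝓝 (chartAt E x x)) (𝓝 x) := by
  have h := (chartAt E x).continuousAt_symm ((chartAt E x).map_source (mem_chart_source E x))
  rw [ContinuousAt, (chartAt E x).left_inv (mem_chart_source E x)] at h
  exact h

theorem IsSmoothFormAt.congr {k : ℕ} {s t : X → CForm E k} {x : X} (h : s =ᶠ[𝓝 x] t)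
    (hs : IsSmoothFormAt s x) : IsSmoothFormAt t x := by
  refine ContDiffAt.congr_of_eventuallyEq hs ?_
  filter_upwards [(tendsto_chart_symm x).eventually h] with z hz
  simp only [formInChart, hz]

theorem IsWeylSectionAt.congr {k : ℕ} {s t : X → WeylFibre E k} {x : X} (h : s =ᶠ[𝓝 x] t)
    (hs : IsWeylSectionAt s x) : IsWeylSectionAt t x := by
  intro r
  refine ⟨h.eq_of_nhds ▸ (hs r).1, fun y => ((hs r).2 y).congr_of_eventuallyEq ?_⟩
  have h1 : Filter.Tendsto (fun p : E × E => (chartAt E x).symm p.1) (𝓝 (chartAt E x x, y))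
      (𝓝 x) := (tendsto_chart_symm x).comp (continuous_fst.tendsto (chartAt E x x, y))
  filter_upwards [h1.eventually h] with p hp
  simp only [weylInChart, hp]

/-- The sheaf of smooth sections of `𝒜^k ⊗ Sym^ T^∨`, that is, of the form degree `k` part of the
holomorphic Weyl bundle modulo `ħ`. -/
def weylSections (E X : Type) [NormedAddCommGroup E] [NormedSpace ℂ E] [TopologicalSpace X]
    [ChartedSpace E X] [IsManifold 𝓘(ℂ, E) ω X] (k : ℕ) :
    LocalCondition X (WeylFibre E k) where
  Holds := IsWeylSectionAt
  congr := IsWeylSectionAt.congr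
  zero x r := ⟨IsHomogeneousPoly.zero r, fun y => by
    have : (fun p : E × E => weylInChart (0 : X → WeylFibre E k) x r p.1 p.2) = fun _ => 0 := by
      funext p; ext v; rfl
    rw [this]; exact contDiffAt_const⟩
  add {s t x} hs ht r := ⟨(hs r).1.add (ht r).1, fun y => ((hs r).2 y).add ((ht r).2 y)⟩
  smul c {s x} hs r := ⟨(hs r).1.smul c, fun y => ((hs r).2 y).const_smul c⟩

/-- The sheaf of smooth sections of the form degree `k` part of the holomorphic Weyl bundle
`𝒜^* ⊗ Sym^ T^∨ [[ħ]]`. -/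
def quantumWeylSections (E X : Type) [NormedAddCommGroup E] [NormedSpace ℂ E]
    [TopologicalSpace X] [ChartedSpace E X] [IsManifold 𝓘(ℂ, E) ω X] (k : ℕ) :
    LocalCondition X (QuantumWeylFibre E k) where
  Holds s x := ∀ j, IsWeylSectionAt (fun x' => s x' j) x
  congr h hs j := (hs j).congr (h.mono fun _ hx => congrFun hx j)
  zero x _ := (weylSections E X k).zero x
  add {s t _} hs ht j := (weylSections E X k).add (s := fun x' => s x' j)
    (t := fun x' => t x' j) (hs j) (ht j)
  smul c {s _} hs j := (weylSections E X k).smul c (s := fun x' => s x' j) (hs j)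

/-- The sheaf `𝒜^{0,k}` of smooth differential forms of type `(0,k)`. -/
def dolbeaultForms (E X : Type) [NormedAddCommGroup E] [NormedSpace ℂ E] [TopologicalSpace X]
    [ChartedSpace E X] [IsManifold 𝓘(ℂ, E) ω X] (k : ℕ) :
    LocalCondition X (CForm E k) where
  Holds s x := IsSmoothFormAt s x ∧ (s x).IsAntiholomorphic
  congr h hs := ⟨hs.1.congr h, h.eq_of_nhds ▸ hs.2⟩
  zero x := ⟨by
    have : formInChart (0 : X → CForm E k) x = fun _ => 0 := by
      funext p; ext v; rfl
    rw [IsSmoothFormAt, this]; exact contDiffAt_const, fun v i c => by simp⟩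
  add {s t x} hs ht := ⟨ContDiffAt.add hs.1 ht.1, fun v i c => by
    have h1 := hs.2 v i c
    have h2 := ht.2 v i c
    simp only [Pi.add_apply, ContinuousAlternatingMap.add_apply, h1, h2, mul_add]⟩
  smul c {s x} hs := ⟨ContDiffAt.const_smul c hs.1, fun v i c' => by
    have h1 := hs.2 v i c'
    simp only [Pi.smul_apply, ContinuousAlternatingMap.smul_apply, h1, smul_eq_mul]
    ring⟩

/-! ### The Dolbeault complex -/

/-- The Dolbeault operator `∂̄`: the antiholomorphic part of the exterior derivative. -/
noncomputable def dbar (k : ℕ) (s : X → CForm E k) (x : X) : CForm E (k + 1) :=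
  CForm.antiholPart (extDeriv (formInChart s x) (chartAt E x x))

/-! ### Holomorphic symplectic forms and symplectic connections -/

/-- The expression of a field of complex bilinear alternating forms in `chartAt E x₀`. -/
noncomputable def holFormInChart (ω₀ : X → E [⋀^Fin 2]→L[ℂ] ℂ) (x₀ : X) (z : E) :
    E [⋀^Fin 2]→L[ℂ] ℂ :=
  (ω₀ ((chartAt E x₀).symm z)).compContinuousLinearMap (jac x₀ ((chartAt E x₀).symm z))

variable (E X) in
/-- A holomorphic symplectic form on the complex manifold `X`: a closed nondegenerate holomorphic
`2`-form. -/
structure HolomorphicSymplecticForm where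
  /-- The value at each point, a complex bilinear alternating form on the tangent space. -/
  toFun : X → E [⋀^Fin 2]→L[ℂ] ℂ
  holomorphic : ∀ x, AnalyticAt ℂ (holFormInChart toFun x) (chartAt E x x)
  closed : ∀ x, extDeriv (holFormInChart toFun x) (chartAt E x x) = 0
  nondegenerate : ∀ (x : X) (u : E), (∀ v, toFun x ![u, v] = 0) → u = 0

variable (E X) in
/-- Connections on the real tangent bundle. A connection on the holomorphic tangent bundle (as a
smooth complex vector bundle) is the same as one which commutes with multiplication by `i`. -/
abbrev TangentConnection : Type :=
  CovariantDerivative 𝓘(ℝ, E) E (TangentSpace 𝓘(ℝ, E) : X → Type)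

/-- The vector field `σ` is differentiable at `x`. -/
def DifferentiableFieldAt (σ : ∀ x : X, TangentSpace 𝓘(ℝ, E) x) (x : X) : Prop :=
  MDifferentiableAt 𝓘(ℝ, E) (𝓘(ℝ, E).prod 𝓘(ℝ, E))
    (fun x' => (⟨x', σ x'⟩ : TangentBundle 𝓘(ℝ, E) X)) x

/-- The components of a tangent vector at `x` in the coordinates `chartAt E x`. -/
def components {x : X} (v : TangentSpace 𝓘(ℝ, E) x) : E := v

/-- Multiplication of a vector field by `i`. -/
noncomputable def mulI (σ : ∀ x : X, TangentSpace 𝓘(ℝ, E) x) (x : X) : TangentSpace 𝓘(ℝ, E) x :=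
  Complex.I • components (σ x)

/-- `∇` is a smooth connection on the tangent bundle that is compatible with the complex structure,
torsion free and compatible with the holomorphic symplectic form. (In Mathlib `∇ σ x v` is the
derivative `∇_v σ` at `x`.) -/
structure IsSymplecticConnection (Ω : HolomorphicSymplecticForm E X)
    (cov : TangentConnection E X) : Prop where
  smooth : CovariantDerivative.ContMDiffCovariantDerivative cov ∞
  complex : ∀ (σ : ∀ x : X, TangentSpace 𝓘(ℝ, E) x) (x : X), DifferentiableFieldAt σ x →
    ∀ v : TangentSpace 𝓘(ℝ, E) x,
      components (cov (mulI σ) x v) = Complex.I • components (cov σ x v)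
  torsionFree : ∀ (σ τ : ∀ x : X, TangentSpace 𝓘(ℝ, E) x) (x : X), DifferentiableFieldAt σ x →
    DifferentiableFieldAt τ x →
    cov τ x (σ x) - cov σ x (τ x) = VectorField.mlieBracket 𝓘(ℝ, E) σ τ x
  symplectic : ∀ (σ τ : ∀ x : X, TangentSpace 𝓘(ℝ, E) x) (x : X), DifferentiableFieldAt σ x →
    DifferentiableFieldAt τ x → ∀ v : TangentSpace 𝓘(ℝ, E) x,
    (mfderiv 𝓘(ℝ, E) 𝓘(ℝ, ℂ) (fun x' => Ω.toFun x' ![components (σ x'), components (τ x')])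
      x v : ℂ) =
      Ω.toFun x ![components (cov σ x v), components (τ x)] +
        Ω.toFun x ![components (σ x), components (cov τ x v)]

/-- The vector field, near `x₀`, with constant components `y` in the coordinates `chartAt E x₀`. -/
noncomputable def coordField (x₀ : X) (y : E) (x : X) : TangentSpace 𝓘(ℝ, E) x := (jac x₀ x y : E)

/-- The connection form of `∇` at `x` in the coordinates `chartAt E x`: `christoffel ∇ x y v` is
the vector `Γ(v, y)` with components `Γ^k_{ij} v^i y^j`. -/
noncomputable def christoffel (cov : TangentConnection E X) (x : X) (y : E) : E →L[ℝ] E :=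
  cov (coordField x y) x

/-! ### Operators on the Weyl bundle -/

/-- The exterior covariant derivative on `𝒜^* ⊗ Sym^ T^∨` induced by `∇`. In local coordinates
`∇ a = d a - Γ^k_{ij} dz^i δ_z^j ∧ ∂a/∂δ_z^k`. -/
noncomputable def covDeriv (cov : TangentConnection E X) {k : ℕ} (s : X → WeylFibre E k) (x : X) :
    WeylFibre E (k + 1) := fun r y =>
  ContinuousAlternatingMap.alternatizeUncurryFin
    (fderiv ℝ (fun z => weylInChart s x r z y) (chartAt E x x) -
      (fderiv ℝ (s x r) y).comp (christoffel cov x y))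

/-- The operator `δ a = dz^i ∧ ∂a/∂δ_z^i` on a fibre. -/
noncomputable def koszulDelta {k : ℕ} (a : WeylFibre E k) : WeylFibre E (k + 1) := fun r y =>
  ContinuousAlternatingMap.alternatizeUncurryFin (fderiv ℝ (a (r + 1)) y)

variable [FiniteDimensional ℂ E]

/-- The inverse matrix `ω^{ij}` of the matrix `ω_{ij}` of the symplectic form at `x`. -/
noncomputable def HolomorphicSymplecticForm.inverse (Ω : HolomorphicSymplecticForm E X) (x : X) :
    Matrix (Fin (Module.finrank ℂ E)) (Fin (Module.finrank ℂ E)) ℂ :=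
  (Matrix.of fun i j => Ω.toFun x ![Module.finBasis ℂ E i, Module.finBasis ℂ E j])⁻¹

/-- The iterated partial derivative `∂^m P / ∂δ_z^{i_1} ⋯ ∂δ_z^{i_m}` in the fibre variables. -/
noncomputable def partialDeriv {k m : ℕ} (i : Fin m → Fin (Module.finrank ℂ E))
    (P : E → CForm E k) (y : E) : CForm E k :=
  iteratedFDeriv ℝ m P y fun t => Module.finBasis ℂ E (i t)

/-- The Weyl product
`a ∘ b = ∑_m (ħ^m / m!) ω^{i_1 j_1} ⋯ ω^{i_m j_m} ∂^m a/∂δ^{i_1}⋯∂δ^{i_m} ∧ ∂^m b/∂δ^{j_1}⋯∂δ^{j_m}`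
on the fibre of the Weyl bundle at `x`, spelled out in the component of `ħ`-degree `j` and
weight `r`. -/
noncomputable def weylProduct (Ω : HolomorphicSymplecticForm E X) (x : X) {k l : ℕ}
    (a : QuantumWeylFibre E k) (b : QuantumWeylFibre E l) : QuantumWeylFibre E (k + l) :=
  fun j r y =>
    ∑ m ∈ Finset.range (j + 1), ∑ q ∈ Finset.HasAntidiagonal.antidiagonal (j - m),
      ∑ w ∈ Finset.HasAntidiagonal.antidiagonal (r + 2 * m),
        ((m.factorial : ℂ)⁻¹) • ∑ i : Fin m → Fin (Module.finrank ℂ E),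
          ∑ i' : Fin m → Fin (Module.finrank ℂ E), (∏ t, Ω.inverse x (i t) (i' t)) •
            (partialDeriv i (a q.1 w.1) y).wedge (partialDeriv i' (b q.2 w.2) y)

/-- The graded commutator `[a, b] = a ∘ b - (-1)^{kl} b ∘ a` of the Weyl product, for `a` of form
degree `k` and `b` of form degree `l`. -/
noncomputable def weylBracket (Ω : HolomorphicSymplecticForm E X) (x : X) {k l : ℕ}
    (a : QuantumWeylFibre E k) (b : QuantumWeylFibre E l) : QuantumWeylFibre E (k + l) :=
  fun j r y => weylProduct Ω x a b j r y -
    ((-1 : ℂ) ^ (k * l)) • (weylProduct Ω x b a j r y).cast (Nat.add_comm l k)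

/-- The operator `D = ∇ - δ + (1/ħ) [I, -]` on the holomorphic Weyl bundle, for a `1`-form `I`
with values in the Weyl bundle. The bracket has no term of `ħ`-degree `0`, so the coefficient of
`ħ^j` in `(1/ħ) [I, s]` is the coefficient of `ħ^{j+1}` in `[I, s]`. -/
noncomputable def fedosovD (Ω : HolomorphicSymplecticForm E X) (cov : TangentConnection E X)
    (I : X → QuantumWeylFibre E 1) {k : ℕ} (s : X → QuantumWeylFibre E k) (x : X) :
    QuantumWeylFibre E (k + 1) := fun j r y =>
  covDeriv cov (fun x' => s x' j) x r y - koszulDelta (s x j) r y +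
    (weylBracket Ω x (I x) (s x) (j + 1) r y).cast (Nat.add_comm 1 k)

/-- `I` is a smooth global `1`-form with values in the Weyl bundle, all of whose components have
weight at least `3`, where `ħ` has weight `2`. -/
def IsInteraction (I : X → QuantumWeylFibre E 1) : Prop :=
  (∀ x, (quantumWeylSections E X 1).Holds I x) ∧
    ∀ (x : X) (j r : ℕ), r + 2 * j < 3 → I x j r = 0

/-- `D` is flat modulo `ħ`: for every local section `s` of the Weyl bundle, the coefficient of
`ħ^0` in `D (D s)` vanishes. -/
def IsFlatModHbar (Ω : HolomorphicSymplecticForm E X) (cov : TangentConnection E X)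
    (I : X → QuantumWeylFibre E 1) : Prop :=
  ∀ (k : ℕ) (s : X → QuantumWeylFibre E k) (x : X),
    (∀ᶠ x' in 𝓝 x, (quantumWeylSections E X k).Holds s x') →
      fedosovD Ω cov I (fedosovD Ω cov I s) x 0 = 0

/-- A family of operators `D` on the Weyl bundle, raising the form degree by one, is a connection:
it consists of morphisms of sheaves of complex vector spaces and satisfies the Leibniz rule
`D (f s) = df ∧ s + f D s` for smooth complex functions `f`. -/
structure IsWeylConnection
    (D : ∀ k : ℕ, (X → QuantumWeylFibre E k) → X → QuantumWeylFibre E (k + 1)) : Prop where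
  isLocalOperator : ∀ k, IsLocalOperator (quantumWeylSections E X k)
    (quantumWeylSections E X (k + 1)) (D k)
  leibniz : ∀ (k : ℕ) (f : X → ℂ) (s : X → QuantumWeylFibre E k) (x : X),
    ContMDiffAt 𝓘(ℝ, E) 𝓘(ℝ, ℂ) ∞ f x → (quantumWeylSections E X k).Holds s x →
    ∀ (j r : ℕ) (y : E), D k (f • s) x j r y =
      ContinuousAlternatingMap.alternatizeUncurryFin
        (ContinuousLinearMap.smulRight 
          (fderiv ℝ (fun z => f ((chartAt E x).symm z)) (chartAt E x x)) (s x j r y)) +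
      f x • D k s x j r y

/-- A section of the Weyl bundle modulo `ħ`, considered as one of the Weyl bundle that is constant
in `ħ`. -/
noncomputable def constInHbar {k : ℕ} (s : X → WeylFibre E k) (x : X) : QuantumWeylFibre E k :=
  fun j => if j = 0 then s x else 0

/-- The operator induced by `D` on the Weyl bundle modulo `ħ`. -/
noncomputable def classicalD (Ω : HolomorphicSymplecticForm E X) (cov : TangentConnection E X)
    (I : X → QuantumWeylFibre E 1) (k : ℕ) (s : X → WeylFibre E k) (x : X) :
    WeylFibre E (k + 1) :=
  fedosovD Ω cov I (constInHbar s) x 0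

/-- The projection `π₀` of the Weyl bundle modulo `ħ` onto its component of type `(0,k)` and
weight `0`. A homogeneous polynomial of degree `0` is identified with its value at the origin. -/
noncomputable def weylProjection (k : ℕ) (s : X → WeylFibre E k) (x : X) : CForm E k :=
  (s x 0 0).antiholPart

end Manifold

end HolWeyl

/-! Modulo `ħ` the operator `D` is a connection along the fibres. In a chart it is the
alternatization of `covNabla`: the derivative in the base point `z` plus the derivations along
one-forms `A p` with values in the vector fields of degree `p` in the fibre variable `y`. Here `A 0
= -id` is the term `-δ`, `A 1 = -Γ`, and `A (p+2)` is the Hamiltonian field of the weight `p+3` part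
of `I` (`weylInChart_classicalD`). Since the Poisson tensor is antisymmetric, only terms of odd
order survive in the graded commutator (`weylBracket_cast`). So the bracket is divisible by `ħ`, and
its leading term is a Poisson bracket (`poissonTerm_one`). Objects at a point are written in the
chart centred there, so smoothness of `D` rests on formulas valid in one fixed chart
(`weylInChart_covDeriv`, `poissonTerm_natural`).

Existence of `∇`. In a chart, `Γ(a, v) = (1/3) ω⁻¹(∂_a ω(v, ·) + ∂_v ω(a, ·))` is symmetric and,
because `dω = 0`, preserves `ω`. All conditions on `∇` are affine, so a partition of unity glues
these local connections.

Existence of `I`. `D² = 0` modulo `ħ` follows once the curvature of `A` vanishes, and this is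
achieved one weight at a time. In weight zero the curvature is the torsion. Let `F` be the component
in the lowest weight not yet killed. It is Hamiltonian, because the connection preserves `ω`
(`curvature_hamiltonian`), and by Euler's identity it has the Hamiltonian `H = ω(F, y) / (deg F +
1)`. The Bianchi identity in this weight says `δH = 0` (`fderiv_curvature_cyclic`). The Koszul
complex is exact in positive weight, so `H = δK` with `K` obtained by contracting `H` with `y` and
dividing by the total degree (`alt_fderiv_totalDegreeInv`). Adding `K/2` to `I` cancels `F`, through
the bracket with `A 0 = -id`, and leaves lower weights unchanged (`curvature_correction`). `K` is
canonical and the curvature is a tensor (`jac_curvature`), so the correction is global without any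
gluing.

The quasi-isomorphism. Let `h a = -ι_y a`, with the `(1,0)`-part of `y`, and let `i` include
`(0,q)`-forms in weight zero. On type `(p,q)` and weight `r`, `(-δ)h + h(-δ)` is multiplication by
`p + r`. The rest of `D` does not lower the weight and `h` raises it by one. Hence `Dh + hD + i π₀`
is the invertible operator `totalDegree` plus a term that strictly raises the weight, and it is
bijective on sections over every open set by recursion on the weight (`exists_solution`,
`solution_unique`). A purely algebraic argument turns this invertibility into a homotopy equivalence
(`homotopyEquivOfPerturbed`): on `ker π₀` the operator is null-homotopic and invertible, so `ker π₀`
is contractible. -/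

set_option maxSynthPendingDepth 3

namespace HolWeyl
open ContinuousAlternatingMap (alternatizeUncurryFin alternatizeUncurryFinCLM alternatizeUncurryFin_apply)

/-! ### Wedge products with one-forms as alternatizations. -/

section FormAlgebra

variable {E : Type} [NormedAddCommGroup E] [NormedSpace ℂ E]

instance CForm.finiteDimensional [FiniteDimensional ℂ E] (k : ℕ) :
    FiniteDimensional ℂ (CForm E k) := by
  have : FiniteDimensional ℝ E := FiniteDimensional.complexToReal E
  let T : CForm E k →ₗ[ℝ] MultilinearMap ℝ (fun _ : Fin k => E) ℂ :=
    { toFun := fun a => a.toMultilinearMap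
      map_add' := fun _ _ => rfl
      map_smul' := fun _ _ => rfl }
  have : FiniteDimensional ℝ (CForm E k) :=
    FiniteDimensional.of_injective T (fun a b h => by
      ext v
      exact congrArg (fun f : MultilinearMap ℝ (fun _ : Fin k => E) ℂ => f v) h)
  exact Module.Finite.of_restrictScalars_finite ℝ ℂ _

/-- Alternatization of a linear map with values in `k`-forms, as a complex linear map. -/
noncomputable def CForm.altCLM (E : Type) [NormedAddCommGroup E] [NormedSpace ℂ E] (k : ℕ) :
    (E →L[ℝ] CForm E k) →L[ℂ] CForm E (k + 1) where
  toFun L := alternatizeUncurryFin L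
  map_add' := ContinuousAlternatingMap.alternatizeUncurryFin_add
  map_smul' c L := ContinuousAlternatingMap.alternatizeUncurryFin_smul c L
  cont := (alternatizeUncurryFinCLM ℝ E ℂ).cont

theorem CForm.altCLM_apply {k : ℕ} (L : E →L[ℝ] CForm E k) :
    CForm.altCLM E k L = alternatizeUncurryFin L := rfl

/-! ### Wedge products with one-forms -/

/-- `Equiv.Perm.decomposeFin` moves `p` to the front by a transposition, while alternatization
deletes the slot `p` and keeps the order of the rest. The permutation `e` is the discrepancy:
`p.cycleRange * swap 0 p` fixes `0` and so comes from a permutation of the remaining indices. -/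
theorem exists_perm_swap_succ {n : ℕ} (p : Fin (n + 1)) :
    ∃ e : Equiv.Perm (Fin n), (∀ i, Equiv.swap 0 p i.succ = p.succAbove (e i)) ∧
      Equiv.Perm.sign e = (-1) ^ (p : ℕ) * Equiv.Perm.sign (Equiv.swap 0 p) := by
  obtain ⟨⟨q, e⟩, hqe⟩ := (Equiv.Perm.decomposeFin (n := n)).symm.surjective
    (p.cycleRange * Equiv.swap 0 p)
  have h0 : (p.cycleRange * Equiv.swap 0 p) 0 = 0 := by
    simp [Equiv.Perm.mul_apply]
  have hq : q = 0 := by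
    rw [← hqe, Equiv.Perm.decomposeFin_symm_apply_zero] at h0
    exact h0
  subst hq
  refine ⟨e, fun i => ?_, ?_⟩
  · have := congrArg (fun f : Equiv.Perm (Fin (n + 1)) => f i.succ) hqe
    simp only [Equiv.Perm.decomposeFin_symm_apply_succ, Equiv.swap_self, Equiv.refl_apply,
      Equiv.Perm.mul_apply] at this
    rw [← Fin.cycleRange_symm_succ, this, Equiv.symm_apply_apply]
  · have := congrArg Equiv.Perm.sign hqe
    rw [Equiv.Perm.decomposeFin.symm_sign, Equiv.Perm.sign_mul, Fin.sign_cycleRange] at this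
    simpa using this

/-- Permutations are grouped by `p = σ 0`. The `k!` permutations in a group contribute equally
because `b` is alternating. -/
theorem sum_perm_mul_alternating {k : ℕ} (a : E → ℂ) (b : CForm E k) (v : Fin (k + 1) → E) :
    ∑ σ : Equiv.Perm (Fin (k + 1)),
        Equiv.Perm.sign σ • (a (v (σ 0)) * b (fun i => v (σ i.succ))) =
      (k.factorial : ℂ) * ∑ p : Fin (k + 1), (-1 : ℤ) ^ (p : ℕ) • (a (v p) * b (p.removeNth v)) := by
  rw [← Equiv.sum_comp (Equiv.Perm.decomposeFin (n := k)).symm, Fintype.sum_prod_type,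
    Finset.mul_sum]
  refine Finset.sum_congr rfl fun p _ => ?_
  obtain ⟨e₀, he₀, hs₀⟩ := exists_perm_swap_succ p
  have key : ∀ e : Equiv.Perm (Fin k),
      Equiv.Perm.sign (Equiv.Perm.decomposeFin.symm (p, e)) •
        (a (v (Equiv.Perm.decomposeFin.symm (p, e) 0)) *
          b (fun i => v (Equiv.Perm.decomposeFin.symm (p, e) i.succ))) =
      (-1 : ℤ) ^ (p : ℕ) • (a (v p) * b (p.removeNth v)) := by
    intro e
    have h1 : (fun i : Fin k => v (Equiv.Perm.decomposeFin.symm (p, e) i.succ)) =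
        (p.removeNth v) ∘ (e₀ * e : Equiv.Perm (Fin k)) := by
      funext i
      simp only [Equiv.Perm.decomposeFin_symm_apply_succ, he₀, Fin.removeNth, Function.comp,
        Equiv.Perm.mul_apply]
    have h2 := b.toAlternatingMap.map_perm (p.removeNth v) (e₀ * e)
    have h3 : Equiv.Perm.sign (Equiv.Perm.decomposeFin.symm (p, e)) =
        Equiv.Perm.sign (Equiv.swap 0 p) * Equiv.Perm.sign e := by
      rw [Equiv.Perm.decomposeFin.symm_sign]
      by_cases hp : p = 0
      · subst hp; simp
      · rw [Equiv.Perm.sign_swap (Ne.symm hp)]; simp [hp]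
    rw [h1, Equiv.Perm.decomposeFin_symm_apply_zero, h3]
    change _ • (_ * b.toAlternatingMap _) = _
    rw [h2, Equiv.Perm.sign_mul, hs₀]
    change _ • (_ * (_ • b _)) = _
    rcases Int.units_eq_one_or (Equiv.Perm.sign (Equiv.swap 0 p)) with h | h <;>
    rcases Int.units_eq_one_or (Equiv.Perm.sign e) with h' | h' <;>
    rcases neg_one_pow_eq_or ℤ (p : ℕ) with h'' | h'' <;>
    simp [h, h', Units.smul_def, h'']
  rw [Finset.sum_congr rfl fun e _ => key e, Finset.sum_const, Finset.card_univ, Fintype.card_perm,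
    Fintype.card_fin, nsmul_eq_mul]

/-- The covector of a one-form. -/
noncomputable def CForm.covector (a : CForm E 1) : E →L[ℝ] ℂ :=
  (ContinuousAlternatingMap.ofSubsingleton ℝ E ℂ (0 : Fin 1)).symm a

theorem CForm.covector_apply (a : CForm E 1) (v : E) : a.covector v = a fun _ => v := by
  simp only [covector, ContinuousAlternatingMap.ofSubsingleton]
  rfl

/-- The wedge product sums over shuffles, that is, over cosets of `S_k × S_l`; a sum over all
permutations counts each coset `k! l!` times. This form avoids representatives of cosets. -/
theorem wedge_factorial_smul {k l : ℕ} (a : CForm E k) (b : CForm E l) (w : Fin (k + l) → E) :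
    ((k.factorial * l.factorial : ℕ) : ℂ) * a.wedge b w =
      ∑ σ : Equiv.Perm (Fin k ⊕ Fin l), Equiv.Perm.sign σ •
        (a (fun i => w (finSumFinEquiv (σ (Sum.inl i)))) *
          b (fun i => w (finSumFinEquiv (σ (Sum.inr i))))) := by
  have h := MultilinearMap.domCoprod_alternization_eq a.toAlternatingMap b.toAlternatingMap
  have h1 := congrArg (fun f => LinearMap.mul' ℝ ℂ (f (w ∘ finSumFinEquiv))) h
  simp only [AlternatingMap.smul_apply, map_nsmul, Fintype.card_fin] at h1
  change _ = (k.factorial * l.factorial) • (a.wedge b w) at h1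
  rw [nsmul_eq_mul] at h1
  rw [← h1, MultilinearMap.alternatization_apply, map_sum]
  refine Finset.sum_congr rfl fun σ _ => ?_
  rcases Int.units_eq_one_or (Equiv.Perm.sign σ) with h | h <;>
  simp [h, Function.comp_def, MultilinearMap.domDomCongr_apply]

theorem wedge_one_cast {k : ℕ} (a : CForm E 1) (b : CForm E k) :
    (a.wedge b).cast (Nat.add_comm 1 k) = alternatizeUncurryFin (a.covector.smulRight b) := by
  ext v
  have hk : ((1 : ℕ).factorial * k.factorial : ℕ) = (k.factorial : ℂ) := by simp
  apply mul_left_cancel₀ (Nat.cast_ne_zero.2 k.factorial_ne_zero : (k.factorial : ℂ) ≠ 0)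
  rw [alternatizeUncurryFin_apply]
  have h := wedge_factorial_smul a b (v ∘ finCongr (Nat.add_comm 1 k))
  rw [hk] at h
  refine Eq.trans h ?_
  have h2 := sum_perm_mul_alternating a.covector b v
  simp only [ContinuousLinearMap.smulRight_apply, ContinuousAlternatingMap.smul_apply, smul_eq_mul]
  rw [← h2]
  -- Relabelling of the slots with that of the one-form placed first, as in the alternatization.
  let θ : Fin 1 ⊕ Fin k ≃ Fin (k + 1) := finSumFinEquiv.trans (finCongr (Nat.add_comm 1 k))
  have hl : ∀ i, θ (Sum.inl i) = 0 := by
    intro i; apply Fin.ext; simp [θ]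
  have hr : ∀ i, θ (Sum.inr i) = i.succ := by
    intro i; apply Fin.ext; simp [θ]
  rw [← Equiv.sum_comp θ.permCongr]
  refine Finset.sum_congr rfl fun σ _ => ?_
  rw [Equiv.Perm.sign_permCongr, CForm.covector_apply]
  have e1 : ∀ i : Fin 1, v (θ (σ (Sum.inl i))) = v (θ.permCongr σ 0) := by
    intro i
    rw [Equiv.permCongr_apply, ← hl i, Equiv.symm_apply_apply]
  have e2 : ∀ i, v (θ (σ (Sum.inr i))) = v (θ.permCongr σ i.succ) := by
    intro i
    rw [Equiv.permCongr_apply, ← hr i, Equiv.symm_apply_apply]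
  simp only [← e1 0, ← e2]
  congr 3
  funext i
  rw [Subsingleton.elim i 0]
  rfl

theorem wedge_one_right {k : ℕ} (a : CForm E 1) (b : CForm E k) :
    b.wedge a = (-1 : ℂ) ^ k • alternatizeUncurryFin (a.covector.smulRight b) := by
  ext v
  have hk : (k.factorial * (1 : ℕ).factorial : ℕ) = (k.factorial : ℂ) := by simp
  apply mul_left_cancel₀ (Nat.cast_ne_zero.2 k.factorial_ne_zero : (k.factorial : ℂ) ≠ 0)
  rw [ContinuousAlternatingMap.smul_apply, alternatizeUncurryFin_apply]
  have h := wedge_factorial_smul b a v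
  rw [hk] at h
  refine Eq.trans h ?_
  have h2 := sum_perm_mul_alternating a.covector b v
  simp only [ContinuousLinearMap.smulRight_apply, ContinuousAlternatingMap.smul_apply, smul_eq_mul]
  rw [mul_left_comm, ← h2, Finset.mul_sum]
  let θ : Fin k ⊕ Fin 1 ≃ Fin (k + 1) := finSumFinEquiv
  have hl : ∀ i, θ (Sum.inl i) = i.castSucc := by
    intro i; apply Fin.ext; simp [θ]
  have hr : ∀ i, θ (Sum.inr i) = Fin.last k := by
    intro i; apply Fin.ext; simp [θ]
  -- The one-form now occupies the last slot. The inverse rotation brings it to the front, and its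
  -- sign is the factor `(-1)^k`.
  rw [← Equiv.sum_comp (θ.permCongr.trans (Equiv.mulRight (finRotate (k + 1))⁻¹))]
  refine Finset.sum_congr rfl fun σ _ => ?_
  have hs : Equiv.Perm.sign ((θ.permCongr.trans (Equiv.mulRight (finRotate (k + 1))⁻¹)) σ) =
      (-1) ^ k * Equiv.Perm.sign σ := by
    simp [Equiv.Perm.sign_mul, Equiv.Perm.sign_permCongr, sign_finRotate, mul_comm]
  have e1 : ∀ i : Fin 1, v (θ (σ (Sum.inr i))) =
      v ((θ.permCongr.trans (Equiv.mulRight (finRotate (k + 1))⁻¹)) σ 0) := by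
    intro i
    have : (finRotate (k + 1))⁻¹ 0 = Fin.last k := by
      rw [Equiv.Perm.inv_eq_iff_eq, finRotate_last]
    simp only [Equiv.trans_apply, Equiv.coe_mulRight, Equiv.Perm.mul_apply, this,
      Equiv.permCongr_apply]
    rw [← hr i, Equiv.symm_apply_apply]
  have e2 : ∀ i, v (θ (σ (Sum.inl i))) =
      v ((θ.permCongr.trans (Equiv.mulRight (finRotate (k + 1))⁻¹)) σ i.succ) := by
    intro i
    have : (finRotate (k + 1))⁻¹ i.succ = i.castSucc := by
      rw [Equiv.Perm.inv_eq_iff_eq, finRotate_apply, Fin.coeSucc_eq_succ]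
    simp only [Equiv.trans_apply, Equiv.coe_mulRight, Equiv.Perm.mul_apply, this,
      Equiv.permCongr_apply]
    rw [← hl i, Equiv.symm_apply_apply]
  rw [hs, CForm.covector_apply]
  simp only [← e1 0, ← e2]
  have e3 : (fun i : Fin 1 => v (finSumFinEquiv (σ (Sum.inr i)))) =
      fun _ => v (θ (σ (Sum.inr 0))) := by
    funext i; rw [Subsingleton.elim i 0]
  rw [e3]
  rcases neg_one_pow_eq_or ℤ k with h | h
  · have h' : (-1 : ℤˣ) ^ k = 1 := by ext; simpa using h
    have h'' : (-1 : ℂ) ^ k = 1 := by exact_mod_cast h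
    rw [h', h'']
    simp [mul_comm, θ]
  · have h' : (-1 : ℤˣ) ^ k = -1 := by ext; simpa using h
    have h'' : (-1 : ℂ) ^ k = -1 := by exact_mod_cast h
    rw [h', h'']
    simp [mul_comm, θ]

end FormAlgebra
end HolWeyl

namespace HolWeyl
open ContinuousAlternatingMap (alternatizeUncurryFin alternatizeUncurryFinCLM alternatizeUncurryFin_apply)

/-! ### Types `(p,q)` of forms by contraction, and the operator of total degree. -/

section Types

/-- Polarization of the fact that the double alternatization of a symmetric bilinear map vanishes,
applied to `B + B.flip`. -/
theorem alt_alt_flip {E F : Type*} [NormedAddCommGroup E] [NormedSpace ℝ E] [NormedAddCommGroup F]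
    [NormedSpace ℝ F] {n : ℕ} (B : E →L[ℝ] E →L[ℝ] E [⋀^Fin n]→L[ℝ] F) :
    alternatizeUncurryFin (alternatizeUncurryFinCLM ℝ E F ∘L B.flip) =
      - alternatizeUncurryFin (alternatizeUncurryFinCLM ℝ E F ∘L B) := by
  have hB : alternatizeUncurryFin (alternatizeUncurryFinCLM ℝ E F ∘L (B + B.flip)) = 0 :=
    ContinuousAlternatingMap.alternatizeUncurryFin_alternatizeUncurryFinCLM_comp_of_symmetric
      fun x y => add_comm (B x y) (B y x)
  rw [ContinuousLinearMap.comp_add, ContinuousAlternatingMap.alternatizeUncurryFin_add] at hB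
  exact eq_neg_of_add_eq_zero_right hB

variable {E : Type} [NormedAddCommGroup E] [NormedSpace ℂ E]

theorem CForm.coe_smul {k : ℕ} (c : ℝ) (a : CForm E k) : (c : ℂ) • a = c • a := by
  ext v
  simp

theorem CForm.curryLeft_cons {k : ℕ} (a : CForm E (k + 1)) (u : E) (v : Fin k → E) :
    a.curryLeft u v = a (Fin.cons u v) := rfl

theorem CForm.ext_cons {k : ℕ} {a b : CForm E (k + 1)} (h : ∀ u, a.curryLeft u = b.curryLeft u) :
    a = b := by
  ext v
  have := congrArg (fun f : CForm E k => f (Fin.tail v)) (h (v 0))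
  simpa only [CForm.curryLeft_cons, Fin.cons_self_tail] using this

variable [FiniteDimensional ℂ E]

/-- Contraction of a form with a tangent vector. -/
noncomputable def CForm.curryC {k : ℕ} (u : E) : CForm E (k + 1) →L[ℂ] CForm E k :=
  LinearMap.toContinuousLinearMap
    { toFun := fun a => a.curryLeft u
      map_add' := fun _ _ => rfl
      map_smul' := fun _ _ => rfl }

theorem CForm.curryC_apply {k : ℕ} (u : E) (a : CForm E (k + 1)) :
    CForm.curryC u a = a.curryLeft u := rfl

theorem CForm.curryC_add {k : ℕ} (u v : E) (a : CForm E (k + 1)) :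
    CForm.curryC (u + v) a = CForm.curryC u a + CForm.curryC v a :=
  a.curryLeft.map_add u v

theorem CForm.curryC_smul {k : ℕ} (c : ℝ) (u : E) (a : CForm E (k + 1)) :
    CForm.curryC (c • u) a = (c : ℂ) • CForm.curryC u a := by
  rw [CForm.coe_smul]
  exact a.curryLeft.map_smul c u

theorem CForm.curryC_I_I {k : ℕ} (u : E) (a : CForm E (k + 1)) :
    CForm.curryC (Complex.I • Complex.I • u) a = - CForm.curryC u a := by
  rw [smul_smul, Complex.I_mul_I, neg_one_smul]
  exact a.curryLeft.map_neg u

theorem complex_smul_eq (c : ℂ) (u : E) : c • u = c.re • u + c.im • Complex.I • u := by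
  conv_lhs => rw [← Complex.re_add_im c]
  rw [add_smul, mul_smul, Complex.coe_smul, Complex.coe_smul]

theorem smul_of_I_smul {F : Type*} [AddCommGroup F] [Module ℂ F] {L : E → F}
    (hadd : ∀ u v, L (u + v) = L u + L v) (hr : ∀ (c : ℝ) u, L (c • u) = (c : ℂ) • L u)
    (hI : ∀ u, L (Complex.I • u) = Complex.I • L u) (c : ℂ) (u : E) : L (c • u) = c • L u := by
  rw [complex_smul_eq, hadd, hr, hr, hI]
  conv_rhs => rw [← Complex.re_add_im c, add_smul, mul_smul]

/-- Contraction of a form with the `(1,0)`-part of a tangent vector. -/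
noncomputable def CForm.contract {k : ℕ} : E →L[ℂ] CForm E (k + 1) →L[ℂ] CForm E k :=
  LinearMap.toContinuousLinearMap
    { toFun := fun u => (1 / 2 : ℂ) • (CForm.curryC u - Complex.I • CForm.curryC (Complex.I • u))
      map_add' := fun u v => by
        ext1 a
        simp only [FunLike.coe_smul, FunLike.coe_sub, FunLike.coe_add, Pi.smul_apply, Pi.sub_apply,
          Pi.add_apply, smul_add, CForm.curryC_add]
        module
      map_smul' := fun c u => by
        revert c u
        refine smul_of_I_smul (F := CForm E (k + 1) →L[ℂ] CForm E k)
          (L := fun u => (1 / 2 : ℂ) • (CForm.curryC u - Complex.I • CForm.curryC (Complex.I • u)))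
          (fun u v => ?_) (fun c u => ?_) (fun u => ?_)
        · ext1 a
          simp only [FunLike.coe_smul, FunLike.coe_sub, FunLike.coe_add, Pi.smul_apply,
            Pi.sub_apply, Pi.add_apply, smul_add, CForm.curryC_add]
          module
        · ext1 a
          simp only [FunLike.coe_smul, FunLike.coe_sub, Pi.smul_apply, Pi.sub_apply,
            smul_comm Complex.I c u, CForm.curryC_smul]
          module
        · ext1 a
          simp only [FunLike.coe_smul, FunLike.coe_sub, Pi.smul_apply, Pi.sub_apply,
            CForm.curryC_I_I]
          have h : Complex.I * Complex.I = -1 := Complex.I_mul_I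
          match_scalars
          · linear_combination (1 / 2 : ℂ) * h
          · ring }

theorem CForm.contract_apply {k : ℕ} (u : E) (a : CForm E (k + 1)) :
    CForm.contract u a = (1 / 2 : ℂ) • (a.curryLeft u - Complex.I • a.curryLeft (Complex.I • u)) :=
  rfl

/-- Contraction of a form with the `(0,1)`-part of a tangent vector. -/
noncomputable def CForm.antiContract {k : ℕ} (u : E) : CForm E (k + 1) →L[ℂ] CForm E k :=
  (1 / 2 : ℂ) • (CForm.curryC u + Complex.I • CForm.curryC (Complex.I • u))

theorem CForm.antiContract_apply {k : ℕ} (u : E) (a : CForm E (k + 1)) :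
    CForm.antiContract u a =
      (1 / 2 : ℂ) • (a.curryLeft u + Complex.I • a.curryLeft (Complex.I • u)) := rfl

theorem CForm.contract_add_antiContract {k : ℕ} (u : E) (a : CForm E (k + 1)) :
    CForm.contract u a + CForm.antiContract u a = a.curryLeft u := by
  rw [CForm.contract_apply, CForm.antiContract_apply]
  module

theorem CForm.antiContract_I {k : ℕ} (u : E) (a : CForm E (k + 1)) :
    CForm.antiContract (Complex.I • u) a = -Complex.I • CForm.antiContract u a := by
  have h1 : a.curryLeft (Complex.I • Complex.I • u) = - a.curryLeft u := CForm.curryC_I_I u a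
  have h : Complex.I * Complex.I = -1 := Complex.I_mul_I
  rw [CForm.antiContract_apply, CForm.antiContract_apply, h1]
  match_scalars
  · linear_combination (1 / 2 : ℂ) * h
  · ring

/-- `T ∘ L` for a complex linear map `T` between spaces of forms. -/
noncomputable def compR {k l : ℕ} (T : CForm E k →L[ℂ] CForm E l) (L : E →L[ℝ] CForm E k) :
    E →L[ℝ] CForm E l := (T.restrictScalars ℝ).comp L

theorem compR_apply {k l : ℕ} (T : CForm E k →L[ℂ] CForm E l) (L : E →L[ℝ] CForm E k) (u : E) :
    compR T L u = T (L u) := rfl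

/-- Contraction is an antiderivation: `ι_u (α ∧ b) = α(u) b - α ∧ ι_u b`. The first summand of the
alternatization gives `L u`; in the others the slots are shifted by one, whence the sign. -/
theorem curryLeft_alt {k : ℕ} (L : E →L[ℝ] CForm E (k + 1)) (u : E) :
    (alternatizeUncurryFin L).curryLeft u =
      L u - alternatizeUncurryFin (compR (CForm.curryC u) L) := by
  ext v
  rw [CForm.curryLeft_cons, alternatizeUncurryFin_apply, Fin.sum_univ_succ,
    ContinuousAlternatingMap.sub_apply, alternatizeUncurryFin_apply, sub_eq_add_neg,
    ← Finset.sum_neg_distrib]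
  congr 1
  · simp
  · refine Finset.sum_congr rfl fun i _ => ?_
    have : i.succ.removeNth (Fin.cons u v : Fin (k + 1 + 1) → E) =
        Fin.cons u (i.removeNth v) := by
      funext j
      refine Fin.cases ?_ (fun j => ?_) j <;> simp [Fin.removeNth]
    rw [this, compR_apply, CForm.curryC_apply, CForm.curryLeft_cons, Fin.cons_succ, Fin.val_succ,
      pow_succ]
    simp

theorem curryLeft_alt_zero (L : E →L[ℝ] CForm E 0) (u : E) :
    (alternatizeUncurryFin L).curryLeft u = L u := by
  ext v
  rw [CForm.curryLeft_cons, alternatizeUncurryFin_apply, Fin.sum_univ_succ]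
  simp

theorem alt_comp_sub {k l : ℕ} (S T : CForm E k →L[ℂ] CForm E l) (L : E →L[ℝ] CForm E k) :
    alternatizeUncurryFin (compR (S - T) L) =
      alternatizeUncurryFin (compR S L) - alternatizeUncurryFin (compR T L) := by
  rw [← CForm.altCLM_apply, ← CForm.altCLM_apply, ← CForm.altCLM_apply, ← map_sub]
  rfl

theorem alt_comp_add {k l : ℕ} (S T : CForm E k →L[ℂ] CForm E l) (L : E →L[ℝ] CForm E k) :
    alternatizeUncurryFin (compR (S + T) L) =
      alternatizeUncurryFin (compR S L) + alternatizeUncurryFin (compR T L) := by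
  rw [← CForm.altCLM_apply, ← CForm.altCLM_apply, ← CForm.altCLM_apply, ← map_add]
  rfl

theorem alt_comp_smul {k l : ℕ} (c : ℂ) (S : CForm E k →L[ℂ] CForm E l) (L : E →L[ℝ] CForm E k) :
    alternatizeUncurryFin (compR (c • S) L) = c • alternatizeUncurryFin (compR S L) := by
  rw [← CForm.altCLM_apply, ← CForm.altCLM_apply, ← map_smul]
  rfl

/-- A complex linear `L` is a combination of the `dz^i`, so it equals its own complex linear part
`(L u - i L(i u)) / 2` and the leading term survives unchanged. -/
theorem contract_alt {k : ℕ} (L : E →L[ℝ] CForm E (k + 1))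
    (hL : ∀ u, L (Complex.I • u) = Complex.I • L u) (u : E) :
    CForm.contract u (alternatizeUncurryFin L) =
      L u - alternatizeUncurryFin (compR (CForm.contract u) L) := by
  have h : (CForm.contract u : CForm E (k + 1) →L[ℂ] CForm E k) =
    (1 / 2 : ℂ) • (CForm.curryC u - Complex.I • CForm.curryC (Complex.I • u)) := rfl
  conv_rhs => rw [h, alt_comp_smul, alt_comp_sub, alt_comp_smul]
  rw [CForm.contract_apply, curryLeft_alt,
    curryLeft_alt, hL]
  have h : Complex.I * Complex.I = -1 := Complex.I_mul_I
  match_scalars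
  · linear_combination (-1 / 2 : ℂ) * h
  · ring
  · ring

theorem contract_alt_zero (L : E →L[ℝ] CForm E 0)
    (hL : ∀ u, L (Complex.I • u) = Complex.I • L u) (u : E) :
    CForm.contract u (alternatizeUncurryFin L) = L u := by
  rw [CForm.contract_apply, curryLeft_alt_zero, curryLeft_alt_zero, hL]
  have h : Complex.I * Complex.I = -1 := Complex.I_mul_I
  match_scalars
  linear_combination (-1 / 2 : ℂ) * h

/-- Here only the antilinear part of `L` remains in the leading term; it vanishes for complex linear
`L`. -/
theorem antiContract_alt {k : ℕ} (L : E →L[ℝ] CForm E (k + 1)) (u : E) :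
    CForm.antiContract u (alternatizeUncurryFin L) =
      (1 / 2 : ℂ) • (L u + Complex.I • L (Complex.I • u)) -
        alternatizeUncurryFin (compR (CForm.antiContract u) L) := by
  have h : (CForm.antiContract u : CForm E (k + 1) →L[ℂ] CForm E k) =
    (1 / 2 : ℂ) • (CForm.curryC u + Complex.I • CForm.curryC (Complex.I • u)) := rfl
  conv_rhs => rw [h, alt_comp_smul, alt_comp_add, alt_comp_smul]
  rw [CForm.antiContract_apply, curryLeft_alt,
    curryLeft_alt]
  module

theorem antiContract_alt_zero (L : E →L[ℝ] CForm E 0) (u : E) :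
    CForm.antiContract u (alternatizeUncurryFin L) =
      (1 / 2 : ℂ) • (L u + Complex.I • L (Complex.I • u)) := by
  rw [CForm.antiContract_apply, curryLeft_alt_zero, curryLeft_alt_zero]

/-! ### The antiholomorphic part -/

theorem sum_finset_fin_succ {M : Type*} [AddCommMonoid M] {k : ℕ} (f : Finset (Fin (k + 1)) → M) :
    ∑ S, f S = ∑ S : Finset (Fin k), (f (S.map (Fin.succEmb k)) +
      f (insert 0 (S.map (Fin.succEmb k)))) := by
  have h0 : (0 : Fin (k + 1)) ∉ (Finset.univ : Finset (Fin k)).map (Fin.succEmb k) := by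
    simp
  have hp : ((Finset.univ : Finset (Fin k)).map (Fin.succEmb k)).powerset =
      Finset.univ.map (Finset.mapEmbedding (Fin.succEmb k)).toEmbedding := by
    ext S
    simp only [Finset.mem_powerset, Finset.mem_map, Finset.mem_univ, true_and,
      Finset.subset_map_iff]
    constructor
    · rintro ⟨t, -, rfl⟩; exact ⟨t, rfl⟩
    · rintro ⟨t, rfl⟩; exact ⟨t, Finset.subset_univ _, rfl⟩
  have hu : (Finset.univ : Finset (Fin (k + 1))) =
      insert 0 ((Finset.univ : Finset (Fin k)).map (Fin.succEmb k)) := by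
    ext i
    refine Fin.cases (by simp) (fun j => by simp) i
  rw [← Finset.powerset_univ, hu, Finset.sum_powerset_insert h0, hp, Finset.sum_map,
    Finset.sum_map, ← Finset.sum_add_distrib]
  rfl

theorem CForm.rotate_map_succ {k : ℕ} (S : Finset (Fin k)) (u : E) (v : Fin k → E) :
    CForm.rotate (S.map (Fin.succEmb k)) (Fin.cons u v : Fin (k + 1) → E) =
      Fin.cons u (CForm.rotate S v) := by
  funext i
  refine Fin.cases ?_ (fun j => ?_) i <;> simp [CForm.rotate]

theorem CForm.rotate_insert_map_succ {k : ℕ} (S : Finset (Fin k)) (u : E) (v : Fin k → E) :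
    CForm.rotate (insert 0 (S.map (Fin.succEmb k))) (Fin.cons u v : Fin (k + 1) → E) =
      Fin.cons (Complex.I • u) (CForm.rotate S v) := by
  funext i
  refine Fin.cases ?_ (fun j => ?_) i <;> simp [CForm.rotate]

theorem CForm.antiholPart_apply {k : ℕ} (a : CForm E k) (v : Fin k → E) :
    a.antiholPart v = (1 / 2 : ℂ) ^ k * ∑ S : Finset (Fin k), Complex.I ^ S.card * a (rotate S v) :=
  rfl

/-- The recursion in the degree behind all properties of the `(0,k)`-part: the subsets of the slots
split according to whether they contain the first one, and the two halves assemble to the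
contraction with the `(0,1)`-part of `u`. -/
theorem curryLeft_antiholPart {k : ℕ} (a : CForm E (k + 1)) (u : E) :
    a.antiholPart.curryLeft u = (CForm.antiContract u a).antiholPart := by
  ext v
  rw [CForm.curryLeft_cons, CForm.antiholPart_apply, CForm.antiholPart_apply, sum_finset_fin_succ,
    pow_succ, mul_assoc, Finset.mul_sum]
  congr 1
  refine Finset.sum_congr rfl fun S _ => ?_
  rw [CForm.rotate_map_succ, CForm.rotate_insert_map_succ, Finset.card_map,
    Finset.card_insert_of_notMem (by simp), Finset.card_map, CForm.antiContract_apply,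
    ContinuousAlternatingMap.smul_apply, ContinuousAlternatingMap.add_apply,
    ContinuousAlternatingMap.smul_apply, CForm.curryLeft_cons, CForm.curryLeft_cons, smul_eq_mul,
    smul_eq_mul]
  ring

theorem antiholPart_zero_form (a : CForm E 0) : a.antiholPart = a := by
  ext v
  rw [CForm.antiholPart_apply, Subsingleton.elim v 0]
  have : (Finset.univ : Finset (Finset (Fin 0))) = {∅} := by decide
  rw [this]
  simp [Subsingleton.elim (CForm.rotate _ _) (0 : Fin 0 → E)]

/-- The projection to the component of type `(0,k)` as a linear map. -/
noncomputable def CForm.antiholCLM (k : ℕ) : CForm E k →L[ℂ] CForm E k :=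
  LinearMap.toContinuousLinearMap
    { toFun := fun a => a.antiholPart
      map_add' := fun a b => by
        ext v
        simp only [CForm.antiholPart_apply, ContinuousAlternatingMap.add_apply, mul_add,
          Finset.sum_add_distrib]
      map_smul' := fun c a => by
        ext v
        simp only [CForm.antiholPart_apply, ContinuousAlternatingMap.smul_apply, smul_eq_mul,
          RingHom.id_apply, mul_left_comm _ c, ← Finset.mul_sum] }

theorem CForm.antiholCLM_apply {k : ℕ} (a : CForm E k) : CForm.antiholCLM k a = a.antiholPart := rfl

/-- Antilinearity in the first slot is read off from the recursion; the other slots are reduced to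
it by a transposition. -/
theorem antiholPart_isAntiholomorphic {k : ℕ} (a : CForm E k) :
    a.antiholPart.IsAntiholomorphic := by
  cases k with
  | zero => intro v i; exact i.elim0
  | succ k =>
  have hI : ∀ u, a.antiholPart.curryLeft (Complex.I • u) =
      -Complex.I • a.antiholPart.curryLeft u := by
    intro u
    rw [curryLeft_antiholPart, curryLeft_antiholPart, CForm.antiContract_I,
      ← CForm.antiholCLM_apply, map_smul]
    rfl
  have h0 : ∀ (c : ℂ) u, a.antiholPart.curryLeft (c • u) =
      (starRingEnd ℂ) c • a.antiholPart.curryLeft u := by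
    intro c u
    rw [complex_smul_eq, map_add, map_smul, map_smul, hI, ← CForm.coe_smul, ← CForm.coe_smul]
    conv_rhs => rw [← Complex.re_add_im c]
    simp only [map_add, map_mul, Complex.conj_ofReal, Complex.conj_I]
    module
  have h0' : ∀ (c : ℂ) (v : Fin (k + 1) → E), a.antiholPart (Function.update v 0 (c • v 0)) =
      (starRingEnd ℂ) c * a.antiholPart v := by
    intro c v
    have := congrArg (fun f : CForm E k => f (Fin.tail v)) (h0 c (v 0))
    simp only [CForm.curryLeft_cons, ContinuousAlternatingMap.smul_apply,
      Fin.cons_self_tail] at this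
    rw [smul_eq_mul] at this
    rw [← this]
    congr 1
    funext j
    refine Fin.cases ?_ (fun j => ?_) j <;> simp [Fin.tail]
  intro v i c
  by_cases hi : i = 0
  · subst hi; exact h0' c v
  have hs : ∀ w : Fin (k + 1) → E, a.antiholPart (w ∘ Equiv.swap 0 i) = - a.antiholPart w :=
    fun w => a.antiholPart.toAlternatingMap.map_swap w (Ne.symm hi)
  have h1 : Function.update v i (c • v i) =
      Function.update (v ∘ Equiv.swap 0 i) 0 (c • (v ∘ Equiv.swap 0 i) 0) ∘ Equiv.swap 0 i := by
    funext j
    by_cases hj : j = i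
    · subst hj; simp
    by_cases hj0 : j = 0
    · subst hj0; simp [hj, hi]
    · simp [Function.update, hj, hj0, Equiv.swap_apply_of_ne_of_ne]
  rw [h1, hs, h0', hs]
  ring

theorem CForm.IsAntiholomorphic.curryLeft {k : ℕ} {a : CForm E (k + 1)} (ha : a.IsAntiholomorphic)
    (u : E) : CForm.IsAntiholomorphic (a.curryLeft u) := by
  intro v i c
  have := ha (Fin.cons u v) i.succ c
  rw [CForm.curryLeft_cons, CForm.curryLeft_cons, ← this]
  congr 1
  rw [Fin.cons_succ, Fin.cons_update]

theorem CForm.IsAntiholomorphic.curryLeft_I {k : ℕ} {a : CForm E (k + 1)} (ha : a.IsAntiholomorphic)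
    (u : E) : a.curryLeft (Complex.I • u) = -Complex.I • a.curryLeft u := by
  ext v
  have := ha (Fin.cons u v) 0 Complex.I
  rw [ContinuousAlternatingMap.smul_apply, CForm.curryLeft_cons, CForm.curryLeft_cons, smul_eq_mul,
    ← Complex.conj_I, ← this, Fin.cons_zero, Fin.update_cons_zero]

theorem CForm.IsAntiholomorphic.antiContract_eq {k : ℕ} {a : CForm E (k + 1)}
    (ha : a.IsAntiholomorphic) (u : E) : CForm.antiContract u a = a.curryLeft u := by
  rw [CForm.antiContract_apply, ha.curryLeft_I]
  have h : Complex.I * Complex.I = -1 := Complex.I_mul_I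
  match_scalars
  linear_combination (-1 / 2 : ℂ) * h

theorem CForm.IsAntiholomorphic.antiholPart_eq {k : ℕ} {a : CForm E k} (ha : a.IsAntiholomorphic) :
    a.antiholPart = a := by
  induction k with
  | zero => exact antiholPart_zero_form a
  | succ k ih =>
    apply CForm.ext_cons
    intro u
    rw [curryLeft_antiholPart, ha.antiContract_eq, ih (ha.curryLeft u)]

theorem antiholPart_antiholPart {k : ℕ} (a : CForm E k) : a.antiholPart.antiholPart = a.antiholPart :=
  CForm.IsAntiholomorphic.antiholPart_eq (antiholPart_isAntiholomorphic a)

/-- Every term of such a form has a factor `dz^i`. In the induction, contraction with a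
`(0,1)`-vector kills that factor and otherwise produces a form of the same kind. It applies to the
image of `δ` and to that of `holDegree`. -/
theorem antiholPart_alt_eq_zero {k : ℕ} (L : E →L[ℝ] CForm E k)
    (hL : ∀ u, L (Complex.I • u) = Complex.I • L u) :
    CForm.antiholPart (alternatizeUncurryFin L) = 0 := by
  have h : Complex.I * Complex.I = -1 := Complex.I_mul_I
  have h0 : ∀ u, (1 / 2 : ℂ) • (L u + Complex.I • L (Complex.I • u)) = 0 := by
    intro u
    rw [hL, smul_smul, h]
    module
  induction k with
  | zero =>
    apply CForm.ext_cons
    intro u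
    rw [curryLeft_antiholPart]
    rw [antiContract_alt_zero, h0, ← CForm.antiholCLM_apply, map_zero]
    rfl
  | succ k ih =>
    apply CForm.ext_cons
    intro u
    rw [curryLeft_antiholPart, antiContract_alt, h0, ← CForm.antiholCLM_apply, zero_sub, map_neg, CForm.antiholCLM_apply]
    have : CForm.antiholPart (alternatizeUncurryFin (compR (CForm.antiContract u) L)) = 0 := by
      have hL' : ∀ w, (compR (CForm.antiContract u) L) (Complex.I • w) =
          Complex.I • (compR (CForm.antiContract u) L) w := by
        intro w
        rw [compR_apply, hL, map_smul, compR_apply]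
      refine ih _ hL' (fun w => ?_)
      rw [hL', smul_smul, h]
      module
    rw [this, neg_zero]
    rfl

/-- A factor `dz^i` in a value of `L` cannot be removed by a further wedge product. This is what
makes the projection to type `(0,*)` compatible with the exterior derivative and `∂̄`. -/
theorem antiholPart_alt_antiholPart {k : ℕ} (L : E →L[ℝ] CForm E k) :
    CForm.antiholPart (alternatizeUncurryFin (compR (CForm.antiholCLM k) L)) =
      CForm.antiholPart (alternatizeUncurryFin L) := by
  induction k with
  | zero =>
    congr 2
    ext1 u
    exact antiholPart_zero_form _
  | succ k ih =>
    apply CForm.ext_cons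
    intro u
    rw [curryLeft_antiholPart, curryLeft_antiholPart, antiContract_alt, antiContract_alt,
      ← CForm.antiholCLM_apply, ← CForm.antiholCLM_apply, map_sub, map_sub]
    congr 1
    · rw [compR_apply, compR_apply, ← map_smul (CForm.antiholCLM (k + 1)), ← map_add, ← map_smul]
      exact antiholPart_antiholPart _
    · rw [CForm.antiholCLM_apply, CForm.antiholCLM_apply, ← ih (compR (CForm.antiContract u) L)]
      congr 2
      ext1 w
      rw [compR_apply, compR_apply, compR_apply, compR_apply, CForm.antiholCLM_apply,
        CForm.IsAntiholomorphic.antiContract_eq (antiholPart_isAntiholomorphic _),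
        curryLeft_antiholPart, CForm.antiholCLM_apply]

/-! ### The holomorphic degree -/

/-- The operator which multiplies forms of type `(p,q)` by `p`. -/
noncomputable def CForm.holDegree : (k : ℕ) → CForm E k →L[ℂ] CForm E k
  | 0 => 0
  | k + 1 => LinearMap.toContinuousLinearMap
    { toFun := fun a => alternatizeUncurryFin ((CForm.contract.flip a).restrictScalars ℝ)
      map_add' := fun a b => by
        rw [← CForm.altCLM_apply, ← CForm.altCLM_apply, ← CForm.altCLM_apply, ← map_add]
        congr 1
        ext1 u
        simp
      map_smul' := fun c a => by
        rw [← CForm.altCLM_apply, ← CForm.altCLM_apply, ← map_smul]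
        congr 1
        ext1 u
        simp }

theorem CForm.holDegree_succ {k : ℕ} (a : CForm E (k + 1)) : CForm.holDegree (k + 1) a =
    alternatizeUncurryFin ((CForm.contract.flip a).restrictScalars ℝ) := rfl

theorem curryLeft_curryLeft_swap {k : ℕ} (a : CForm E (k + 2)) (u v : E) :
    (a.curryLeft u).curryLeft v = - (a.curryLeft v).curryLeft u := by
  ext w
  simp only [CForm.curryLeft_cons, ContinuousAlternatingMap.neg_apply]
  have := a.toAlternatingMap.map_swap (Fin.cons v (Fin.cons u w)) (i := 0) (j := 1) (by simp)
  refine Eq.trans ?_ this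
  change _ = a _
  congr 1
  funext j
  refine Fin.cases ?_ (fun j => Fin.cases ?_ (fun j => ?_) j) j
  · simp
  · rw [Function.comp, show (Fin.succ (0 : Fin (k + 1))) = 1 from rfl, Equiv.swap_apply_right]
    rfl
  · rw [Function.comp, Equiv.swap_apply_of_ne_of_ne]
    · rfl
    · exact Fin.succ_ne_zero _
    · intro h
      exact Fin.succ_ne_zero j (Fin.succ_injective _ h)

theorem contract_curryLeft {k : ℕ} (a : CForm E (k + 2)) (u v : E) :
    CForm.contract v (a.curryLeft u) = - (CForm.contract v a).curryLeft u := by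
  rw [CForm.contract_apply, CForm.contract_apply, curryLeft_curryLeft_swap a u v,
    curryLeft_curryLeft_swap a u (Complex.I • v)]
  ext w
  simp only [CForm.curryLeft_cons, ContinuousAlternatingMap.neg_apply,
    ContinuousAlternatingMap.smul_apply, ContinuousAlternatingMap.sub_apply]
  simp only [smul_eq_mul]
  ring

/-- The commutation relation of a number operator: `holDegree` is `∑ dz^i ∧ ι_i`, and its commutator
with `ι_u` is the contraction with the `(1,0)`-part of `u`. -/
theorem curryLeft_holDegree {k : ℕ} (a : CForm E (k + 1)) (u : E) :
    (CForm.holDegree (k + 1) a).curryLeft u =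
      CForm.contract u a + CForm.holDegree k (a.curryLeft u) := by
  cases k with
  | zero =>
    rw [CForm.holDegree_succ, curryLeft_alt_zero, CForm.holDegree]
    simp
  | succ k =>
    rw [CForm.holDegree_succ, curryLeft_alt, CForm.holDegree_succ, sub_eq_add_neg]
    congr 1
    rw [← CForm.altCLM_apply, ← CForm.altCLM_apply, ← map_neg]
    congr 1
    ext1 v
    change - (CForm.contract v a).curryLeft u = CForm.contract v (a.curryLeft u)
    rw [contract_curryLeft]

/-- The contraction with a `(1,0)`-vector lowers the eigenvalue `p` by one. -/
theorem contract_holDegree {k : ℕ} (a : CForm E (k + 1)) (u : E) :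
    CForm.contract u (CForm.holDegree (k + 1) a) =
      CForm.contract u a + CForm.holDegree k (CForm.contract u a) := by
  have h : Complex.I * Complex.I = -1 := Complex.I_mul_I
  rw [CForm.contract_apply, curryLeft_holDegree, curryLeft_holDegree, map_smul]
  have h2 : CForm.holDegree k (CForm.contract u a) = (1 / 2 : ℂ) • (CForm.holDegree k
      (a.curryLeft u) - Complex.I • CForm.holDegree k (a.curryLeft (Complex.I • u))) := by
    rw [CForm.contract_apply, map_smul, map_sub, map_smul]
  rw [h2]
  simp only [FunLike.coe_smul, Pi.smul_apply]
  match_scalars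
  · linear_combination (-1 / 2 : ℂ) * h
  · ring
  · ring

/-- The eigenvalues `p` are nonnegative, but no eigenspace decomposition is needed. For `a` in the
kernel, its `(1,0)`-contractions lie in the kernel of `holDegree + (c + 1)` in lower degree, so they
vanish. All contractions then lie in the kernel of `holDegree + c`, so they vanish as well. -/
theorem holDegree_add_injective {k : ℕ} (c : ℕ) (hc : 0 < c) (a : CForm E k)
    (h : CForm.holDegree k a + (c : ℂ) • a = 0) : a = 0 := by
  induction k generalizing c with
  | zero =>
    have hc' : (c : ℂ) ≠ 0 := Nat.cast_ne_zero.2 hc.ne'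
    rw [CForm.holDegree] at h
    have h' : (c : ℂ) • a = 0 := by simpa using h
    exact (smul_eq_zero.1 h').resolve_left hc'
  | succ k ih =>
    have h1 : ∀ u, CForm.contract u a = 0 := by
      intro u
      apply ih (c + 1) c.succ_pos
      have := congrArg (CForm.contract u) h
      rw [map_add, contract_holDegree, map_zero, map_smul] at this
      rw [← this]
      push_cast
      module
    apply CForm.ext_cons
    intro u
    apply ih c hc
    have := curryLeft_holDegree a u
    rw [h1, zero_add] at this
    rw [← this, ← CForm.curryC_apply, ← CForm.curryC_apply, ← map_smul, ← map_add, h, map_zero]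

/-- The `(1,0)`-contractions of `a` are killed by `holDegree + 1`, hence vanish; so every
contraction of `a` is a `(0,1)`-contraction and the recursion for the `(0,k)`-part applies. -/
theorem isAntiholomorphic_of_holDegree_eq_zero {k : ℕ} (a : CForm E k)
    (h : CForm.holDegree k a = 0) : a.antiholPart = a := by
  induction k with
  | zero => exact antiholPart_zero_form a
  | succ k ih =>
    have h1 : ∀ u, CForm.contract u a = 0 := by
      intro u
      apply holDegree_add_injective 1 one_pos
      have := congrArg (CForm.contract u) h
      rw [contract_holDegree, map_zero] at this
      rw [← this]
      push_cast
      module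
    apply CForm.ext_cons
    intro u
    have h2 := CForm.contract_add_antiContract u a
    rw [h1, zero_add] at h2
    rw [curryLeft_antiholPart, h2]
    apply ih
    have := curryLeft_holDegree a u
    rw [h1, zero_add] at this
    rw [← this, h]
    rfl

theorem antiholPart_holDegree {k : ℕ} (a : CForm E k) :
    (CForm.holDegree k a).antiholPart = 0 := by
  cases k with
  | zero => rw [CForm.holDegree, antiholPart_zero_form]; rfl
  | succ k =>
    rw [CForm.holDegree_succ]
    exact antiholPart_alt_eq_zero _ fun u =>
      ((CForm.contract (E := E) (k := k)).flip a).map_smul Complex.I u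

/-- The wedge product with `dz^i` raises `p` by one. The two orders in which the contraction and the
wedge product can occur are compared by `alt_alt_flip`. -/
theorem holDegree_alt {k : ℕ} (L : E →L[ℝ] CForm E k)
    (hL : ∀ u, L (Complex.I • u) = Complex.I • L u) :
    CForm.holDegree (k + 1) (alternatizeUncurryFin L) =
      alternatizeUncurryFin L + alternatizeUncurryFin (compR (CForm.holDegree k) L) := by
  rw [CForm.holDegree_succ]
  cases k with
  | zero =>
    have h1 : (CForm.contract.flip (alternatizeUncurryFin L)).restrictScalars ℝ = L := by
      ext1 u
      exact contract_alt_zero L hL u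
    have h2 : compR (CForm.holDegree (E := E) 0) L = 0 := rfl
    rw [h1, h2, ← CForm.altCLM_apply 0, map_zero, add_zero]
  | succ k =>
    -- `B u w` is the `(1,0)`-contraction with `u` of `L w`; alternating in one order gives the
    -- correction in `contract_alt`, in the other order it gives `holDegree` of the values of `L`.
    let B : E →L[ℝ] E →L[ℝ] CForm E k :=
      LinearMap.toContinuousLinearMap
        { toFun := fun u => compR (CForm.contract u) L
          map_add' := fun u v => by ext1 w; simp [compR_apply]
          map_smul' := fun c u => by
            ext1 w
            simp only [compR_apply, RingHom.id_apply, FunLike.coe_smul, Pi.smul_apply]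
            rw [← Complex.coe_smul, map_smul, ← CForm.coe_smul]
            rfl }
    have hB := alt_alt_flip B
    have h1 : (CForm.contract.flip (alternatizeUncurryFin L)).restrictScalars ℝ =
        L - alternatizeUncurryFinCLM ℝ E ℂ ∘L B := by
      ext1 u
      exact contract_alt L hL u
    have h2 : compR (CForm.holDegree (k + 1)) L = alternatizeUncurryFinCLM ℝ E ℂ ∘L B.flip := by
      ext1 u
      rw [compR_apply, CForm.holDegree_succ]
      change _ = alternatizeUncurryFin (B.flip u)
      congr 1
    rw [h1, h2]
    simp only [← ContinuousAlternatingMap.alternatizeUncurryFinCLM_apply] at hB ⊢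
    rw [map_sub, hB, sub_eq_add_neg]

/-- The operator `p + r` on forms of type `(p,q)`, corrected by the identity on its kernel. -/
noncomputable def CForm.totalDegree (k r : ℕ) : CForm E k →L[ℂ] CForm E k :=
  CForm.holDegree k + (r : ℂ) • ContinuousLinearMap.id ℂ _ +
    if r = 0 then CForm.antiholCLM k else 0

theorem CForm.totalDegree_zero_apply {k : ℕ} (a : CForm E k) :
    CForm.totalDegree k 0 a = CForm.holDegree k a + a.antiholPart := by
  change CForm.holDegree k a + ((0 : ℕ) : ℂ) • a + a.antiholPart = _
  rw [Nat.cast_zero, zero_smul ℂ a, add_zero]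

theorem CForm.totalDegree_succ_apply {k r : ℕ} (hr : r ≠ 0) (a : CForm E k) :
    CForm.totalDegree k r a = CForm.holDegree k a + (r : ℂ) • a := by
  simp [totalDegree, hr]

/-- For positive weight this is `holDegree_add_injective`. In weight zero the `(0,k)`-part of the
equation shows that the `(0,k)`-part of `a` vanishes; what remains lies in the kernel of `holDegree`
and so equals its `(0,k)`-part. -/
theorem totalDegree_injective (k r : ℕ) :
    Function.Injective (CForm.totalDegree (E := E) k r) := by
  rw [injective_iff_map_eq_zero]
  intro a ha
  by_cases hr : r = 0
  · subst hr
    rw [CForm.totalDegree_zero_apply] at ha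
    have h1 := congrArg CForm.antiholPart ha
    rw [← CForm.antiholCLM_apply, ← CForm.antiholCLM_apply, map_add,
      CForm.antiholCLM_apply, CForm.antiholCLM_apply, antiholPart_holDegree, zero_add,
      CForm.antiholCLM_apply, antiholPart_antiholPart,
      show CForm.antiholPart (0 : CForm E k) = 0 from map_zero (CForm.antiholCLM k)] at h1
    rw [h1, add_zero] at ha
    rw [← isAntiholomorphic_of_holDegree_eq_zero a ha, h1]
  · rw [CForm.totalDegree_succ_apply hr] at ha
    exact holDegree_add_injective r (Nat.pos_of_ne_zero hr) a ha

/-- The inverse of `totalDegree`. -/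
noncomputable def CForm.totalDegreeInv (k r : ℕ) : CForm E k →L[ℂ] CForm E k :=
  LinearMap.toContinuousLinearMap
    (LinearEquiv.ofInjectiveEndo (CForm.totalDegree k r).toLinearMap
      (totalDegree_injective k r)).symm.toLinearMap

theorem totalDegree_totalDegreeInv {k r : ℕ} (a : CForm E k) :
    CForm.totalDegree k r (CForm.totalDegreeInv k r a) = a :=
  (LinearEquiv.ofInjectiveEndo (CForm.totalDegree k r).toLinearMap
      (totalDegree_injective k r)).apply_symm_apply a

/-! ### Pull-back -/

theorem CForm.pullback_apply (J : E →L[ℂ] E) {k : ℕ} (a : CForm E k) (v : Fin k → E) :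
    a.pullback J v = a (J ∘ v) := rfl

/-- Pull-back of forms as a linear map. -/
noncomputable def CForm.pullbackCLM (J : E →L[ℂ] E) (k : ℕ) : CForm E k →L[ℂ] CForm E k :=
  LinearMap.toContinuousLinearMap
    { toFun := fun a => a.pullback J
      map_add' := fun _ _ => rfl
      map_smul' := fun _ _ => rfl }

theorem CForm.pullbackCLM_apply (J : E →L[ℂ] E) {k : ℕ} (a : CForm E k) :
    CForm.pullbackCLM J k a = a.pullback J := rfl

theorem pullback_alt (J : E →L[ℂ] E) {k : ℕ} (L : E →L[ℝ] CForm E k) :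
    CForm.pullback J (alternatizeUncurryFin L) =
      alternatizeUncurryFin (compR (CForm.pullbackCLM J k) (L.comp (J.restrictScalars ℝ))) := by
  ext v
  rw [CForm.pullback_apply, alternatizeUncurryFin_apply, alternatizeUncurryFin_apply]
  rfl

theorem curryLeft_pullback (J : E →L[ℂ] E) {k : ℕ} (a : CForm E (k + 1)) (u : E) :
    (a.pullback J).curryLeft u = CForm.pullback J (a.curryLeft (J u)) := by
  ext v
  rw [CForm.curryLeft_cons, CForm.pullback_apply, CForm.pullback_apply, CForm.curryLeft_cons,
    Fin.comp_cons]

theorem contract_pullback (J : E →L[ℂ] E) {k : ℕ} (a : CForm E (k + 1)) (u : E) :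
    CForm.contract u (a.pullback J) = (CForm.contract (J u) a).pullback J := by
  rw [CForm.contract_apply, CForm.contract_apply, curryLeft_pullback, curryLeft_pullback,
    J.map_smul]
  rfl

theorem antiholPart_pullback (J : E →L[ℂ] E) {k : ℕ} (a : CForm E k) :
    (a.pullback J).antiholPart = a.antiholPart.pullback J := by
  ext v
  rw [CForm.antiholPart_apply, CForm.pullback_apply, CForm.antiholPart_apply]
  congr 1
  refine Finset.sum_congr rfl fun S _ => ?_
  rw [CForm.pullback_apply]
  congr 2
  funext i
  simp only [CForm.rotate, Function.comp]
  split_ifs <;> simp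

theorem holDegree_pullback (J : E →L[ℂ] E) {k : ℕ} (a : CForm E k) :
    CForm.holDegree k (a.pullback J) = (CForm.holDegree k a).pullback J := by
  cases k with
  | zero => rfl
  | succ k =>
    rw [CForm.holDegree_succ, CForm.holDegree_succ, pullback_alt]
    congr 1
    ext1 u
    exact contract_pullback J a u

theorem totalDegree_pullback (J : E →L[ℂ] E) {k r : ℕ} (a : CForm E k) :
    CForm.totalDegree k r (a.pullback J) = (CForm.totalDegree k r a).pullback J := by
  by_cases hr : r = 0
  · subst hr
    rw [CForm.totalDegree_zero_apply, CForm.totalDegree_zero_apply, holDegree_pullback,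
      antiholPart_pullback]
    rfl
  · rw [CForm.totalDegree_succ_apply hr, CForm.totalDegree_succ_apply hr, holDegree_pullback]
    rfl

/-- Inherited from `totalDegree` by injectivity; `J` need not be invertible. Because of this
naturality, fibrewise division by the total degree is an operation on global sections. -/
theorem totalDegreeInv_pullback (J : E →L[ℂ] E) {k r : ℕ} (a : CForm E k) :
    CForm.totalDegreeInv k r (a.pullback J) = (CForm.totalDegreeInv k r a).pullback J := by
  apply totalDegree_injective k r
  rw [totalDegree_totalDegreeInv, totalDegree_pullback, totalDegree_totalDegreeInv]

end Types
end HolWeyl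

namespace HolWeyl
open ContinuousAlternatingMap (alternatizeUncurryFin alternatizeUncurryFinCLM alternatizeUncurryFin_apply)

/-! ### Homogeneous polynomial maps. -/

section Polynomials

variable {E : Type} [NormedAddCommGroup E] [NormedSpace ℂ E]
  {F G H : Type} [NormedAddCommGroup F] [NormedSpace ℂ F] [NormedAddCommGroup G] [NormedSpace ℂ G]
  [NormedAddCommGroup H] [NormedSpace ℂ H]

namespace IsHomogeneousPoly

theorem fun_add {r : ℕ} {P Q : E → F} (hP : IsHomogeneousPoly r P) (hQ : IsHomogeneousPoly r Q) :
    IsHomogeneousPoly r (fun y => P y + Q y) := hP.add hQ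

theorem fun_smul {r : ℕ} {P : E → F} (c : ℂ) (hP : IsHomogeneousPoly r P) :
    IsHomogeneousPoly r (fun y => c • P y) := hP.smul c

theorem fun_neg {r : ℕ} {P : E → F} (hP : IsHomogeneousPoly r P) :
    IsHomogeneousPoly r (fun y => - P y) := by
  simpa using hP.fun_smul (-1)

theorem fun_sub {r : ℕ} {P Q : E → F} (hP : IsHomogeneousPoly r P) (hQ : IsHomogeneousPoly r Q) :
    IsHomogeneousPoly r (fun y => P y - Q y) := by
  simpa [sub_eq_add_neg] using hP.fun_add hQ.fun_neg

theorem fun_sum {ι : Type*} {s : Finset ι} {r : ℕ} {P : ι → E → F}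
    (h : ∀ i ∈ s, IsHomogeneousPoly r (P i)) : IsHomogeneousPoly r (fun y => ∑ i ∈ s, P i y) := by
  classical
  induction s using Finset.induction_on with
  | empty => exact IsHomogeneousPoly.zero (E := E) (F := F) r
  | insert i s hi ih =>
    simp only [Finset.sum_insert hi]
    exact (h i (Finset.mem_insert_self i s)).fun_add
      (ih fun j hj => h j (Finset.mem_insert_of_mem hj))

theorem clm_comp {r : ℕ} {P : E → F} (hP : IsHomogeneousPoly r P) (T : F →L[ℂ] G) :
    IsHomogeneousPoly r (fun y => T (P y)) := by
  obtain ⟨f, hf⟩ := hP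
  exact ⟨T.compContinuousMultilinearMap f, fun y => by simp [hf]⟩

theorem comp_clm {E' : Type} [NormedAddCommGroup E'] [NormedSpace ℂ E'] {r : ℕ} {P : E → F}
    (hP : IsHomogeneousPoly r P) (J : E' →L[ℂ] E) : IsHomogeneousPoly r (fun y => P (J y)) := by
  obtain ⟨f, hf⟩ := hP
  exact ⟨f.compContinuousLinearMap fun _ => J, fun y => by simp [hf]⟩

theorem const (c : F) : IsHomogeneousPoly 0 (fun _ : E => c) :=
  ⟨ContinuousMultilinearMap.constOfIsEmpty ℂ _ c, fun _ => rfl⟩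

theorem eq_const {P : E → F} (hP : IsHomogeneousPoly 0 P) (y : E) : P y = P 0 := by
  obtain ⟨f, hf⟩ := hP
  rw [hf, hf]
  congr 1
  exact Subsingleton.elim _ _

theorem clm (T : E →L[ℂ] F) : IsHomogeneousPoly 1 (fun y => T y) :=
  ⟨ContinuousMultilinearMap.ofSubsingleton ℂ E F 0 T, fun _ => rfl⟩

theorem eq_zero_of_zero {P : E → F} (r : ℕ) (h : ∀ y, P y = 0) : IsHomogeneousPoly r P := by
  have : P = 0 := funext h
  rw [this]
  exact IsHomogeneousPoly.zero r

theorem contDiff {r : ℕ} {P : E → F} (hP : IsHomogeneousPoly r P) {n : WithTop ℕ∞} :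
    ContDiff ℂ n P := by
  obtain ⟨f, hf⟩ := hP
  rw [funext hf]
  exact f.contDiff.comp (contDiff_pi.2 fun _ => contDiff_id)

theorem mul_coord {r : ℕ} {P : E → F} (hP : IsHomogeneousPoly r P) (φ : E →L[ℂ] ℂ) :
    IsHomogeneousPoly (r + 1) (fun y => φ y • P y) := by
  obtain ⟨f, hf⟩ := hP
  refine ⟨(φ.smulRight f).uncurryLeft, fun y => ?_⟩
  change φ y • P y = _
  rw [hf]
  rfl

variable [FiniteDimensional ℂ E]

/-- The coordinate functions of the standard basis. -/
noncomputable def _root_.HolWeyl.coord (E : Type) [NormedAddCommGroup E] [NormedSpace ℂ E]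
    [FiniteDimensional ℂ E] (i : Fin (Module.finrank ℂ E)) : E →L[ℂ] ℂ :=
  LinearMap.toContinuousLinearMap ((Module.finBasis ℂ E).coord i)

theorem _root_.HolWeyl.sum_coord (y : E) : ∑ i, coord E i y • Module.finBasis ℂ E i = y :=
  (Module.finBasis ℂ E).sum_repr y

/-- The induction principle for homogeneous polynomials: products, derivatives and Euler's identity
are all reduced to multiplication by one coordinate at a time. -/
theorem exists_succ {r : ℕ} {P : E → F} (hP : IsHomogeneousPoly (r + 1) P) :
    ∃ Q : Fin (Module.finrank ℂ E) → E → F, (∀ i, IsHomogeneousPoly r (Q i)) ∧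
      P = fun y => ∑ i, coord E i y • Q i y := by
  obtain ⟨f, hf⟩ := hP
  refine ⟨fun i y => f.curryLeft (Module.finBasis ℂ E i) fun _ => y,
    fun i => ⟨f.curryLeft (Module.finBasis ℂ E i), fun y => rfl⟩, funext fun y => ?_⟩
  have h1 : P y = f.curryLeft y fun _ => y := by
    rw [hf, ContinuousMultilinearMap.curryLeft_apply]
    congr 1
    funext i
    refine Fin.cases ?_ (fun i => ?_) i <;> simp
  rw [h1]
  conv_lhs => rw [← sum_coord y]
  rw [map_sum, sum_apply]
  simp only [map_smul, smul_apply, sum_coord]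

theorem bilin {a b : ℕ} {P : E → F} {Q : E → G} (hP : IsHomogeneousPoly a P)
    (hQ : IsHomogeneousPoly b Q) (B : F →L[ℂ] G →L[ℂ] H) :
    IsHomogeneousPoly (a + b) (fun y => B (P y) (Q y)) := by
  induction a generalizing P with
  | zero =>
    have : (fun y => B (P y) (Q y)) = fun y => B (P 0) (Q y) := by
      funext y; rw [hP.eq_const]
    rw [this, zero_add]
    exact hQ.clm_comp _
  | succ a ih =>
    obtain ⟨R, hR, rfl⟩ := hP.exists_succ
    have : (fun y => B (∑ i, coord E i y • R i y) (Q y)) =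
        fun y => ∑ i, coord E i y • B (R i y) (Q y) := by
      funext y
      simp
    rw [this, Nat.add_right_comm]
    exact fun_sum fun i _ => (ih (hR i)).mul_coord _

theorem smul_fun {a b : ℕ} {P : E → ℂ} {Q : E → F} (hP : IsHomogeneousPoly a P)
    (hQ : IsHomogeneousPoly b Q) : IsHomogeneousPoly (a + b) (fun y => P y • Q y) :=
  hP.bilin hQ (ContinuousLinearMap.lsmul ℂ ℂ)

theorem fderiv_const {P : E → F} (hP : IsHomogeneousPoly 0 P) (y : E) : fderiv ℂ P y = 0 := by
  have : P = fun _ => P 0 := funext hP.eq_const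
  rw [this]
  simp

theorem fderiv_complex {r : ℕ} {P : E → F} (hP : IsHomogeneousPoly (r + 1) P) :
    IsHomogeneousPoly r (fun y => fderiv ℂ P y) := by
  induction r generalizing P with
  | zero =>
    obtain ⟨Q, hQ, rfl⟩ := hP.exists_succ
    have : (fun y => fderiv ℂ (fun y => ∑ i, coord E i y • Q i y) y) =
        fun y => ∑ i, (coord E i).smulRight (Q i y) := by
      funext y
      rw [fderiv_fun_sum fun i _ => ((coord E i).differentiableAt).fun_smul
        (((hQ i).contDiff (n := 1)).differentiable one_ne_zero y)]
      refine Finset.sum_congr rfl fun i _ => ?_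
      rw [fderiv_fun_smul (coord E i).differentiableAt
        (((hQ i).contDiff (n := 1)).differentiable one_ne_zero y), (hQ i).fderiv_const,
        ContinuousLinearMap.fderiv, smul_zero, zero_add]
    rw [this]
    exact fun_sum fun i _ => (hQ i).clm_comp
      ((ContinuousLinearMap.smulRightL ℂ E F (coord E i)))
  | succ r ih =>
    obtain ⟨Q, hQ, rfl⟩ := hP.exists_succ
    have : (fun y => fderiv ℂ (fun y => ∑ i, coord E i y • Q i y) y) =
        fun y => ∑ i, (coord E i y • fderiv ℂ (Q i) y + (coord E i).smulRight (Q i y)) := by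
      funext y
      rw [fderiv_fun_sum fun i _ => ((coord E i).differentiableAt).fun_smul
        (((hQ i).contDiff (n := 1)).differentiable one_ne_zero y)]
      refine Finset.sum_congr rfl fun i _ => ?_
      rw [fderiv_fun_smul (coord E i).differentiableAt
        (((hQ i).contDiff (n := 1)).differentiable one_ne_zero y),
        ContinuousLinearMap.fderiv]
    rw [this]
    exact fun_sum fun i _ => ((ih (hQ i)).mul_coord _).fun_add ((hQ i).clm_comp
      ((ContinuousLinearMap.smulRightL ℂ E F (coord E i))))

theorem euler {r : ℕ} {P : E → F} (hP : IsHomogeneousPoly r P) (y : E) :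
    fderiv ℂ P y y = (r : ℂ) • P y := by
  induction r generalizing P with
  | zero => simp [hP.fderiv_const]
  | succ r ih =>
    obtain ⟨Q, hQ, rfl⟩ := hP.exists_succ
    rw [fderiv_fun_sum fun i _ => ((coord E i).differentiableAt).fun_smul
      (((hQ i).contDiff (n := 1)).differentiable one_ne_zero y), sum_apply,
      Finset.smul_sum]
    refine Finset.sum_congr rfl fun i _ => ?_
    rw [fderiv_fun_smul (coord E i).differentiableAt
      (((hQ i).contDiff (n := 1)).differentiable one_ne_zero y),
      ContinuousLinearMap.fderiv]
    simp only [FunLike.coe_add, FunLike.coe_smul, Pi.add_apply, Pi.smul_apply,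
      ContinuousLinearMap.smulRight_apply, ih (hQ i)]
    push_cast
    module

section Real

variable [NormedSpace ℝ F] [IsScalarTower ℝ ℂ F]

theorem contDiff_real {r : ℕ} {P : E → F} (hP : IsHomogeneousPoly r P) {n : WithTop ℕ∞} :
    ContDiff ℝ n P := hP.contDiff.restrict_scalars ℝ

theorem differentiableAt_real {r : ℕ} {P : E → F} (hP : IsHomogeneousPoly r P) (y : E) :
    DifferentiableAt ℝ P y := (hP.contDiff_real (n := 1)).differentiable one_ne_zero y

theorem fderiv_real {r : ℕ} {P : E → F} (hP : IsHomogeneousPoly r P) (y u : E) :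
    fderiv ℝ P y u = fderiv ℂ P y u := by
  rw [((hP.contDiff (n := 1)).differentiable one_ne_zero y).fderiv_restrictScalars ℝ]
  rfl

theorem fderiv_apply_smul {r : ℕ} {P : E → F} (hP : IsHomogeneousPoly r P) (y u : E) (c : ℂ) :
    fderiv ℝ P y (c • u) = c • fderiv ℝ P y u := by
  rw [hP.fderiv_real, hP.fderiv_real, map_smul]

theorem fderiv_apply {r : ℕ} {P : E → F} (hP : IsHomogeneousPoly (r + 1) P) (u : E) :
    IsHomogeneousPoly r (fun y => fderiv ℝ P y u) := by
  simp only [hP.fderiv_real]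
  exact hP.fderiv_complex.clm_comp (ContinuousLinearMap.apply ℂ F u)

theorem fderiv_apply_zero {P : E → F} (hP : IsHomogeneousPoly 0 P) (y u : E) :
    fderiv ℝ P y u = 0 := by
  rw [hP.fderiv_real, hP.fderiv_const]
  rfl

theorem fderiv_apply_self {r : ℕ} {P : E → F} (hP : IsHomogeneousPoly r P) (y : E) :
    fderiv ℝ P y y = (r : ℂ) • P y := by
  rw [hP.fderiv_real, hP.euler]

theorem fderiv_apply_eq_sum {r : ℕ} {P : E → F} (hP : IsHomogeneousPoly r P) (y u : E) :
    fderiv ℝ P y u = ∑ i, coord E i u • fderiv ℝ P y (Module.finBasis ℂ E i) := by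
  conv_lhs => rw [← sum_coord u]
  rw [map_sum]
  exact Finset.sum_congr rfl fun i _ => hP.fderiv_apply_smul _ _ _

/-- Degree count for the derivative along a polynomial vector field. The relation `q + p = r + 1`
also covers `q = 0`, where the derivative vanishes. -/
theorem fderiv_comp {q p : ℕ} {P : E → F} {A : E → E} (hP : IsHomogeneousPoly q P)
    (hA : IsHomogeneousPoly p A) {r : ℕ} (hr : q + p = r + 1) :
    IsHomogeneousPoly r (fun y => fderiv ℝ P y (A y)) := by
  cases q with
  | zero => exact eq_zero_of_zero r fun y => hP.fderiv_apply_zero y _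
  | succ q =>
    simp only [fun y => hP.fderiv_apply_eq_sum y (A y)]
    have : r = p + q := by omega
    subst this
    exact fun_sum fun i _ => (hA.clm_comp (coord E i)).smul_fun (hP.fderiv_apply _)

theorem iteratedFDeriv_apply {r m : ℕ} {P : E → F} (hP : IsHomogeneousPoly (r + m) P)
    (v : Fin m → E) : IsHomogeneousPoly r (fun y => iteratedFDeriv ℝ m P y v) := by
  induction m generalizing r with
  | zero => simpa using hP
  | succ m ih =>
    have h1 : IsHomogeneousPoly (r + 1) (fun y => iteratedFDeriv ℝ m P y (Fin.tail v)) :=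
      ih (by rwa [Nat.add_assoc, Nat.add_comm 1]) _
    have h2 : ∀ y, iteratedFDeriv ℝ (m + 1) P y v =
        fderiv ℝ (fun y => iteratedFDeriv ℝ m P y (Fin.tail v)) y (v 0) := by
      intro y
      rw [iteratedFDeriv_succ_apply_left]
      have hd : DifferentiableAt ℝ (iteratedFDeriv ℝ m P) y :=
        (hP.contDiff_real (n := m + 1)).differentiable_iteratedFDeriv
          (by exact_mod_cast Nat.lt_succ_self m) y
      rw [fderiv_continuousMultilinear_apply_const_apply hd]
    simp only [h2]
    exact h1.fderiv_apply _

theorem iteratedFDeriv_eq_zero {r m : ℕ} (hrm : r < m) {P : E → F} (hP : IsHomogeneousPoly r P)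
    (v : Fin m → E) (y : E) : iteratedFDeriv ℝ m P y v = 0 := by
  induction m generalizing r y with
  | zero => omega
  | succ m ih =>
    rw [iteratedFDeriv_succ_apply_left]
    have hd : DifferentiableAt ℝ (iteratedFDeriv ℝ m P) y :=
      (hP.contDiff_real (n := m + 1)).differentiable_iteratedFDeriv
        (by exact_mod_cast Nat.lt_succ_self m) y
    rw [← fderiv_continuousMultilinear_apply_const_apply hd]
    rcases Nat.lt_succ_iff_lt_or_eq.1 hrm with h | h
    · simp only [fun y => ih h hP (Fin.tail v) y]
      simp
    · have h1 : IsHomogeneousPoly (0 + m) P := by rwa [zero_add, ← h]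
      exact (h1.iteratedFDeriv_apply (Fin.tail v)).fderiv_apply_zero _ _

end Real

section Limits

variable [FiniteDimensional ℂ F]

/-- Homogeneous polynomials of fixed degree form a finite-dimensional, hence closed, subspace of all
functions with the topology of pointwise convergence. -/
theorem of_tendsto {ι : Type*} {l : Filter ι} [l.NeBot] {r : ℕ} {P : ι → E → F} {Q : E → F}
    (hP : ∀ᶠ i in l, IsHomogeneousPoly r (P i))
    (h : ∀ y, Filter.Tendsto (fun i => P i y) l (𝓝 (Q y))) : IsHomogeneousPoly r Q := by
  let Φ : ContinuousMultilinearMap ℂ (fun _ : Fin r => E) F →ₗ[ℂ] (E → F) :=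
    { toFun := fun f y => f fun _ => y
      map_add' := fun _ _ => rfl
      map_smul' := fun _ _ => rfl }
  have : FiniteDimensional ℂ (ContinuousMultilinearMap ℂ (fun _ : Fin r => E) F) :=
    FiniteDimensional.of_injective
      ({ toFun := fun f => f.toMultilinearMap
         map_add' := fun _ _ => rfl
         map_smul' := fun _ _ => rfl } :
        ContinuousMultilinearMap ℂ (fun _ : Fin r => E) F →ₗ[ℂ]
          MultilinearMap ℂ (fun _ : Fin r => E) F)
      ContinuousMultilinearMap.toMultilinearMap_injective
  have hc := (LinearMap.range Φ).closed_of_finiteDimensional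
  have hQ : Q ∈ LinearMap.range Φ := by
    refine hc.mem_of_tendsto (tendsto_pi_nhds.2 h) ?_
    filter_upwards [hP] with i hi
    obtain ⟨f, hf⟩ := hi
    exact ⟨f, funext fun y => (hf y).symm⟩
  obtain ⟨f, hf⟩ := hQ
  exact ⟨f, fun y => (congrFun hf y).symm⟩

/-- The derivative in the base point is a pointwise limit of difference quotients, which are
homogeneous polynomials in the fibre variable. -/
theorem fderiv_param [NormedSpace ℝ F] [IsScalarTower ℝ ℂ F] {r : ℕ} {P : E → E → F} {z : E}
    (hP : ∀ᶠ z' in 𝓝 z, IsHomogeneousPoly r (P z'))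
    (hd : ∀ y, DifferentiableAt ℝ (fun z' => P z' y) z) (v : E) :
    IsHomogeneousPoly r (fun y => fderiv ℝ (fun z' => P z' y) z v) := by
  have hz : IsHomogeneousPoly r (P z) := hP.self_of_nhds
  have ht : Filter.Tendsto (fun t : ℝ => z + t • v) (𝓝[≠] 0) (𝓝 z) := by
    have : ContinuousAt (fun t : ℝ => z + t • v) 0 := by fun_prop
    have h := this.tendsto
    simp only [zero_smul, add_zero] at h
    exact h.mono_left nhdsWithin_le_nhds
  refine of_tendsto (l := 𝓝[≠] (0 : ℝ)) (P := fun t y => t⁻¹ • (P (z + t • v) y - P z y)) ?_ ?_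
  · filter_upwards [ht.eventually hP] with t h
    have h' := (h.fun_sub hz).fun_smul ((t⁻¹ : ℝ) : ℂ)
    convert! h' using 2 with y
    rw [← smul_one_smul ℂ (t⁻¹ : ℝ) (P (z + t • v) y - P z y)]
    congr 1
    simp
  · intro y
    have := ((hd y).hasFDerivAt.hasLineDerivAt v).tendsto_slope_zero
    simpa using this

end Limits

end IsHomogeneousPoly

end Polynomials
end HolWeyl

namespace HolWeyl
open ContinuousAlternatingMap (alternatizeUncurryFin alternatizeUncurryFinCLM alternatizeUncurryFin_apply)

/-! ### Coordinate changes and the local expressions of sections. -/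

section Charts

variable {E : Type} [NormedAddCommGroup E] [NormedSpace ℂ E]
  {X : Type} [TopologicalSpace X] [ChartedSpace E X]

/-- The change from the coordinates `chartAt E x₀` to `chartAt E x₁`. -/
noncomputable def chartChange (x₀ x₁ : X) (z : E) : E := chartAt E x₁ ((chartAt E x₀).symm z)

/-- The coordinates `z` of `chartAt E x₀` belong to a point in the domain of `chartAt E x₁`. -/
def InOverlap (x₀ x₁ : X) (z : E) : Prop :=
  z ∈ (chartAt E x₀).target ∧ (chartAt E x₀).symm z ∈ (chartAt E x₁).source

theorem InOverlap.of_mem {x₀ x₁ x : X} (h₀ : x ∈ (chartAt E x₀).source)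
    (h₁ : x ∈ (chartAt E x₁).source) : InOverlap x₀ x₁ (chartAt E x₀ x) :=
  ⟨(chartAt E x₀).map_source h₀, by rwa [(chartAt E x₀).left_inv h₀]⟩

theorem InOverlap.self {x₀ : X} {z : E} (hz : z ∈ (chartAt E x₀).target) :
    InOverlap x₀ ((chartAt E x₀).symm z) z := ⟨hz, mem_chart_source E _⟩

theorem InOverlap.eventually {x₀ x₁ : X} {z : E} (h : InOverlap x₀ x₁ z) :
    ∀ᶠ z' in 𝓝 z, InOverlap x₀ x₁ z' := by
  have h1 := (chartAt E x₀).continuousAt_symm h.1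
  filter_upwards [(chartAt E x₀).open_target.mem_nhds h.1,
    h1.eventually ((chartAt E x₁).open_source.mem_nhds h.2)] with z' h h' using ⟨h, h'⟩

theorem chart_symm_chartChange {x₀ x₁ : X} {z : E} (h : InOverlap x₀ x₁ z) :
    (chartAt E x₁).symm (chartChange x₀ x₁ z) = (chartAt E x₀).symm z :=
  (chartAt E x₁).left_inv h.2

theorem InOverlap.symm {x₀ x₁ : X} {z : E} (h : InOverlap x₀ x₁ z) :
    InOverlap x₁ x₀ (chartChange x₀ x₁ z) :=
  ⟨(chartAt E x₁).map_source h.2, by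
    rw [chart_symm_chartChange h]; exact (chartAt E x₀).map_target h.1⟩

variable [IsManifold 𝓘(ℂ, E) ω X]

theorem contDiffAt_chartChange {x₀ x₁ : X} {z : E} (h : InOverlap x₀ x₁ z) :
    ContDiffAt ℂ ω (chartChange x₀ x₁) z := by
  have h1 := (contDiffGroupoid ω 𝓘(ℂ, E)).compatible (chart_mem_atlas E x₀) (chart_mem_atlas E x₁)
  have h2 : ContDiffOn ℂ ω _ _ := (mem_groupoid_of_pregroupoid.1 h1).1
  have h3 : ContDiffOn ℂ ω (chartChange x₀ x₁)
      ((chartAt E x₀).symm ≫ₕ (chartAt E x₁)).source := by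
    simpa using! h2
  exact h3.contDiffAt (((chartAt E x₀).symm ≫ₕ (chartAt E x₁)).open_source.mem_nhds
    ⟨h.1, h.2⟩)

theorem contDiffAt_chartChange_real {x₀ x₁ : X} {z : E} (h : InOverlap x₀ x₁ z) {n : WithTop ℕ∞} :
    ContDiffAt ℝ n (chartChange x₀ x₁) z :=
  ((contDiffAt_chartChange h).of_le le_top).restrict_scalars ℝ

theorem differentiableAt_chartChange {x₀ x₁ : X} {z : E} (h : InOverlap x₀ x₁ z) :
    DifferentiableAt ℂ (chartChange x₀ x₁) z :=
  (contDiffAt_chartChange h).differentiableAt (by simp)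

theorem fderiv_chartChange_real {x₀ x₁ : X} {z : E} (h : InOverlap x₀ x₁ z) :
    fderiv ℝ (chartChange x₀ x₁) z = (fderiv ℂ (chartChange x₀ x₁) z).restrictScalars ℝ :=
  (differentiableAt_chartChange h).fderiv_restrictScalars ℝ

theorem contDiffAt_fderiv_chartChange {x₀ x₁ : X} {z : E} (h : InOverlap x₀ x₁ z)
    {n : WithTop ℕ∞} : ContDiffAt ℝ n (fun z => fderiv ℂ (chartChange x₀ x₁) z) z := by
  have h1 : ContDiffAt ℂ ω (fderiv ℂ (chartChange x₀ x₁)) z :=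
    (contDiffAt_chartChange h).fderiv_right (m := ω) (by simp)
  exact (h1.of_le le_top).restrict_scalars ℝ

theorem fderiv_chartChange_comp {x₀ x₁ x₂ : X} {z : E} (h : InOverlap x₀ x₁ z)
    (h' : InOverlap x₀ x₂ z) :
    fderiv ℂ (chartChange x₀ x₂) z =
      (fderiv ℂ (chartChange x₁ x₂) (chartChange x₀ x₁ z)).comp (fderiv ℂ (chartChange x₀ x₁) z) := by
  have h12 : InOverlap x₁ x₂ (chartChange x₀ x₁ z) :=
    ⟨h.symm.1, by rw [chart_symm_chartChange h]; exact h'.2⟩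
  rw [← fderiv_comp z (differentiableAt_chartChange h12) (differentiableAt_chartChange h)]
  refine Filter.EventuallyEq.fderiv_eq ?_
  filter_upwards [h.eventually] with z' hz'
  simp only [Function.comp, chartChange]
  rw [(chartAt E x₁).left_inv hz'.2]

theorem fderiv_chartChange_self {x₀ : X} {z : E} (h : z ∈ (chartAt E x₀).target) :
    fderiv ℂ (chartChange x₀ x₀) z = ContinuousLinearMap.id ℂ E := by
  have : chartChange x₀ x₀ =ᶠ[𝓝 z] id := by
    filter_upwards [(chartAt E x₀).open_target.mem_nhds h] with z' hz'
    exact (chartAt E x₀).right_inv hz'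
  rw [this.fderiv_eq, fderiv_id]

theorem jac_eq (x₀ x : X) : jac x₀ x = fderiv ℂ (chartChange x₀ x) (chartAt E x₀ x) := by
  rw [jac, tangentCoordChange_def]
  simp only [mfld_simps, fderivWithin_univ]
  rfl

theorem jac_symm {x₀ : X} {z : E} (hz : z ∈ (chartAt E x₀).target) :
    jac x₀ ((chartAt E x₀).symm z) = fderiv ℂ (chartChange x₀ ((chartAt E x₀).symm z)) z := by
  rw [jac_eq, (chartAt E x₀).right_inv hz]

theorem jac_self (x : X) : jac x x = ContinuousLinearMap.id ℂ E := by
  rw [jac_eq, fderiv_chartChange_self (mem_chart_target E x)]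

/-- The inverse of `jac x₀ x`. -/
noncomputable def jacInv (x₀ x : X) : E →L[ℂ] E := fderiv ℂ (chartChange x x₀) (chartAt E x x)

theorem jacInv_self (x : X) : jacInv x x = ContinuousLinearMap.id ℂ E := by
  rw [jacInv, fderiv_chartChange_self (mem_chart_target E x)]

theorem jac_comp_jacInv {x₀ x : X} (h : x ∈ (chartAt E x₀).source) :
    (jac x₀ x).comp (jacInv x₀ x) = ContinuousLinearMap.id ℂ E := by
  have h1 := InOverlap.of_mem (E := E) (mem_chart_source E x) h
  have h2 := InOverlap.of_mem (E := E) (mem_chart_source E x) (mem_chart_source E x)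
  have := fderiv_chartChange_comp h1 h2
  rw [fderiv_chartChange_self h1.1] at this
  rw [jac_eq, jacInv, this, chartChange, (chartAt E x).left_inv (mem_chart_source E x)]

theorem jacInv_comp_jac {x₀ x : X} (h : x ∈ (chartAt E x₀).source) :
    (jacInv x₀ x).comp (jac x₀ x) = ContinuousLinearMap.id ℂ E := by
  have h1 := InOverlap.of_mem (E := E) h (mem_chart_source E x)
  have h2 := InOverlap.of_mem (E := E) h h
  have := fderiv_chartChange_comp h1 h2
  rw [fderiv_chartChange_self h1.1] at this
  rw [jac_eq, jacInv, this, chartChange, (chartAt E x₀).left_inv h]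

theorem jac_jacInv {x₀ x : X} (h : x ∈ (chartAt E x₀).source) (y : E) :
    jac x₀ x (jacInv x₀ x y) = y := DFunLike.congr_fun (jac_comp_jacInv h) y

theorem jacInv_jac {x₀ x : X} (h : x ∈ (chartAt E x₀).source) (y : E) :
    jacInv x₀ x (jac x₀ x y) = y := DFunLike.congr_fun (jacInv_comp_jac h) y

/-- The chain rule. It lets an expression centred at a varying point be compared with expressions in
two fixed charts. -/
theorem jac_cocycle {x₀ x₁ : X} {z : E} (h : InOverlap x₀ x₁ z) :
    jac x₀ ((chartAt E x₀).symm z) =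
      (jac x₁ ((chartAt E x₀).symm z)).comp (fderiv ℂ (chartChange x₀ x₁) z) := by
  rw [jac_symm h.1, jac_eq, fderiv_chartChange_comp h (InOverlap.self h.1)]
  rfl

theorem weylInChart_overlap {k : ℕ} (s : X → WeylFibre E k) {x₀ x₁ : X} (r : ℕ) {z : E}
    (h : InOverlap x₀ x₁ z) (y : E) : weylInChart s x₀ r z y =
      (weylInChart s x₁ r (chartChange x₀ x₁ z) (fderiv ℂ (chartChange x₀ x₁) z y)).pullback
        (fderiv ℂ (chartChange x₀ x₁) z) := by
  rw [weylInChart, weylInChart, chart_symm_chartChange h, jac_cocycle h]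
  rfl

theorem holFormInChart_overlap (s : X → E [⋀^Fin 2]→L[ℂ] ℂ) {x₀ x₁ : X} {z : E}
    (h : InOverlap x₀ x₁ z) : holFormInChart s x₀ z =
      (holFormInChart s x₁ (chartChange x₀ x₁ z)).compContinuousLinearMap
        (fderiv ℂ (chartChange x₀ x₁) z) := by
  rw [holFormInChart, holFormInChart, chart_symm_chartChange h, jac_cocycle h]
  rfl

theorem weylInChart_self {k : ℕ} (s : X → WeylFibre E k) (x : X) (r : ℕ) (y : E) :
    weylInChart s x r (chartAt E x x) y = s x r y := by
  rw [weylInChart, (chartAt E x).left_inv (mem_chart_source E x), jac_self]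
  rfl

variable [FiniteDimensional ℂ E]

instance : FiniteDimensional ℝ E := Module.Finite.trans ℂ E

instance (k : ℕ) : FiniteDimensional ℝ (CForm E k) := Module.Finite.trans ℂ _

/-- A finite family of vectors detects a form. -/
theorem CForm.exists_leftInverse (E : Type) [NormedAddCommGroup E] [NormedSpace ℂ E]
    [FiniteDimensional ℂ E] (k : ℕ) :
    ∃ T : ((Fin k → Fin (Module.finrank ℝ E)) → ℂ) →L[ℝ] CForm E k, ∀ a : CForm E k,
      T (fun i => a fun t => Module.finBasis ℝ E (i t)) = a := by
  let S : CForm E k →ₗ[ℝ] ((Fin k → Fin (Module.finrank ℝ E)) → ℂ) :=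
    { toFun := fun a i => a fun t => Module.finBasis ℝ E (i t)
      map_add' := fun _ _ => rfl
      map_smul' := fun _ _ => rfl }
  have hS : LinearMap.ker S = ⊥ := by
    refine LinearMap.ker_eq_bot'.2 fun a ha => ?_
    have : a.toAlternatingMap.toMultilinearMap = 0 :=
      Module.Basis.ext_multilinear (fun _ => Module.finBasis ℝ E) fun v => congrFun ha v
    ext v
    exact DFunLike.congr_fun this v
  obtain ⟨T, hT⟩ := S.exists_leftInverse_of_injective hS
  exact ⟨LinearMap.toContinuousLinearMap T, fun a => DFunLike.congr_fun hT a⟩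

theorem CForm.contDiffAt_of_apply {V : Type*} [NormedAddCommGroup V] [NormedSpace ℝ V] {k : ℕ}
    {f : V → CForm E k} {x : V} {n : WithTop ℕ∞}
    (h : ∀ v, ContDiffAt ℝ n (fun x => f x v) x) : ContDiffAt ℝ n f x := by
  obtain ⟨T, hT⟩ := CForm.exists_leftInverse E k
  have : f = fun x => T (fun i => f x fun t => Module.finBasis ℝ E (i t)) :=
    funext fun x => (hT _).symm
  rw [this]
  exact T.contDiff.contDiffAt.comp x (contDiffAt_pi.2 fun i => h _)

/-- Forms depending on a parameter, evaluated at vectors depending on it. -/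
theorem CForm.contDiffAt_apply {V : Type*} [NormedAddCommGroup V] [NormedSpace ℝ V] {k : ℕ}
    {f : V → CForm E k} {g : V → Fin k → E} {x : V} {n : WithTop ℕ∞} (hf : ContDiffAt ℝ n f x)
    (hg : ContDiffAt ℝ n g x) : ContDiffAt ℝ n (fun x => f x (g x)) x := by
  have h : ∀ x, f x (g x) = ∑ i : Fin k → Fin (Module.finrank ℝ E),
      (∏ t, (Module.finBasis ℝ E).coord (i t) (g x t)) •
        f x fun t => Module.finBasis ℝ E (i t) := by
    intro x
    conv_lhs => rw [show g x = fun t => ∑ j, (Module.finBasis ℝ E).coord j (g x t) •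
      Module.finBasis ℝ E j from funext fun t => ((Module.finBasis ℝ E).sum_repr _).symm]
    have h1 := (f x).toMultilinearMap.map_sum (fun t j => (Module.finBasis ℝ E).coord j (g x t) •
      Module.finBasis ℝ E j)
    refine h1.trans (Finset.sum_congr rfl fun i _ => ?_)
    exact (f x).toMultilinearMap.map_smul_univ _ _
  rw [funext h]
  refine ContDiffAt.sum fun i _ => ContDiffAt.fun_smul (contDiffAt_prod fun t _ => ?_) ?_
  · exact (LinearMap.toContinuousLinearMap ((Module.finBasis ℝ E).coord (i t))).contDiff.contDiffAt.comp
      x (contDiffAt_pi.1 hg t)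
  · let ev : CForm E k →L[ℝ] ℂ := LinearMap.toContinuousLinearMap
      { toFun := fun a => a fun t => Module.finBasis ℝ E (i t)
        map_add' := fun _ _ => rfl
        map_smul' := fun _ _ => rfl }
    exact ev.contDiff.contDiffAt.comp x hf

theorem CForm.contDiffAt_pullback {V : Type*} [NormedAddCommGroup V] [NormedSpace ℝ V] {k : ℕ}
    {f : V → CForm E k} {J : V → E →L[ℂ] E} {x : V} {n : WithTop ℕ∞} (hf : ContDiffAt ℝ n f x)
    (hJ : ContDiffAt ℝ n J x) : ContDiffAt ℝ n (fun x => (f x).pullback (J x)) x := by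
  refine CForm.contDiffAt_of_apply fun v => ?_
  simp only [CForm.pullback_apply]
  refine CForm.contDiffAt_apply hf (contDiffAt_pi.2 fun t => ?_)
  exact ((ContinuousLinearMap.apply ℂ E (v t)).restrictScalars ℝ).contDiff.contDiffAt.comp x hJ

theorem contDiffAt_clm_apply_complex {V : Type*} [NormedAddCommGroup V] [NormedSpace ℝ V]
    {J : V → E →L[ℂ] E} {g : V → E} {x : V} {n : WithTop ℕ∞} (hJ : ContDiffAt ℝ n J x)
    (hg : ContDiffAt ℝ n g x) : ContDiffAt ℝ n (fun x => J x (g x)) x := by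
  have h : ContDiff ℂ n (fun p : (E →L[ℂ] E) × E => p.1 p.2) :=
    contDiff_fst.clm_apply contDiff_snd
  exact (h.restrict_scalars ℝ).contDiffAt.comp x (hJ.prodMk hg)

/-- A family of polynomial maps, indexed by the weight and depending on a parameter `z`, is given by
homogeneous polynomials at `z` and is smooth. -/
def IsWeylExpr {V : Type} [NormedAddCommGroup V] [NormedSpace ℂ V] [NormedSpace ℝ V]
    (S : ℕ → E → E → V) (z : E) : Prop :=
  ∀ r, IsHomogeneousPoly r (S r z) ∧ ∀ y, ContDiffAt ℝ ∞ (fun p : E × E => S r p.1 p.2) (z, y)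

theorem isWeylSectionAt_iff {k : ℕ} (s : X → WeylFibre E k) (x : X) :
    IsWeylSectionAt s x ↔ IsWeylExpr (weylInChart s x) (chartAt E x x) := by
  refine forall_congr' fun r => ?_
  rw [show weylInChart s x r (chartAt E x x) = s x r from funext (weylInChart_self s x r)]

/-- The transition map acts on the fibre variable by its Jacobian, which is complex linear, so the
weight and complex polynomiality are preserved; smoothness follows because the Jacobian depends
smoothly on the base point. -/
theorem IsWeylExpr.overlap {k : ℕ} {s : X → WeylFibre E k} {x₀ x₁ : X} {z : E}
    (h : InOverlap x₀ x₁ z) (hs : IsWeylExpr (weylInChart s x₁) (chartChange x₀ x₁ z)) :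
    IsWeylExpr (weylInChart s x₀) z := by
  intro r
  refine ⟨?_, fun y => ?_⟩
  · rw [show weylInChart s x₀ r z = _ from funext fun y => weylInChart_overlap s r h y]
    exact ((hs r).1.comp_clm _).clm_comp (CForm.pullbackCLM _ k)
  · have h1 : (fun p : E × E => weylInChart s x₀ r p.1 p.2) =ᶠ[𝓝 (z, y)] fun p =>
        (weylInChart s x₁ r (chartChange x₀ x₁ p.1)
          (fderiv ℂ (chartChange x₀ x₁) p.1 p.2)).pullback (fderiv ℂ (chartChange x₀ x₁) p.1) := by
      filter_upwards [(continuous_fst.tendsto (z, y)).eventually h.eventually] with p hp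
      exact weylInChart_overlap s r hp p.2
    refine ContDiffAt.congr_of_eventuallyEq ?_ h1
    have hJ : ContDiffAt ℝ ∞ (fun p : E × E => fderiv ℂ (chartChange x₀ x₁) p.1) (z, y) :=
      (contDiffAt_fderiv_chartChange h).comp (z, y) contDiffAt_fst
    refine CForm.contDiffAt_pullback ?_ hJ
    exact ((hs r).2 _).comp (z, y) (((contDiffAt_chartChange_real h).comp (z, y)
      contDiffAt_fst).prodMk (contDiffAt_clm_apply_complex hJ contDiffAt_snd))

/-- Smoothness may be checked in any chart. -/
theorem isWeylSectionAt_iff_of_mem {k : ℕ} (s : X → WeylFibre E k) {x₀ x : X}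
    (h : x ∈ (chartAt E x₀).source) :
    IsWeylSectionAt s x ↔ IsWeylExpr (weylInChart s x₀) (chartAt E x₀ x) := by
  rw [isWeylSectionAt_iff]
  have h1 := InOverlap.of_mem (E := E) h (mem_chart_source E x)
  have h2 := InOverlap.of_mem (E := E) (mem_chart_source E x) h
  constructor <;> intro hs
  · refine IsWeylExpr.overlap h1 ?_
    rwa [chartChange, (chartAt E x₀).left_inv h]
  · refine IsWeylExpr.overlap h2 ?_
    rwa [chartChange, (chartAt E x).left_inv (mem_chart_source E x)]

theorem eventually_inChart {P : X → Prop} {x : X} (h : ∀ᶠ x' in 𝓝 x, P x') :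
    ∀ᶠ z in 𝓝 (chartAt E x x), z ∈ (chartAt E x).target ∧ P ((chartAt E x).symm z) := by
  filter_upwards [(chartAt E x).open_target.mem_nhds (mem_chart_target E x),
    (tendsto_chart_symm x).eventually h] with z h h' using ⟨h, h'⟩

theorem eventually_isWeylExpr {k : ℕ} {s : X → WeylFibre E k} {x : X}
    (h : ∀ᶠ x' in 𝓝 x, IsWeylSectionAt s x') :
    ∀ᶠ z in 𝓝 (chartAt E x x), IsWeylExpr (weylInChart s x) z := by
  filter_upwards [eventually_inChart (E := E) h] with z hz
  have := (isWeylSectionAt_iff_of_mem s ((chartAt E x).map_target hz.1)).1 hz.2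
  rwa [(chartAt E x).right_inv hz.1] at this

end Charts
end HolWeyl

namespace HolWeyl
open ContinuousAlternatingMap (alternatizeUncurryFin alternatizeUncurryFinCLM alternatizeUncurryFin_apply)

/-! ### Vector fields, Lie brackets and connections in a chart. -/

section Fields

variable {E : Type} [NormedAddCommGroup E] [NormedSpace ℂ E]
  {X : Type} [TopologicalSpace X] [ChartedSpace E X] [IsManifold 𝓘(ℂ, E) ω X]

/-- The components of a vector field in the coordinates `chartAt E x₀`. -/
noncomputable def fieldInChart (σ : ∀ x : X, TangentSpace 𝓘(ℝ, E) x) (x₀ : X) (z : E) : E :=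
  jacInv x₀ ((chartAt E x₀).symm z) (components (σ ((chartAt E x₀).symm z)))

theorem fieldInChart_chart (σ : ∀ x : X, TangentSpace 𝓘(ℝ, E) x) {x₀ x : X}
    (h : x ∈ (chartAt E x₀).source) :
    fieldInChart σ x₀ (chartAt E x₀ x) = jacInv x₀ x (components (σ x)) := by
  rw [fieldInChart, (chartAt E x₀).left_inv h]

theorem jac_fieldInChart (σ : ∀ x : X, TangentSpace 𝓘(ℝ, E) x) {x₀ x : X}
    (h : x ∈ (chartAt E x₀).source) :
    jac x₀ x (fieldInChart σ x₀ (chartAt E x₀ x)) = components (σ x) := by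
  rw [fieldInChart_chart σ h, jac_jacInv h]

theorem fieldInChart_coordField {x₀ : X} {z : E} (hz : z ∈ (chartAt E x₀).target) (y : E) :
    fieldInChart (coordField x₀ y) x₀ z = y :=
  jacInv_jac ((chartAt E x₀).map_target hz) y

theorem mdifferentiableAt_iff_inChart {F : Type*} [NormedAddCommGroup F] [NormedSpace ℝ F]
    {g : X → F} {x₀ x : X} (h : x ∈ (chartAt E x₀).source) :
    MDifferentiableAt 𝓘(ℝ, E) 𝓘(ℝ, F) g x ↔
      DifferentiableAt ℝ (g ∘ (chartAt E x₀).symm) (chartAt E x₀ x) := by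
  rw [mdifferentiableAt_iff_source_of_mem_source h]
  simp only [mfld_simps, mdifferentiableWithinAt_univ]
  exact mdifferentiableAt_iff_differentiableAt

theorem contMDiffAt_iff_inChart {F : Type*} [NormedAddCommGroup F] [NormedSpace ℝ F]
    {g : X → F} {x₀ x : X} (h : x ∈ (chartAt E x₀).source) :
    ContMDiffAt 𝓘(ℝ, E) 𝓘(ℝ, F) ∞ g x ↔
      ContDiffAt ℝ ∞ (g ∘ (chartAt E x₀).symm) (chartAt E x₀ x) := by
  rw [contMDiffAt_iff_source_of_mem_source h]
  simp only [mfld_simps, contMDiffWithinAt_univ]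
  exact contMDiffAt_iff_contDiffAt

theorem trivialization_snd (σ : ∀ x : X, TangentSpace 𝓘(ℝ, E) x) (x₀ x : X)
    (h : x ∈ (chartAt E x₀).source) :
    (trivializationAt E (TangentSpace 𝓘(ℝ, E)) x₀ ⟨x, σ x⟩).2 =
      jacInv x₀ x (components (σ x)) := by
  rw [TangentBundle.trivializationAt_apply]
  simp only [mfld_simps, fderivWithin_univ]
  exact DFunLike.congr_fun
    (fderiv_chartChange_real (InOverlap.of_mem (mem_chart_source E x) h)) (components (σ x))

theorem differentiableFieldAt_iff {σ : ∀ x : X, TangentSpace 𝓘(ℝ, E) x} {x₀ x : X}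
    (h : x ∈ (chartAt E x₀).source) :
    DifferentiableFieldAt σ x ↔ DifferentiableAt ℝ (fieldInChart σ x₀) (chartAt E x₀ x) := by
  rw [DifferentiableFieldAt, (trivializationAt E (TangentSpace 𝓘(ℝ, E)) x₀).mdifferentiableAt_section_iff
    _ _ h, mdifferentiableAt_iff_inChart h]
  refine Filter.EventuallyEq.differentiableAt_iff ?_
  filter_upwards [(chartAt E x₀).open_target.mem_nhds ((chartAt E x₀).map_source h)] with z hz
  exact trivialization_snd σ x₀ _ ((chartAt E x₀).map_target hz)

theorem contMDiffAt_field_iff {σ : ∀ x : X, TangentSpace 𝓘(ℝ, E) x} {x₀ x : X}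
    (h : x ∈ (chartAt E x₀).source) :
    ContMDiffAt 𝓘(ℝ, E) (𝓘(ℝ, E).prod 𝓘(ℝ, E)) ∞
      (fun x => (⟨x, σ x⟩ : TangentBundle 𝓘(ℝ, E) X)) x ↔
      ContDiffAt ℝ ∞ (fieldInChart σ x₀) (chartAt E x₀ x) := by
  rw [(trivializationAt E (TangentSpace 𝓘(ℝ, E)) x₀).contMDiffAt_section_iff h,
    contMDiffAt_iff_inChart h]
  have h1 : (fun x => (trivializationAt E (TangentSpace 𝓘(ℝ, E)) x₀ ⟨x, σ x⟩).2) ∘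
      (chartAt E x₀).symm =ᶠ[𝓝 (chartAt E x₀ x)] fieldInChart σ x₀ := by
    filter_upwards [(chartAt E x₀).open_target.mem_nhds ((chartAt E x₀).map_source h)] with z hz
    exact trivialization_snd σ x₀ _ ((chartAt E x₀).map_target hz)
  exact ⟨fun h => h.congr_of_eventuallyEq h1.symm, fun h => h.congr_of_eventuallyEq h1⟩

theorem differentiableFieldAt_coordField {x₀ x : X} (h : x ∈ (chartAt E x₀).source) (y : E) :
    DifferentiableFieldAt (coordField x₀ y) x := by
  rw [differentiableFieldAt_iff h]
  refine (differentiableAt_const y).congr_of_eventuallyEq ?_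
  filter_upwards [(chartAt E x₀).open_target.mem_nhds ((chartAt E x₀).map_source h)] with z hz
  exact fieldInChart_coordField hz y

theorem fderiv_fieldInChart_coordField {x₀ : X} {z : E} (h : z ∈ (chartAt E x₀).target) (y : E) :
    fderiv ℝ (fieldInChart (coordField x₀ y) x₀) z = 0 := by
  have : fieldInChart (coordField x₀ y) x₀ =ᶠ[𝓝 z] fun _ => y := by
    filter_upwards [(chartAt E x₀).open_target.mem_nhds h] with z hz
    exact fieldInChart_coordField hz y
  rw [this.fderiv_eq]
  simp

theorem hasMFDerivAt_chart {x₀ x : X} (h : x ∈ (chartAt E x₀).source) :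
    HasMFDerivAt 𝓘(ℝ, E) 𝓘(ℝ, E) (chartAt E x₀) x
      ((jacInv (E := E) x₀ x).restrictScalars ℝ : E →L[ℝ] E) := by
  refine ⟨(chartAt E x₀).continuousAt h, ?_⟩
  simp only [mfld_simps]
  refine HasFDerivAt.hasFDerivWithinAt ?_
  have h1 := (differentiableAt_chartChange (E := E)
    (InOverlap.of_mem (mem_chart_source E x) h)).hasFDerivAt.restrictScalars ℝ
  exact h1

theorem mfderiv_inChart {F : Type*} [NormedAddCommGroup F] [NormedSpace ℝ F]
    {g : X → F} {x₀ x : X} (h : x ∈ (chartAt E x₀).source)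
    (hg : MDifferentiableAt 𝓘(ℝ, E) 𝓘(ℝ, F) g x) (v : TangentSpace 𝓘(ℝ, E) x) :
    (mfderiv 𝓘(ℝ, E) 𝓘(ℝ, F) g x v : F) =
      fderiv ℝ (g ∘ (chartAt E x₀).symm) (chartAt E x₀ x) (jacInv x₀ x (components v)) := by
  have h1 := ((mdifferentiableAt_iff_inChart h).1 hg).hasFDerivAt.hasMFDerivAt
  have h2 := HasMFDerivAt.comp x h1 (hasMFDerivAt_chart h)
  have h3 : (g ∘ (chartAt E x₀).symm) ∘ chartAt E x₀ =ᶠ[𝓝 x] g := by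
    filter_upwards [(chartAt E x₀).open_source.mem_nhds h] with x' hx'
    simp only [Function.comp, (chartAt E x₀).left_inv hx']
  have h4 := h2.congr_of_eventuallyEq h3.symm
  rw [h4.mfderiv]
  rfl

theorem mpullback_fieldInChart (σ : ∀ x : X, TangentSpace 𝓘(ℝ, E) x) {x₀ x : X}
    (h : x ∈ (chartAt E x₀).source) :
    VectorField.mpullback 𝓘(ℝ, E) 𝓘(ℝ, E) (chartAt E x₀) (fieldInChart σ x₀) x = σ x := by
  change (mfderiv 𝓘(ℝ, E) 𝓘(ℝ, E) (chartAt E x₀) x).inverse _ = _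
  rw [(hasMFDerivAt_chart h).mfderiv]
  let e : E ≃L[ℝ] E := ContinuousLinearEquiv.equivOfInverse ((jacInv x₀ x).restrictScalars ℝ)
    ((jac x₀ x).restrictScalars ℝ) (jac_jacInv h) (jacInv_jac h)
  have h1 : ((jacInv x₀ x).restrictScalars ℝ).inverse = (jac x₀ x).restrictScalars ℝ :=
    ContinuousLinearMap.inverse_equiv e
  exact (DFunLike.congr_fun h1 _).trans (jac_fieldInChart σ h)

variable [FiniteDimensional ℂ E]

/-- Near `x` both fields are pull-backs along the chart of their coordinate expressions. The Lie
bracket commutes with pull-back and is the usual bracket on the model space. -/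
theorem mlieBracket_inChart {σ τ : ∀ x : X, TangentSpace 𝓘(ℝ, E) x} {x₀ x : X}
    (h : x ∈ (chartAt E x₀).source) (hσ : DifferentiableFieldAt σ x)
    (hτ : DifferentiableFieldAt τ x) :
    components (VectorField.mlieBracket 𝓘(ℝ, E) σ τ x) = jac x₀ x
      (fderiv ℝ (fieldInChart τ x₀) (chartAt E x₀ x) (jacInv x₀ x (components (σ x))) -
        fderiv ℝ (fieldInChart σ x₀) (chartAt E x₀ x) (jacInv x₀ x (components (τ x)))) := by
  have hσ' := (differentiableFieldAt_iff h).1 hσ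
  have hτ' := (differentiableFieldAt_iff h).1 hτ
  have hev : ∀ ρ : ∀ x : X, TangentSpace 𝓘(ℝ, E) x, ρ =ᶠ[𝓝 x]
      VectorField.mpullback 𝓘(ℝ, E) 𝓘(ℝ, E) (chartAt E x₀) (fieldInChart ρ x₀) := by
    intro ρ
    filter_upwards [(chartAt E x₀).open_source.mem_nhds h] with x' hx'
    exact (mpullback_fieldInChart ρ hx').symm
  rw [Filter.EventuallyEq.mlieBracket_vectorField_eq (hev σ) (hev τ)]
  have hd : ∀ f : E → E, DifferentiableAt ℝ f (chartAt E x₀ x) →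
      MDifferentiableAt 𝓘(ℝ, E) (𝓘(ℝ, E).prod 𝓘(ℝ, E))
        (fun z => (⟨z, f z⟩ : TangentBundle 𝓘(ℝ, E) E)) (chartAt E x₀ x) := by
    intro f hf
    refine (mdifferentiableAt_section (IB := 𝓘(ℝ, E)) (F := E)
      (E := (TangentSpace 𝓘(ℝ, E) : E → Type)) (s := fun z => (f z : E))).2 ?_
    simpa using! hf.mdifferentiableAt
  have hc : ContMDiffAt 𝓘(ℝ, E) 𝓘(ℝ, E) ∞ (chartAt E x₀) x :=
    (contMDiffOn_chart (I := 𝓘(ℝ, E)) (n := ∞) x h).contMDiffAt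
      ((chartAt E x₀).open_source.mem_nhds h)
  have : IsManifold 𝓘(ℝ, E) (minSmoothness ℝ 2) X :=
    IsManifold.of_le (n := ∞) (by simp [minSmoothness_of_isRCLikeNormedField]; exact WithTop.coe_le_coe.2 (le_top : (2 : ℕ∞) ≤ ⊤))
  have := VectorField.mpullback_mlieBracket (hd _ hσ') (hd _ hτ') hc
    (by simp [minSmoothness_of_isRCLikeNormedField]; exact WithTop.coe_le_coe.2 (le_top : (2 : ℕ∞) ≤ ⊤))
  rw [← this]
  change components ((mfderiv 𝓘(ℝ, E) 𝓘(ℝ, E) (chartAt E x₀) x).inverse _) = _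
  rw [(hasMFDerivAt_chart h).mfderiv]
  let e : E ≃L[ℝ] E := ContinuousLinearEquiv.equivOfInverse ((jacInv x₀ x).restrictScalars ℝ)
    ((jac x₀ x).restrictScalars ℝ) (jac_jacInv h) (jacInv_jac h)
  have h1 : ((jacInv x₀ x).restrictScalars ℝ).inverse = (jac x₀ x).restrictScalars ℝ :=
    ContinuousLinearMap.inverse_equiv e
  have h2 : VectorField.mlieBracket 𝓘(ℝ, E) (fieldInChart σ x₀) (fieldInChart τ x₀)
      (chartAt E x₀ x) = VectorField.lieBracket ℝ (fieldInChart σ x₀) (fieldInChart τ x₀)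
      (chartAt E x₀ x) := by
    have h3 := VectorField.mlieBracketWithin_eq_lieBracketWithin (𝕜 := ℝ)
      (V := fieldInChart σ x₀) (W := fieldInChart τ x₀) (s := Set.univ)
    have h4 := (VectorField.mlieBracketWithin_univ (I := 𝓘(ℝ, E)) (V := fieldInChart σ x₀)
      (W := fieldInChart τ x₀)).symm.trans (h3.trans VectorField.lieBracketWithin_univ)
    exact congrFun h4 _
  refine (DFunLike.congr_fun h1 _).trans ((congrArg (fun w : E => jac x₀ x w) h2).trans ?_)
  rw [VectorField.lieBracket, fieldInChart_chart σ h, fieldInChart_chart τ h]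

/-! ### Connections in local coordinates -/

/-- The derivative of the components in the coordinates `chartAt E x₀`, as a connection over the
domain of the chart. -/
noncomputable def flatConnection (x₀ : X) (σ : ∀ x : X, TangentSpace 𝓘(ℝ, E) x) (x : X) :
    TangentSpace 𝓘(ℝ, E) x →L[ℝ] TangentSpace 𝓘(ℝ, E) x :=
  (((jac x₀ x).restrictScalars ℝ).comp ((fderiv ℝ (fieldInChart σ x₀) (chartAt E x₀ x)).comp
    ((jacInv x₀ x).restrictScalars ℝ)) : E →L[ℝ] E)

theorem flatConnection_isCovariantDerivativeOn (x₀ : X) :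
    IsCovariantDerivativeOn E (flatConnection (E := E) x₀) (chartAt E x₀).source where
  add {σ σ' x} hσ hσ' hx := by
    have h1 := (differentiableFieldAt_iff hx).1 hσ
    have h2 := (differentiableFieldAt_iff hx).1 hσ'
    have h3 : fieldInChart (σ + σ') x₀ = fieldInChart σ x₀ + fieldInChart σ' x₀ := by
      funext z
      exact map_add (jacInv x₀ _) _ _
    have h4 := fderiv_add h1 h2
    rw [← h3] at h4
    refine ContinuousLinearMap.ext fun (v : E) => ?_
    refine (congrArg (jac x₀ x) (DFunLike.congr_fun h4 (jacInv x₀ x (v : E)))).trans ?_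
    exact map_add (jac x₀ x) _ _
  leibniz {σ g x} hσ hg hx := by
    have h1 := (differentiableFieldAt_iff hx).1 hσ
    have h2 := (mdifferentiableAt_iff_inChart hx).1 hg
    have h3 : fieldInChart (g • σ) x₀ = (g ∘ (chartAt E x₀).symm) • fieldInChart σ x₀ := by
      funext z
      exact ((jacInv x₀ _).restrictScalars ℝ).map_smul _ _
    have h4 := fderiv_smul h2 h1
    rw [← h3] at h4
    refine ContinuousLinearMap.ext fun (v : E) => ?_
    refine (congrArg (jac x₀ x) (DFunLike.congr_fun h4 (jacInv x₀ x (v : E)))).trans ?_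
    refine (map_add ((jac x₀ x).restrictScalars ℝ) _ _).trans ?_
    refine congrArg₂ (· + ·) ?_ ?_
    · refine (((jac x₀ x).restrictScalars ℝ).map_smul _ _).trans ?_
      simp only [Function.comp, (chartAt E x₀).left_inv hx]
      rfl
    · refine (((jac x₀ x).restrictScalars ℝ).map_smul _ _).trans ?_
      refine congrArg₂ (· • ·) (mfderiv_inChart hx hg v).symm ?_
      exact jac_fieldInChart σ hx

theorem flatConnection_coordField {x₀ x : X} (h : x ∈ (chartAt E x₀).source) (y : E) :
    flatConnection x₀ (coordField x₀ y) x = (0 : E →L[ℝ] E) := by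
  rw [flatConnection, fderiv_fieldInChart_coordField ((chartAt E x₀).map_source h)]
  refine ContinuousLinearMap.ext fun v => ?_
  simp

/-- The connection form of `∇` in the coordinates `chartAt E x₀`. -/
noncomputable def connectionForm (cov : TangentConnection E X) (x₀ : X) (z y : E) : E →L[ℝ] E :=
  ((jacInv x₀ ((chartAt E x₀).symm z)).restrictScalars ℝ).comp
    ((show E →L[ℝ] E from cov (coordField x₀ y) ((chartAt E x₀).symm z)).comp
      ((jac x₀ ((chartAt E x₀).symm z)).restrictScalars ℝ))

/-- The difference of two connections is tensorial, so `σ` may be replaced by the coordinate field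
with the same value at `x`, on which the flat connection vanishes. -/
theorem cov_apply (cov : TangentConnection E X) {σ : ∀ x : X, TangentSpace 𝓘(ℝ, E) x} {x₀ x : X}
    (h : x ∈ (chartAt E x₀).source) (hσ : DifferentiableFieldAt σ x) :
    cov σ x = flatConnection x₀ σ x +
      cov (coordField x₀ (jacInv x₀ x (components (σ x)))) x := by
  have hf := flatConnection_isCovariantDerivativeOn (E := E) x₀
  have hc := cov.isCovariantDerivativeOn (s := (chartAt E x₀).source)
  have h1 := IsCovariantDerivativeOn.difference_apply hc hf h hσ
  have h2 := IsCovariantDerivativeOn.difference_apply hc hf h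
    (differentiableFieldAt_coordField h (jacInv x₀ x (components (σ x))))
  have h3 : coordField x₀ (jacInv x₀ x (components (σ x))) x = σ x :=
    jac_jacInv h (components (σ x))
  have h4 : flatConnection x₀ (coordField x₀ (jacInv x₀ x (components (σ x)))) x = 0 :=
    flatConnection_coordField h _
  rw [h3, h1, h4, sub_zero] at h2
  rw [← h2]
  abel

theorem connectionForm_apply (cov : TangentConnection E X) {x₀ x : X}
    (h : x ∈ (chartAt E x₀).source) (y v : E) :
    jac x₀ x (connectionForm cov x₀ (chartAt E x₀ x) y v) =
      components (cov (coordField x₀ y) x (jac x₀ x v : E)) := by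
  rw [connectionForm, (chartAt E x₀).left_inv h]
  exact jac_jacInv h _

end Fields
end HolWeyl

namespace HolWeyl
open ContinuousAlternatingMap (alternatizeUncurryFin alternatizeUncurryFinCLM alternatizeUncurryFin_apply)

/-! ### The symplectic form and its Poisson tensor in a chart. -/

section Symplectic

variable {E : Type} [NormedAddCommGroup E] [NormedSpace ℂ E]

/-- The complex bilinear form given by an alternating form. -/
noncomputable def holBilin (E : Type) [NormedAddCommGroup E] [NormedSpace ℂ E] :
    (E [⋀^Fin 2]→L[ℂ] ℂ) →L[ℂ] (E →L[ℂ] E →L[ℂ] ℂ) :=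
  ((ContinuousLinearMap.compL ℂ E (ContinuousMultilinearMap ℂ (fun _ : Fin 1 => E) ℂ) (E →L[ℂ] ℂ))
    ((continuousMultilinearCurryFin1 ℂ E ℂ).toContinuousLinearEquiv :
      ContinuousMultilinearMap ℂ (fun _ : Fin 1 => E) ℂ →L[ℂ] (E →L[ℂ] ℂ))).comp
    (((continuousMultilinearCurryLeftEquiv ℂ (fun _ : Fin 2 => E) ℂ).toContinuousLinearEquiv :
      ContinuousMultilinearMap ℂ (fun _ : Fin 2 => E) ℂ →L[ℂ]
        (E →L[ℂ] ContinuousMultilinearMap ℂ (fun _ : Fin 1 => E) ℂ)).comp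
      (ContinuousAlternatingMap.toContinuousMultilinearMapCLM ℂ))

theorem holBilin_apply (f : E [⋀^Fin 2]→L[ℂ] ℂ) (a b : E) : holBilin E f a b = f ![a, b] := by
  change f (Fin.cons a (Fin.snoc 0 b)) = _
  congr 1
  funext i
  refine Fin.cases rfl (fun i => ?_) i
  rw [Subsingleton.elim i 0]
  rfl

variable {X : Type} [TopologicalSpace X] [ChartedSpace E X] [IsManifold 𝓘(ℂ, E) ω X]

namespace HolomorphicSymplecticForm

variable (Ω : HolomorphicSymplecticForm E X)

/-- The symplectic form in the coordinates `chartAt E x₀`, as a bilinear form. -/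
noncomputable def bilin (x₀ : X) (z : E) : E →L[ℂ] E →L[ℂ] ℂ :=
  holBilin E (holFormInChart Ω.toFun x₀ z)

theorem bilin_apply (x₀ : X) (z a b : E) :
    Ω.bilin x₀ z a b = holFormInChart Ω.toFun x₀ z ![a, b] := holBilin_apply _ _ _

theorem bilin_chart {x₀ x : X} (h : x ∈ (chartAt E x₀).source) (a b : E) :
    Ω.bilin x₀ (chartAt E x₀ x) a b = Ω.toFun x ![jac x₀ x a, jac x₀ x b] := by
  rw [bilin_apply, holFormInChart, (chartAt E x₀).left_inv h]
  change Ω.toFun x (jac x₀ x ∘ ![a, b]) = _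
  congr 1
  funext i
  refine Fin.cases rfl (fun i => ?_) i
  rw [Subsingleton.elim i 0]
  rfl

theorem bilin_self (x : X) (a b : E) : Ω.bilin x (chartAt E x x) a b = Ω.toFun x ![a, b] := by
  rw [bilin_chart Ω (mem_chart_source E x), jac_self]
  rfl

theorem bilin_overlap {x₀ x₁ : X} {z : E} (h : InOverlap x₀ x₁ z) (a b : E) :
    Ω.bilin x₀ z a b = Ω.bilin x₁ (chartChange x₀ x₁ z) (fderiv ℂ (chartChange x₀ x₁) z a)
      (fderiv ℂ (chartChange x₀ x₁) z b) := by
  have h1 := bilin_chart Ω ((chartAt E x₀).map_target h.1) a b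
  have h2 := bilin_chart Ω h.2 (fderiv ℂ (chartChange x₀ x₁) z a)
    (fderiv ℂ (chartChange x₀ x₁) z b)
  rw [(chartAt E x₀).right_inv h.1, jac_cocycle h] at h1
  exact h1.trans h2.symm

theorem bilin_swap (x₀ : X) (z a b : E) : Ω.bilin x₀ z a b = - Ω.bilin x₀ z b a := by
  rw [bilin_apply, bilin_apply]
  have := (holFormInChart Ω.toFun x₀ z).toAlternatingMap.map_swap ![b, a] (i := 0) (j := 1)
    (by decide)
  refine Eq.trans ?_ this
  change _ = holFormInChart Ω.toFun x₀ z (![b, a] ∘ ⇑(Equiv.swap 0 1))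
  refine congrArg _ ?_
  funext i
  fin_cases i <;> rfl

/-- Holomorphy is required at each point only in the chart centred there; it is transported by the
holomorphic transition map. -/
theorem contDiffAt_bilin {x₀ : X} {z : E} (hz : z ∈ (chartAt E x₀).target) :
    ContDiffAt ℂ ω (Ω.bilin x₀) z := by
  have h : InOverlap x₀ ((chartAt E x₀).symm z) z := InOverlap.self hz
  set x := (chartAt E x₀).symm z
  have h0 : ContDiffAt ℂ ω (Ω.bilin x) (chartChange x₀ x z) := by
    have : chartChange x₀ x z = chartAt E x x := rfl
    rw [this]
    exact (holBilin E).contDiff.contDiffAt.comp _ (Ω.holomorphic x).contDiffAt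
  have h1 : Ω.bilin x₀ =ᶠ[𝓝 z] fun z => ((ContinuousLinearMap.compL ℂ E E ℂ).flip
      (fderiv ℂ (chartChange x₀ x) z)).comp ((Ω.bilin x (chartChange x₀ x z)).comp
      (fderiv ℂ (chartChange x₀ x) z)) := by
    filter_upwards [h.eventually] with z' hz'
    ext a b
    exact bilin_overlap Ω hz' a b
  refine ContDiffAt.congr_of_eventuallyEq ?_ h1
  have hJ : ContDiffAt ℂ ω (fderiv ℂ (chartChange x₀ x)) z :=
    (contDiffAt_chartChange h).fderiv_right (m := ω) (by simp)
  refine ContDiffAt.clm_comp ?_ (ContDiffAt.clm_comp ?_ hJ)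
  · exact ((ContinuousLinearMap.compL ℂ E E ℂ).flip).contDiff.contDiffAt.comp z hJ
  · exact h0.comp z (contDiffAt_chartChange h)

theorem contDiffAt_bilin_apply {x₀ : X} {z : E} (hz : z ∈ (chartAt E x₀).target) (a b : E)
    {n : WithTop ℕ∞} : ContDiffAt ℝ n (fun z => Ω.bilin x₀ z a b) z := by
  have h : ContDiffAt ℂ ω (fun z => Ω.bilin x₀ z a b) z :=
    ((Ω.contDiffAt_bilin hz).clm_apply contDiffAt_const).clm_apply contDiffAt_const
  exact (h.of_le le_top).restrict_scalars ℝ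

theorem differentiableAt_bilin {x₀ : X} {z : E} (hz : z ∈ (chartAt E x₀).target) :
    DifferentiableAt ℂ (Ω.bilin x₀) z := (Ω.contDiffAt_bilin hz).differentiableAt (by simp)

theorem fderiv_bilin_apply {x₀ : X} {z : E} (hz : z ∈ (chartAt E x₀).target) (a b v : E) :
    fderiv ℝ (fun z => Ω.bilin x₀ z a b) z v = fderiv ℂ (Ω.bilin x₀) z v a b := by
  have h1 : HasFDerivAt (fun z => Ω.bilin x₀ z a b)
      ((((ContinuousLinearMap.apply ℂ ℂ b).comp
        (ContinuousLinearMap.apply ℂ (E →L[ℂ] ℂ) a)).comp (fderiv ℂ (Ω.bilin x₀) z))) z :=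
    (((ContinuousLinearMap.apply ℂ ℂ b).comp
      (ContinuousLinearMap.apply ℂ (E →L[ℂ] ℂ) a)).hasFDerivAt).comp z
      (Ω.differentiableAt_bilin hz).hasFDerivAt
  rw [(h1.restrictScalars ℝ).fderiv]
  rfl

theorem nondegenerate_bilin {x₀ : X} {z : E} (hz : z ∈ (chartAt E x₀).target) {a : E}
    (h : ∀ b, Ω.bilin x₀ z a b = 0) : a = 0 := by
  have hx := (chartAt E x₀).map_target hz
  have h1 : jac x₀ ((chartAt E x₀).symm z) a = 0 := by
    refine Ω.nondegenerate ((chartAt E x₀).symm z) _ fun v => ?_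
    have h2 := bilin_chart Ω hx a (jacInv x₀ ((chartAt E x₀).symm z) v)
    rw [(chartAt E x₀).right_inv hz, h, jac_jacInv hx] at h2
    exact h2.symm
  rw [← jacInv_jac hx a, h1, map_zero]

/-- The components of `dω`. -/
theorem fderiv_bilin_cyclic {x₀ : X} {z : E} (hz : z ∈ (chartAt E x₀).target) (u a b : E) :
    fderiv ℂ (Ω.bilin x₀) z u a b - fderiv ℂ (Ω.bilin x₀) z a u b +
      fderiv ℂ (Ω.bilin x₀) z b u a = 0 := by
  have h : InOverlap x₀ ((chartAt E x₀).symm z) z := InOverlap.self hz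
  set x := (chartAt E x₀).symm z
  have hzx : chartChange x₀ x z = chartAt E x x := rfl
  have hdx : DifferentiableAt ℂ (holFormInChart Ω.toFun x) (chartChange x₀ x z) := by
    rw [hzx]; exact (Ω.holomorphic x).differentiableAt
  have hev : holFormInChart Ω.toFun x₀ =ᶠ[𝓝 z] fun z =>
      (holFormInChart Ω.toFun x (chartChange x₀ x z)).compContinuousLinearMap
        (fderiv ℂ (chartChange x₀ x) z) := by
    filter_upwards [h.eventually] with z' hz' using holFormInChart_overlap _ hz'
  have hd : DifferentiableAt ℂ (holFormInChart Ω.toFun x₀) z := by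
    refine DifferentiableAt.congr_of_eventuallyEq ?_ hev
    refine DifferentiableAt.continuousAlternatingMapCompContinuousLinearMap
      (hdx.comp z (differentiableAt_chartChange h)) ?_
    exact ((contDiffAt_chartChange h).fderiv_right (m := ω) (by simp)).differentiableAt (by simp)
  -- Closedness too is given only at the centre of each chart. The exterior derivative commutes with
  -- pull-back along the transition map.
  have h0 : extDeriv (holFormInChart Ω.toFun x₀) z = 0 := by
    rw [hev.extDeriv_eq, extDeriv_pullback hdx (contDiffAt_chartChange h) (by simp), hzx,
      Ω.closed x]
    rfl
  have h2 : fderiv ℂ (Ω.bilin x₀) z = (holBilin E).comp (fderiv ℂ (holFormInChart Ω.toFun x₀) z) :=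
    ((holBilin E).hasFDerivAt.comp z hd.hasFDerivAt).fderiv
  have h3 := DFunLike.congr_fun h0 ![u, a, b]
  rw [extDeriv, alternatizeUncurryFin_apply, Fin.sum_univ_three] at h3
  simp only [h2, ContinuousLinearMap.comp_apply, holBilin_apply]
  have e0 : Fin.removeNth 0 ![u, a, b] = ![a, b] := by
    funext i; fin_cases i <;> rfl
  have e1 : Fin.removeNth 1 ![u, a, b] = ![u, b] := by
    funext i; fin_cases i <;> rfl
  have e2 : Fin.removeNth 2 ![u, a, b] = ![u, a] := by
    funext i; fin_cases i <;> rfl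
  rw [e0, e1, e2] at h3
  have h4 : ((0 : E [⋀^Fin (2 + 1)]→L[ℂ] ℂ)) ![u, a, b] = 0 := rfl
  rw [h4] at h3
  rw [← h3]
  simp
  ring

variable [FiniteDimensional ℂ E]

/-- The matrix of the symplectic form in the coordinates `chartAt E x₀`. -/
noncomputable def matrix (x₀ : X) (z : E) :
    Matrix (Fin (Module.finrank ℂ E)) (Fin (Module.finrank ℂ E)) ℂ :=
  Matrix.of fun i j => Ω.bilin x₀ z (Module.finBasis ℂ E i) (Module.finBasis ℂ E j)

/-- The Poisson tensor in the coordinates `chartAt E x₀`. -/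
noncomputable def poisson (x₀ : X) (z : E) :
    Matrix (Fin (Module.finrank ℂ E)) (Fin (Module.finrank ℂ E)) ℂ := (Ω.matrix x₀ z)⁻¹

theorem poisson_self (x : X) : Ω.poisson x (chartAt E x x) = Ω.inverse x := by
  simp only [poisson, inverse, matrix, bilin_self]

/-- A row vector annihilating the matrix gives the coordinates of a vector in the radical of the
form. -/
theorem isUnit_matrix_det {x₀ : X} {z : E} (hz : z ∈ (chartAt E x₀).target) :
    IsUnit (Ω.matrix x₀ z).det := by
  rw [isUnit_iff_ne_zero]
  intro h0
  obtain ⟨v, hv, h1⟩ := Matrix.exists_vecMul_eq_zero_iff.2 h0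
  apply hv
  have h2 : ∑ i, v i • Module.finBasis ℂ E i = 0 := by
    refine Ω.nondegenerate_bilin hz fun b => ?_
    have h3 : ∀ j, Ω.bilin x₀ z (∑ i, v i • Module.finBasis ℂ E i) (Module.finBasis ℂ E j) = 0 := by
      intro j
      have := congrFun h1 j
      simp only [Matrix.vecMul, dotProduct, matrix, Matrix.of_apply] at this
      simpa using this
    rw [← sum_coord b, map_sum]
    refine Finset.sum_eq_zero fun j _ => ?_
    rw [map_smul, h3, smul_zero]
  funext i
  exact (linearIndependent_iff'.1 (Module.finBasis ℂ E).linearIndependent) Finset.univ v h2 i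
    (Finset.mem_univ i)

theorem contDiffAt_matrix {x₀ : X} {z : E} (hz : z ∈ (chartAt E x₀).target) (i j)
    {n : WithTop ℕ∞} : ContDiffAt ℝ n (fun z => Ω.matrix x₀ z i j) z :=
  Ω.contDiffAt_bilin_apply hz _ _

theorem contDiffAt_det {m : Type*} [Fintype m] [DecidableEq m] {M : E → Matrix m m ℂ} {z : E}
    {n : WithTop ℕ∞} (h : ∀ i j, ContDiffAt ℝ n (fun z => M z i j) z) :
    ContDiffAt ℝ n (fun z => (M z).det) z := by
  simp only [Matrix.det_apply]
  refine ContDiffAt.sum fun σ _ => ?_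
  simp only [Units.smul_def, zsmul_eq_mul]
  exact contDiffAt_const.mul (contDiffAt_prod fun i _ => h _ _)

theorem contDiffAt_poisson {x₀ : X} {z : E} (hz : z ∈ (chartAt E x₀).target) (i j)
    {n : WithTop ℕ∞} : ContDiffAt ℝ n (fun z => Ω.poisson x₀ z i j) z := by
  have hd := contDiffAt_det (n := n) fun i j => Ω.contDiffAt_matrix hz i j
  have h1 : ∀ z, Ω.poisson x₀ z i j = (Ω.matrix x₀ z).det⁻¹ *
      ((Ω.matrix x₀ z).updateRow j (Pi.single i 1)).det := by
    intro z
    rw [poisson, Matrix.inv_def, Matrix.smul_apply, Matrix.adjugate_apply, Ring.inverse_eq_inv]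
    -- Cramer's rule expresses the inverse through determinants, which are polynomial in the
    -- entries.
    rfl
  simp only [h1]
  refine (hd.inv (Ω.isUnit_matrix_det hz).ne_zero).mul (contDiffAt_det fun a b => ?_)
  by_cases h : a = j
  · subst h
    simp only [Matrix.updateRow_self]
    exact contDiffAt_const
  · simp only [Matrix.updateRow_ne h]
    exact Ω.contDiffAt_matrix hz a b

theorem poisson_swap {x₀ : X} (z : E) (i j) :
    Ω.poisson x₀ z i j = - Ω.poisson x₀ z j i := by
  have h1 : (Ω.matrix x₀ z).transpose = - Ω.matrix x₀ z := by
    ext i j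
    exact Ω.bilin_swap x₀ z _ _
  have h2 := Matrix.transpose_nonsing_inv (Ω.matrix x₀ z)
  rw [h1] at h2
  -- No condition on `z` is needed: where the matrix is singular, both inverses are zero by
  -- convention.
  have h3 : (-Ω.matrix x₀ z)⁻¹ = - (Ω.matrix x₀ z)⁻¹ := by
    have := Matrix.inv_smul' (Ω.matrix x₀ z)
    by_cases hu : IsUnit (Ω.matrix x₀ z).det
    · exact Matrix.inv_eq_right_inv (by rw [neg_mul_neg, Matrix.mul_nonsing_inv _ hu])
    · have hu' : ¬ IsUnit (-Ω.matrix x₀ z).det := by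
        rw [Matrix.det_neg]
        intro h
        exact hu (isUnit_of_mul_isUnit_right h)
      rw [Matrix.nonsing_inv_apply_not_isUnit _ hu, Matrix.nonsing_inv_apply_not_isUnit _ hu',
        neg_zero]
  rw [h3] at h2
  have h4 := congrFun (congrFun h2 j) i
  exact h4

end HolomorphicSymplecticForm

end Symplectic
end HolWeyl

namespace HolWeyl
open ContinuousAlternatingMap (alternatizeUncurryFin alternatizeUncurryFinCLM alternatizeUncurryFin_apply)

/-! ### The connection form of a symplectic connection. -/

section ConnectionForm

variable {E : Type} [NormedAddCommGroup E] [NormedSpace ℂ E] [FiniteDimensional ℂ E]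
  {X : Type} [TopologicalSpace X] [ChartedSpace E X] [IsManifold 𝓘(ℂ, E) ω X]

theorem connectionForm_apply_eq (cov : TangentConnection E X) {x₀ x : X}
    (h : x ∈ (chartAt E x₀).source) (y v : E) :
    connectionForm cov x₀ (chartAt E x₀ x) y v =
      jacInv x₀ x (components (cov (coordField x₀ y) x (jac x₀ x v : E))) := by
  rw [← connectionForm_apply cov h, jacInv_jac h]

theorem connectionForm_add (cov : TangentConnection E X) {x₀ : X} {z : E}
    (hz : z ∈ (chartAt E x₀).target) (y y' : E) : connectionForm cov x₀ z (y + y') =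
      connectionForm cov x₀ z y + connectionForm cov x₀ z y' := by
  have hx := (chartAt E x₀).map_target hz
  have h1 : coordField x₀ (y + y') = coordField x₀ y + coordField x₀ y' := by
    funext x
    exact map_add (jac (E := E) x₀ x) y y'
  have h2 := cov.isCovariantDerivativeOnUniv.add (differentiableFieldAt_coordField hx y)
    (differentiableFieldAt_coordField hx y')
  rw [← h1] at h2
  refine ContinuousLinearMap.ext fun v => ?_
  refine (congrArg (fun w : E => jacInv x₀ ((chartAt E x₀).symm z) w)
    (DFunLike.congr_fun h2 (jac x₀ ((chartAt E x₀).symm z) v : E))).trans ?_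
  exact map_add (jacInv (E := E) x₀ _) _ _

theorem connectionForm_smul_real (cov : TangentConnection E X) {x₀ : X} {z : E}
    (hz : z ∈ (chartAt E x₀).target) (c : ℝ) (y : E) : connectionForm cov x₀ z (c • y) =
      c • connectionForm cov x₀ z y := by
  have hx := (chartAt E x₀).map_target hz
  have h1 : coordField x₀ (c • y) = c • coordField x₀ y := by
    funext x
    exact ((jac (E := E) x₀ x).restrictScalars ℝ).map_smul c y
  have h2 := cov.isCovariantDerivativeOnUniv.smul_const c (differentiableFieldAt_coordField hx y)
  rw [← h1] at h2
  refine ContinuousLinearMap.ext fun v => ?_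
  refine (congrArg (fun w : E => jacInv x₀ ((chartAt E x₀).symm z) w)
    (DFunLike.congr_fun h2 (jac x₀ ((chartAt E x₀).symm z) v : E))).trans ?_
  exact ((jacInv (E := E) x₀ _).restrictScalars ℝ).map_smul _ _

variable {Ω : HolomorphicSymplecticForm E X} {cov : TangentConnection E X}

namespace IsSymplecticConnection

variable (hc : IsSymplecticConnection Ω cov)
include hc

theorem connectionForm_smul_I {x₀ : X} {z : E} (hz : z ∈ (chartAt E x₀).target) (y v : E) :
    connectionForm cov x₀ z (Complex.I • y) v = Complex.I • connectionForm cov x₀ z y v := by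
  have hx := (chartAt E x₀).map_target hz
  have h1 : coordField x₀ (Complex.I • y) = mulI (coordField x₀ y) := by
    funext x
    exact (jac (E := E) x₀ x).map_smul Complex.I y
  have h2 := hc.complex _ _ (differentiableFieldAt_coordField hx y)
    (jac x₀ ((chartAt E x₀).symm z) v : E)
  rw [← h1] at h2
  refine (congrArg (fun w : E => jacInv x₀ ((chartAt E x₀).symm z) w) h2).trans ?_
  exact (jacInv (E := E) x₀ _).map_smul _ _

theorem connectionForm_smul {x₀ : X} {z : E} (hz : z ∈ (chartAt E x₀).target) (c : ℂ) (y v : E) :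
    connectionForm cov x₀ z (c • y) v = c • connectionForm cov x₀ z y v := by
  have h1 : ∀ w : E, c • w = c.re • w + c.im • (Complex.I • w) := by
    intro w
    conv_lhs => rw [← Complex.re_add_im c, add_smul, mul_smul]
    rfl
  rw [h1 y, h1 (connectionForm cov x₀ z y v), connectionForm_add cov hz,
    connectionForm_smul_real cov hz, connectionForm_smul_real cov hz]
  change _ + c.im • connectionForm cov x₀ z (Complex.I • y) v = _
  rw [hc.connectionForm_smul_I hz]
  rfl

/-- Coordinate fields commute, so vanishing torsion becomes symmetry of the Christoffel symbols. -/
theorem connectionForm_symm {x₀ : X} {z : E} (hz : z ∈ (chartAt E x₀).target) (y v : E) :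
    connectionForm cov x₀ z y v = connectionForm cov x₀ z v y := by
  have hx := (chartAt E x₀).map_target hz
  have hy := differentiableFieldAt_coordField hx y
  have hv := differentiableFieldAt_coordField hx v
  have h1 := hc.torsionFree _ _ _ hy hv
  have h2 := mlieBracket_inChart hx hy hv
  rw [(chartAt E x₀).right_inv hz, fderiv_fieldInChart_coordField hz,
    fderiv_fieldInChart_coordField hz] at h2
  have h3 : components (VectorField.mlieBracket 𝓘(ℝ, E) (coordField x₀ y) (coordField x₀ v)
      ((chartAt E x₀).symm z)) = 0 := by rw [h2]; simp
  have h4 := sub_eq_zero.1 (h1.trans h3)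
  have h5 := connectionForm_apply_eq cov hx y v
  have h6 := connectionForm_apply_eq cov hx v y
  rw [(chartAt E x₀).right_inv hz] at h5 h6
  rw [h5, h6]
  exact congrArg (fun w : E => jacInv x₀ ((chartAt E x₀).symm z) w) h4.symm

theorem connectionForm_clm {x₀ : X} {z : E} (hz : z ∈ (chartAt E x₀).target) (v : E) :
    ∃ T : E →L[ℂ] E, ∀ y, connectionForm cov x₀ z y v = T y :=
  ⟨LinearMap.toContinuousLinearMap
    { toFun := fun y => connectionForm cov x₀ z y v
      map_add' := fun y y' => by rw [connectionForm_add cov hz]; rfl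
      map_smul' := fun c y => hc.connectionForm_smul hz c y v }, fun _ => rfl⟩

/-- This is `∇ω = 0` evaluated on coordinate fields. -/
theorem fderiv_bilin {x₀ : X} {z : E} (hz : z ∈ (chartAt E x₀).target) (a b v : E) :
    fderiv ℝ (fun z => Ω.bilin x₀ z a b) z v =
      Ω.bilin x₀ z (connectionForm cov x₀ z a v) b +
        Ω.bilin x₀ z a (connectionForm cov x₀ z b v) := by
  have hx := (chartAt E x₀).map_target hz
  have h1 := hc.symplectic _ _ _ (differentiableFieldAt_coordField hx a)
    (differentiableFieldAt_coordField hx b) (jac x₀ ((chartAt E x₀).symm z) v : E)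
  have hev : (fun x' => Ω.toFun x' ![components (coordField x₀ a x'),
      components (coordField x₀ b x')]) ∘ (chartAt E x₀).symm =ᶠ[𝓝 z]
      fun z => Ω.bilin x₀ z a b := by
    filter_upwards [(chartAt E x₀).open_target.mem_nhds hz] with z' hz'
    have := Ω.bilin_chart ((chartAt E x₀).map_target hz') a b
    rw [(chartAt E x₀).right_inv hz'] at this
    exact this.symm
  have hd : MDifferentiableAt 𝓘(ℝ, E) 𝓘(ℝ, ℂ) (fun x' => Ω.toFun x'
      ![components (coordField x₀ a x'), components (coordField x₀ b x')])
      ((chartAt E x₀).symm z) := by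
    rw [mdifferentiableAt_iff_inChart hx, (chartAt E x₀).right_inv hz]
    exact ((Ω.contDiffAt_bilin_apply hz a b (n := 1)).differentiableAt
      one_ne_zero).congr_of_eventuallyEq hev
  have h2 := mfderiv_inChart hx hd (jac x₀ ((chartAt E x₀).symm z) v : E)
  rw [(chartAt E x₀).right_inv hz, hev.fderiv_eq] at h2
  have h3 : jacInv x₀ ((chartAt E x₀).symm z) (components (x := (chartAt E x₀).symm z)
      (jac x₀ ((chartAt E x₀).symm z) v : E)) = v := jacInv_jac hx v
  rw [h3] at h2
  rw [← h2]
  refine h1.trans ?_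
  have h4 := fun y => connectionForm_apply cov hx y v
  have h5 := Ω.bilin_chart hx
  rw [(chartAt E x₀).right_inv hz] at h4 h5
  rw [h5, h5, h4, h4]
  rfl

variable [T2Space X]

/-- Smoothness of `∇` concerns globally smooth fields, while a coordinate field is meaningful only
in its chart. It is cut off by a bump function equal to one near the point, and covariant
derivatives do not see the cut-off there. -/
theorem contDiffAt_connectionForm_apply {x₀ : X} {z : E} (hz : z ∈ (chartAt E x₀).target)
    (y v : E) : ContDiffAt ℝ ∞ (fun z => connectionForm cov x₀ z y v) z := by
  have hx := (chartAt E x₀).map_target hz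
  set x := (chartAt E x₀).symm z with hxdef
  obtain ⟨f, -, hf⟩ := ((SmoothBumpFunction.nhds_basis_tsupport (I := 𝓘(ℝ, E)) x).mem_iff.1
    ((chartAt E x₀).open_source.mem_nhds hx))
  let σ : ∀ x : X, TangentSpace 𝓘(ℝ, E) x := fun x' => f x' • coordField x₀ y x'
  have hσ : ∀ x', ContMDiffAt 𝓘(ℝ, E) (𝓘(ℝ, E).prod 𝓘(ℝ, E)) ∞
      (fun x => (⟨x, σ x⟩ : TangentBundle 𝓘(ℝ, E) X)) x' := by
    intro x'
    by_cases h : x' ∈ (chartAt E x₀).source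
    · rw [contMDiffAt_field_iff h]
      have h1 : fieldInChart σ x₀ =ᶠ[𝓝 (chartAt E x₀ x')]
          fun z => (f ∘ (chartAt E x₀).symm) z • y := by
        filter_upwards [(chartAt E x₀).open_target.mem_nhds ((chartAt E x₀).map_source h)]
          with z' hz'
        refine (((jacInv (E := E) x₀ _).restrictScalars ℝ).map_smul _ _).trans ?_
        exact congrArg _ (fieldInChart_coordField hz' y)
      refine ContDiffAt.congr_of_eventuallyEq ?_ h1
      exact ((contMDiffAt_iff_inChart h).1 f.contMDiffAt).smul contDiffAt_const
    · have h1 : x' ∉ tsupport f := fun h' => h (hf h')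
      have h2 : fieldInChart σ x' =ᶠ[𝓝 (chartAt E x' x')] fun _ => 0 := by
        have h3 := (tendsto_chart_symm (E := E) x').eventually
          ((notMem_tsupport_iff_eventuallyEq.1 h1 : _ =ᶠ[𝓝 x'] _))
        filter_upwards [h3] with z' hz'
        have h4 : σ ((chartAt E x').symm z') = 0 := by
          simp only [σ, hz']
          exact zero_smul ℝ _
        rw [fieldInChart, h4]
        exact map_zero (jacInv (E := E) x' _)
      rw [contMDiffAt_field_iff (mem_chart_source E x')]
      exact contDiffAt_const.congr_of_eventuallyEq h2
  have h1 := hc.smooth.contMDiff.contMDiff (σ := σ) (fun x' _ => (hσ x').contMDiffWithinAt)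
  have h2 := (h1 x (Set.mem_univ x)).contMDiffAt Filter.univ_mem
  have hv : ContMDiffAt 𝓘(ℝ, E) (𝓘(ℝ, E).prod 𝓘(ℝ, E)) ∞
      (fun x => (⟨x, coordField x₀ v x⟩ : TangentBundle 𝓘(ℝ, E) X)) x := by
    rw [contMDiffAt_field_iff hx]
    refine (contDiffAt_const (c := v)).congr_of_eventuallyEq ?_
    filter_upwards [(chartAt E x₀).open_target.mem_nhds ((chartAt E x₀).map_source hx)] with z' hz'
    exact fieldInChart_coordField hz' v
  have h3 := ContMDiffAt.clm_bundle_apply (F₁ := E) (F₂ := E) h2 hv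
  have h4 := (contMDiffAt_field_iff (σ := fun x => cov σ x (coordField x₀ v x)) hx).1 h3
  rw [hxdef, (chartAt E x₀).right_inv hz] at h4
  refine h4.congr_of_eventuallyEq ?_
  have h5 : ∀ᶠ x' in 𝓝 x, ∀ᶠ x'' in 𝓝 x', f x'' = 1 := by
    have := f.eventuallyEq_one
    exact this.eventually_nhds
  have h6 : Filter.Tendsto (chartAt E x₀).symm (𝓝 z) (𝓝 x) :=
    (chartAt E x₀).continuousAt_symm hz
  filter_upwards [(chartAt E x₀).open_target.mem_nhds hz, h6.eventually h5] with z' hz' hz''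
  have hx' := (chartAt E x₀).map_target hz'
  have h7 : cov σ ((chartAt E x₀).symm z') = cov (coordField x₀ y) ((chartAt E x₀).symm z') := by
    refine cov.isCovariantDerivativeOnUniv.congr_of_eventuallyEq
      ((hσ _).mdifferentiableAt (by simp)) (differentiableFieldAt_coordField hx' y)
      Filter.univ_mem ?_
    filter_upwards [hz''] with x'' hx''
    simp only [σ, hx'']
    exact one_smul ℝ _
  rw [fieldInChart, h7]
  rfl

end IsSymplecticConnection

end ConnectionForm
end HolWeyl

namespace HolWeyl
open ContinuousAlternatingMap (alternatizeUncurryFin alternatizeUncurryFinCLM alternatizeUncurryFin_apply)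

/-! ### Connections with polynomial components of all weights, and their curvature. -/

section GradedConnections

open Finset.HasAntidiagonal (antidiagonal)

/-- Both sides are the sum over all triples with total `n`. The variants below account for
derivations lowering the weight by one: the extra index caused by this shift carries a vanishing
term. -/
theorem sum_antidiagonal_assoc {V : Type*} [AddCommMonoid V] (f : ℕ → ℕ → ℕ → V) (n : ℕ) :
    ∑ u ∈ antidiagonal n, ∑ w ∈ antidiagonal u.1, f w.1 w.2 u.2 =
      ∑ u ∈ antidiagonal n, ∑ w ∈ antidiagonal u.2, f u.1 w.1 w.2 := by
  rw [Finset.sum_sigma', Finset.sum_sigma']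
  refine Finset.sum_nbij' (fun x => ⟨(x.2.1, x.2.2 + x.1.2), (x.2.2, x.1.2)⟩)
    (fun x => ⟨(x.1.1 + x.2.1, x.2.2), (x.1.1, x.2.1)⟩) ?_ ?_ ?_ ?_ ?_
  all_goals
    rintro ⟨⟨a, b⟩, c, d⟩ h
    simp only [Finset.mem_sigma, Finset.HasAntidiagonal.mem_antidiagonal] at h ⊢
  · exact ⟨by omega, trivial⟩
  · exact ⟨by omega, trivial⟩
  · obtain ⟨h1, rfl⟩ := h; rfl
  · obtain ⟨h1, rfl⟩ := h; rfl

theorem sum_antidiagonal_succ_assoc {V : Type*} [AddCommMonoid V] (f : ℕ → ℕ → ℕ → V)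
    (hf : ∀ p p', f 0 p p' = 0) (r : ℕ) :
    ∑ u ∈ antidiagonal (r + 1), ∑ w ∈ antidiagonal (u.1 + 1), f w.1 w.2 u.2 =
      ∑ u ∈ antidiagonal (r + 2), ∑ w ∈ antidiagonal u.2, f u.1 w.1 w.2 := by
  rw [← sum_antidiagonal_assoc, Finset.Nat.sum_antidiagonal_succ (n := r + 1)]
  simp [hf]

/-- In the application `hf` holds because weight zero components do not depend on the fibre
variable, and `hf'` because `A 0` does not depend on it. -/
theorem sum_antidiagonal_succ_assoc' {V : Type*} [AddCommMonoid V] (f : ℕ → ℕ → ℕ → V)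
    (hf : ∀ p p', f 0 p p' = 0) (hf' : ∀ q p', f q 0 p' = 0) (r : ℕ) :
    ∑ u ∈ antidiagonal (r + 1), ∑ w ∈ antidiagonal (u.1 + 1), f w.1 w.2 u.2 =
      ∑ u ∈ antidiagonal (r + 1), ∑ w ∈ antidiagonal (u.2 + 1), f u.1 w.1 w.2 := by
  rw [sum_antidiagonal_succ_assoc f hf, Finset.Nat.sum_antidiagonal_succ' (n := r + 1)]
  simp [hf']

theorem sum_antidiagonal_succ_comm {V : Type*} [AddCommMonoid V] (f : ℕ → ℕ → ℕ → V)
    (hf : ∀ p p', f 0 p p' = 0) (r : ℕ) :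
    ∑ u ∈ antidiagonal (r + 1), ∑ w ∈ antidiagonal (u.1 + 1), f w.1 w.2 u.2 =
      ∑ u ∈ antidiagonal (r + 1), ∑ w ∈ antidiagonal (u.1 + 1), f w.1 u.2 w.2 := by
  rw [sum_antidiagonal_succ_assoc f hf,
    sum_antidiagonal_succ_assoc (fun a b c => f a c b) fun p p' => hf p' p]
  refine Finset.sum_congr rfl fun u _ => ?_
  exact (Finset.Nat.sum_antidiagonal_swap (f := fun w => f u.1 w.1 w.2)).symm

variable {E : Type} [NormedAddCommGroup E] [NormedSpace ℂ E]
  {V : Type} [NormedAddCommGroup V] [NormedSpace ℝ V]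

section Partial

variable {S : E → E → V} {z y : E}

theorem fderiv_fst (h : DifferentiableAt ℝ (fun p : E × E => S p.1 p.2) (z, y)) (v : E) :
    fderiv ℝ (fun z => S z y) z v = fderiv ℝ (fun p : E × E => S p.1 p.2) (z, y) (v, 0) := by
  have h1 : HasFDerivAt (fun z : E => (z, y)) (ContinuousLinearMap.inl ℝ E E) z :=
    hasFDerivAt_prodMk_left z y
  have := HasFDerivAt.comp (g := fun p : E × E => S p.1 p.2) z h.hasFDerivAt h1
  exact DFunLike.congr_fun this.fderiv v

theorem fderiv_snd (h : DifferentiableAt ℝ (fun p : E × E => S p.1 p.2) (z, y)) (v : E) :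
    fderiv ℝ (S z) y v = fderiv ℝ (fun p : E × E => S p.1 p.2) (z, y) (0, v) := by
  have h1 : HasFDerivAt (fun y : E => (z, y)) (ContinuousLinearMap.inr ℝ E E) y :=
    hasFDerivAt_prodMk_right z y
  have := HasFDerivAt.comp (g := fun p : E × E => S p.1 p.2) y h.hasFDerivAt h1
  exact DFunLike.congr_fun this.fderiv v

theorem eventually_differentiableAt {W V : Type*} [NormedAddCommGroup W] [NormedSpace ℝ W]
    [NormedAddCommGroup V] [NormedSpace ℝ V] {f : W → V} {p : W}
    (h : ContDiffAt ℝ ∞ f p) : ∀ᶠ p' in 𝓝 p, DifferentiableAt ℝ f p' := by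
  have h1 : ContDiffAt ℝ 1 f p := h.of_le (by exact_mod_cast le_top)
  filter_upwards [h1.eventually (by simp)] with p' hp' using hp'.differentiableAt one_ne_zero

theorem contDiffAt_fderiv {W V : Type*} [NormedAddCommGroup W] [NormedSpace ℝ W]
    [NormedAddCommGroup V] [NormedSpace ℝ V] {f : W → V} {p : W}
    (h : ContDiffAt ℝ ∞ f p) : ContDiffAt ℝ ∞ (fderiv ℝ f) p :=
  h.fderiv_right (m := ∞) (by simp)

theorem contDiffAt_fderiv_fst (h : ContDiffAt ℝ ∞ (fun p : E × E => S p.1 p.2) (z, y)) (v : E) :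
    ContDiffAt ℝ ∞ (fun p : E × E => fderiv ℝ (fun z => S z p.2) p.1 v) (z, y) := by
  have h1 : (fun p : E × E => fderiv ℝ (fun z => S z p.2) p.1 v) =ᶠ[𝓝 (z, y)]
      fun p => fderiv ℝ (fun p : E × E => S p.1 p.2) p (v, 0) := by
    filter_upwards [eventually_differentiableAt h] with p hp using fderiv_fst hp v
  exact ((contDiffAt_fderiv h).clm_apply contDiffAt_const).congr_of_eventuallyEq h1

theorem contDiffAt_fderiv_snd (h : ContDiffAt ℝ ∞ (fun p : E × E => S p.1 p.2) (z, y))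
    {B : E × E → E} (hB : ContDiffAt ℝ ∞ B (z, y)) :
    ContDiffAt ℝ ∞ (fun p : E × E => fderiv ℝ (S p.1) p.2 (B p)) (z, y) := by
  have h1 : (fun p : E × E => fderiv ℝ (S p.1) p.2 (B p)) =ᶠ[𝓝 (z, y)]
      fun p => fderiv ℝ (fun p : E × E => S p.1 p.2) p (0, B p) := by
    filter_upwards [eventually_differentiableAt h] with p hp using fderiv_snd hp (B p)
  exact ((contDiffAt_fderiv h).clm_apply
    (contDiffAt_const.prodMk hB)).congr_of_eventuallyEq h1

end Partial

/-- The covariant derivative, at the point `z`, of a family `S` of polynomial maps in `y`, indexed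
by the weight, with respect to a connection `A` with components `A p` of weight `p`. -/
noncomputable def covNabla (A : ℕ → E → E → E →L[ℝ] E) (S : ℕ → E → E → V) (r : ℕ) (z y : E) :
    E →L[ℝ] V :=
  fderiv ℝ (fun z => S r z y) z +
    ∑ w ∈ antidiagonal (r + 1), (fderiv ℝ (S w.1 z) y).comp (A w.2 z y)

/-- The component of weight `m` of the curvature of the connection `A`. -/
noncomputable def curvature (A : ℕ → E → E → E →L[ℝ] E) (m : ℕ) (z y v w : E) : E :=
  covNabla A (fun p z y => A p z y w) m z y v - covNabla A (fun p z y => A p z y v) m z y w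

theorem covNabla_apply (A : ℕ → E → E → E →L[ℝ] E) (S : ℕ → E → E → V) (r : ℕ) (z y v : E) :
    covNabla A S r z y v = fderiv ℝ (fun z => S r z y) z v +
      ∑ w ∈ antidiagonal (r + 1), fderiv ℝ (S w.1 z) y (A w.2 z y v) := by
  simp [covNabla]

/-- Partial derivatives are rewritten through the total derivative on `E × E`, so that one symmetry
statement for second derivatives covers base, fibre and mixed directions. -/
theorem covNabla_eq_total (A : ℕ → E → E → E →L[ℝ] E) {S : ℕ → E → E → V} {z y : E}
    (hS : ∀ q, DifferentiableAt ℝ (fun p : E × E => S q p.1 p.2) (z, y)) (r : ℕ) (v : E) :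
    covNabla A S r z y v = fderiv ℝ (fun p : E × E => S r p.1 p.2) (z, y) (v, 0) +
      ∑ w ∈ antidiagonal (r + 1),
        fderiv ℝ (fun p : E × E => S w.1 p.1 p.2) (z, y) (0, A w.2 z y v) := by
  rw [covNabla_apply, fderiv_fst (hS r)]
  simp only [fun q => fderiv_snd (hS q)]

theorem eventually_covNabla_eq_total (A : ℕ → E → E → E →L[ℝ] E) {S : ℕ → E → E → V} {z y : E}
    (hS : ∀ q, ContDiffAt ℝ ∞ (fun p : E × E => S q p.1 p.2) (z, y)) (r : ℕ) (v : E) :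
    (fun p : E × E => covNabla A S r p.1 p.2 v) =ᶠ[𝓝 (z, y)] fun p =>
      fderiv ℝ (fun p : E × E => S r p.1 p.2) p (v, 0) + ∑ w ∈ antidiagonal (r + 1),
        fderiv ℝ (fun p : E × E => S w.1 p.1 p.2) p (0, A w.2 p.1 p.2 v) := by
  have h1 := (Filter.eventually_all_finset (Finset.range (r + 2)) (l := 𝓝 (z, y))
    (p := fun q p => DifferentiableAt ℝ (fun p : E × E => S q p.1 p.2) p)).2
    fun q _ => eventually_differentiableAt (hS q)
  filter_upwards [h1] with p hp
  rw [covNabla_apply, fderiv_fst (hp r (by simp))]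
  congr 1
  refine Finset.sum_congr rfl fun w hw => fderiv_snd (hp w.1 ?_) _
  rw [Finset.HasAntidiagonal.mem_antidiagonal] at hw
  simp; omega

theorem contDiffAt_covNabla {A : ℕ → E → E → E →L[ℝ] E} {S : ℕ → E → E → V} {z y v : E}
    (hS : ∀ q, ContDiffAt ℝ ∞ (fun p : E × E => S q p.1 p.2) (z, y))
    (hA : ∀ p, ContDiffAt ℝ ∞ (fun q : E × E => A p q.1 q.2 v) (z, y)) (r : ℕ) :
    ContDiffAt ℝ ∞ (fun p : E × E => covNabla A S r p.1 p.2 v) (z, y) := by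
  simp only [covNabla_apply]
  exact (contDiffAt_fderiv_fst (hS r) v).add
    (ContDiffAt.sum fun w _ => contDiffAt_fderiv_snd (hS w.1) (hA w.2))

theorem fderiv_covNabla {A : ℕ → E → E → E →L[ℝ] E} {S : ℕ → E → E → V} {z y : E}
    (hS : ∀ q, ContDiffAt ℝ ∞ (fun p : E × E => S q p.1 p.2) (z, y)) {w : E}
    (hA : ∀ p, ContDiffAt ℝ ∞ (fun q : E × E => A p q.1 q.2 w) (z, y)) (r : ℕ) (h : E × E) :
    fderiv ℝ (fun p : E × E => covNabla A S r p.1 p.2 w) (z, y) h =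
      fderiv ℝ (fderiv ℝ (fun p : E × E => S r p.1 p.2)) (z, y) h (w, 0) +
      ∑ u ∈ antidiagonal (r + 1),
        (fderiv ℝ (fderiv ℝ (fun p : E × E => S u.1 p.1 p.2)) (z, y) h (0, A u.2 z y w) +
          fderiv ℝ (fun p : E × E => S u.1 p.1 p.2) (z, y)
            (0, fderiv ℝ (fun q : E × E => A u.2 q.1 q.2 w) (z, y) h)) := by
  have hd : ∀ q, DifferentiableAt ℝ (fderiv ℝ (fun p : E × E => S q p.1 p.2)) (z, y) :=
    fun q => (contDiffAt_fderiv (hS q)).differentiableAt (by simp)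
  have ha : ∀ q, DifferentiableAt ℝ (fun p : E × E => ((0, A q p.1 p.2 w) : E × E)) (z, y) :=
    fun q => (differentiableAt_const (0 : E)).prodMk ((hA q).differentiableAt (by simp))
  have h1 : ∀ u : ℕ × ℕ, DifferentiableAt ℝ (fun p : E × E =>
      fderiv ℝ (fun p : E × E => S u.1 p.1 p.2) p (0, A u.2 p.1 p.2 w)) (z, y) :=
    fun u => (hd u.1).clm_apply (ha u.2)
  rw [(eventually_covNabla_eq_total A hS r w).fderiv_eq,
    fderiv_fun_add ((hd r).clm_apply (differentiableAt_const _))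
      (DifferentiableAt.fun_sum fun u _ => h1 u), fderiv_fun_sum fun u _ => h1 u,
    fderiv_clm_apply (hd r) (differentiableAt_const _)]
  simp only [FunLike.coe_add, Pi.add_apply, sum_apply]
  congr 1
  · simp
  · refine Finset.sum_congr rfl fun u _ => ?_
    rw [fderiv_clm_apply (hd u.1) (ha u.2)]
    simp only [FunLike.coe_add, Pi.add_apply, ContinuousLinearMap.comp_apply,
      ContinuousLinearMap.flip_apply]
    rw [(differentiableAt_const (0 : E)).fderiv_prodMk ((hA u.2).differentiableAt (by simp))]
    simp [add_comm]

/-- The commutator of covariant derivatives is given by the curvature. -/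
theorem covNabla_commutator {A : ℕ → E → E → E →L[ℝ] E} {S : ℕ → E → E → V} {z y : E}
    (hS : ∀ q, ContDiffAt ℝ ∞ (fun p : E × E => S q p.1 p.2) (z, y))
    (hA : ∀ p v, ContDiffAt ℝ ∞ (fun q : E × E => A p q.1 q.2 v) (z, y))
    (hS0 : ∀ᶠ p in 𝓝 (z, y), fderiv ℝ (S 0 p.1) p.2 = 0) (hA0 : ∀ y', A 0 z y' = A 0 z 0)
    (r : ℕ) (v w : E) :
    covNabla A (fun r z y => covNabla A S r z y w) r z y v -
      covNabla A (fun r z y => covNabla A S r z y v) r z y w =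
    ∑ u ∈ antidiagonal (r + 1), fderiv ℝ (S u.1 z) y (curvature A u.2 z y v w) := by
  set D : ℕ → E × E →L[ℝ] V := fun q => fderiv ℝ (fun p : E × E => S q p.1 p.2) (z, y) with hD
  set B : ℕ → E × E → E × E → V := fun q h k =>
    fderiv ℝ (fderiv ℝ (fun p : E × E => S q p.1 p.2)) (z, y) h k with hB
  set a : ℕ → E → E := fun p v => A p z y v with ha
  set a' : ℕ → E → E × E → E := fun p w h =>
    fderiv ℝ (fun q : E × E => A p q.1 q.2 w) (z, y) h with ha'
  have hsymm : ∀ q h k, B q h k = B q k h := fun q h k =>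
    ((hS q).isSymmSndFDerivAt (by
      rw [minSmoothness_of_isRCLikeNormedField]; exact WithTop.coe_le_coe.2 (le_top : (2 : ℕ∞) ≤ ⊤))) h k
  -- The three vanishing statements `hD0`, `hB0` and `ha0` supply the boundary conditions for
  -- reindexing the sums over weights.
  have hD0 : ∀ u : E, D 0 (0, u) = 0 := by
    intro u
    rw [hD, ← fderiv_snd ((hS 0).differentiableAt (by simp)), hS0.self_of_nhds]
    rfl
  have hB0 : ∀ (h : E × E) (u : E), B 0 h (0, u) = 0 := by
    intro h u
    have h1 : (fun p => fderiv ℝ (fun p : E × E => S 0 p.1 p.2) p (0, u)) =ᶠ[𝓝 (z, y)]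
        fun _ => 0 := by
      filter_upwards [eventually_differentiableAt (hS 0), hS0] with p hp hp0
      rw [← fderiv_snd hp, hp0]
      rfl
    have h2 := h1.fderiv_eq (𝕜 := ℝ)
    rw [fderiv_clm_apply ((contDiffAt_fderiv (hS 0)).differentiableAt (by simp))
      (differentiableAt_const _)] at h2
    have h3 := DFunLike.congr_fun h2 h
    simpa [B] using h3
  have ha0 : ∀ w u : E, a' 0 w (0, u) = 0 := by
    intro w u
    have h1 := fderiv_snd (S := fun z y => A 0 z y w) ((hA 0 w).differentiableAt (by simp)) u
    simp only [ha']
    rw [← h1, show (fun y => A 0 z y w) = fun _ => A 0 z 0 w from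
      funext fun y' => by rw [hA0]]
    simp
  -- Expansion of `∇_v ∇_w S` into second derivatives of `S` and first derivatives of `S` along `∇_v
  -- A_w`.
  have key : ∀ v w : E, covNabla A (fun r z y => covNabla A S r z y w) r z y v =
      B r (v, 0) (w, 0) + ∑ u ∈ antidiagonal (r + 1),
        (B u.1 (v, 0) (0, a u.2 w) + B u.1 (w, 0) (0, a u.2 v)) +
      ∑ u ∈ antidiagonal (r + 1), ∑ t ∈ antidiagonal (u.1 + 1),
        B t.1 (0, a u.2 v) (0, a t.2 w) +
      ∑ u ∈ antidiagonal (r + 1), D u.1 (0, covNabla A (fun p z y => A p z y w) u.2 z y v) := by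
    intro v w
    have hT : ∀ q, ContDiffAt ℝ ∞ (fun p : E × E => covNabla A S q p.1 p.2 w) (z, y) :=
      contDiffAt_covNabla hS fun p => hA p w
    rw [covNabla_eq_total A fun q => (hT q).differentiableAt (by simp)]
    simp only [fun q h => fderiv_covNabla hS (fun p => hA p w) q h]
    have h1 : ∀ u : ℕ × ℕ, D u.1 (0, covNabla A (fun p z y => A p z y w) u.2 z y v) =
        D u.1 (0, a' u.2 w (v, 0)) + ∑ t ∈ antidiagonal (u.2 + 1),
          D u.1 (0, a' t.1 w (0, a t.2 v)) := by
      intro u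
      rw [covNabla_eq_total A fun q => (hA q w).differentiableAt (by simp)]
      have h2 : ∀ x : E, D u.1 (0, x) = (D u.1).comp (ContinuousLinearMap.inr ℝ E E) x :=
        fun x => rfl
      simp only [h2]
      rw [map_add, map_sum]
    simp only [h1, Finset.sum_add_distrib]
    have h3 := sum_antidiagonal_succ_assoc' (fun q p p' => D q (0, a' p w (0, a p' v)))
      (fun p p' => hD0 _) (fun q p' => by
        rw [ha0]; exact map_zero (D q)) r
    rw [← h3]
    simp only [fun u : ℕ × ℕ => hsymm u.1 (w, 0) (0, a u.2 v)]
    simp only [hB, hD, ha, ha']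
    abel
  -- All second-derivative terms are symmetric in `v` and `w`: the base and mixed ones visibly, the
  -- fibre ones after exchanging the weights of the two vector fields.
  rw [key v w, key w v, hsymm r (w, 0) (v, 0)]
  have h4 := sum_antidiagonal_succ_comm (fun q p p' => B q (0, a p' v) (0, a p w))
    (fun p p' => hB0 _ _) r
  have h5 : ∑ u ∈ antidiagonal (r + 1), ∑ t ∈ antidiagonal (u.1 + 1),
      B t.1 (0, a u.2 w) (0, a t.2 v) = ∑ u ∈ antidiagonal (r + 1), ∑ t ∈ antidiagonal (u.1 + 1),
      B t.1 (0, a u.2 v) (0, a t.2 w) := by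
    rw [h4]
    exact Finset.sum_congr rfl fun u _ => Finset.sum_congr rfl fun t _ => hsymm _ _ _
  have h6 : ∀ u : ℕ × ℕ, fderiv ℝ (S u.1 z) y (curvature A u.2 z y v w) =
      D u.1 (0, covNabla A (fun p z y => A p z y w) u.2 z y v) -
      D u.1 (0, covNabla A (fun p z y => A p z y v) u.2 z y w) := by
    intro u
    rw [curvature, map_sub, fderiv_snd ((hS u.1).differentiableAt (by simp)),
      fderiv_snd ((hS u.1).differentiableAt (by simp))]
  simp only [h6, Finset.sum_sub_distrib, h5, Finset.sum_add_distrib]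
  abel

end GradedConnections
end HolWeyl

namespace HolWeyl
open ContinuousAlternatingMap (alternatizeUncurryFin alternatizeUncurryFinCLM alternatizeUncurryFin_apply)
open Finset.HasAntidiagonal (antidiagonal)

/-! ### The graded commutator of the Weyl product with a one-form. -/

section Bracket

variable {E : Type} [NormedAddCommGroup E] [NormedSpace ℂ E]

theorem CForm.cast_sum {ι : Type*} {k l : ℕ} (h : k = l) (s : Finset ι) (a : ι → CForm E k) :
    (∑ i ∈ s, a i).cast h = ∑ i ∈ s, (a i).cast h := by
  subst h
  rfl

theorem CForm.cast_smul {k l : ℕ} (h : k = l) (c : ℂ) (a : CForm E k) :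
    (c • a).cast h = c • a.cast h := by
  subst h
  rfl

theorem CForm.cast_sub {k l : ℕ} (h : k = l) (a b : CForm E k) :
    (a - b).cast h = a.cast h - b.cast h := by
  subst h
  rfl

theorem CForm.cast_cast {k l : ℕ} (h : k = l) (h' : l = k) (a : CForm E k) :
    (a.cast h).cast h' = a := by
  subst h
  rfl

theorem CForm.cast_zero {k l : ℕ} (h : k = l) : (0 : CForm E k).cast h = 0 := by
  subst h
  rfl

variable [FiniteDimensional ℂ E]

/-- The term of order `m` in the product of a `1`-form and a `k`-form with respect to the
bivector `B`. -/
noncomputable def poissonTerm (B : Matrix (Fin (Module.finrank ℂ E)) (Fin (Module.finrank ℂ E)) ℂ)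
    (m : ℕ) {k : ℕ} (P : E → CForm E 1) (Q : E → CForm E k) (y : E) : CForm E (k + 1) :=
  ∑ i : Fin m → Fin (Module.finrank ℂ E), ∑ i' : Fin m → Fin (Module.finrank ℂ E),
    (∏ t, B (i t) (i' t)) •
      alternatizeUncurryFin ((partialDeriv i P y).covector.smulRight (partialDeriv i' Q y))

theorem cast_sum_wedge (B : Matrix (Fin (Module.finrank ℂ E)) (Fin (Module.finrank ℂ E)) ℂ)
    (m : ℕ) {k : ℕ} (P : E → CForm E 1) (Q : E → CForm E k) (y : E) :
    (∑ i : Fin m → Fin (Module.finrank ℂ E), ∑ i' : Fin m → Fin (Module.finrank ℂ E),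
      (∏ t, B (i t) (i' t)) • (partialDeriv i P y).wedge (partialDeriv i' Q y)).cast
        (Nat.add_comm 1 k) = poissonTerm B m P Q y := by
  simp only [CForm.cast_sum, CForm.cast_smul, wedge_one_cast]
  rfl

/-- Exchanging the factors costs `(-1)^k` for moving a one-form past a `k`-form and one sign for
each of the `m` antisymmetric bivectors. -/
theorem sum_wedge_swap {B : Matrix (Fin (Module.finrank ℂ E)) (Fin (Module.finrank ℂ E)) ℂ}
    (hB : ∀ i j, B i j = - B j i) (m : ℕ) {k : ℕ} (P : E → CForm E 1) (Q : E → CForm E k) (y : E) :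
    ∑ i : Fin m → Fin (Module.finrank ℂ E), ∑ i' : Fin m → Fin (Module.finrank ℂ E),
      (∏ t, B (i t) (i' t)) • (partialDeriv i Q y).wedge (partialDeriv i' P y) =
      ((-1 : ℂ) ^ k * (-1) ^ m) • poissonTerm B m P Q y := by
  rw [Finset.sum_comm, poissonTerm, Finset.smul_sum]
  refine Finset.sum_congr rfl fun i _ => ?_
  rw [Finset.smul_sum]
  refine Finset.sum_congr rfl fun i' _ => ?_
  have h1 : ∏ t, B (i' t) (i t) = (-1) ^ m * ∏ t, B (i t) (i' t) := by
    rw [Finset.prod_congr rfl fun t _ => hB (i' t) (i t), Finset.prod_neg]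
    simp
  rw [wedge_one_right, h1, smul_smul, smul_smul]
  congr 1
  ring

variable {X : Type} [TopologicalSpace X] [ChartedSpace E X] [IsManifold 𝓘(ℂ, E) ω X]

/-- The sign `(-1)^k` of the graded commutator cancels the one from the forms. Only `(-1)^m` is
left, so the terms of even order drop out, in particular the undeformed product. -/
theorem weylBracket_cast (Ω : HolomorphicSymplecticForm E X) (x : X) {k : ℕ}
    (a : QuantumWeylFibre E 1) (b : QuantumWeylFibre E k) (j r : ℕ) (y : E) :
    (weylBracket Ω x a b j r y).cast (Nat.add_comm 1 k) =
      ∑ m ∈ Finset.range (j + 1), ∑ q ∈ antidiagonal (j - m), ∑ w ∈ antidiagonal (r + 2 * m),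
        ((m.factorial : ℂ)⁻¹ * (1 - (-1) ^ m)) •
          poissonTerm (Ω.inverse x) m (a q.1 w.1) (b q.2 w.2) y := by
  have hB : ∀ i j, Ω.inverse x i j = - Ω.inverse x j i := by
    rw [← Ω.poisson_self]
    exact Ω.poisson_swap _
  have h1 : (weylProduct Ω x a b j r y).cast (Nat.add_comm 1 k) =
      ∑ m ∈ Finset.range (j + 1), ∑ q ∈ antidiagonal (j - m), ∑ w ∈ antidiagonal (r + 2 * m),
        ((m.factorial : ℂ)⁻¹) • poissonTerm (Ω.inverse x) m (a q.1 w.1) (b q.2 w.2) y := by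
    rw [weylProduct, CForm.cast_sum]
    refine Finset.sum_congr rfl fun m _ => ?_
    rw [CForm.cast_sum]
    refine Finset.sum_congr rfl fun q _ => ?_
    rw [CForm.cast_sum]
    refine Finset.sum_congr rfl fun w _ => ?_
    rw [CForm.cast_smul, cast_sum_wedge]
  have h2 : weylProduct Ω x b a j r y =
      ∑ m ∈ Finset.range (j + 1), ∑ q ∈ antidiagonal (j - m), ∑ w ∈ antidiagonal (r + 2 * m),
        ((m.factorial : ℂ)⁻¹ * ((-1 : ℂ) ^ k * (-1) ^ m)) •
          poissonTerm (Ω.inverse x) m (a q.1 w.1) (b q.2 w.2) y := by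
    rw [weylProduct]
    refine Finset.sum_congr rfl fun m _ => ?_
    rw [← Finset.Nat.sum_antidiagonal_swap]
    refine Finset.sum_congr rfl fun q _ => ?_
    rw [← Finset.Nat.sum_antidiagonal_swap]
    refine Finset.sum_congr rfl fun w _ => ?_
    rw [Prod.fst_swap, Prod.snd_swap, Prod.fst_swap, Prod.snd_swap, sum_wedge_swap hB, smul_smul]
  rw [weylBracket, CForm.cast_sub, CForm.cast_smul, CForm.cast_cast, h1, h2, one_mul]
  simp only [Finset.smul_sum]
  simp only [← Finset.sum_sub_distrib]
  refine Finset.sum_congr rfl fun m _ => Finset.sum_congr rfl fun q _ =>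
    Finset.sum_congr rfl fun w _ => ?_
  rw [smul_smul, ← sub_smul]
  congr 1
  have h3 : (-1 : ℂ) ^ k * (-1) ^ k = 1 := by rw [← mul_pow]; simp
  linear_combination (-(m.factorial : ℂ)⁻¹ * (-1) ^ m) * h3

/-- The Weyl bracket has no term of order zero in `ħ`. -/
theorem weylBracket_zero (Ω : HolomorphicSymplecticForm E X) (x : X) {k : ℕ}
    (a : QuantumWeylFibre E 1) (b : QuantumWeylFibre E k) : weylBracket Ω x a b 0 = 0 := by
  funext r y
  rw [← CForm.cast_cast (Nat.add_comm 1 k) (Nat.add_comm k 1) (weylBracket Ω x a b 0 r y),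
    weylBracket_cast]
  simp [CForm.cast_zero]

/-- The derivation `2 ω^{ij} ∂_i P ∂_j` defined by a polynomial `1`-form `P`. -/
noncomputable def hamField (B : Matrix (Fin (Module.finrank ℂ E)) (Fin (Module.finrank ℂ E)) ℂ)
    (P : E → CForm E 1) (y : E) : E →L[ℝ] E :=
  ∑ i, ∑ j, (2 * B i j) • (fderiv ℝ P y (Module.finBasis ℂ E i)).covector.smulRight
    (Module.finBasis ℂ E j)

theorem hamField_apply (B : Matrix (Fin (Module.finrank ℂ E)) (Fin (Module.finrank ℂ E)) ℂ)
    (P : E → CForm E 1) (y v : E) : hamField B P y v = ∑ i, ∑ j,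
      ((2 * B i j) * fderiv ℝ P y (Module.finBasis ℂ E i) fun _ => v) • Module.finBasis ℂ E j := by
  simp only [hamField, sum_apply, FunLike.coe_smul, Pi.smul_apply,
    ContinuousLinearMap.smulRight_apply, CForm.covector_apply, smul_smul]

theorem sum_fin_one_fun {V : Type*} [AddCommMonoid V] {n : ℕ} (f : (Fin 1 → Fin n) → V) :
    ∑ i, f i = ∑ j, f fun _ => j :=
  ((Equiv.funUnique (Fin 1) (Fin n)).symm.sum_comp f).symm

theorem partialDeriv_one {k : ℕ} (i : Fin (Module.finrank ℂ E)) (P : E → CForm E k) (y : E) :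
    partialDeriv (fun _ : Fin 1 => i) P y = fderiv ℝ P y (Module.finBasis ℂ E i) := by
  rw [partialDeriv, iteratedFDeriv_one_apply]

/-- The first-order term is the derivation of `Q` along the Hamiltonian field of `P`. Complex
homogeneity of `Q` makes its derivative complex linear, so that complex coefficients may be moved
into the argument. -/
theorem poissonTerm_one (B : Matrix (Fin (Module.finrank ℂ E)) (Fin (Module.finrank ℂ E)) ℂ)
    {k q : ℕ} (P : E → CForm E 1) {Q : E → CForm E k} (hQ : IsHomogeneousPoly q Q) (y : E) :
    (2 : ℂ) • poissonTerm B 1 P Q y =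
      alternatizeUncurryFin ((fderiv ℝ Q y).comp (hamField B P y)) := by
  have h1 : (fderiv ℝ Q y).comp (hamField B P y) = ∑ i, ∑ j, (2 * B i j) •
      (fderiv ℝ P y (Module.finBasis ℂ E i)).covector.smulRight
        (fderiv ℝ Q y (Module.finBasis ℂ E j)) := by
    refine ContinuousLinearMap.ext fun v => ?_
    rw [ContinuousLinearMap.comp_apply, hamField_apply, map_sum, sum_apply]
    refine Finset.sum_congr rfl fun i _ => ?_
    rw [map_sum, sum_apply]
    refine Finset.sum_congr rfl fun j _ => ?_
    rw [hQ.fderiv_apply_smul, mul_smul]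
    rfl
  rw [h1]
  simp only [← CForm.altCLM_apply, map_sum, map_smul]
  simp only [poissonTerm, sum_fin_one_fun, partialDeriv_one, Finset.smul_sum, smul_smul,
    Fin.prod_univ_one, CForm.altCLM_apply]

/-- For `ħ`-degree one, order `m = 0` has coefficient zero and order `m = 1` has coefficient two.
The latter uses up the only power of `ħ`, so just the classical parts of `a` and `b` occur. -/
theorem weylBracket_one_cast (Ω : HolomorphicSymplecticForm E X) (x : X) {k : ℕ}
    (a : QuantumWeylFibre E 1) (b : QuantumWeylFibre E k) (r : ℕ) (y : E) :
    (weylBracket Ω x a b 1 r y).cast (Nat.add_comm 1 k) = ∑ w ∈ antidiagonal (r + 2),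
      (2 : ℂ) • poissonTerm (Ω.inverse x) 1 (a 0 w.1) (b 0 w.2) y := by
  rw [weylBracket_cast, Finset.sum_range_succ, Finset.sum_range_one]
  simp
  norm_num

theorem fedosovD_zero_apply (Ω : HolomorphicSymplecticForm E X) (cov : TangentConnection E X)
    (I : X → QuantumWeylFibre E 1) {k : ℕ} (s : X → QuantumWeylFibre E k) (x : X) (r : ℕ) (y : E) :
    fedosovD Ω cov I s x 0 r y = covDeriv cov (fun x' => s x' 0) x r y -
      koszulDelta (s x 0) r y + ∑ w ∈ antidiagonal (r + 2),
      (2 : ℂ) • poissonTerm (Ω.inverse x) 1 (I x 0 w.1) (s x 0 w.2) y := by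
  rw [fedosovD, zero_add, weylBracket_one_cast]

theorem fedosovD_zero_eq_classicalD (Ω : HolomorphicSymplecticForm E X)
    (cov : TangentConnection E X) (I : X → QuantumWeylFibre E 1) {k : ℕ}
    (s : X → QuantumWeylFibre E k) (x : X) :
    fedosovD Ω cov I s x 0 = classicalD Ω cov I k (fun x' => s x' 0) x := by
  funext r y
  rw [classicalD, fedosovD_zero_apply, fedosovD_zero_apply]
  rfl

end Bracket
end HolWeyl

namespace HolWeyl
open ContinuousAlternatingMap (alternatizeUncurryFin alternatizeUncurryFinCLM alternatizeUncurryFin_apply)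
open Finset.HasAntidiagonal (antidiagonal)

/-! ### The exterior covariant derivative in a fixed chart. -/

section CovariantDerivative

variable {E : Type} [NormedAddCommGroup E] [NormedSpace ℂ E] [FiniteDimensional ℂ E]
  {X : Type} [TopologicalSpace X] [ChartedSpace E X] [IsManifold 𝓘(ℂ, E) ω X]

/-- The inhomogeneous transformation law of Christoffel symbols. The extra term is the derivative of
a coordinate field of one chart, written in the other. -/
theorem christoffel_jac (cov : TangentConnection E X) {x₀ : X} {z : E}
    (hz : z ∈ (chartAt E x₀).target) (y v : E) :
    christoffel cov ((chartAt E x₀).symm z) (jac x₀ ((chartAt E x₀).symm z) y)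
        (jac x₀ ((chartAt E x₀).symm z) v) =
      jac x₀ ((chartAt E x₀).symm z) (connectionForm cov x₀ z y v) -
        fderiv ℝ (fieldInChart (coordField x₀ y) ((chartAt E x₀).symm z))
          (chartChange x₀ ((chartAt E x₀).symm z) z) (jac x₀ ((chartAt E x₀).symm z) v) := by
  set x := (chartAt E x₀).symm z with hx
  have hxs : x ∈ (chartAt E x₀).source := (chartAt E x₀).map_target hz
  have h0 := connectionForm_apply cov hxs y v
  rw [hx, (chartAt E x₀).right_inv hz, ← hx] at h0
  have h1 := DFunLike.congr_fun (cov_apply cov (mem_chart_source E x)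
    (differentiableFieldAt_coordField hxs y)) (jac x₀ x v : E)
  have h2 : jacInv x x (components (coordField x₀ y x)) = jac x₀ x y := by
    rw [jacInv_self]
    rfl
  rw [h2] at h1
  have h3 : components (flatConnection x (coordField x₀ y) x (jac x₀ x v : E)) =
      fderiv ℝ (fieldInChart (coordField x₀ y) x) (chartAt E x x) (jac x₀ x v) := by
    change jac x x (fderiv ℝ (fieldInChart (coordField x₀ y) x) (chartAt E x x)
      (jacInv x x (jac x₀ x v))) = _
    rw [jacInv_self, jac_self]
    rfl
  rw [h0]
  change _ = _ - fderiv ℝ (fieldInChart (coordField x₀ y) x) (chartAt E x x) (jac x₀ x v)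
  rw [← h3]
  exact eq_sub_of_add_eq' h1.symm

/-- `covDeriv` is defined by a different chart at each point. Read in the chart at `x₀`, the section
with `y` held fixed is the pull-back under the transition map of a form whose fibre argument is a
coordinate field. The exterior derivative commutes with this pull-back, and the derivative of the
coordinate field cancels the inhomogeneous term of `christoffel_jac`. -/
theorem weylInChart_covDeriv (cov : TangentConnection E X) {k : ℕ} {s : X → WeylFibre E k}
    {x₀ : X} {z : E} (hz : z ∈ (chartAt E x₀).target)
    (hs : IsWeylSectionAt s ((chartAt E x₀).symm z)) (r : ℕ) (y : E) :
    weylInChart (covDeriv cov s) x₀ r z y = alternatizeUncurryFin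
      (fderiv ℝ (fun z => weylInChart s x₀ r z y) z -
        (fderiv ℝ (weylInChart s x₀ r z) y).comp (connectionForm cov x₀ z y)) := by
  set x := (chartAt E x₀).symm z with hx
  have hO : InOverlap x₀ x z := InOverlap.self hz
  set φ := chartChange (E := E) x₀ x with hφ
  set J := jac (E := E) x₀ x with hJ
  have hJφ : fderiv ℂ φ z = J := (jac_symm hz).symm
  have hφz : φ z = chartAt E x x := rfl
  set G := weylInChart s x r with hG
  set Ψ := fieldInChart (coordField x₀ y) x with hΨ
  have hGs : ContDiffAt ℝ ∞ (fun p : E × E => G p.1 p.2) (φ z, J y) := ((hs r).2 (J y))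
  have hGd := hGs.differentiableAt (by simp)
  have hxs : x ∈ (chartAt E x₀).source := (chartAt E x₀).map_target hz
  have hΨd : DifferentiableAt ℝ Ψ (φ z) := (differentiableFieldAt_iff (mem_chart_source E x)).1
    (differentiableFieldAt_coordField hxs y)
  have hΨz : ∀ z', InOverlap x₀ x z' → Ψ (φ z') = fderiv ℂ φ z' y := by
    intro z' hz'
    have h1 := fieldInChart_chart (coordField x₀ y) hz'.2
    change Ψ (φ z') = _ at h1
    rw [h1]
    change jacInv x _ (jac x₀ _ y) = _
    rw [jac_cocycle hz', ContinuousLinearMap.comp_apply, jacInv_jac hz'.2]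
  have hΨ0 : Ψ (φ z) = J y := by rw [hΨz z hO, hJφ]
  -- The argument `y`, constant in the coordinates at `x₀`, becomes the varying vector `Ψ w` in the
  -- coordinates at `x`.
  have hη : HasFDerivAt (fun w => G w (Ψ w))
      ((fderiv ℝ (fun p : E × E => G p.1 p.2) (φ z, J y)).comp
        ((ContinuousLinearMap.id ℝ E).prod (fderiv ℝ Ψ (φ z)))) (φ z) := by
    have h1 : HasFDerivAt (fun w => (w, Ψ w))
      ((ContinuousLinearMap.id ℝ E).prod (fderiv ℝ Ψ (φ z))) (φ z) :=
      (hasFDerivAt_id (φ z)).prodMk hΨd.hasFDerivAt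
    have h2 : HasFDerivAt (fun p : E × E => G p.1 p.2)
        (fderiv ℝ (fun p : E × E => G p.1 p.2) (φ z, J y)) (φ z, Ψ (φ z)) := by
      rw [hΨ0]; exact hGd.hasFDerivAt
    exact h2.comp (φ z) h1
  have hF : (fun z => weylInChart s x₀ r z y) =ᶠ[𝓝 z] fun z =>
      (G (φ z) (Ψ (φ z))).compContinuousLinearMap (fderiv ℝ φ z) := by
    filter_upwards [hO.eventually] with z' hz'
    rw [weylInChart_overlap s r hz', hΨz z' hz', fderiv_chartChange_real hz']
    rfl
  have hext := extDeriv_pullback (r := ∞) hη.differentiableAt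
    (contDiffAt_chartChange_real hO (n := ∞)) (by
      rw [minSmoothness_of_isRCLikeNormedField]; exact WithTop.coe_le_coe.2 (le_top : (2 : ℕ∞) ≤ ⊤))
  have h1 : alternatizeUncurryFin (fderiv ℝ (fun z => weylInChart s x₀ r z y) z) =
      CForm.pullback J (alternatizeUncurryFin
        ((fderiv ℝ (fun p : E × E => G p.1 p.2) (φ z, J y)).comp
          ((ContinuousLinearMap.id ℝ E).prod (fderiv ℝ Ψ (φ z))))) := by
    rw [hF.fderiv_eq]
    refine hext.trans ?_
    rw [extDeriv, hη.fderiv, fderiv_chartChange_real hO, hJφ]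
    rfl
  have h2 : (fderiv ℝ (weylInChart s x₀ r z) y).comp (connectionForm cov x₀ z y) =
      compR (CForm.pullbackCLM J k) ((fderiv ℝ (G (φ z)) (J y)).comp
        ((J.restrictScalars ℝ).comp (connectionForm cov x₀ z y))) := by
    have h3 : weylInChart s x₀ r z =
        (CForm.pullbackCLM J k).restrictScalars ℝ ∘ G (φ z) ∘ (J.restrictScalars ℝ) := by
      funext y'
      rw [weylInChart_overlap s r hO, hJφ]
      rfl
    have h4 : HasFDerivAt (G (φ z)) (fderiv ℝ (G (φ z)) (J y)) (J.restrictScalars ℝ y) := by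
      refine DifferentiableAt.hasFDerivAt ?_
      exact DifferentiableAt.comp (f := fun y' => (φ z, y')) (J y) hGd (by fun_prop)
    rw [h3, (((CForm.pullbackCLM J k).restrictScalars ℝ).hasFDerivAt.comp y
      (h4.comp y (J.restrictScalars ℝ).hasFDerivAt)).fderiv]
    rfl
  rw [← CForm.altCLM_apply, map_sub, CForm.altCLM_apply, CForm.altCLM_apply, h1, h2]
  rw [pullback_alt, ← CForm.altCLM_apply, ← CForm.altCLM_apply, ← map_sub]
  change CForm.pullback J (covDeriv cov s x r (J y)) = _
  rw [covDeriv, pullback_alt, ← CForm.altCLM_apply]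
  congr 1
  refine ContinuousLinearMap.ext fun v => ?_
  simp only [compR_apply, FunLike.coe_sub, Pi.sub_apply, ContinuousLinearMap.comp_apply]
  rw [← map_sub]
  congr 1
  have h5 := christoffel_jac cov hz y v
  rw [← hx, ← hJ] at h5
  have h6 : s x r = G (φ z) := funext fun y' => (weylInChart_self s x r y').symm
  change fderiv ℝ (fun z => G z (J y)) (φ z) (J v) -
    fderiv ℝ (s x r) (J y) (christoffel cov x (J y) (J v)) = _
  rw [h5, h6, map_sub, fderiv_fst hGd]
  have h7 := fderiv_snd hGd (fderiv ℝ Ψ (φ z) (J v))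
  change _ - (_ - fderiv ℝ (G (φ z)) (J y) (fderiv ℝ Ψ (φ z) (J v))) =
    fderiv ℝ (fun p : E × E => G p.1 p.2) (φ z, J y) (J v, fderiv ℝ Ψ (φ z) (J v)) -
      fderiv ℝ (G (φ z)) (J y) (J (connectionForm cov x₀ z y v))
  have h8 : ((J v, fderiv ℝ Ψ (φ z) (J v)) : E × E) = (J v, 0) + (0, fderiv ℝ Ψ (φ z) (J v)) := by
    simp
  rw [h7, h8, map_add]
  abel

end CovariantDerivative
end HolWeyl

namespace HolWeyl
open ContinuousAlternatingMap (alternatizeUncurryFin alternatizeUncurryFinCLM alternatizeUncurryFin_apply)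
open Finset.HasAntidiagonal (antidiagonal)

/-! ### Polynomiality, smoothness and transformation of bidifferential terms. -/

section Poisson

variable {E : Type} [NormedAddCommGroup E] [NormedSpace ℂ E] [FiniteDimensional ℂ E]

/-- Exterior multiplication by a `1`-form. -/
noncomputable def CForm.wedgeOne (k : ℕ) : CForm E 1 →L[ℂ] CForm E k →L[ℂ] CForm E (k + 1) :=
  LinearMap.toContinuousLinearMap
    ((LinearMap.toContinuousLinearMap : (CForm E k →ₗ[ℂ] CForm E (k + 1)) ≃ₗ[ℂ] _).toLinearMap ∘ₗ
      LinearMap.mk₂ ℂ (fun (a : CForm E 1) (b : CForm E k) =>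
        alternatizeUncurryFin (a.covector.smulRight b))
      (fun a a' b => by
        rw [← CForm.altCLM_apply, ← CForm.altCLM_apply, ← CForm.altCLM_apply, ← map_add]
        congr 1
        ext v
        simp [CForm.covector_apply, add_mul])
      (fun c a b => by
        rw [← CForm.altCLM_apply, ← CForm.altCLM_apply, ← map_smul]
        congr 1
        ext v
        simp [CForm.covector_apply, mul_assoc])
      (fun a b b' => by
        rw [← CForm.altCLM_apply, ← CForm.altCLM_apply, ← CForm.altCLM_apply, ← map_add]
        congr 1
        ext v
        simp [CForm.covector_apply])
      (fun c a b => by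
        rw [← CForm.altCLM_apply, ← CForm.altCLM_apply, ← map_smul]
        congr 1
        ext v
        simp [CForm.covector_apply]
        ring))

theorem CForm.wedgeOne_apply {k : ℕ} (a : CForm E 1) (b : CForm E k) :
    CForm.wedgeOne k a b = alternatizeUncurryFin (a.covector.smulRight b) := rfl

theorem CForm.contDiff_wedgeOne (k : ℕ) {n : WithTop ℕ∞} :
    ContDiff ℝ n (fun p : CForm E 1 × CForm E k => CForm.wedgeOne k p.1 p.2) := by
  have h : ContDiff ℂ n (fun p : CForm E 1 × CForm E k => CForm.wedgeOne k p.1 p.2) :=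
    (ContinuousLinearMap.isBoundedBilinearMap (𝕜 := ℂ) (E := CForm E 1) (F := CForm E k)
      (G := CForm E (k + 1)) (CForm.wedgeOne k)).contDiff
  exact h.restrict_scalars ℝ

theorem CForm.contDiffAt_wedgeOne {V : Type*} [NormedAddCommGroup V] [NormedSpace ℝ V] {k : ℕ}
    {f : V → CForm E 1} {g : V → CForm E k} {p : V} {n : WithTop ℕ∞} (hf : ContDiffAt ℝ n f p)
    (hg : ContDiffAt ℝ n g p) : ContDiffAt ℝ n (fun p => CForm.wedgeOne k (f p) (g p)) p :=
  ContDiffAt.comp (g := fun p : CForm E 1 × CForm E k => CForm.wedgeOne k p.1 p.2)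
    (f := fun p => (f p, g p)) p (CForm.contDiff_wedgeOne k).contDiffAt (hf.prodMk hg)

theorem CForm.wedgeOne_pullback (J : E →L[ℂ] E) {k : ℕ} (a : CForm E 1) (b : CForm E k) :
    CForm.wedgeOne k (a.pullback J) (b.pullback J) = (CForm.wedgeOne k a b).pullback J := by
  rw [CForm.wedgeOne_apply, CForm.wedgeOne_apply, pullback_alt]
  congr 1

variable (E) in
/-- The real coordinate forms. -/
noncomputable def CForm.realCoord (b : Fin (Module.finrank ℝ E)) : CForm E 1 :=
  ContinuousAlternatingMap.ofSubsingleton ℝ E ℂ (0 : Fin 1)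
    (Complex.ofRealCLM.comp (LinearMap.toContinuousLinearMap ((Module.finBasis ℝ E).coord b)))

theorem CForm.realCoord_covector_apply (b : Fin (Module.finrank ℝ E)) (v : E) :
    (CForm.realCoord E b).covector v = ((Module.finBasis ℝ E).coord b v : ℂ) := by
  rw [CForm.covector, CForm.realCoord, Equiv.symm_apply_apply]
  rfl

/-- A real basis reduces polynomiality and smoothness of an alternatization to those of finitely
many values of `L`. -/
theorem alt_eq_sum {k : ℕ} (L : E →L[ℝ] CForm E k) : alternatizeUncurryFin L =
    ∑ b, CForm.wedgeOne k (CForm.realCoord E b) (L (Module.finBasis ℝ E b)) := by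
  simp only [CForm.wedgeOne_apply, ← CForm.altCLM_apply]
  rw [← map_sum]
  congr 1
  refine ContinuousLinearMap.ext fun v => ?_
  simp only [sum_apply, ContinuousLinearMap.smulRight_apply, CForm.realCoord_covector_apply,
    CForm.coe_smul]
  conv_lhs => rw [← (Module.finBasis ℝ E).sum_repr v, map_sum]
  refine Finset.sum_congr rfl fun b _ => ?_
  rw [map_smul]
  rfl

theorem IsHomogeneousPoly.alt {r k : ℕ} {L : E → E →L[ℝ] CForm E k}
    (h : ∀ v, IsHomogeneousPoly r (fun y => L y v)) :
    IsHomogeneousPoly r (fun y => alternatizeUncurryFin (L y)) := by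
  simp only [alt_eq_sum]
  exact IsHomogeneousPoly.fun_sum fun b _ => (h _).clm_comp (CForm.wedgeOne k _)

theorem contDiffAt_alt {V : Type*} [NormedAddCommGroup V] [NormedSpace ℝ V] {k : ℕ}
    {L : V → E →L[ℝ] CForm E k} {p : V} {n : WithTop ℕ∞}
    (h : ∀ v, ContDiffAt ℝ n (fun p => L p v) p) :
    ContDiffAt ℝ n (fun p => alternatizeUncurryFin (L p)) p := by
  simp only [alt_eq_sum]
  exact ContDiffAt.sum fun b _ =>
    ((CForm.wedgeOne k (CForm.realCoord E b)).restrictScalars ℝ).contDiff.contDiffAt.comp p (h _)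

theorem poissonTerm_eq (B : Matrix (Fin (Module.finrank ℂ E)) (Fin (Module.finrank ℂ E)) ℂ)
    (m : ℕ) {k : ℕ} (P : E → CForm E 1) (Q : E → CForm E k) (y : E) :
    poissonTerm B m P Q y =
      ∑ i : Fin m → Fin (Module.finrank ℂ E), ∑ i' : Fin m → Fin (Module.finrank ℂ E),
        (∏ t, B (i t) (i' t)) • CForm.wedgeOne k (partialDeriv i P y) (partialDeriv i' Q y) := rfl

theorem partialDeriv_zero_fun {k m : ℕ} (i : Fin m → Fin (Module.finrank ℂ E)) (y : E) :
    partialDeriv i (0 : E → CForm E k) y = 0 := by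
  change iteratedFDeriv ℝ m (fun _ => 0) y _ = 0
  rw [iteratedFDeriv_fun_zero]
  rfl

theorem isHomogeneousPoly_poissonTerm
    (B : Matrix (Fin (Module.finrank ℂ E)) (Fin (Module.finrank ℂ E)) ℂ)
    {m k a b r : ℕ} {P : E → CForm E 1} {Q : E → CForm E k} (hP : IsHomogeneousPoly a P)
    (hQ : IsHomogeneousPoly b Q) (hr : a + b = r + 2 * m) :
    IsHomogeneousPoly r (fun y => poissonTerm B m P Q y) := by
  simp only [poissonTerm_eq]
  refine IsHomogeneousPoly.fun_sum fun i _ => IsHomogeneousPoly.fun_sum fun i' _ =>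
    IsHomogeneousPoly.fun_smul _ ?_
  -- When the order exceeds one of the degrees the term vanishes, and zero is homogeneous of every
  -- degree.
  rcases Nat.lt_or_ge a m with h | h
  · refine IsHomogeneousPoly.eq_zero_of_zero r fun y => ?_
    rw [partialDeriv, hP.iteratedFDeriv_eq_zero h, map_zero]
    rfl
  rcases Nat.lt_or_ge b m with h' | h'
  · refine IsHomogeneousPoly.eq_zero_of_zero r fun y => ?_
    rw [partialDeriv, partialDeriv, hQ.iteratedFDeriv_eq_zero h', map_zero]
  obtain ⟨a, rfl⟩ := Nat.exists_eq_add_of_le' h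
  obtain ⟨b, rfl⟩ := Nat.exists_eq_add_of_le' h'
  obtain rfl : r = a + b := by omega
  exact (hP.iteratedFDeriv_apply _).bilin (hQ.iteratedFDeriv_apply _) (CForm.wedgeOne k)

theorem contDiffAt_partialDeriv {k q m : ℕ} (i : Fin m → Fin (Module.finrank ℂ E))
    {P : E → E → CForm E k} {z y : E} (hP : ∀ᶠ z' in 𝓝 z, IsHomogeneousPoly q (P z'))
    (hd : ContDiffAt ℝ ∞ (fun p : E × E => P p.1 p.2) (z, y)) :
    ContDiffAt ℝ ∞ (fun p : E × E => partialDeriv i (P p.1) p.2) (z, y) := by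
  simp only [partialDeriv]
  generalize (fun t => Module.finBasis ℂ E (i t)) = v
  clear i
  induction m with
  | zero => simpa using hd
  | succ m ih =>
    refine (contDiffAt_fderiv_snd (S := fun z y => iteratedFDeriv ℝ m (P z) y (Fin.tail v))
      (ih (Fin.tail v)) (contDiffAt_const (c := v 0))).congr_of_eventuallyEq ?_
    filter_upwards [(continuous_fst.tendsto (z, y)).eventually hP] with p hp
    have hd : DifferentiableAt ℝ (iteratedFDeriv ℝ m (P p.1)) p.2 :=
      (hp.contDiff_real (n := m + 1)).differentiable_iteratedFDeriv
        (by exact_mod_cast Nat.lt_succ_self m) p.2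
    rw [iteratedFDeriv_succ_apply_left, fderiv_continuousMultilinear_apply_const_apply hd]

theorem contDiffAt_poissonTerm
    {B : E → Matrix (Fin (Module.finrank ℂ E)) (Fin (Module.finrank ℂ E)) ℂ} {z y : E}
    (hB : ∀ i j, ContDiffAt ℝ ∞ (fun z => B z i j) z)
    {m k a b : ℕ} {P : E → E → CForm E 1} {Q : E → E → CForm E k}
    (hP : ∀ᶠ z' in 𝓝 z, IsHomogeneousPoly a (P z'))
    (hPd : ContDiffAt ℝ ∞ (fun p : E × E => P p.1 p.2) (z, y))
    (hQ : ∀ᶠ z' in 𝓝 z, IsHomogeneousPoly b (Q z'))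
    (hQd : ContDiffAt ℝ ∞ (fun p : E × E => Q p.1 p.2) (z, y)) :
    ContDiffAt ℝ ∞ (fun p : E × E => poissonTerm (B p.1) m (P p.1) (Q p.1) p.2) (z, y) := by
  simp only [poissonTerm_eq]
  refine ContDiffAt.sum fun i _ => ContDiffAt.sum fun i' _ => ContDiffAt.fun_smul (𝕜 := ℝ) ?_ ?_
  · exact contDiffAt_prod fun t _ => (hB _ _).comp (z, y) contDiffAt_fst
  · exact CForm.contDiffAt_wedgeOne (contDiffAt_partialDeriv i hP hPd)
      (contDiffAt_partialDeriv i' hQ hQd)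

/-- Real derivatives of a complex polynomial are restrictions of complex ones. Complex
multilinearity is what permits a complex change of basis in them. -/
theorem partialDeriv_eq_complex {k q m : ℕ} (i : Fin m → Fin (Module.finrank ℂ E))
    {P : E → CForm E k} (hP : IsHomogeneousPoly q P) (y : E) : partialDeriv i P y =
      iteratedFDeriv ℂ m P y fun t => Module.finBasis ℂ E (i t) := by
  rw [partialDeriv, ← (hP.contDiff (n := m)).contDiffAt.restrictScalars_iteratedFDeriv (𝕜 := ℝ)
    (x := y)]
  rfl

theorem partialDeriv_pullback {k q m : ℕ} (i : Fin m → Fin (Module.finrank ℂ E)) (J : E →L[ℂ] E)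
    {P : E → CForm E k} (hP : IsHomogeneousPoly q P) (y : E) :
    partialDeriv i (fun y => (P (J y)).pullback J) y =
      (iteratedFDeriv ℂ m P (J y) fun t => J (Module.finBasis ℂ E (i t))).pullback J := by
  refine (partialDeriv_eq_complex i (P := fun y => (P (J y)).pullback J)
    ((hP.comp_clm J).clm_comp (CForm.pullbackCLM J k)) y).trans ?_
  have h1 := (CForm.pullbackCLM J k).iteratedFDeriv_comp_left (n := m) (i := m) (f := P ∘ J)
    (x := y) (hP.comp_clm J).contDiff.contDiffAt le_rfl
  have h2 := J.iteratedFDeriv_comp_right (n := m) (i := m) (f := P) hP.contDiff y le_rfl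
  rw [h2] at h1
  exact DFunLike.congr_fun h1 _

theorem _root_.MultilinearMap.map_sum_smul {n m : ℕ} {W : Type*} [AddCommGroup W] [Module ℂ W]
    (M : Matrix (Fin n) (Fin n) ℂ) (e e' : Fin n → E) (he : ∀ i, e' i = ∑ a, M a i • e a)
    (S : MultilinearMap ℂ (fun _ : Fin m => E) W) (i : Fin m → Fin n) :
    S (fun t => e' (i t)) = ∑ a : Fin m → Fin n, (∏ t, M (a t) (i t)) • S fun t => e (a t) := by
  simp only [he]
  rw [S.map_sum]
  exact Finset.sum_congr rfl fun a _ => S.map_smul_univ _ _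

/-- Transformation of the contraction of multilinear maps with a bivector. -/
theorem sum_bivector_map {n m : ℕ} {W₁ W₂ W : Type*} [AddCommGroup W₁] [Module ℂ W₁]
    [AddCommGroup W₂] [Module ℂ W₂] [AddCommGroup W] [Module ℂ W] (β : W₁ →ₗ[ℂ] W₂ →ₗ[ℂ] W)
    (B B' M : Matrix (Fin n) (Fin n) ℂ) (hB : M * B' * M.transpose = B) (e e' : Fin n → E)
    (he : ∀ i, e' i = ∑ a, M a i • e a)
    (S : MultilinearMap ℂ (fun _ : Fin m => E) W₁) (T : MultilinearMap ℂ (fun _ : Fin m => E) W₂) :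
    ∑ i : Fin m → Fin n, ∑ i' : Fin m → Fin n,
        (∏ t, B' (i t) (i' t)) • β (S fun t => e' (i t)) (T fun t => e' (i' t)) =
      ∑ i : Fin m → Fin n, ∑ i' : Fin m → Fin n,
        (∏ t, B (i t) (i' t)) • β (S fun t => e (i t)) (T fun t => e (i' t)) := by
  have key2 : ∀ a a' : Fin m → Fin n, ∏ t, B (a t) (a' t) =
      ∑ i : Fin m → Fin n, ∑ i' : Fin m → Fin n,
        (∏ t, B' (i t) (i' t)) * ((∏ t, M (a t) (i t)) * ∏ t, M (a' t) (i' t)) := by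
    intro a a'
    -- Entrywise form of the congruence `hB`; multiplying over `t` and expanding gives the
    -- transformation rule for the `m`-fold product.
    have h1 : ∀ t, B (a t) (a' t) =
        ∑ i, ∑ i', B' i i' * (M (a t) i * M (a' t) i') := by
      intro t
      rw [← hB, Matrix.mul_apply]
      simp only [Matrix.mul_apply, Matrix.transpose_apply, Finset.sum_mul]
      rw [Finset.sum_comm]
      exact Finset.sum_congr rfl fun i _ => Finset.sum_congr rfl fun i' _ => by ring
    simp only [h1]
    rw [Finset.prod_univ_sum, Fintype.piFinset_univ]
    refine Finset.sum_congr rfl fun i _ => ?_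
    rw [Finset.prod_univ_sum, Fintype.piFinset_univ]
    refine Finset.sum_congr rfl fun i' _ => ?_
    rw [Finset.prod_mul_distrib, Finset.prod_mul_distrib]
  have hl : ∀ i i' : Fin m → Fin n, (∏ t, B' (i t) (i' t)) •
      β (S fun t => e' (i t)) (T fun t => e' (i' t)) = ∑ a : Fin m → Fin n, ∑ a' : Fin m → Fin n,
        ((∏ t, B' (i t) (i' t)) * ((∏ t, M (a t) (i t)) * ∏ t, M (a' t) (i' t))) •
          β (S fun t => e (a t)) (T fun t => e (a' t)) := by
    intro i i'
    rw [S.map_sum_smul M e e' he, T.map_sum_smul M e e' he]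
    simp only [map_sum, LinearMap.sum_apply, map_smul, LinearMap.smul_apply, Finset.smul_sum,
      smul_smul]
    rw [Finset.sum_comm]
    refine Finset.sum_congr rfl fun a _ => Finset.sum_congr rfl fun a' _ => ?_
    rw [mul_comm (∏ t, M (a t) (i t))]
  simp only [hl, key2, Finset.sum_smul]
  rw [Finset.sum_congr rfl fun i _ => Finset.sum_comm, Finset.sum_comm]
  refine Finset.sum_congr rfl fun a _ => ?_
  rw [Finset.sum_congr rfl fun i _ => Finset.sum_comm, Finset.sum_comm]

end Poisson

/-! ### Invariance of the bidifferential terms under coordinate changes. -/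

section Naturality

variable {E : Type} [NormedAddCommGroup E] [NormedSpace ℂ E] [FiniteDimensional ℂ E]
  {X : Type} [TopologicalSpace X] [ChartedSpace E X] [IsManifold 𝓘(ℂ, E) ω X]

/-- The matrix of the coordinate change. -/
noncomputable def jacMatrix (x₀ x : X) :
    Matrix (Fin (Module.finrank ℂ E)) (Fin (Module.finrank ℂ E)) ℂ :=
  LinearMap.toMatrix (Module.finBasis ℂ E) (Module.finBasis ℂ E) (jac x₀ x : E →L[ℂ] E).toLinearMap

theorem jac_basis (x₀ x : X) (i : Fin (Module.finrank ℂ E)) :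
    jac x₀ x (Module.finBasis ℂ E i) =
      ∑ a, jacMatrix (E := E) x₀ x a i • Module.finBasis ℂ E a := by
  conv_lhs => rw [← (Module.finBasis ℂ E).sum_repr (jac x₀ x (Module.finBasis ℂ E i))]
  refine Finset.sum_congr rfl fun a _ => ?_
  rw [jacMatrix, LinearMap.toMatrix_apply]
  rfl

/-- The matrix of the form transforms by congruence with the Jacobian; taking inverses gives the
rule for the Poisson tensor. -/
theorem poisson_transform (Ω : HolomorphicSymplecticForm E X) {x₀ x : X}
    (h : x ∈ (chartAt E x₀).source) :
    jacMatrix x₀ x * Ω.poisson x₀ (chartAt E x₀ x) * (jacMatrix x₀ x).transpose =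
      Ω.inverse x := by
  set M := jacMatrix (E := E) x₀ x
  have h1 : Ω.matrix x₀ (chartAt E x₀ x) = M.transpose * Ω.matrix x (chartAt E x x) * M := by
    ext i j
    have h2 : Ω.matrix x₀ (chartAt E x₀ x) i j = Ω.bilin x (chartAt E x x)
        (jac x₀ x (Module.finBasis ℂ E i)) (jac x₀ x (Module.finBasis ℂ E j)) := by
      rw [Ω.bilin_self]
      exact Ω.bilin_chart h _ _
    rw [h2, jac_basis, jac_basis, Matrix.mul_apply]
    simp only [map_sum, sum_apply, map_smul, FunLike.coe_smul, Pi.smul_apply, smul_eq_mul,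
      Matrix.mul_apply, Matrix.transpose_apply, Finset.sum_mul]
    refine Finset.sum_congr rfl fun a _ => ?_
    rw [Finset.mul_sum]
    refine Finset.sum_congr rfl fun b _ => ?_
    rw [HolomorphicSymplecticForm.matrix, Matrix.of_apply]
    ring
  have hM : IsUnit M.det := by
    have h2 : M * LinearMap.toMatrix (Module.finBasis ℂ E) (Module.finBasis ℂ E)
        (jacInv x₀ x : E →L[ℂ] E).toLinearMap = 1 := by
      refine (LinearMap.toMatrix_mul (Module.finBasis ℂ E) _ _).symm.trans ?_
      rw [← LinearMap.toMatrix_one (Module.finBasis ℂ E)]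
      congr 1
      exact LinearMap.ext fun v => jac_jacInv h v
    exact Matrix.isUnit_det_of_right_inverse h2
  have hM' : IsUnit M.transpose.det := by rwa [Matrix.det_transpose]
  rw [HolomorphicSymplecticForm.poisson, h1, Matrix.mul_inv_rev, Matrix.mul_inv_rev, ← Ω.poisson_self,
    HolomorphicSymplecticForm.poisson, Matrix.mul_nonsing_inv_cancel_left _ _ hM,
    Matrix.nonsing_inv_mul_cancel_right _ _ hM']

/-- By the chain rule, fibre derivatives of the pulled-back polynomials are derivatives along the
images of the basis under the Jacobian. `sum_bivector_map` then absorbs the change of basis into the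
bivector. -/
theorem poissonTerm_natural (Ω : HolomorphicSymplecticForm E X) {x₀ x : X}
    (h : x ∈ (chartAt E x₀).source) {m k a b : ℕ} {P : E → CForm E 1} {Q : E → CForm E k}
    (hP : IsHomogeneousPoly a P) (hQ : IsHomogeneousPoly b Q) (y : E) :
    (poissonTerm (Ω.inverse x) m P Q (jac x₀ x y)).pullback (jac x₀ x) =
      poissonTerm (Ω.poisson x₀ (chartAt E x₀ x)) m
        (fun y => (P (jac x₀ x y)).pullback (jac x₀ x))
        (fun y => (Q (jac x₀ x y)).pullback (jac x₀ x)) y := by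
  rw [poissonTerm_eq, poissonTerm_eq]
  simp only [partialDeriv_pullback _ _ hP, partialDeriv_pullback _ _ hQ,
    partialDeriv_eq_complex _ hP, partialDeriv_eq_complex _ hQ]
  have h1 := sum_bivector_map
    (LinearMap.mk₂ ℂ (fun (a : CForm E 1) (b : CForm E k) =>
      CForm.wedgeOne k (a.pullback (jac x₀ x)) (b.pullback (jac x₀ x)))
      (fun a a' b => by simp only [← CForm.pullbackCLM_apply, map_add]; rfl)
      (fun c a b => by simp only [← CForm.pullbackCLM_apply, map_smul]; rfl)
      (fun a b b' => by simp only [← CForm.pullbackCLM_apply, map_add])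
      (fun c a b => by simp only [← CForm.pullbackCLM_apply, map_smul]))
    (Ω.inverse x) (Ω.poisson x₀ (chartAt E x₀ x)) (jacMatrix x₀ x) (poisson_transform Ω h)
    (Module.finBasis ℂ E) (fun i => jac x₀ x (Module.finBasis ℂ E i)) (jac_basis x₀ x)
    (iteratedFDeriv ℂ m P (jac x₀ x y)).toMultilinearMap
    (iteratedFDeriv ℂ m Q (jac x₀ x y)).toMultilinearMap
  refine Eq.trans ?_ h1.symm
  rw [← CForm.pullbackCLM_apply, map_sum]
  refine Finset.sum_congr rfl fun i _ => ?_
  rw [map_sum]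
  refine Finset.sum_congr rfl fun i' _ => ?_
  rw [map_smul, CForm.pullbackCLM_apply, ← CForm.wedgeOne_pullback]
  rfl

end Naturality
end HolWeyl

namespace HolWeyl
open ContinuousAlternatingMap (alternatizeUncurryFin alternatizeUncurryFinCLM alternatizeUncurryFin_apply)
open Finset.HasAntidiagonal (antidiagonal)

/-! ### The operator `D` as a smooth connection on the Weyl bundle. -/

section Operators

variable {E : Type} [NormedAddCommGroup E] [NormedSpace ℂ E] [FiniteDimensional ℂ E]

theorem alt_add {k : ℕ} (L L' : E →L[ℝ] CForm E k) :
    alternatizeUncurryFin (L + L') = alternatizeUncurryFin L + alternatizeUncurryFin L' :=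
  map_add (CForm.altCLM E k) L L'

theorem alt_sub {k : ℕ} (L L' : E →L[ℝ] CForm E k) :
    alternatizeUncurryFin (L - L') = alternatizeUncurryFin L - alternatizeUncurryFin L' :=
  map_sub (CForm.altCLM E k) L L'

theorem alt_smul {k : ℕ} (c : ℂ) (L : E →L[ℝ] CForm E k) :
    alternatizeUncurryFin (c • L) = c • alternatizeUncurryFin L :=
  map_smul (CForm.altCLM E k) c L

theorem partialDeriv_add {k q m : ℕ} (i : Fin m → Fin (Module.finrank ℂ E)) {P Q : E → CForm E k}
    (hP : IsHomogeneousPoly q P) (hQ : IsHomogeneousPoly q Q) (y : E) :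
    partialDeriv i (P + Q) y = partialDeriv i P y + partialDeriv i Q y := by
  rw [partialDeriv, iteratedFDeriv_add_apply hP.contDiff_real.contDiffAt
    hQ.contDiff_real.contDiffAt]
  rfl

theorem partialDeriv_smul {k q m : ℕ} (i : Fin m → Fin (Module.finrank ℂ E)) {P : E → CForm E k}
    (c : ℂ) (hP : IsHomogeneousPoly q P) (y : E) :
    partialDeriv i (c • P) y = c • partialDeriv i P y := by
  rw [partialDeriv_eq_complex i (hP.smul c), partialDeriv_eq_complex i hP,
    iteratedFDeriv_const_smul_apply hP.contDiff.contDiffAt]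
  rfl

theorem poissonTerm_add (B : Matrix (Fin (Module.finrank ℂ E)) (Fin (Module.finrank ℂ E)) ℂ)
    {m k q : ℕ} (P : E → CForm E 1) {Q Q' : E → CForm E k} (hQ : IsHomogeneousPoly q Q)
    (hQ' : IsHomogeneousPoly q Q') (y : E) : poissonTerm B m P (Q + Q') y =
      poissonTerm B m P Q y + poissonTerm B m P Q' y := by
  simp only [poissonTerm_eq, partialDeriv_add _ hQ hQ', map_add, smul_add,
    Finset.sum_add_distrib]

theorem poissonTerm_smul (B : Matrix (Fin (Module.finrank ℂ E)) (Fin (Module.finrank ℂ E)) ℂ)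
    {m k q : ℕ} (P : E → CForm E 1) {Q : E → CForm E k} (c : ℂ) (hQ : IsHomogeneousPoly q Q)
    (y : E) : poissonTerm B m P (c • Q) y = c • poissonTerm B m P Q y := by
  simp only [poissonTerm_eq, partialDeriv_smul _ c hQ, map_smul, Finset.smul_sum]
  exact Finset.sum_congr rfl fun i _ => Finset.sum_congr rfl fun i' _ => smul_comm _ _ _

variable {X : Type} [TopologicalSpace X] [ChartedSpace E X] [IsManifold 𝓘(ℂ, E) ω X]

theorem weylInChart_koszulDelta {k : ℕ} {s : X → WeylFibre E k} {x₀ : X} {z : E}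
    (hs : IsWeylSectionAt s ((chartAt E x₀).symm z)) (r : ℕ) (y : E) :
    weylInChart (fun x => koszulDelta (s x)) x₀ r z y =
      alternatizeUncurryFin (fderiv ℝ (weylInChart s x₀ (r + 1) z) y) := by
  rw [weylInChart, koszulDelta, pullback_alt]
  congr 1
  set x := (chartAt E x₀).symm z
  have h1 := ((hs (r + 1)).1.differentiableAt_real (jac x₀ x y)).hasFDerivAt
  have h2 := ((CForm.pullbackCLM (jac (E := E) x₀ x) k).restrictScalars ℝ).hasFDerivAt.comp y
    (h1.comp y ((jac (E := E) x₀ x).restrictScalars ℝ).hasFDerivAt)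
  exact h2.fderiv.symm

theorem weylInChart_poissonTerm (Ω : HolomorphicSymplecticForm E X) {k : ℕ}
    {a : X → WeylFibre E 1} {s : X → WeylFibre E k} {x₀ : X} {z : E}
    (hz : z ∈ (chartAt E x₀).target) (ha : IsWeylSectionAt a ((chartAt E x₀).symm z))
    (hs : IsWeylSectionAt s ((chartAt E x₀).symm z)) (m p q : ℕ) (y : E) :
    (poissonTerm (Ω.inverse ((chartAt E x₀).symm z)) m (a ((chartAt E x₀).symm z) p)
      (s ((chartAt E x₀).symm z) q) (jac x₀ ((chartAt E x₀).symm z) y)).pullback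
        (jac x₀ ((chartAt E x₀).symm z)) =
      poissonTerm (Ω.poisson x₀ z) m (weylInChart a x₀ p z) (weylInChart s x₀ q z) y := by
  have h := poissonTerm_natural Ω ((chartAt E x₀).map_target hz) (m := m) (ha p).1 (hs q).1 y
  rw [(chartAt E x₀).right_inv hz] at h
  exact h

/-- The value of `D s` at each point is computed in the chart centred there. This formula in a
single chart makes smoothness of `D s` visible. -/
theorem weylInChart_fedosovD (Ω : HolomorphicSymplecticForm E X) (cov : TangentConnection E X)
    {I : X → QuantumWeylFibre E 1} {k : ℕ} {s : X → QuantumWeylFibre E k} {x₀ : X} {z : E}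
    (hz : z ∈ (chartAt E x₀).target)
    (hI : (quantumWeylSections E X 1).Holds I ((chartAt E x₀).symm z))
    (hs : (quantumWeylSections E X k).Holds s ((chartAt E x₀).symm z)) (j r : ℕ) (y : E) :
    weylInChart (fun x => fedosovD Ω cov I s x j) x₀ r z y = alternatizeUncurryFin
      (fderiv ℝ (fun z => weylInChart (fun x => s x j) x₀ r z y) z -
        (fderiv ℝ (weylInChart (fun x => s x j) x₀ r z) y).comp (connectionForm cov x₀ z y)) -
      alternatizeUncurryFin (fderiv ℝ (weylInChart (fun x => s x j) x₀ (r + 1) z) y) +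
      ∑ m ∈ Finset.range (j + 1 + 1), ∑ q ∈ antidiagonal (j + 1 - m),
        ∑ w ∈ antidiagonal (r + 2 * m), ((m.factorial : ℂ)⁻¹ * (1 - (-1) ^ m)) •
          poissonTerm (Ω.poisson x₀ z) m (weylInChart (fun x => I x q.1) x₀ w.1 z)
            (weylInChart (fun x => s x q.2) x₀ w.2 z) y := by
  rw [← weylInChart_covDeriv cov hz (hs j), ← weylInChart_koszulDelta (hs j)]
  have h1 : ∀ q w : ℕ × ℕ, ∀ m, poissonTerm (Ω.poisson x₀ z) m
      (weylInChart (fun x => I x q.1) x₀ w.1 z) (weylInChart (fun x => s x q.2) x₀ w.2 z) y = _ :=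
    fun q w m => (weylInChart_poissonTerm Ω hz (hI q.1) (hs q.2) m w.1 w.2 y).symm
  simp only [h1]
  rw [weylInChart]
  simp only [fedosovD, weylBracket_cast]
  simp only [← CForm.pullbackCLM_apply, map_add, map_sub, map_sum, map_smul]
  rfl

theorem IsSymplecticConnection.contDiffAt_connectionForm {Ω : HolomorphicSymplecticForm E X}
    {cov : TangentConnection E X} [T2Space X] (hc : IsSymplecticConnection Ω cov) {x₀ : X} {z : E}
    (hz : z ∈ (chartAt E x₀).target) (y v : E) :
    ContDiffAt ℝ ∞ (fun p : E × E => connectionForm cov x₀ p.1 p.2 v) (z, y) := by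
  have h1 : (fun p : E × E => connectionForm cov x₀ p.1 p.2 v) =ᶠ[𝓝 (z, y)] fun p =>
      ∑ i, coord E i p.2 • connectionForm cov x₀ p.1 (Module.finBasis ℂ E i) v := by
    filter_upwards [(continuous_fst.tendsto (z, y)).eventually
      ((chartAt E x₀).open_target.mem_nhds hz)] with p hp
    obtain ⟨T, hT⟩ := hc.connectionForm_clm hp v
    simp only [hT]
    conv_lhs => rw [← sum_coord p.2]
    rw [map_sum]
    simp only [map_smul]
  refine ContDiffAt.congr_of_eventuallyEq (ContDiffAt.sum fun i _ => ?_) h1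
  refine ContDiffAt.fun_smul (𝕜 := ℝ) ?_ ?_
  · exact (((coord E i).restrictScalars ℝ).contDiff.contDiffAt).comp (z, y) contDiffAt_snd
  · exact (hc.contDiffAt_connectionForm_apply hz _ v).comp (z, y) contDiffAt_fst

section Expr

variable {k : ℕ} {S : ℕ → E → E → CForm E k} {z : E}

theorem isWeylExpr_of_eventually {T : ℕ → E → E → CForm E k} (hT : IsWeylExpr T z)
    (h : ∀ᶠ z' in 𝓝 z, ∀ r y, S r z' y = T r z' y) : IsWeylExpr S z := by
  refine fun r => ⟨?_, fun y => ((hT r).2 y).congr_of_eventuallyEq ?_⟩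
  · rw [show S r z = T r z from funext (h.self_of_nhds r)]
    exact (hT r).1
  · filter_upwards [(continuous_fst.tendsto (z, y)).eventually h] with p hp using hp r p.2

theorem IsWeylExpr.contDiffAt_left {V : Type} [NormedAddCommGroup V] [NormedSpace ℂ V]
    {S : ℕ → E → E → V} (hS : IsWeylExpr S z) (r : ℕ) (y : E) :
    ContDiffAt ℝ ∞ (fun z => S r z y) z :=
  ((hS r).2 y).comp z (contDiffAt_id.prodMk contDiffAt_const)

theorem IsWeylExpr.add {T : ℕ → E → E → CForm E k} (hS : IsWeylExpr S z) (hT : IsWeylExpr T z) :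
    IsWeylExpr (fun r z y => S r z y + T r z y) z :=
  fun r => ⟨(hS r).1.fun_add (hT r).1, fun y => ((hS r).2 y).add ((hT r).2 y)⟩

theorem IsWeylExpr.sub {T : ℕ → E → E → CForm E k} (hS : IsWeylExpr S z) (hT : IsWeylExpr T z) :
    IsWeylExpr (fun r z y => S r z y - T r z y) z :=
  fun r => ⟨(hS r).1.fun_sub (hT r).1, fun y => ((hS r).2 y).sub ((hT r).2 y)⟩

theorem IsWeylExpr.alt {L : ℕ → E → E → E →L[ℝ] CForm E k}
    (hL : ∀ v, IsWeylExpr (fun r z y => L r z y v) z) :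
    IsWeylExpr (fun r z y => alternatizeUncurryFin (L r z y)) z :=
  fun r => ⟨IsHomogeneousPoly.alt fun v => (hL v r).1, fun y => contDiffAt_alt fun v => (hL v r).2 y⟩

theorem IsWeylExpr.fderiv_fst (hS : ∀ᶠ z' in 𝓝 z, IsWeylExpr S z') (v : E) :
    IsWeylExpr (fun r z y => fderiv ℝ (fun z => S r z y) z v) z := fun r =>
  ⟨IsHomogeneousPoly.fderiv_param (P := S r) (hS.mono fun _ h => (h r).1) (fun y =>
    (hS.self_of_nhds.contDiffAt_left r y).differentiableAt (by simp)) v,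
    fun y => contDiffAt_fderiv_fst ((hS.self_of_nhds r).2 y) v⟩

theorem IsWeylExpr.fderiv_snd {V : Type} [NormedAddCommGroup V] [NormedSpace ℂ V]
    {S : ℕ → E → E → V} (hS : IsWeylExpr S z) {A : E → E → E} {p : ℕ}
    (hA : IsHomogeneousPoly p (A z))
    (hA' : ∀ y, ContDiffAt ℝ ∞ (fun q : E × E => A q.1 q.2) (z, y)) (f : ℕ → ℕ)
    (hf : ∀ r, f r + p = r + 1) :
    IsWeylExpr (fun r z y => fderiv ℝ (S (f r) z) y (A z y)) z := fun r =>
  ⟨(hS (f r)).1.fderiv_comp hA (hf r), fun y => contDiffAt_fderiv_snd ((hS (f r)).2 y) (hA' y)⟩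

end Expr

variable [T2Space X] {Ω : HolomorphicSymplecticForm E X} {cov : TangentConnection E X}

theorem IsSymplecticConnection.isWeylExpr_covDeriv (hc : IsSymplecticConnection Ω cov) {x₀ : X}
    {k : ℕ} {S : ℕ → E → E → CForm E k} {z : E} (hz : z ∈ (chartAt E x₀).target)
    (hS : ∀ᶠ z' in 𝓝 z, IsWeylExpr S z') :
    IsWeylExpr (fun r z y => alternatizeUncurryFin
      (fderiv ℝ (fun z => S r z y) z - (fderiv ℝ (S r z) y).comp (connectionForm cov x₀ z y))) z := by
  refine IsWeylExpr.alt fun v => (IsWeylExpr.fderiv_fst hS v).sub ?_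
  refine hS.self_of_nhds.fderiv_snd (p := 1) (A := fun z y => connectionForm cov x₀ z y v) ?_
    (fun y => hc.contDiffAt_connectionForm hz y v) id fun _ => rfl
  obtain ⟨T, hT⟩ := hc.connectionForm_clm hz v
  simp only [hT]
  exact IsHomogeneousPoly.clm T

theorem isWeylExpr_koszulDelta {k : ℕ} {S : ℕ → E → E → CForm E k} {z : E}
    (hS : IsWeylExpr S z) :
    IsWeylExpr (fun r z y => alternatizeUncurryFin (fderiv ℝ (S (r + 1) z) y)) z :=
  IsWeylExpr.alt fun v => hS.fderiv_snd (p := 0) (A := fun _ _ => v) (IsHomogeneousPoly.const v)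
    (fun _ => contDiffAt_const) (· + 1) fun _ => rfl

theorem isWeylExpr_poissonTerm {x₀ : X} {m k : ℕ} {P : ℕ → E → E → CForm E 1}
    {S : ℕ → E → E → CForm E k} {z : E} (hz : z ∈ (chartAt E x₀).target)
    (hP : ∀ᶠ z' in 𝓝 z, IsWeylExpr P z') (hS : ∀ᶠ z' in 𝓝 z, IsWeylExpr S z') :
    IsWeylExpr (fun r z y => ∑ w ∈ antidiagonal (r + 2 * m),
      poissonTerm (Ω.poisson x₀ z) m (P w.1 z) (S w.2 z) y) z := fun _ =>
  ⟨IsHomogeneousPoly.fun_sum fun w hw => isHomogeneousPoly_poissonTerm _ (hP.self_of_nhds w.1).1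
    (hS.self_of_nhds w.2).1 (Finset.HasAntidiagonal.mem_antidiagonal.1 hw),
  fun y => ContDiffAt.sum fun w _ => contDiffAt_poissonTerm
    (fun i j => Ω.contDiffAt_poisson hz i j) (hP.mono fun _ h => (h w.1).1)
    ((hP.self_of_nhds w.1).2 y) (hS.mono fun _ h => (h w.2).1) ((hS.self_of_nhds w.2).2 y)⟩

/-- In a chart, each summand is built from smooth polynomial expressions by operations with the
right degree count; the sums at given `ħ`-degree and weight are finite. -/
theorem fedosovD_isWeylSectionAt (hc : IsSymplecticConnection Ω cov)
    {I : X → QuantumWeylFibre E 1} (hI : ∀ x, (quantumWeylSections E X 1).Holds I x) {k : ℕ}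
    {s : X → QuantumWeylFibre E k} {x : X}
    (hs : ∀ᶠ x' in 𝓝 x, (quantumWeylSections E X k).Holds s x') (j : ℕ) :
    IsWeylSectionAt (fun x' => fedosovD Ω cov I s x' j) x := by
  rw [isWeylSectionAt_iff]
  have hz := mem_chart_target E x
  have hS : ∀ j, ∀ᶠ z in 𝓝 (chartAt E x x), IsWeylExpr (weylInChart (fun x => s x j) x) z :=
    fun j => eventually_isWeylExpr (hs.mono fun x' h => h j)
  have hI' : ∀ j, ∀ᶠ z in 𝓝 (chartAt E x x), IsWeylExpr (weylInChart (fun x => I x j) x) z :=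
    fun j => eventually_isWeylExpr (Filter.Eventually.of_forall fun x' => hI x' j)
  refine isWeylExpr_of_eventually (((hc.isWeylExpr_covDeriv hz (hS j)).sub
    (isWeylExpr_koszulDelta (hS j).self_of_nhds)).add (T := fun r z y =>
      ∑ m ∈ Finset.range (j + 1 + 1), ∑ q ∈ antidiagonal (j + 1 - m),
        ∑ w ∈ antidiagonal (r + 2 * m), ((m.factorial : ℂ)⁻¹ * (1 - (-1) ^ m)) •
          poissonTerm (Ω.poisson x z) m (weylInChart (fun x => I x q.1) x w.1 z)
            (weylInChart (fun x => s x q.2) x w.2 z) y) ?_) ?_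
  · intro r
    have h1 : ∀ m (q : ℕ × ℕ), IsWeylExpr (fun r z y => ∑ w ∈ antidiagonal (r + 2 * m),
        poissonTerm (Ω.poisson x z) m (weylInChart (fun x => I x q.1) x w.1 z)
          (weylInChart (fun x => s x q.2) x w.2 z) y) (chartAt E x x) :=
      fun m q => isWeylExpr_poissonTerm hz (hI' q.1) (hS q.2)
    simp only [← Finset.smul_sum]
    exact ⟨IsHomogeneousPoly.fun_sum fun m _ => IsHomogeneousPoly.fun_smul _
      (IsHomogeneousPoly.fun_sum fun q _ => (h1 m q r).1), fun y => ContDiffAt.sum fun m _ =>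
      (ContDiffAt.sum fun q _ => (h1 m q r).2 y).const_smul _⟩
  · filter_upwards [eventually_inChart (E := E) hs] with z hz' r y
    exact weylInChart_fedosovD Ω cov hz'.1 (hI _) hz'.2 j r y

theorem fedosovD_congr {I : X → QuantumWeylFibre E 1} {k : ℕ} {s t : X → QuantumWeylFibre E k}
    {x : X} (h : s =ᶠ[𝓝 x] t) : fedosovD Ω cov I s x = fedosovD Ω cov I t x := by
  funext j r y
  have h1 : (fun z => weylInChart (fun x' => s x' j) x r z y) =ᶠ[𝓝 (chartAt E x x)]
      fun z => weylInChart (fun x' => t x' j) x r z y := by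
    filter_upwards [(tendsto_chart_symm x).eventually h] with z hz
    simp only [weylInChart, hz]
  rw [fedosovD, fedosovD, covDeriv, covDeriv, h1.fderiv_eq, h.eq_of_nhds]

theorem differentiableAt_weylInChart {k : ℕ} {s : X → WeylFibre E k} {x : X}
    (hs : IsWeylSectionAt s x) (r : ℕ) (y : E) :
    DifferentiableAt ℝ (fun z => weylInChart s x r z y) (chartAt E x x) :=
  (((isWeylSectionAt_iff s x).1 hs).contDiffAt_left r y).differentiableAt (by simp)

theorem covDeriv_add {k : ℕ} {s t : X → WeylFibre E k} {x : X} (hs : IsWeylSectionAt s x)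
    (ht : IsWeylSectionAt t x) : covDeriv cov (s + t) x = covDeriv cov s x + covDeriv cov t x := by
  funext r y
  have h1 := fderiv_fun_add (differentiableAt_weylInChart hs r y)
    (differentiableAt_weylInChart ht r y)
  have h2 := fderiv_add ((hs r).1.differentiableAt_real y) ((ht r).1.differentiableAt_real y)
  change alternatizeUncurryFin (fderiv ℝ (fun z => weylInChart s x r z y + weylInChart t x r z y)
    (chartAt E x x) - (fderiv ℝ (s x r + t x r) y).comp _) = alternatizeUncurryFin _ +
      alternatizeUncurryFin _
  rw [h1, h2, ContinuousLinearMap.add_comp, add_sub_add_comm, alt_add]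

theorem koszulDelta_add {k : ℕ} {a b : WeylFibre E k} (ha : ∀ r, IsHomogeneousPoly r (a r))
    (hb : ∀ r, IsHomogeneousPoly r (b r)) :
    koszulDelta (a + b) = koszulDelta a + koszulDelta b := by
  funext r y
  change alternatizeUncurryFin (fderiv ℝ (a (r + 1) + b (r + 1)) y) = alternatizeUncurryFin _ +
    alternatizeUncurryFin _
  rw [fderiv_add ((ha _).differentiableAt_real y) ((hb _).differentiableAt_real y), alt_add]

theorem koszulDelta_smul {k : ℕ} (c : ℂ) {a : WeylFibre E k}
    (ha : ∀ r, IsHomogeneousPoly r (a r)) : koszulDelta (c • a) = c • koszulDelta a := by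
  funext r y
  change alternatizeUncurryFin (fderiv ℝ (c • a (r + 1)) y) = c • alternatizeUncurryFin _
  rw [fderiv_const_smul ((ha _).differentiableAt_real y), alt_smul]

theorem fedosovD_add {I : X → QuantumWeylFibre E 1} {k : ℕ} {s t : X → QuantumWeylFibre E k}
    {x : X} (hs : (quantumWeylSections E X k).Holds s x)
    (ht : (quantumWeylSections E X k).Holds t x) :
    fedosovD Ω cov I (s + t) x = fedosovD Ω cov I s x + fedosovD Ω cov I t x := by
  funext j r y
  change covDeriv cov ((fun x => s x j) + fun x => t x j) x r y - koszulDelta (s x j + t x j) r y +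
    _ = (_ - _ + _) + (_ - _ + _)
  rw [covDeriv_add (hs j) (ht j), koszulDelta_add (fun r => (hs j r).1) fun r => (ht j r).1]
  simp only [weylBracket_cast, Pi.add_apply]
  simp only [fun (a : E → CForm E 1) m q r => poissonTerm_add (Ω.inverse x) (m := m) a
    (hs q r).1 (ht q r).1 y, smul_add, Finset.sum_add_distrib]
  abel

theorem fedosovD_leibniz {I : X → QuantumWeylFibre E 1} {k : ℕ} {f : X → ℂ}
    {s : X → QuantumWeylFibre E k} {x : X} (hf : ContMDiffAt 𝓘(ℝ, E) 𝓘(ℝ, ℂ) ∞ f x)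
    (hs : (quantumWeylSections E X k).Holds s x) (j r : ℕ) (y : E) :
    fedosovD Ω cov I (f • s) x j r y = alternatizeUncurryFin (ContinuousLinearMap.smulRight
      (fderiv ℝ (fun z => f ((chartAt E x).symm z)) (chartAt E x x)) (s x j r y)) +
      f x • fedosovD Ω cov I s x j r y := by
  have hf' : DifferentiableAt ℝ (fun z => f ((chartAt E x).symm z)) (chartAt E x x) :=
    ((contMDiffAt_iff_inChart (mem_chart_source E x)).1 hf).differentiableAt (by simp)
  have h1 := fderiv_fun_smul hf' (differentiableAt_weylInChart (hs j) r y)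
  rw [(chartAt E x).left_inv (mem_chart_source E x), weylInChart_self] at h1
  have h2 := fderiv_const_smul ((hs j r).1.differentiableAt_real y) (f x)
  have h3 : covDeriv cov (fun x => (f • s) x j) x r y = alternatizeUncurryFin
      (ContinuousLinearMap.smulRight
        (fderiv ℝ (fun z => f ((chartAt E x).symm z)) (chartAt E x x)) (s x j r y)) +
      f x • covDeriv cov (fun x => s x j) x r y := by
    change alternatizeUncurryFin (fderiv ℝ (fun z => f ((chartAt E x).symm z) •
      weylInChart (fun x => s x j) x r z y) (chartAt E x x) -
        (fderiv ℝ (f x • s x j r) y).comp _) = _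
    rw [h1, h2, covDeriv, ← alt_smul, ← alt_add]
    congr 1
    rw [smul_sub, ContinuousLinearMap.smul_comp]
    abel
  change covDeriv cov (fun x => (f • s) x j) x r y - koszulDelta (f x • s x j) r y + _ = _
  rw [h3, koszulDelta_smul _ fun r => (hs j r).1, fedosovD, smul_add, smul_sub, weylBracket_cast,
    weylBracket_cast]
  have h4 : ∀ q, (f • s) x q = f x • s x q := fun q => rfl
  simp only [h4, Pi.smul_apply]
  simp only [fun (a : E → CForm E 1) m q r => poissonTerm_smul (Ω.inverse x) (m := m) a (f x)
    (hs q r).1 y, Finset.smul_sum, smul_comm (f x)]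
  abel

theorem isWeylConnection_fedosovD (hc : IsSymplecticConnection Ω cov)
    {I : X → QuantumWeylFibre E 1} (hI : ∀ x, (quantumWeylSections E X 1).Holds I x) :
    IsWeylConnection (fun _ => fedosovD Ω cov I) where
  isLocalOperator k :=
    { congr := fedosovD_congr
      holds := fun hs j => fedosovD_isWeylSectionAt hc hI hs j
      add := fedosovD_add
      smul := fun c s x hs => by
        funext j r y
        -- Linearity over the constants is the Leibniz rule for a constant function.
        have h := fedosovD_leibniz (Ω := Ω) (cov := cov) (I := I) (f := fun _ => c)
          contMDiffAt_const hs j r y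
        refine h.trans ?_
        rw [fderiv_const_apply]
        have h0 : ContinuousLinearMap.smulRight (0 : E →L[ℝ] ℂ) (s x j r y) = 0 := by
          ext1 v
          simp
        rw [h0, ← CForm.altCLM_apply, map_zero, zero_add]
        rfl }
  leibniz _ _ _ _ hf hs := fedosovD_leibniz hf hs

end Operators
end HolWeyl

namespace HolWeyl
open ContinuousAlternatingMap (alternatizeUncurryFin alternatizeUncurryFinCLM alternatizeUncurryFin_apply)
open Finset.HasAntidiagonal (antidiagonal)

/-! ### An algebraic perturbation criterion for homotopy equivalences. -/

section Homotopies

open Limits HomologicalComplex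

variable {𝒞 : Type*} [Category 𝒞] [Preadditive 𝒞] {J : Type*} {c : ComplexShape J}
  {C A : HomologicalComplex 𝒞 c} (π : C ⟶ A) (i : ∀ k, A.X k ⟶ C.X k) (h : ∀ k l, C.X k ⟶ C.X l)

/-- The perturbation, by the projection `π ≫ i`, of the map of complexes that is null-homotopic
by `h`. -/
noncomputable def perturbed (k : J) : C.X k ⟶ C.X k :=
  (Homotopy.nullHomotopicMap h).f k + π.f k ≫ i k

variable {π i h}

section

variable (hi : ∀ k, i k ≫ π.f k = 𝟙 _) (hπ : ∀ k l, h k l ≫ π.f l = 0)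
  [∀ k, IsIso (perturbed π i h k)]
include hi hπ

/-- Both `dh` and `hd` die under `π`, since `π` kills the values of `h` and commutes with `d`. -/
theorem nullHomotopicMap_f_comp (k : J) : (Homotopy.nullHomotopicMap h).f k ≫ π.f k = 0 := by
  have h1 := Homotopy.nullHomotopicMap_comp h π
  have h2 : (fun k l => h k l ≫ π.f l) = 0 := by
    funext k l
    exact hπ k l
  rw [h2] at h1
  have h3 := congrArg (fun f => f.f k) h1
  simp only [comp_f] at h3
  rw [h3]
  simp [Homotopy.nullHomotopicMap, dNext, prevD]

/-- The perturbed map induces the identity on the quotient `A`, so it preserves `ker π` and so does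
its inverse. -/
theorem inv_perturbed_comp (k : J) : inv (perturbed π i h k) ≫ π.f k = π.f k := by
  rw [IsIso.inv_comp_eq, perturbed, Preadditive.add_comp, nullHomotopicMap_f_comp hi hπ,
    Category.assoc, hi, Category.comp_id, zero_add]

theorem inv_perturbed_comp_nullHomotopicMap (k : J) :
    inv (perturbed π i h k) ≫ (Homotopy.nullHomotopicMap h).f k = 𝟙 _ - π.f k ≫ i k := by
  rw [IsIso.inv_comp_eq, Preadditive.comp_sub, Category.comp_id, ← Category.assoc]
  have h1 : perturbed π i h k ≫ π.f k = π.f k := by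
    have := inv_perturbed_comp hi hπ k
    rw [IsIso.inv_comp_eq] at this
    exact this.symm
  rw [h1, perturbed, add_sub_cancel_right]

theorem complement_comp (k : J) : (𝟙 _ - π.f k ≫ i k) ≫ π.f k = 0 := by
  rw [Preadditive.sub_comp, Category.assoc, hi, Category.comp_id, Category.id_comp, sub_self]

theorem complement_comp_complement (k : J) :
    (𝟙 _ - π.f k ≫ i k) ≫ (𝟙 _ - π.f k ≫ i k) = 𝟙 _ - π.f k ≫ i k := by
  rw [Preadditive.comp_sub, ← Category.assoc, complement_comp hi hπ, zero_comp, sub_zero,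
    Category.comp_id]

/-- The perturbed map need not commute with `d`, as `i` is not a chain map. On `ker π`, however, the
perturbation vanishes and what remains is a null-homotopic chain map; so its inverse commutes with
`d` there. -/
theorem complement_comp_d (k l : J) :
    (𝟙 _ - π.f k ≫ i k) ≫ C.d k l ≫ inv (perturbed π i h l) =
      (𝟙 _ - π.f k ≫ i k) ≫ inv (perturbed π i h k) ≫ C.d k l := by
  rw [← Category.assoc, IsIso.comp_inv_eq]
  simp only [Category.assoc]
  have h1 : C.d k l ≫ perturbed π i h l =
      C.d k l ≫ (Homotopy.nullHomotopicMap h).f l + C.d k l ≫ π.f l ≫ i l := by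
    rw [← Preadditive.comp_add]
    rfl
  rw [h1, Preadditive.comp_add, Preadditive.comp_add, ← (Homotopy.nullHomotopicMap h).comm]
  rw [reassoc_of% (inv_perturbed_comp_nullHomotopicMap hi hπ k),
    reassoc_of% (complement_comp_complement hi hπ k)]
  rw [← π.comm_assoc, reassoc_of% (inv_perturbed_comp hi hπ k),
    reassoc_of% (complement_comp hi hπ k)]
  simp

theorem complement_comp_d_comp (k l : J) :
    (𝟙 _ - π.f k ≫ i k) ≫ C.d k l ≫ (𝟙 _ - π.f l ≫ i l) = (𝟙 _ - π.f k ≫ i k) ≫ C.d k l := by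
  rw [Preadditive.comp_sub, Category.comp_id, Preadditive.comp_sub, ← π.comm_assoc,
    reassoc_of% (complement_comp hi hπ k), zero_comp, sub_zero]

end

variable (π i h)

/-- The contraction of the kernel of `π`. -/
noncomputable def contraction [∀ k, IsIso (perturbed π i h k)] (k l : J) : C.X k ⟶ C.X l :=
  (𝟙 _ - π.f k ≫ i k) ≫ inv (perturbed π i h k) ≫ h k l

variable {π i h}
variable (hi : ∀ k, i k ≫ π.f k = 𝟙 _) (hπ : ∀ k l, h k l ≫ π.f l = 0)
  [∀ k, IsIso (perturbed π i h k)]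

/-- On `ker π` the operator `perturbed⁻¹ (dh + hd)` is the identity, so `ker π` is contractible. Off
`ker π` the contraction, precomposed with the projection, contributes only a correction of the
section `i`. -/
theorem dNext_add_prevD_contraction (hi : ∀ k, i k ≫ π.f k = 𝟙 _)
    (hπ : ∀ k l, h k l ≫ π.f l = 0) (k : J) :
    dNext k (contraction π i h) + prevD k (contraction π i h) =
      𝟙 _ - π.f k ≫ (i k - i k ≫ dNext k (contraction π i h)) := by
  have h1 : prevD k (contraction π i h) =
      (𝟙 _ - π.f k ≫ i k) ≫ inv (perturbed π i h k) ≫ prevD k h := by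
    simp [prevD, contraction]
  have h2 : dNext k (contraction π i h) =
      (𝟙 _ - π.f k ≫ i k) ≫ inv (perturbed π i h k) ≫ dNext k h +
        π.f k ≫ i k ≫ dNext k (contraction π i h) := by
    have h3 : (𝟙 _ - π.f k ≫ i k) ≫ dNext k (contraction π i h) =
        (𝟙 _ - π.f k ≫ i k) ≫ inv (perturbed π i h k) ≫ dNext k h := by
      change (𝟙 _ - π.f k ≫ i k) ≫ C.d k _ ≫ (𝟙 _ - π.f _ ≫ i _) ≫ inv (perturbed π i h _) ≫ h _ k
        = (𝟙 _ - π.f k ≫ i k) ≫ inv (perturbed π i h k) ≫ C.d k _ ≫ h _ k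
      rw [← reassoc_of% (complement_comp_d hi hπ k (c.next k)),
        reassoc_of% (complement_comp_d_comp hi hπ k (c.next k))]
    rw [← h3, Preadditive.sub_comp, Category.id_comp, Category.assoc, sub_add_cancel]
  have h4 : (𝟙 _ - π.f k ≫ i k) ≫ inv (perturbed π i h k) ≫ (dNext k h + prevD k h) =
      𝟙 _ - π.f k ≫ i k := by
    have := inv_perturbed_comp_nullHomotopicMap hi hπ k
    change inv (perturbed π i h k) ≫ (dNext k h + prevD k h) = _ at this
    rw [this, complement_comp_complement hi hπ]
  rw [Preadditive.comp_add, Preadditive.comp_add] at h4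
  rw [Preadditive.comp_sub, ← sub_add, h1]
  conv_lhs => rw [h2]
  exact (add_right_comm _ _ _).trans (congrArg (· + _) h4)

theorem section_comp (hi : ∀ k, i k ≫ π.f k = 𝟙 _) (hπ : ∀ k l, h k l ≫ π.f l = 0) (k : J) :
    (i k - i k ≫ dNext k (contraction π i h)) ≫ π.f k = 𝟙 _ := by
  rw [Preadditive.sub_comp, hi]
  have : dNext k (contraction π i h) ≫ π.f k = 0 := by
    simp [dNext, contraction, hπ]
  rw [Category.assoc, this, comp_zero, sub_zero]

/-- The corrected section composed with `π` is a chain map, being the identity minus a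
null-homotopic map. Since `π` is split onto, the corrected section is a chain map as well. -/
theorem map_comp_section (hi : ∀ k, i k ≫ π.f k = 𝟙 _) (hπ : ∀ k l, h k l ≫ π.f l = 0) (k : J) :
    π.f k ≫ (i k - i k ≫ dNext k (contraction π i h)) =
      (𝟙 C - Homotopy.nullHomotopicMap (contraction π i h)).f k := by
  have := dNext_add_prevD_contraction hi hπ k
  rw [sub_f_apply, id_f]
  change _ = 𝟙 _ - (dNext k (contraction π i h) + prevD k (contraction π i h))
  rw [this, sub_sub_cancel]

/-- A degreewise split map of complexes is a homotopy equivalence if a null-homotopic endomorphism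
becomes invertible after adding the projection to the section. -/
noncomputable def homotopyEquivOfPerturbed (hi : ∀ k, i k ≫ π.f k = 𝟙 _)
    (hπ : ∀ k l, h k l ≫ π.f l = 0) (h0 : ∀ k l, ¬ c.Rel l k → h k l = 0) :
    HomotopyEquiv C A where
  hom := π
  inv :=
    { f := fun k => i k - i k ≫ dNext k (contraction π i h)
      comm' := by
        intro k l _
        -- Inserting `i ≫ π = 𝟙` turns the corrected section into a composite with the chain map of
        -- `map_comp_section`.
        have h1 : i k - i k ≫ dNext k (contraction π i h) = i k ≫ π.f k ≫
            (i k - i k ≫ dNext k (contraction π i h)) := by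
          rw [reassoc_of% (hi k)]
        have h2 := (𝟙 C - Homotopy.nullHomotopicMap (contraction π i h)).comm k l
        rw [h1, map_comp_section hi hπ, Category.assoc, h2, ← map_comp_section hi hπ,
          ← π.comm_assoc, reassoc_of% (hi k)] }
  homotopyHomInvId :=
    { hom := fun k l => - contraction π i h k l
      zero := fun k l hkl => by simp [contraction, h0 k l hkl]
      comm := fun k => by
        have h1 := dNext_add_prevD_contraction hi hπ k
        have h2 : (fun k l => - contraction π i h k l) = - contraction π i h := rfl
        rw [h2, map_neg, map_neg, comp_f, id_f, ← neg_add, h1]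
        simp }
  homotopyInvHomId := Homotopy.ofEq (by
    ext k
    exact section_comp hi hπ k)

end Homotopies
end HolWeyl

namespace HolWeyl
open ContinuousAlternatingMap (alternatizeUncurryFin alternatizeUncurryFinCLM alternatizeUncurryFin_apply)
open Finset.HasAntidiagonal (antidiagonal)

/-! ### Isomorphisms of sheaves given by local operators. -/

section SheafMorphisms

variable {X : Type} [TopologicalSpace X] {V V' V'' : Type} [AddCommGroup V] [Module ℂ V]
  [AddCommGroup V'] [Module ℂ V'] [AddCommGroup V''] [Module ℂ V'']
  {P : LocalCondition X V} {Q : LocalCondition X V'} {R : LocalCondition X V''}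

/-- The value of the image of a section under a morphism of sheaves. -/
noncomputable def sheafValue (f : P.sheaf ⟶ Q.sheaf) {U : Opens X} (s : P.sections U) (x : U) : V' :=
  ((f.hom.app (op U)).hom s : Q.sections U).1 x

theorem sheafValue_sheafHom_comp {T : (X → V) → X → V'} {S : (X → V') → X → V''}
    (hT : IsLocalOperator P Q T) (hS : IsLocalOperator Q R S) {U : Opens X}
    (s : P.sections U) (x : U) :
    sheafValue (hT.sheafHom ≫ hS.sheafHom) s x = S (T (extendZero (U : Set X) s.1)) x :=
  hS.congr (extendZero_apply_eventuallyEq (U := U) (T (extendZero (U : Set X) s.1)) x.2)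

theorem sheafValue_add (f g : P.sheaf ⟶ Q.sheaf) {U : Opens X} (s : P.sections U) (x : U) :
    sheafValue (f + g) s x = sheafValue f s x + sheafValue g s x := rfl

theorem sheafHom_ext {f g : P.sheaf ⟶ Q.sheaf}
    (h : ∀ (U : Opens X) (s : P.sections U) (x : U), sheafValue f s x = sheafValue g s x) :
    f = g := by
  apply ObjectProperty.hom_ext
  apply NatTrans.ext
  funext U
  apply ModuleCat.hom_ext
  apply LinearMap.ext
  intro s
  apply Subtype.ext
  funext x
  exact h U.unop s x

/-- Bijectivity on sections over every open set. Sections are handled as functions on all of `X`,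
extended by zero, and locality of `T` makes the extension irrelevant. -/
theorem isIso_of_localOperator (f : P.sheaf ⟶ Q.sheaf) (T : (X → V) → X → V')
    (hf : ∀ (U : Opens X) (s : P.sections U) (x : U),
      sheafValue f s x = T (extendZero (U : Set X) s.1) x)
    (hT : ∀ {s t : X → V} {x : X}, s =ᶠ[𝓝 x] t → T s x = T t x)
    (hinj : ∀ (U : Opens X) (s t : X → V), (∀ x ∈ U, P.Holds s x) → (∀ x ∈ U, P.Holds t x) →
      (∀ x ∈ U, T s x = T t x) → ∀ x ∈ U, s x = t x)
    (hsurj : ∀ (U : Opens X) (a : X → V'), (∀ x ∈ U, Q.Holds a x) →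
      ∃ s : X → V, (∀ x ∈ U, P.Holds s x) ∧ ∀ x ∈ U, T s x = a x) : IsIso f := by
  have h1 : ∀ U : (Opens (TopCat.of X))ᵒᵖ, IsIso (f.hom.app U) := by
    intro U
    have h2 : Function.Bijective (f.hom.app U).hom := by
      constructor
      · intro s t hst
        apply Subtype.ext
        funext x
        have h3 : ∀ x (hx : x ∈ U.unop), T (extendZero (U.unop : Set X) s.1) x =
            T (extendZero (U.unop : Set X) t.1) x := by
          intro x hx
          rw [← hf U.unop s ⟨x, hx⟩, ← hf U.unop t ⟨x, hx⟩]
          exact congrFun (congrArg Subtype.val hst) _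
        have := hinj U.unop _ _ (fun x hx => s.2 ⟨x, hx⟩) (fun x hx => t.2 ⟨x, hx⟩) h3 x x.2
        have h4 := (extendZero_apply (U := (U.unop : Set X)) s.1 x).symm.trans this
        exact h4.trans (extendZero_apply (U := (U.unop : Set X)) t.1 x)
      · intro a
        obtain ⟨s, hs, hsa⟩ := hsurj U.unop (extendZero (U.unop : Set X) a.1)
          fun x hx => a.2 ⟨x, hx⟩
        refine ⟨⟨fun x => s x, fun x => P.congr
          (extendZero_apply_eventuallyEq (U := U.unop) s x.2).symm (hs x x.2)⟩, ?_⟩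
        apply Subtype.ext
        funext x
        refine (hf U.unop _ x).trans ?_
        refine (hT (extendZero_apply_eventuallyEq (U := U.unop) s x.2)).trans ?_
        exact (hsa x x.2).trans (extendZero_apply (U := (U.unop : Set X)) a.1 x)
    exact (ConcreteCategory.isIso_iff_bijective (f.hom.app U)).2 h2
  have h2 : IsIso f.hom := (NatTrans.isIso_iff_isIso_app f.hom).2 h1
  have h3 : IsIso ((TopCat.Sheaf.forget (ModuleCat.{0} ℂ) (TopCat.of X)).map f) := h2
  exact isIso_of_reflects_iso f (TopCat.Sheaf.forget (ModuleCat.{0} ℂ) (TopCat.of X))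

end SheafMorphisms

/-! ### Inversion of the total degree plus a weight-raising term. -/

section Recursion

variable {E : Type} [NormedAddCommGroup E] [NormedSpace ℂ E] [FiniteDimensional ℂ E]
  {X : Type} [TopologicalSpace X] [ChartedSpace E X] [IsManifold 𝓘(ℂ, E) ω X]

/-- An operator on fibres that commutes with pull-back has the same expression in every chart. -/
theorem isWeylSectionAt_of_natural {k l : ℕ} (T : ℕ → CForm E k →L[ℂ] CForm E l)
    (hT : ∀ r (J : E →L[ℂ] E) a, T r (CForm.pullback J a) = (T r a).pullback J)
    {s : X → WeylFibre E k} {x : X} (hs : IsWeylSectionAt s x) :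
    IsWeylSectionAt (fun x r y => T r (s x r y)) x := by
  intro r
  refine ⟨(hs r).1.clm_comp (T r), fun y => ?_⟩
  have h1 : (fun p : E × E => weylInChart (fun x r y => T r (s x r y)) x r p.1 p.2) =
      fun p => T r (weylInChart s x r p.1 p.2) := by
    funext p
    exact (hT r _ _).symm
  rw [h1]
  exact ((T r).restrictScalars ℝ).contDiff.contDiffAt.comp _ ((hs r).2 y)

variable {k : ℕ} {N : (X → WeylFibre E k) → X → WeylFibre E k}

/-- The approximations to the solution of `M s + N s = a`, where `M` is the total degree. -/
noncomputable def approxSolution (N : (X → WeylFibre E k) → X → WeylFibre E k)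
    (a : X → WeylFibre E k) : ℕ → X → WeylFibre E k
  | 0 => 0
  | n + 1 => fun x r y =>
      CForm.totalDegreeInv k r (a x r y - N (approxSolution N a n) x r y)

/-- Since the weight `r` part of `N s` involves only smaller weights of `s`, each iteration fixes
one more weight. The symmetric algebra is completed, so no convergence is at issue, and the
construction works over the whole of `U` without shrinking. -/
theorem exists_solution (hN : ∀ (s t : X → WeylFibre E k) (x : X) (r : ℕ),
      (∀ᶠ x' in 𝓝 x, ∀ q < r, s x' q = t x' q) → N s x r = N t x r)
    (hN' : ∀ (s : X → WeylFibre E k) (x : X), (∀ᶠ x' in 𝓝 x, IsWeylSectionAt s x') →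
      IsWeylSectionAt (N s) x) (U : Opens X) (a : X → WeylFibre E k)
    (ha : ∀ x ∈ U, IsWeylSectionAt a x) :
    ∃ s : X → WeylFibre E k, (∀ x ∈ U, IsWeylSectionAt s x) ∧
      ∀ x ∈ U, ∀ r y, CForm.totalDegree k r (s x r y) + N s x r y = a x r y := by
  set b := approxSolution N a
  have hb : ∀ n x, x ∈ U → IsWeylSectionAt (b n) x := by
    intro n
    induction n with
    | zero => exact fun x _ => (weylSections E X k).zero x
    | succ n ih =>
      intro x hx
      refine isWeylSectionAt_of_natural (fun r => CForm.totalDegreeInv k r)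
        (fun r J a => totalDegreeInv_pullback J a) (s := fun x r y => a x r y - N (b n) x r y) ?_
      have h1 := hN' (b n) x (by
        filter_upwards [U.isOpen.mem_nhds hx] with x' hx' using ih x' hx')
      have h2 := (weylSections E X k).add (ha x hx) ((weylSections E X k).smul (-1) h1)
      convert! h2 using 1
      funext x r y
      simp [sub_eq_add_neg]
  have hstep : ∀ n x, x ∈ U → ∀ q < n, b (n + 1) x q = b n x q := by
    intro n
    induction n with
    | zero => intro x _ q hq; omega
    | succ n ih =>
      intro x hx q hq
      have h1 : N (b (n + 1)) x q = N (b n) x q := by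
        refine hN _ _ x q ?_
        filter_upwards [U.isOpen.mem_nhds hx] with x' hx' p hp
        exact ih x' hx' p (by omega)
      funext y
      change CForm.totalDegreeInv k q (a x q y - N (b (n + 1)) x q y) =
        CForm.totalDegreeInv k q (a x q y - N (b n) x q y)
      rw [h1]
  have hlim : ∀ n x, x ∈ U → ∀ q < n, b n x q = b (q + 1) x q := by
    intro n x hx q hq
    induction n, hq using Nat.le_induction with
    | base => rfl
    | succ n hn ih => rw [hstep n x hx q hn, ih]
  -- The weight `r` component is stable from the approximation of index `r + 1` on.
  refine ⟨fun x r => b (r + 1) x r, fun x hx r => hb (r + 1) x hx r, fun x hx r y => ?_⟩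
  have h1 : N (fun x r => b (r + 1) x r) x r = N (b r) x r := by
    refine hN _ _ x r ?_
    filter_upwards [U.isOpen.mem_nhds hx] with x' hx' q hq
    exact (hlim r x' hx' q hq).symm
  rw [h1]
  change CForm.totalDegree k r (CForm.totalDegreeInv k r (a x r y - N (b r) x r y)) + _ = _
  rw [totalDegree_totalDegreeInv, sub_add_cancel]

theorem solution_unique (hN : ∀ (s t : X → WeylFibre E k) (x : X) (r : ℕ),
      (∀ᶠ x' in 𝓝 x, ∀ q < r, s x' q = t x' q) → N s x r = N t x r) (U : Opens X)
    {s t : X → WeylFibre E k} (h : ∀ x ∈ U, ∀ r y,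
      CForm.totalDegree k r (s x r y) + N s x r y = CForm.totalDegree k r (t x r y) + N t x r y) :
    ∀ x ∈ U, s x = t x := by
  have h1 : ∀ r, ∀ x ∈ U, s x r = t x r := by
    intro r
    induction r using Nat.strong_induction_on with
    | _ r ih =>
      intro x hx
      funext y
      have h2 : N s x r = N t x r := by
        refine hN _ _ x r ?_
        filter_upwards [U.isOpen.mem_nhds hx] with x' hx' q hq using ih q hq x' hx'
      have h3 := h x hx r y
      rw [h2] at h3
      exact totalDegree_injective k r (add_right_cancel h3)
  exact fun x hx => funext fun r => h1 r x hx

end Recursion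
end HolWeyl

namespace HolWeyl
open ContinuousAlternatingMap (alternatizeUncurryFin alternatizeUncurryFinCLM alternatizeUncurryFin_apply)
open Finset.HasAntidiagonal (antidiagonal)

/-! ### The Koszul homotopy and the comparison of `D` with `∂̄`. -/

section Dolbeault

variable {E : Type} [NormedAddCommGroup E] [NormedSpace ℂ E] [FiniteDimensional ℂ E]
  {X : Type} [TopologicalSpace X] [ChartedSpace E X] [IsManifold 𝓘(ℂ, E) ω X]

/-- The homotopy `a ↦ - ι_y a` for the operator `- δ`. -/
noncomputable def koszulHomotopy {k : ℕ} (a : WeylFibre E (k + 1)) : WeylFibre E k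
  | 0, _ => 0
  | r + 1, y => - CForm.contract y (a r y)

theorem koszulHomotopy_add {k : ℕ} (a b : WeylFibre E (k + 1)) :
    koszulHomotopy (a + b) = koszulHomotopy a + koszulHomotopy b := by
  funext r y
  cases r with
  | zero => exact (add_zero _).symm
  | succ r =>
    change - CForm.contract y (a r y + b r y) = _
    rw [map_add, neg_add]
    rfl

theorem koszulHomotopy_smul {k : ℕ} (c : ℂ) (a : WeylFibre E (k + 1)) :
    koszulHomotopy (c • a) = c • koszulHomotopy a := by
  funext r y
  cases r with
  | zero => exact (smul_zero (A := CForm E k) c).symm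
  | succ r =>
    change - CForm.contract y (c • a r y) = _
    rw [map_smul, ← smul_neg]
    rfl

theorem koszulHomotopy_sub {k : ℕ} (a b : WeylFibre E (k + 1)) :
    koszulHomotopy (a - b) = koszulHomotopy a - koszulHomotopy b := by
  rw [sub_eq_add_neg, koszulHomotopy_add, ← neg_one_smul ℂ b, koszulHomotopy_smul, neg_one_smul,
    sub_eq_add_neg]

theorem contDiffAt_contract {V : Type*} [NormedAddCommGroup V] [NormedSpace ℝ V] {k : ℕ}
    {f : V → E} {g : V → CForm E (k + 1)} {p : V} {n : WithTop ℕ∞} (hf : ContDiffAt ℝ n f p)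
    (hg : ContDiffAt ℝ n g p) : ContDiffAt ℝ n (fun p => CForm.contract (f p) (g p)) p := by
  have h : ContDiff ℂ n (fun p : E × CForm E (k + 1) => CForm.contract p.1 p.2) :=
    (ContinuousLinearMap.isBoundedBilinearMap (𝕜 := ℂ) (E := E) (F := CForm E (k + 1))
      (G := CForm E k) CForm.contract).contDiff
  exact ContDiffAt.comp (g := fun p : E × CForm E (k + 1) => CForm.contract p.1 p.2)
    (f := fun p => (f p, g p)) p (h.restrict_scalars ℝ).contDiffAt (hf.prodMk hg)

theorem koszulHomotopy_isHomogeneousPoly {k r : ℕ} {P : E → CForm E (k + 1)}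
    (hP : IsHomogeneousPoly r P) : IsHomogeneousPoly (r + 1) (fun y => CForm.contract y (P y)) := by
  have := (IsHomogeneousPoly.clm (ContinuousLinearMap.id ℂ E)).bilin hP CForm.contract
  rwa [Nat.add_comm 1 r] at this

theorem isLocalOperator_koszulHomotopy (k : ℕ) : IsLocalOperator (weylSections E X (k + 1))
    (weylSections E X k) (fun s x => koszulHomotopy (s x)) where
  congr h := by rw [h.eq_of_nhds]
  holds {s x} hs := by
    have hs := hs.self_of_nhds
    rintro (_ | r)
    · exact (weylSections E X k).zero x 0
    · refine ⟨(koszulHomotopy_isHomogeneousPoly (hs r).1).fun_neg, fun y => ?_⟩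
      have h1 : (fun p : E × E => weylInChart (fun x => koszulHomotopy (s x)) x (r + 1) p.1 p.2) =
          fun p => - CForm.contract p.2 (weylInChart s x r p.1 p.2) := by
        funext p
        rw [weylInChart, weylInChart, contract_pullback]
        rfl
      rw [h1]
      exact (contDiffAt_contract contDiffAt_snd ((hs r).2 y)).neg
  add _ _ := koszulHomotopy_add _ _
  smul c _ _ _ := koszulHomotopy_smul c _

theorem fderiv_contract {k r : ℕ} {P : E → CForm E (k + 1)} (hP : IsHomogeneousPoly r P)
    -- Product rule: the variable `y` occurs both as the contracting vector and as the argument of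
    -- `P`.
    (y v : E) : fderiv ℝ (fun y => - CForm.contract y (P y)) y v =
      - (CForm.contract v (P y) + CForm.contract y (fderiv ℝ P y v)) := by
  have h1 := koszulHomotopy_isHomogeneousPoly hP
  have h2 : HasFDerivAt (𝕜 := ℂ) P (fderiv ℂ P y) y :=
    ((hP.contDiff (n := 1)).differentiable one_ne_zero y).hasFDerivAt
  have h3 := HasFDerivAt.clm_apply (𝕜 := ℂ) (c := fun y => CForm.contract (E := E) (k := k) y)
    (x := y) (CForm.contract (E := E) (k := k)).hasFDerivAt h2
  rw [fderiv_fun_neg, neg_apply, h1.fderiv_real, h3.fderiv, hP.fderiv_real, add_comm]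
  rfl

/-- A Cartan formula. Differentiating the contracting vector in `ι_y a` gives `p`, Euler's identity
in `ι_y (δ a)` gives `r`, and the remaining terms cancel because contraction is an antiderivation.
-/
theorem koszulDelta_koszulHomotopy {k : ℕ} {a : WeylFibre E (k + 1)}
    (ha : ∀ r, IsHomogeneousPoly r (a r)) (r : ℕ) (y : E) :
    - (koszulDelta (koszulHomotopy a) r y) - koszulHomotopy (koszulDelta a) r y =
      CForm.holDegree (k + 1) (a r y) + (r : ℂ) • a r y := by
  have h1 : koszulDelta (koszulHomotopy a) r y = - (CForm.holDegree (k + 1) (a r y) +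
      alternatizeUncurryFin (compR (CForm.contract y) (fderiv ℝ (a r) y))) := by
    rw [koszulDelta, CForm.holDegree_succ, ← alt_add, ← CForm.altCLM_apply, ← CForm.altCLM_apply,
      ← map_neg]
    congr 1
    exact ContinuousLinearMap.ext fun v => fderiv_contract (ha r) y v
  cases r with
  | zero =>
    have h2 : compR (CForm.contract y) (fderiv ℝ (a 0) y) = 0 := by
      ext1 v
      rw [compR_apply, (ha 0).fderiv_apply_zero, map_zero]
      rfl
    rw [h1, h2, ← CForm.altCLM_apply, map_zero]
    change - -(_ + 0) - 0 = _
    simp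
  | succ r =>
    have h2 : koszulHomotopy (koszulDelta a) (r + 1) y = - (((r + 1 : ℕ) : ℂ) • a (r + 1) y -
        alternatizeUncurryFin (compR (CForm.contract y) (fderiv ℝ (a (r + 1)) y))) := by
      change - CForm.contract y (alternatizeUncurryFin (fderiv ℝ (a (r + 1)) y)) = _
      rw [contract_alt _ fun u => (ha (r + 1)).fderiv_apply_smul y u Complex.I,
        (ha (r + 1)).fderiv_apply_self]
    rw [h1, h2]
    abel

/-- In form degree zero only one of the two compositions exists, and Euler's identity alone accounts
for it. -/
theorem koszulHomotopy_koszulDelta_zero {a : WeylFibre E 0}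
    (ha : ∀ r, IsHomogeneousPoly r (a r)) (r : ℕ) (y : E) :
    - koszulHomotopy (koszulDelta a) r y = CForm.holDegree 0 (a r y) + (r : ℂ) • a r y := by
  have h0 : CForm.holDegree 0 (a r y) = 0 := rfl
  rw [h0, zero_add]
  cases r with
  | zero =>
    change - (0 : CForm E 0) = _
    rw [Nat.cast_zero, zero_smul ℂ, neg_zero]
  | succ r =>
    change - - CForm.contract y (alternatizeUncurryFin (fderiv ℝ (a (r + 1)) y)) = _
    rw [contract_alt_zero _ fun u => (ha (r + 1)).fderiv_apply_smul y u Complex.I,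
      (ha (r + 1)).fderiv_apply_self, neg_neg]

/-- Forms as sections of the Weyl bundle of weight zero. -/
noncomputable def weylInclusion (k : ℕ) (a : X → CForm E k) (x : X) : WeylFibre E k :=
  fun r _ => if r = 0 then a x else 0

theorem isLocalOperator_weylInclusion (k : ℕ) :
    IsLocalOperator (dolbeaultForms E X k) (weylSections E X k) (weylInclusion k) where
  congr h := by
    funext r y
    rw [weylInclusion, weylInclusion, h.eq_of_nhds]
  holds {a x} ha := by
    have ha := ha.self_of_nhds.1
    intro r
    by_cases hr : r = 0
    · subst hr
      refine ⟨IsHomogeneousPoly.const (a x), fun y => ?_⟩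
      exact ContDiffAt.comp (g := formInChart a x) (f := Prod.fst) (chartAt E x x, y) ha
        contDiffAt_fst
    · have h1 : ∀ x, weylInclusion k a x r = 0 := by
        intro x
        funext y
        simp [weylInclusion, hr]
      refine ⟨by rw [h1]; exact IsHomogeneousPoly.zero r, fun y => ?_⟩
      have h2 : (fun p : E × E => weylInChart (weylInclusion k a) x r p.1 p.2) = fun _ => 0 := by
        funext p
        rw [weylInChart, h1]
        rfl
      rw [h2]
      exact contDiffAt_const
  add _ _ := by
    funext r y
    by_cases hr : r = 0 <;> simp [weylInclusion, hr]
  smul c _ _ _ := by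
    funext r y
    by_cases hr : r = 0 <;> simp [weylInclusion, hr]

theorem formInChart_weylProjection {k : ℕ} (s : X → WeylFibre E k) (x₀ : X) (z : E) :
    formInChart (weylProjection k s) x₀ z = CForm.antiholCLM k (weylInChart s x₀ 0 z 0) := by
  rw [formInChart, weylProjection, weylInChart, map_zero, CForm.antiholCLM_apply,
    antiholPart_pullback]

theorem isLocalOperator_weylProjection (k : ℕ) :
    IsLocalOperator (weylSections E X k) (dolbeaultForms E X k) (weylProjection k) where
  congr h := by rw [weylProjection, weylProjection, h.eq_of_nhds]
  holds {s x} hs := by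
    refine ⟨?_, antiholPart_isAntiholomorphic _⟩
    have h1 : formInChart (weylProjection k s) x = fun z =>
        CForm.antiholCLM k (weylInChart s x 0 z 0) :=
      funext fun z => formInChart_weylProjection s x z
    rw [IsSmoothFormAt, h1]
    exact ((CForm.antiholCLM k).restrictScalars ℝ).contDiff.contDiffAt.comp _
      (((isWeylSectionAt_iff s x).1 hs.self_of_nhds).contDiffAt_left 0 0)
  add {s t x} _ _ := map_add (CForm.antiholCLM k) (s x 0 0) (t x 0 0)
  smul c s x _ := map_smul (CForm.antiholCLM k) c (s x 0 0)

theorem weylProjection_weylInclusion {k : ℕ} {a : X → CForm E k} {x : X}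
    (ha : (a x).IsAntiholomorphic) : weylProjection k (weylInclusion k a) x = a x :=
  ha.antiholPart_eq

variable {Ω : HolomorphicSymplecticForm E X} {cov : TangentConnection E X}
  {I : X → QuantumWeylFibre E 1}

variable (Ω cov I) in
/-- The part of the operator `D` that does not lower the weight. -/
noncomputable def fedosovPart {k : ℕ} (s : X → WeylFibre E k) (x : X) : WeylFibre E (k + 1) :=
  fun r y => covDeriv cov s x r y + ∑ w ∈ antidiagonal (r + 2),
    (2 : ℂ) • poissonTerm (Ω.inverse x) 1 (I x 0 w.1) (s x w.2) y

theorem classicalD_eq {k : ℕ} (s : X → WeylFibre E k) (x : X) :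
    classicalD Ω cov I k s x = fedosovPart Ω cov I s x - koszulDelta (s x) := by
  funext r y
  rw [classicalD, fedosovD_zero_apply]
  exact sub_add_eq_add_sub _ _ _

theorem poissonTerm_zero_left (B : Matrix (Fin (Module.finrank ℂ E)) (Fin (Module.finrank ℂ E)) ℂ)
    (m : ℕ) {k : ℕ} (Q : E → CForm E k) (y : E) : poissonTerm B m 0 Q y = 0 := by
  simp only [poissonTerm_eq, partialDeriv_zero_fun, map_zero]
  simp

theorem covDeriv_congr {k : ℕ} {s t : X → WeylFibre E k} {x : X} {r : ℕ}
    (h : ∀ᶠ x' in 𝓝 x, s x' r = t x' r) (y : E) :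
    covDeriv cov s x r y = covDeriv cov t x r y := by
  have h1 : (fun z => weylInChart s x r z y) =ᶠ[𝓝 (chartAt E x x)]
      fun z => weylInChart t x r z y := by
    filter_upwards [(tendsto_chart_symm x).eventually h] with z hz
    rw [weylInChart, weylInChart, hz]
  rw [covDeriv, covDeriv, h1.fderiv_eq, h.self_of_nhds]

/-- `∇` preserves the weight, and the bracket with a component of `I` of weight at least three
raises it, as it takes away only two. -/
theorem fedosovPart_congr (hI : IsInteraction I) {k : ℕ} {s t : X → WeylFibre E k} {x : X} {r : ℕ}
    (h : ∀ᶠ x' in 𝓝 x, ∀ q ≤ r, s x' q = t x' q) :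
    fedosovPart Ω cov I s x r = fedosovPart Ω cov I t x r := by
  funext y
  refine congrArg₂ (· + ·) (covDeriv_congr (h.mono fun _ h => h r le_rfl) y)
    (Finset.sum_congr rfl fun w hw => ?_)
  rw [Finset.HasAntidiagonal.mem_antidiagonal] at hw
  by_cases hw2 : w.2 ≤ r
  · rw [h.self_of_nhds w.2 hw2]
  -- If the weight of the second factor exceeds `r`, that of the first is at most one, where `I`
  -- vanishes.
  · have h3 : I x 0 w.1 = 0 := hI.2 x 0 w.1 (by omega)
    rw [h3, poissonTerm_zero_left, poissonTerm_zero_left]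

theorem constInHbar_holds {k : ℕ} {s : X → WeylFibre E k} {x : X} (hs : IsWeylSectionAt s x) :
    (quantumWeylSections E X k).Holds (constInHbar s) x := by
  intro j
  by_cases hj : j = 0
  · subst hj; exact hs
  · have : (fun x' => constInHbar s x' j) = 0 := by
      funext x'
      simp [constInHbar, hj]
    rw [this]
    exact (weylSections E X k).zero x

variable [T2Space X]

theorem isLocalOperator_classicalD (hc : IsSymplecticConnection Ω cov)
    (hI : ∀ x, (quantumWeylSections E X 1).Holds I x) (k : ℕ) :
    IsLocalOperator (weylSections E X k) (weylSections E X (k + 1)) (classicalD Ω cov I k) where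
  congr {s t x} h := by
    have h1 : constInHbar s =ᶠ[𝓝 x] constInHbar t := by
      filter_upwards [h] with x' hx'
      funext j
      rw [constInHbar, constInHbar, hx']
    rw [classicalD, classicalD, fedosovD_congr h1]
  holds hs := fedosovD_isWeylSectionAt hc hI (hs.mono fun _ h => constInHbar_holds h) 0
  add {s t x} hs ht := by
    have h1 : constInHbar (s + t) = constInHbar s + constInHbar t := by
      funext x' j
      by_cases hj : j = 0 <;> simp [constInHbar, hj]
    rw [classicalD, h1, fedosovD_add (constInHbar_holds hs) (constInHbar_holds ht)]
    rfl
  smul c s x hs := by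
    have h1 : constInHbar (c • s) = c • constInHbar s := by
      funext x' j
      by_cases hj : j = 0 <;> simp [constInHbar, hj]
    rw [classicalD, h1, ((isWeylConnection_fedosovD hc hI).isLocalOperator k).smul c
      (constInHbar_holds hs)]
    rfl

theorem squaresToZero_classicalD (hflat : IsFlatModHbar Ω cov I) :
    SquaresToZero (weylSections E X) (classicalD Ω cov I) := by
  intro k s x hs
  have h1 := hflat k (constInHbar s) x (hs.mono fun _ h => constInHbar_holds h)
  rw [fedosovD_zero_eq_classicalD] at h1
  exact h1

/-- In weight zero only the exterior derivative survives the projection: `δ` produces forms with a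
factor `dz^i`, the Christoffel term differentiates a constant in `y`, and the bracket would need a
component of `I` of weight at most two. The `(0,*)`-part of `d` depends only on the `(0,*)`-part of
the form. -/
theorem intertwines_weylProjection (hI : IsInteraction I) :
    Intertwines (weylSections E X) (classicalD Ω cov I) dbar weylProjection := by
  intro k s x hs
  have hs := hs.self_of_nhds
  have h1 : weylProjection (k + 1) (classicalD Ω cov I k s) x = CForm.antiholPart
      (alternatizeUncurryFin (fderiv ℝ (fun z => weylInChart s x 0 z 0) (chartAt E x x))) := by
    rw [weylProjection, classicalD_eq, ← CForm.antiholCLM_apply, Pi.sub_apply, Pi.sub_apply,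
      map_sub]
    have h2 : CForm.antiholCLM (k + 1) (koszulDelta (s x) 0 0) = 0 :=
      antiholPart_alt_eq_zero _ fun u => (hs 1).1.fderiv_apply_smul 0 u Complex.I
    have h3 : fderiv ℝ (s x 0) 0 = 0 :=
      ContinuousLinearMap.ext fun v => (hs 0).1.fderiv_apply_zero 0 v
    rw [h2, sub_zero, fedosovPart, covDeriv, h3, ContinuousLinearMap.zero_comp, sub_zero,
      Finset.sum_eq_zero, add_zero]
    · rfl
    · intro w hw
      rw [Finset.HasAntidiagonal.mem_antidiagonal] at hw
      rw [hI.2 x 0 w.1 (by omega), poissonTerm_zero_left, smul_zero]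
  rw [h1, dbar, extDeriv]
  conv_rhs => rw [← antiholPart_alt_antiholPart]
  congr 2
  have h4 : formInChart (weylProjection k s) x = fun z =>
      CForm.antiholCLM k (weylInChart s x 0 z 0) :=
    funext fun z => formInChart_weylProjection s x z
  rw [h4]
  exact (((CForm.antiholCLM k).restrictScalars ℝ).hasFDerivAt.comp _
    (differentiableAt_weylInChart hs 0 0).hasFDerivAt).fderiv

theorem dbar_congr {k : ℕ} {a b : X → CForm E k} {x : X} (h : a =ᶠ[𝓝 x] b) :
    dbar k a x = dbar k b x := by
  have h1 : formInChart a x =ᶠ[𝓝 (chartAt E x x)] formInChart b x := by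
    filter_upwards [(tendsto_chart_symm x).eventually h] with z hz
    rw [formInChart, formInChart, hz]
  rw [dbar, dbar, extDeriv, extDeriv, h1.fderiv_eq]

/-- Since `π₀ i` is the identity, `∂̄ = π₀ D i`. Smoothness of `∂̄ a` thus comes from that of `D`,
with no separate treatment of chart changes. -/
theorem dbar_eq (hI : IsInteraction I) {k : ℕ} {a : X → CForm E k} {x : X}
    (ha : ∀ᶠ x' in 𝓝 x, (dolbeaultForms E X k).Holds a x') :
    dbar k a x = weylProjection (k + 1) (classicalD Ω cov I k (weylInclusion k a)) x := by
  rw [← intertwines_weylProjection hI k _ x (ha.eventually_nhds.mono fun x' h =>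
    (isLocalOperator_weylInclusion k).holds h)]
  refine dbar_congr ?_
  filter_upwards [ha] with x' hx'
  exact (weylProjection_weylInclusion hx'.2).symm

theorem isLocalOperator_dbar (hc : IsSymplecticConnection Ω cov) (hI : IsInteraction I) (k : ℕ) :
    IsLocalOperator (dolbeaultForms E X k) (dolbeaultForms E X (k + 1)) (dbar k) where
  congr := dbar_congr
  holds {a x} ha := by
    have h1 : ∀ᶠ x' in 𝓝 x, (weylSections E X k).Holds (weylInclusion k a) x' :=
      ha.eventually_nhds.mono fun x' h => (isLocalOperator_weylInclusion k).holds h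
    have h2 : ∀ᶠ x' in 𝓝 x, (weylSections E X (k + 1)).Holds
        (classicalD Ω cov I k (weylInclusion k a)) x' :=
      h1.eventually_nhds.mono fun x' h => (isLocalOperator_classicalD hc hI.1 k).holds h
    refine (dolbeaultForms E X (k + 1)).congr ?_ ((isLocalOperator_weylProjection (k + 1)).holds h2)
    exact ha.eventually_nhds.mono fun x' h => (dbar_eq hI h).symm
  add {s t x} hs ht := by
    have h1 := fderiv_add (hs.1.differentiableAt (by simp)) (ht.1.differentiableAt (by simp))
    change CForm.antiholCLM (k + 1) (alternatizeUncurryFin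
      (fderiv ℝ (formInChart s x + formInChart t x) (chartAt E x x))) = _
    rw [h1, alt_add, map_add]
    rfl
  smul c s x hs := by
    have h1 := fderiv_const_smul (hs.1.differentiableAt (by simp)) c
    change CForm.antiholCLM (k + 1) (alternatizeUncurryFin
      (fderiv ℝ (c • formInChart s x) (chartAt E x x))) = _
    rw [h1, alt_smul, map_smul]
    rfl

/-- `∂̄² = ∂̄ π₀ D i = π₀ D² i`, and `D² = 0`. -/
theorem squaresToZero_dbar (hc : IsSymplecticConnection Ω cov) (hI : IsInteraction I)
    (hflat : IsFlatModHbar Ω cov I) : SquaresToZero (dolbeaultForms E X) dbar := by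
  intro k a x ha
  have h1 : ∀ᶠ x' in 𝓝 x, (weylSections E X k).Holds (weylInclusion k a) x' :=
    ha.eventually_nhds.mono fun x' h => (isLocalOperator_weylInclusion k).holds h
  have h2 : ∀ᶠ x' in 𝓝 x, (weylSections E X (k + 1)).Holds
      (classicalD Ω cov I k (weylInclusion k a)) x' :=
    h1.eventually_nhds.mono fun x' h => (isLocalOperator_classicalD hc hI.1 k).holds h
  have h3 : dbar k a =ᶠ[𝓝 x] weylProjection (k + 1) (classicalD Ω cov I k (weylInclusion k a)) :=
    ha.eventually_nhds.mono fun x' h => dbar_eq hI h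
  rw [dbar_congr h3, intertwines_weylProjection (Ω := Ω) (cov := cov) hI (k + 1) _ x h2,
    weylProjection, squaresToZero_classicalD hflat k _ x h1]
  exact map_zero (CForm.antiholCLM (k + 2))

end Dolbeault
end HolWeyl

namespace HolWeyl
open ContinuousAlternatingMap (alternatizeUncurryFin alternatizeUncurryFinCLM alternatizeUncurryFin_apply)
open Finset.HasAntidiagonal (antidiagonal)

/-! ### The perturbation criterion for complexes of sheaves. -/

section PerturbationLemma

variable {X : Type} [TopologicalSpace X] {V V' : ℕ → Type} [∀ k, AddCommGroup (V k)]
  [∀ k, Module ℂ (V k)] [∀ k, AddCommGroup (V' k)] [∀ k, Module ℂ (V' k)]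
  {P : ∀ k, LocalCondition X (V k)} {T : ∀ k, (X → V k) → X → V (k + 1)}
  {P' : ∀ k, LocalCondition X (V' k)} {T' : ∀ k, (X → V' k) → X → V' (k + 1)}
  {p : ∀ k, (X → V k) → X → V' k} {i : ∀ k, (X → V' k) → X → V k}
  {K : ∀ k, (X → V (k + 1)) → X → V k}

variable (T p i K) in
/-- The perturbation of `K T + T K` by the projection `i p`. -/
def perturbedOperator : ∀ k, (X → V k) → X → V k
  | 0 => fun s => K 0 (T 0 s) + i 0 (p 0 s)
  | k + 1 => fun s => K (k + 1) (T (k + 1) s) + T k (K k s) + i (k + 1) (p (k + 1) s)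

/-- The family of morphisms of sheaves given by operators that lower the degree. -/
noncomputable def homotopyOf (hT : ∀ k, IsLocalOperator (P k) (P (k + 1)) (T k))
    (hTT : SquaresToZero P T) (hK : ∀ k, IsLocalOperator (P (k + 1)) (P k) (K k)) (k l : ℕ) :
    (complexOf hT hTT).X k ⟶ (complexOf hT hTT).X l :=
  if e : l + 1 = k then
    e.rec (motive := fun k _ => (complexOf hT hTT).X k ⟶ (complexOf hT hTT).X l) (hK l).sheafHom
  else 0

variable (hT : ∀ k, IsLocalOperator (P k) (P (k + 1)) (T k))
    (hTT : SquaresToZero P T) (hK : ∀ k, IsLocalOperator (P (k + 1)) (P k) (K k))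

theorem homotopyOf_succ (k : ℕ) : homotopyOf hT hTT hK (k + 1) k = (hK k).sheafHom :=
  dif_pos rfl

theorem complexOf_d (k : ℕ) : (complexOf hT hTT).d k (k + 1) = (hT k).sheafHom :=
  CochainComplex.of_d (fun k => (P k).sheaf) (fun k => (hT k).sheafHom) k

variable (hT' : ∀ k, IsLocalOperator (P' k) (P' (k + 1)) (T' k)) (hTT' : SquaresToZero P' T')
  (hp : ∀ k, IsLocalOperator (P k) (P' k) (p k)) (hpT : Intertwines P T T' p)
  (hi : ∀ k, IsLocalOperator (P' k) (P k) (i k))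

/-- Identifies the categorical perturbed morphism with the explicit operator. Degree zero is
separate since no differential enters it. -/
theorem sheafValue_perturbed (k : ℕ) {U : Opens X} (s : (P k).sections U) (x : U) :
    sheafValue (P := P k) (Q := P k) (perturbed (complexHomOf hT hTT hT' hTT' hp hpT)
        (fun k => (hi k).sheafHom) (homotopyOf hT hTT hK) k) s x =
      perturbedOperator T p i K k (extendZero (U : Set X) s.1) x := by
  cases k with
  | zero =>
    have h1 : perturbed (complexHomOf hT hTT hT' hTT' hp hpT)
        (fun k => (hi k).sheafHom) (homotopyOf hT hTT hK) 0 =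
        (hT 0).sheafHom ≫ (hK 0).sheafHom + (hp 0).sheafHom ≫ (hi 0).sheafHom := by
      refine congrArg (· + _) ((Homotopy.nullHomotopicMap_f_of_not_rel_right
        (c := ComplexShape.up ℕ) (k₁ := 0) (k₀ := 1) rfl (fun l => Nat.succ_ne_zero l) _).trans ?_)
      rw [complexOf_d, homotopyOf_succ]
      rfl
    rw [h1]
    refine (sheafValue_add (P := P 0) (Q := P 0) _ _ s x).trans ?_
    rw [sheafValue_sheafHom_comp, sheafValue_sheafHom_comp]
    rfl
  | succ k =>
    have h1 : perturbed (complexHomOf hT hTT hT' hTT' hp hpT)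
        (fun k => (hi k).sheafHom) (homotopyOf hT hTT hK) (k + 1) =
        ((hT (k + 1)).sheafHom ≫ (hK (k + 1)).sheafHom + (hK k).sheafHom ≫ (hT k).sheafHom) +
          (hp (k + 1)).sheafHom ≫ (hi (k + 1)).sheafHom := by
      refine congrArg (· + _) ((Homotopy.nullHomotopicMap_f (c := ComplexShape.up ℕ)
        (k₂ := k) (k₁ := k + 1) (k₀ := k + 2)
        rfl rfl _).trans ?_)
      rw [complexOf_d, homotopyOf_succ, complexOf_d, homotopyOf_succ]
      rfl
    rw [h1]
    refine (sheafValue_add (P := P (k + 1)) (Q := P (k + 1)) _ _ s x).trans ?_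
    refine (congrArg (· + _) (sheafValue_add (P := P (k + 1)) (Q := P (k + 1)) _ _ s x)).trans ?_
    rw [sheafValue_sheafHom_comp, sheafValue_sheafHom_comp, sheafValue_sheafHom_comp]
    rfl

include hK hi in
/-- A degreewise split morphism of complexes of sheaves is a quasi-isomorphism if the perturbed
operators are bijective on local sections. -/
theorem quasiIso_complexHomOf
    (hpi : ∀ k (a : X → V' k) (x : X), (P' k).Holds a x → p k (i k a) x = a x)
    (hpK : ∀ k (s : X → V (k + 1)) (x : X), p k (K k s) x = 0)
    (hinj : ∀ k (U : Opens X) (s t : X → V k), (∀ x ∈ U, (P k).Holds s x) →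
      (∀ x ∈ U, (P k).Holds t x) →
      (∀ x ∈ U, perturbedOperator T p i K k s x = perturbedOperator T p i K k t x) →
      ∀ x ∈ U, s x = t x)
    (hsurj : ∀ k (U : Opens X) (a : X → V k), (∀ x ∈ U, (P k).Holds a x) →
      ∃ s : X → V k, (∀ x ∈ U, (P k).Holds s x) ∧
        ∀ x ∈ U, perturbedOperator T p i K k s x = a x) :
    QuasiIso (complexHomOf hT hTT hT' hTT' hp hpT) := by
  -- Composites of local operators are local, because equality of germs at a point is equality of
  -- germs at all nearby points.
  have hcongr : ∀ k {s t : X → V k} {x : X}, s =ᶠ[𝓝 x] t →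
      perturbedOperator T p i K k s x = perturbedOperator T p i K k t x := by
    intro k s t x h
    have hip : i k (p k s) x = i k (p k t) x :=
      (hi k).congr (h.eventuallyEq_nhds.mono fun y h => (hp k).congr h)
    have hKT : K k (T k s) x = K k (T k t) x :=
      (hK k).congr (h.eventuallyEq_nhds.mono fun y h => (hT k).congr h)
    cases k with
    | zero => exact congrArg₂ (· + ·) hKT hip
    | succ k => exact congrArg₂ (· + ·) (congrArg₂ (· + ·) hKT
        ((hT k).congr (h.eventuallyEq_nhds.mono fun y h => (hK k).congr h))) hip
  have : ∀ k, IsIso (perturbed (complexHomOf hT hTT hT' hTT' hp hpT)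
      (fun k => (hi k).sheafHom) (homotopyOf hT hTT hK) k) := fun k =>
    isIso_of_localOperator (P := P k) (Q := P k) _ (perturbedOperator T p i K k)
      (fun _ s x => sheafValue_perturbed hT hTT hK hT' hTT' hp hpT hi k s x)
      (hcongr k) (hinj k) (hsurj k)
  have h1 : ∀ k, (hi k).sheafHom ≫ (hp k).sheafHom = 𝟙 (P' k).sheaf := fun k => by
    refine sheafHom_ext fun U s x => ?_
    rw [sheafValue_sheafHom_comp, hpi k _ _ (s.2 x)]
    exact extendZero_apply s.1 x
  have h2 : ∀ k l, homotopyOf hT hTT hK k l ≫ (hp l).sheafHom = 0 := fun k l => by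
    by_cases e : l + 1 = k
    · subst e
      rw [homotopyOf_succ]
      exact (hK l).sheafHom_comp_eq_zero (hp l) fun s x _ => hpK l s x
    · rw [homotopyOf, dif_neg e]
      exact Limits.zero_comp
  exact (homotopyEquivOfPerturbed (π := complexHomOf hT hTT hT' hTT' hp hpT)
    (i := fun k => (hi k).sheafHom) (h := homotopyOf hT hTT hK) h1 h2
    fun k l e => dif_neg e).quasiIso_hom

end PerturbationLemma

/-! ### The projection `π₀` is a quasi-isomorphism. -/

section Dolbeault

variable {E : Type} [NormedAddCommGroup E] [NormedSpace ℂ E] [FiniteDimensional ℂ E]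
  {X : Type} [TopologicalSpace X] [ChartedSpace E X] [IsManifold 𝓘(ℂ, E) ω X] [T2Space X]
  {Ω : HolomorphicSymplecticForm E X} {cov : TangentConnection E X}
  {I : X → QuantumWeylFibre E 1}

variable (Ω cov I) in
/-- The part of the perturbed operator that raises the weight. -/
noncomputable def fedosovPerturbation : ∀ k, (X → WeylFibre E k) → X → WeylFibre E k
  | 0 => fun s x => koszulHomotopy (fedosovPart Ω cov I s x)
  | _ + 1 => fun s x => koszulHomotopy (fedosovPart Ω cov I s x) +
      fedosovPart Ω cov I (fun x => koszulHomotopy (s x)) x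

theorem koszulHomotopy_congr {k : ℕ} {a b : WeylFibre E (k + 1)} {r : ℕ}
    (h : ∀ q < r, a q = b q) : koszulHomotopy a r = koszulHomotopy b r := by
  cases r with
  | zero => rfl
  | succ r =>
    funext y
    rw [koszulHomotopy, koszulHomotopy, h r r.lt_succ_self]

/-- The homotopy raises the weight by one and `fedosovPart` does not lower it, so the composites
strictly raise the weight in either order. -/
theorem fedosovPerturbation_congr (hI : IsInteraction I) {k : ℕ} {s t : X → WeylFibre E k} {x : X}
    {r : ℕ} (h : ∀ᶠ x' in 𝓝 x, ∀ q < r, s x' q = t x' q) :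
    fedosovPerturbation Ω cov I k s x r = fedosovPerturbation Ω cov I k t x r := by
  have h1 : koszulHomotopy (fedosovPart Ω cov I s x) r =
      koszulHomotopy (fedosovPart Ω cov I t x) r :=
    koszulHomotopy_congr fun q hq => fedosovPart_congr hI
      (h.mono fun x' h q' hq' => h q' (hq'.trans_lt hq))
  cases k with
  | zero => exact h1
  | succ k =>
    exact congrArg₂ (· + ·) h1 (fedosovPart_congr hI (h.mono fun x' h q hq =>
      koszulHomotopy_congr fun q' hq' => h q' (hq'.trans_le hq)))

theorem isWeylSectionAt_koszulDelta {k : ℕ} {s : X → WeylFibre E k} {x : X}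
    (hs : ∀ᶠ x' in 𝓝 x, IsWeylSectionAt s x') :
    IsWeylSectionAt (fun x => koszulDelta (s x)) x := by
  rw [isWeylSectionAt_iff]
  refine isWeylExpr_of_eventually
    (isWeylExpr_koszulDelta ((isWeylSectionAt_iff s x).1 hs.self_of_nhds)) ?_
  filter_upwards [eventually_inChart (E := E) hs] with z hz r y
  exact weylInChart_koszulDelta hz.2 r y

theorem isWeylSectionAt_fedosovPart (hc : IsSymplecticConnection Ω cov) (hI : IsInteraction I)
    {k : ℕ} {s : X → WeylFibre E k} {x : X} (hs : ∀ᶠ x' in 𝓝 x, IsWeylSectionAt s x') :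
    IsWeylSectionAt (fedosovPart Ω cov I s) x := by
  have h1 : fedosovPart Ω cov I s = classicalD Ω cov I k s + fun x => koszulDelta (s x) := by
    funext x
    rw [Pi.add_apply, classicalD_eq, sub_add_cancel]
  rw [h1]
  exact (weylSections E X (k + 1)).add ((isLocalOperator_classicalD hc hI.1 k).holds hs)
    (isWeylSectionAt_koszulDelta hs)

theorem isWeylSectionAt_fedosovPerturbation (hc : IsSymplecticConnection Ω cov)
    (hI : IsInteraction I) {k : ℕ} {s : X → WeylFibre E k} {x : X}
    (hs : ∀ᶠ x' in 𝓝 x, IsWeylSectionAt s x') :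
    IsWeylSectionAt (fedosovPerturbation Ω cov I k s) x := by
  have h1 : (weylSections E X k).Holds (fun x => koszulHomotopy (fedosovPart Ω cov I s x)) x :=
    (isLocalOperator_koszulHomotopy k).holds
      (hs.eventually_nhds.mono fun x' h => isWeylSectionAt_fedosovPart hc hI h)
  cases k with
  | zero => exact h1
  | succ k =>
    have h2 : (weylSections E X (k + 1)).Holds
        (fedosovPart Ω cov I (fun x => koszulHomotopy (s x))) x :=
      isWeylSectionAt_fedosovPart hc hI
        (hs.eventually_nhds.mono fun x' h => (isLocalOperator_koszulHomotopy k).holds h)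
    exact (weylSections E X (k + 1)).add h1 h2

/-- The `-δ` part of `D` together with `h` gives `p + r`; the projection `i π₀` supplies the
identity where `p + r = 0`; everything else is weight-raising. -/
theorem perturbedOperator_eq {k : ℕ} {s : X → WeylFibre E k} {x : X}
    (hs : IsWeylSectionAt s x) (r : ℕ) (y : E) :
    perturbedOperator (classicalD Ω cov I) weylProjection weylInclusion
        (fun _ s x => koszulHomotopy (s x)) k s x r y =
      CForm.totalDegree k r (s x r y) + fedosovPerturbation Ω cov I k s x r y := by
  have hπ : weylInclusion k (weylProjection k s) x r y =
      (if r = 0 then CForm.antiholCLM k else 0) (s x r y) := by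
    by_cases hr : r = 0
    · subst hr
      -- A polynomial of degree zero is constant, so evaluating at the origin in `weylProjection`
      -- loses nothing.
      rw [if_pos rfl, (hs 0).1.eq_const y]
      rfl
    · rw [if_neg hr, weylInclusion, if_neg hr]
      rfl
  have hM : CForm.totalDegree k r (s x r y) = (CForm.holDegree k (s x r y) + (r : ℂ) • s x r y) +
      (if r = 0 then CForm.antiholCLM k else 0) (s x r y) := rfl
  have h1 : koszulHomotopy (classicalD Ω cov I k s x) r y =
      koszulHomotopy (fedosovPart Ω cov I s x) r y - koszulHomotopy (koszulDelta (s x)) r y := by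
    rw [classicalD_eq, koszulHomotopy_sub]
    rfl
  rw [hM, ← hπ]
  cases k with
  | zero =>
    rw [← koszulHomotopy_koszulDelta_zero fun r => (hs r).1]
    change koszulHomotopy (classicalD Ω cov I 0 s x) r y + _ = _ + koszulHomotopy _ r y
    rw [h1]
    abel
  | succ k =>
    rw [← koszulDelta_koszulHomotopy fun r => (hs r).1]
    change koszulHomotopy (classicalD Ω cov I (k + 1) s x) r y +
      classicalD Ω cov I k (fun x => koszulHomotopy (s x)) x r y + _ =
      _ + (koszulHomotopy _ r y + fedosovPart Ω cov I (fun x => koszulHomotopy (s x)) x r y)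
    rw [h1, classicalD_eq, Pi.sub_apply, Pi.sub_apply]
    abel

theorem quasiIso_weylProjection (hc : IsSymplecticConnection Ω cov) (hI : IsInteraction I)
    (hflat : IsFlatModHbar Ω cov I) :
    QuasiIso (complexHomOf (isLocalOperator_classicalD hc hI.1) (squaresToZero_classicalD hflat)
      (isLocalOperator_dbar hc hI) (squaresToZero_dbar hc hI hflat) isLocalOperator_weylProjection
      (intertwines_weylProjection hI)) := by
  refine quasiIso_complexHomOf (P := weylSections E X) (P' := dolbeaultForms E X)
    (K := fun _ s x => koszulHomotopy (s x)) (i := weylInclusion)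
    (isLocalOperator_classicalD hc hI.1) (squaresToZero_classicalD hflat)
    isLocalOperator_koszulHomotopy (isLocalOperator_dbar hc hI) (squaresToZero_dbar hc hI hflat)
    isLocalOperator_weylProjection (intertwines_weylProjection hI) isLocalOperator_weylInclusion
    (fun k a x ha => weylProjection_weylInclusion ha.2)
    (fun k s x => map_zero (CForm.antiholCLM k)) (fun k U s t hs ht h => ?_) fun k U a ha => ?_
  · refine solution_unique (N := fedosovPerturbation Ω cov I k)
      (fun s t x r h => fedosovPerturbation_congr hI h) U fun x hx r y => ?_
    rw [← perturbedOperator_eq (hs x hx), ← perturbedOperator_eq (ht x hx), h x hx]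
  · obtain ⟨s, hs, h⟩ := exists_solution (N := fedosovPerturbation Ω cov I k)
      (fun s t x r h => fedosovPerturbation_congr hI h)
      (fun s x h => isWeylSectionAt_fedosovPerturbation hc hI h) U a ha
    refine ⟨s, hs, fun x hx => ?_⟩
    funext r y
    rw [perturbedOperator_eq (hs x hx), h x hx]

end Dolbeault
end HolWeyl

namespace HolWeyl
open ContinuousAlternatingMap (alternatizeUncurryFin alternatizeUncurryFinCLM alternatizeUncurryFin_apply)
open Finset.HasAntidiagonal (antidiagonal)

/-! ### The Bianchi identity and the Hamiltonian nature of the curvature. -/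

section Curvature

variable {E : Type} [NormedAddCommGroup E] [NormedSpace ℂ E]
  {V : Type} [NormedAddCommGroup V] [NormedSpace ℂ V]
  {A : ℕ → E → E → E →L[ℝ] E} {S T : ℕ → E → E → V} {z : E}

theorem covNabla_sub {y : E} (hS : ∀ q, ContDiffAt ℝ ∞ (fun p : E × E => S q p.1 p.2) (z, y))
    (hT : ∀ q, ContDiffAt ℝ ∞ (fun p : E × E => T q p.1 p.2) (z, y)) (r : ℕ) (v : E) :
    covNabla A (fun r z y => S r z y - T r z y) r z y v =
      covNabla A S r z y v - covNabla A T r z y v := by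
  have hS' := fun q => (hS q).differentiableAt (by simp)
  have hT' := fun q => (hT q).differentiableAt (by simp)
  rw [covNabla_eq_total A hS', covNabla_eq_total A hT',
    covNabla_eq_total A fun q => (hS' q).sub (hT' q)]
  simp only [fun q => fderiv_fun_sub (hS' q) (hT' q), FunLike.coe_sub, Pi.sub_apply,
    Finset.sum_sub_distrib]
  abel

section

variable [FiniteDimensional ℂ E] [FiniteDimensional ℂ V]

theorem isWeylExpr_covNabla (hS : ∀ᶠ z' in 𝓝 z, IsWeylExpr S z')
    (hA : ∀ v, IsWeylExpr (fun p z y => A p z y v) z) (v : E) :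
    IsWeylExpr (fun r z y => covNabla A S r z y v) z := by
  intro r
  refine ⟨?_, fun y => contDiffAt_covNabla (fun q => (hS.self_of_nhds q).2 y)
    (fun p => (hA v p).2 y) r⟩
  simp only [covNabla_apply]
  refine IsHomogeneousPoly.fun_add (IsHomogeneousPoly.fderiv_param (P := S r)
    (hS.mono fun _ h => (h r).1) (fun y => ?_) v)
    (IsHomogeneousPoly.fun_sum fun w hw => (hS.self_of_nhds w.1).1.fderiv_comp (hA v w.2).1
      (Finset.HasAntidiagonal.mem_antidiagonal.1 hw))
  exact (ContDiffAt.comp (g := fun p : E × E => S r p.1 p.2) (f := fun z => (z, y)) z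
    ((hS.self_of_nhds r).2 y) (contDiffAt_id.prodMk contDiffAt_const)).differentiableAt (by simp)

variable (hA : ∀ᶠ z' in 𝓝 z, ∀ v, IsWeylExpr (fun p z y => A p z y v) z')
include hA

theorem isWeylExpr_curvature (v w : E) :
    IsWeylExpr (fun m z y => curvature A m z y v w) z := fun m =>
  ⟨(isWeylExpr_covNabla (hA.mono fun _ h => h w) hA.self_of_nhds v m).1.fun_sub
    (isWeylExpr_covNabla (hA.mono fun _ h => h v) hA.self_of_nhds w m).1,
  fun y => ((isWeylExpr_covNabla (hA.mono fun _ h => h w) hA.self_of_nhds v m).2 y).sub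
    ((isWeylExpr_covNabla (hA.mono fun _ h => h v) hA.self_of_nhds w m).2 y)⟩

/-- The Bianchi identity, in the lowest weight in which the curvature does not vanish. -/
theorem fderiv_curvature_cyclic (hA0 : ∀ᶠ z' in 𝓝 z, ∀ y v, A 0 z' y v = - v) {m : ℕ}
    (hF : ∀ᶠ z' in 𝓝 z, ∀ q ≤ m, ∀ y v w, curvature A q z' y v w = 0) (y u v w : E) :
    fderiv ℝ (fun y => curvature A (m + 1) z y v w) y u +
      fderiv ℝ (fun y => curvature A (m + 1) z y w u) y v +
      fderiv ℝ (fun y => curvature A (m + 1) z y u v) y w = 0 := by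
  set N : E → E → E → E := fun u v w =>
    covNabla A (fun r z y => covNabla A (fun p z y => A p z y w) r z y v) m z y u with hN
  have hA' := fun p v => (hA.self_of_nhds v p).2 y
  -- The left side is the weight `m` part of `∇_u F(v, w)`. All components of `F` in weights at most
  -- `m` vanish, so only the pairing of weight `m + 1` with `A 0 = -id` remains.
  have h1 : ∀ u v w, N u v w - N u w v =
      - fderiv ℝ (fun y => curvature A (m + 1) z y v w) y u := by
    intro u v w
    have hc : ∀ v w q, ContDiffAt ℝ ∞ (fun p : E × E =>
        covNabla A (fun p z y => A p z y w) q p.1 p.2 v) (z, y) := fun v w q =>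
      (isWeylExpr_covNabla (hA.mono fun _ h => h w) hA.self_of_nhds v q).2 y
    have h2 := covNabla_sub (A := A)
      (S := fun q z y => covNabla A (fun p z y => A p z y w) q z y v)
      (T := fun q z y => covNabla A (fun p z y => A p z y v) q z y w) (hc v w) (hc w v) m u
    refine h2.symm.trans ?_
    change covNabla A (fun p z y => curvature A p z y v w) m z y u = _
    have h3 : (fun z => curvature A m z y v w) =ᶠ[𝓝 z] fun _ => 0 := by
      filter_upwards [hF] with z' hz' using hz' m le_rfl y v w
    rw [covNabla_apply, h3.fderiv_eq, fderiv_fun_const, Finset.sum_eq_single (m + 1, 0),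
      hA0.self_of_nhds, map_neg]
    · exact zero_add _
    · intro p hp hp'
      rw [Finset.HasAntidiagonal.mem_antidiagonal] at hp
      have h4 : p.1 ≤ m := by
        by_contra h
        exact hp' (Prod.ext (by change p.1 = m + 1; omega) (by change p.2 = 0; omega))
      have h5 : (fun y => curvature A p.1 z y v w) = fun _ => 0 :=
        funext fun y => hF.self_of_nhds p.1 h4 y v w
      rw [h5, fderiv_fun_const]
      rfl
    · simp
  -- The commutator is a derivative of some `A p` along a component of `F`. In total weight `m + 1`,
  -- either `p = 0`, where `A 0` is constant in `y`, or the component of `F` has weight at most `m`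
  -- and vanishes.
  have h2 : ∀ u v w, N u v w = N v u w := by
    intro u v w
    have h3 : ∀ᶠ p : E × E in 𝓝 (z, y), fderiv ℝ (fun y => A 0 p.1 y w) p.2 = 0 := by
      filter_upwards [(continuous_fst.tendsto (z, y)).eventually hA0] with p hp
      have : (fun y => A 0 p.1 y w) = fun _ => - w := funext fun y => hp y w
      rw [this, fderiv_fun_const]
      rfl
    have h4 := covNabla_commutator (A := A) (S := fun p z y => A p z y w) (fun q => hA' q w)
      hA' h3 (fun y' => ContinuousLinearMap.ext fun v => by
        rw [hA0.self_of_nhds, hA0.self_of_nhds]) m u v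
    rw [← sub_eq_zero]
    refine h4.trans (Finset.sum_eq_zero fun p hp => ?_)
    rw [Finset.HasAntidiagonal.mem_antidiagonal] at hp
    by_cases hp0 : p.1 = 0
    · have h5 := h3.self_of_nhds
      rw [hp0]
      exact DFunLike.congr_fun h5 _
    · rw [hF.self_of_nhds p.2 (by omega), map_zero]
  have h3 := h1 u v w
  have h4 := h1 v w u
  have h5 := h1 w u v
  rw [h2 u v w] at h3
  rw [h2 v w u] at h4
  rw [h2 w u v] at h5
  -- Given the symmetry in the first two arguments, the cyclic sum of the differences telescopes to
  -- zero.
  rw [← neg_inj, neg_add, neg_add, ← h3, ← h4, ← h5]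
  abel

end

section Hamiltonian

variable {β : E → E →L[ℝ] E →L[ℝ] ℂ}

theorem fderiv_form_apply {f : E × E → E} {y : E} (hβ : ContDiffAt ℝ ∞ β z)
    (hf : ContDiffAt ℝ ∞ f (z, y)) (a h : E × E) (u : E) :
    fderiv ℝ (fun p : E × E => β p.1 (fderiv ℝ f p a) u) (z, y) h =
      fderiv ℝ β z h.1 (fderiv ℝ f (z, y) a) u + β z (fderiv ℝ (fderiv ℝ f) (z, y) h a) u := by
  have h1 : HasFDerivAt (fun p : E × E => β p.1)
      ((fderiv ℝ β z).comp (ContinuousLinearMap.fst ℝ E E)) (z, y) :=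
    HasFDerivAt.comp (g := β) (f := Prod.fst) (z, y)
      (hβ.differentiableAt (by simp)).hasFDerivAt hasFDerivAt_fst
  have h2 : HasFDerivAt (fun p => fderiv ℝ f p a) _ (z, y) :=
    ((contDiffAt_fderiv hf).differentiableAt (by simp)).hasFDerivAt.clm_apply
      (hasFDerivAt_const a (z, y))
  have h3 := (h1.clm_apply h2).clm_apply (hasFDerivAt_const u (z, y))
  rw [h3.fderiv]
  simp [add_comm]

theorem fderiv_fderiv_form {y : E} (hβ : ContDiffAt ℝ ∞ β z) (w u u' : E) (h : E × E) :
    fderiv ℝ (fun p : E × E => fderiv ℝ (fun z => β z u' u) p.1 w) (z, y) h =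
      fderiv ℝ (fderiv ℝ (fun z => β z u' u)) z h.1 w := by
  have h0 : ContDiffAt ℝ ∞ (fun z => β z u' u) z :=
    (hβ.clm_apply contDiffAt_const).clm_apply contDiffAt_const
  have h1 : HasFDerivAt (fun p : E × E => fderiv ℝ (fun z => β z u' u) p.1)
      ((fderiv ℝ (fderiv ℝ (fun z => β z u' u)) z).comp (ContinuousLinearMap.fst ℝ E E)) (z, y) :=
    HasFDerivAt.comp (g := fderiv ℝ (fun z => β z u' u)) (f := Prod.fst) (z, y)
      ((contDiffAt_fderiv h0).differentiableAt (by simp)).hasFDerivAt hasFDerivAt_fst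
  have h3 := h1.clm_apply (hasFDerivAt_const w (z, y))
  rw [h3.fderiv]
  simp

/-- The curvature of a connection that preserves a family of symplectic forms consists of
Hamiltonian vector fields. -/
theorem curvature_hamiltonian {y : E}
    (hA : ∀ p v, ContDiffAt ℝ ∞ (fun q : E × E => A p q.1 q.2 v) (z, y)) (hβ : ContDiffAt ℝ ∞ β z) (hβ' : ∀ u u', β z u u' = - β z u' u)
    (hσ : ∀ᶠ z' in 𝓝 z, ∀ p y w u' u, β z' (fderiv ℝ (fun y => A p z' y w) y u') u -
      β z' (fderiv ℝ (fun y => A p z' y w) y u) u' =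
        (if p = 1 then -1 else 0) * fderiv ℝ (fun z => β z u' u) z' w) (m : ℕ) (v w u u' : E) :
    β z (fderiv ℝ (fun y => curvature A m z y v w) y u') u =
      β z (fderiv ℝ (fun y => curvature A m z y v w) y u) u' := by
  set D : ℕ → E → E × E →L[ℝ] E := fun q w => fderiv ℝ (fun p : E × E => A q p.1 p.2 w) (z, y)
    with hD
  set D2 : ℕ → E → E × E → E × E →L[ℝ] E := fun q w h =>
    fderiv ℝ (fderiv ℝ (fun p : E × E => A q p.1 p.2 w)) (z, y) h with hD2
  have hsymm : ∀ q w h k, D2 q w h k = D2 q w k h := fun q w h k =>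
    ((hA q w).isSymmSndFDerivAt (by
      rw [minSmoothness_of_isRCLikeNormedField]
      exact WithTop.coe_le_coe.2 (le_top : (2 : ℕ∞) ≤ ⊤))) h k
  have h1 : ∀ q w u' u, β z (D q w (0, u')) u - β z (D q w (0, u)) u' =
      (if q = 1 then -1 else 0) * fderiv ℝ (fun z => β z u' u) z w := by
    intro q w u' u
    rw [← hσ.self_of_nhds q y w u' u, fderiv_snd (S := fun z y => A q z y w) ((hA q w).differentiableAt (by simp)),
      fderiv_snd (S := fun z y => A q z y w) ((hA q w).differentiableAt (by simp))]
  -- The derivative of the compatibility condition `hσ` in a direction `h` of the base and the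
  -- fibre.
  have h2 : ∀ q w (h : E × E) u' u, (fderiv ℝ β z h.1 (D q w (0, u')) u + β z (D2 q w h (0, u')) u) -
      (fderiv ℝ β z h.1 (D q w (0, u)) u' + β z (D2 q w h (0, u)) u') =
      (if q = 1 then -1 else 0) * fderiv ℝ (fderiv ℝ (fun z => β z u' u)) z h.1 w := by
    intro q w h u' u
    have h3 : (fun p : E × E => β p.1 (fderiv ℝ (fun p : E × E => A q p.1 p.2 w) p (0, u')) u -
        β p.1 (fderiv ℝ (fun p : E × E => A q p.1 p.2 w) p (0, u)) u') =ᶠ[𝓝 (z, y)]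
        fun p => (if q = 1 then (-1 : ℂ) else 0) * fderiv ℝ (fun z => β z u' u) p.1 w := by
      filter_upwards [(continuous_fst.tendsto (z, y)).eventually hσ,
        eventually_differentiableAt (hA q w)] with p hp hp'
      rw [← hp q p.2 w u' u, fderiv_snd (S := fun z y => A q z y w) hp',
        fderiv_snd (S := fun z y => A q z y w) hp']
    have hdiff : ∀ u u', DifferentiableAt ℝ (fun p : E × E =>
        β p.1 (fderiv ℝ (fun p : E × E => A q p.1 p.2 w) p (0, u')) u) (z, y) := fun u u' =>
      (((ContDiffAt.comp (g := β) (f := Prod.fst) (z, y) hβ contDiffAt_fst).clm_apply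
        ((contDiffAt_fderiv (hA q w)).clm_apply contDiffAt_const)).clm_apply
          contDiffAt_const).differentiableAt (by simp)
    have hdiff' : DifferentiableAt ℝ (fun p : E × E =>
        fderiv ℝ (fun z => β z u' u) p.1 w) (z, y) := by
      have h0 : ContDiffAt ℝ ∞ (fun z => β z u' u) z :=
        (hβ.clm_apply contDiffAt_const).clm_apply contDiffAt_const
      exact ((ContDiffAt.comp (g := fderiv ℝ (fun z => β z u' u)) (f := Prod.fst) (z, y)
        (contDiffAt_fderiv h0) contDiffAt_fst).clm_apply contDiffAt_const).differentiableAt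
          (by simp)
    have h4 := DFunLike.congr_fun (h3.fderiv_eq (𝕜 := ℝ)) h
    rw [fderiv_fun_sub (hdiff u u') (hdiff u' u), fderiv_const_mul hdiff',
      FunLike.coe_sub, Pi.sub_apply, fderiv_form_apply hβ (hA q w),
      fderiv_form_apply hβ (hA q w)] at h4
    exact h4.trans (congrArg (_ * ·) (fderiv_fderiv_form hβ w u u' h))
  set K : E → E → E → E := fun v w u' => fderiv ℝ (fun p : E × E =>
    covNabla A (fun p z y => A p z y w) m p.1 p.2 v) (z, y) (0, u') with hK
  have hK' : ∀ v w u', K v w u' = D2 m w (v, 0) (0, u') + ∑ x ∈ antidiagonal (m + 1),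
      (D2 x.1 w (0, A x.2 z y v) (0, u') + D x.1 w (0, D x.2 v (0, u'))) := by
    intro v w u'
    rw [hK]
    refine (fderiv_covNabla (fun q => hA q w) (fun p => hA p v) m (0, u')).trans ?_
    refine congrArg₂ (· + ·) (hsymm m w _ _) (Finset.sum_congr rfl fun x _ => ?_)
    exact congrArg (· + _) (hsymm x.1 w _ _)
  -- Terms with two first derivatives. Antisymmetry of `β`, together with the exchange of weights,
  -- makes `Q` symmetric in `v` and `w`.
  set Q : E → E → ℂ := fun v w => ∑ x ∈ antidiagonal (m + 1),
    (β z (D x.1 w (0, u)) (D x.2 v (0, u')) - β z (D x.1 w (0, u')) (D x.2 v (0, u))) with hQ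
  have hQs : ∀ v w, Q v w = Q w v := by
    intro v w
    simp only [hQ]
    rw [← Finset.Nat.sum_antidiagonal_swap]
    refine Finset.sum_congr rfl fun x _ => ?_
    rw [Prod.fst_swap, Prod.snd_swap, hβ' (D x.2 w _), hβ' (D x.2 w _)]
    ring
  set M : E → E → ℂ := fun v w => fderiv ℝ β z v (D m w (0, u')) u -
    fderiv ℝ β z v (D m w (0, u)) u' with hM
  -- The failure of `∇_v A_w` to be Hamiltonian. Each part of it is symmetric in `v` and `w`, so it
  -- disappears on antisymmetrizing to the curvature.
  have hG : ∀ v w, β z (K v w u') u - β z (K v w u) u' =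
      (if m = 1 then -1 else 0) * fderiv ℝ (fderiv ℝ (fun z => β z u' u)) z v w -
        M v w - M w v + Q v w := by
    intro v w
    have e1 := h2 m w (v, 0) u' u
    have e2 : ∀ x : ℕ × ℕ, β z (D2 x.1 w (0, A x.2 z y v) (0, u')) u -
        β z (D2 x.1 w (0, A x.2 z y v) (0, u)) u' = 0 := by
      intro x
      have := h2 x.1 w (0, A x.2 z y v) u' u
      simpa using this
    have e3 : ∀ x : ℕ × ℕ, β z (D x.1 w (0, D x.2 v (0, u'))) u -
        β z (D x.1 w (0, D x.2 v (0, u))) u' =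
        (β z (D x.1 w (0, u)) (D x.2 v (0, u')) - β z (D x.1 w (0, u')) (D x.2 v (0, u))) +
        (if x.1 = 1 then -1 else 0) * (fderiv ℝ β z w (D x.2 v (0, u')) u -
          fderiv ℝ β z w (D x.2 v (0, u)) u') := by
      intro x
      have hβw : ∀ a b, fderiv ℝ (fun z => β z a b) z w = fderiv ℝ β z w a b := by
        intro a b
        have := ((hβ.differentiableAt (by simp)).hasFDerivAt.clm_apply
          (hasFDerivAt_const a z)).clm_apply (hasFDerivAt_const b z)
        rw [this.fderiv]
        simp
      have i1 := h1 x.1 w (D x.2 v (0, u')) u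
      have i2 := h1 x.1 w (D x.2 v (0, u)) u'
      rw [hβw] at i1 i2
      linear_combination i1 - i2
    -- Only the linear component `A 1` fails to be Hamiltonian, so only the pair `(1, m)`
    -- contributes.
    have e4 : ∑ x ∈ antidiagonal (m + 1), (if x.1 = 1 then (-1 : ℂ) else 0) *
        (fderiv ℝ β z w (D x.2 v (0, u')) u - fderiv ℝ β z w (D x.2 v (0, u)) u') = - M w v := by
      rw [Finset.sum_eq_single (1, m)]
      · simp [hM]
      · intro x hx hx'
        rw [Finset.HasAntidiagonal.mem_antidiagonal] at hx
        rw [if_neg, zero_mul]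
        intro h
        exact hx' (Prod.ext h (by change x.2 = m; omega))
      · intro h
        exact absurd (Finset.HasAntidiagonal.mem_antidiagonal.2 (Nat.add_comm 1 m)) h
    have e5 : β z (K v w u') u - β z (K v w u) u' =
        (β z (D2 m w (v, 0) (0, u')) u - β z (D2 m w (v, 0) (0, u)) u') +
        ∑ x ∈ antidiagonal (m + 1), ((β z (D2 x.1 w (0, A x.2 z y v) (0, u')) u -
          β z (D2 x.1 w (0, A x.2 z y v) (0, u)) u') +
          (β z (D x.1 w (0, D x.2 v (0, u'))) u - β z (D x.1 w (0, D x.2 v (0, u))) u')) := by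
      rw [hK', hK']
      simp only [map_add, map_sum, FunLike.coe_add, Pi.add_apply, sum_apply,
        Finset.sum_add_distrib, Finset.sum_sub_distrib]
      ring
    rw [e5]
    simp only [e2, e3, zero_add, Finset.sum_add_distrib]
    simp only [e4]
    simp only [hM, hQ]
    linear_combination e1
  have hF : ∀ u', fderiv ℝ (fun y => curvature A m z y v w) y u' = K v w u' - K w v u' := by
    intro u'
    have hd : ∀ v w, DifferentiableAt ℝ (fun p : E × E =>
        covNabla A (fun p z y => A p z y w) m p.1 p.2 v) (z, y) := fun v w =>
      (contDiffAt_covNabla (fun q => hA q w) (fun p => hA p v) m).differentiableAt (by simp)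
    have := fderiv_snd (S := fun z y => curvature A m z y v w) ((hd v w).sub (hd w v)) u'
    refine this.trans ?_
    simp only [curvature]
    rw [fderiv_fun_sub (hd v w) (hd w v)]
    rfl
  have hs2 : fderiv ℝ (fderiv ℝ (fun z => β z u' u)) z v w =
      fderiv ℝ (fderiv ℝ (fun z => β z u' u)) z w v :=
    ContDiffAt.isSymmSndFDerivAt (n := ∞)
      ((hβ.clm_apply contDiffAt_const).clm_apply contDiffAt_const) (by
      rw [minSmoothness_of_isRCLikeNormedField]
      exact WithTop.coe_le_coe.2 (le_top : (2 : ℕ∞) ≤ ⊤)) v w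
  have g1 := hG v w
  have g2 := hG w v
  rw [hQs v w, hs2] at g1
  rw [hF, hF, map_sub, map_sub, sub_apply, sub_apply]
  linear_combination g1 - g2

end Hamiltonian

end Curvature
end HolWeyl

namespace HolWeyl
open ContinuousAlternatingMap (alternatizeUncurryFin alternatizeUncurryFinCLM alternatizeUncurryFin_apply)
open Finset.HasAntidiagonal (antidiagonal)

/-! ### Removing the lowest component of the curvature. -/

section Correction

variable {E : Type} [NormedAddCommGroup E] [NormedSpace ℂ E]

theorem alt_apply_two (L : E →L[ℝ] CForm E 1) (v w : E) :
    alternatizeUncurryFin L ![v, w] = L v (fun _ => w) - L w (fun _ => v) := by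
  rw [alternatizeUncurryFin_apply, Fin.sum_univ_two]
  have h1 : (0 : Fin 2).removeNth ![v, w] = fun _ => w := by
    funext i; rw [Subsingleton.elim i 0]; rfl
  have h2 : (1 : Fin 2).removeNth ![v, w] = fun _ => v := by
    funext i; rw [Subsingleton.elim i 0]; rfl
  rw [h1, h2]
  simp [sub_eq_add_neg]

theorem alt_apply_three (L : E →L[ℝ] CForm E 2) (u v w : E) :
    alternatizeUncurryFin L ![u, v, w] = L u ![v, w] - L v ![u, w] + L w ![u, v] := by
  rw [alternatizeUncurryFin_apply, Fin.sum_univ_three]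
  have h1 : (0 : Fin 3).removeNth ![u, v, w] = ![v, w] := by
    funext i; fin_cases i <;> rfl
  have h2 : (1 : Fin 3).removeNth ![u, v, w] = ![u, w] := by
    funext i; fin_cases i <;> rfl
  have h3 : (2 : Fin 3).removeNth ![u, v, w] = ![u, v] := by
    funext i; fin_cases i <;> rfl
  rw [h1, h2, h3]
  simp [sub_eq_add_neg]

theorem CForm.apply_swap (a : CForm E 2) (v w : E) : a ![w, v] = - a ![v, w] := by
  have := a.toAlternatingMap.map_swap ![v, w] (i := 0) (j := 1) (by decide)
  refine Eq.trans ?_ this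
  change _ = a (![v, w] ∘ ⇑(Equiv.swap 0 1))
  refine congrArg _ ?_
  funext i
  fin_cases i <;> rfl

theorem CForm.ext_two {a b : CForm E 2} (h : ∀ v w, a ![v, w] = b ![v, w]) : a = b := by
  ext m
  have : m = ![m 0, m 1] := by
    funext i; fin_cases i <;> rfl
  rw [this, h]

theorem CForm.ext_three {a b : CForm E 3} (h : ∀ u v w, a ![u, v, w] = b ![u, v, w]) : a = b := by
  ext m
  have : m = ![m 0, m 1, m 2] := by
    funext i; fin_cases i <;> rfl
  rw [this, h]

variable [FiniteDimensional ℂ E]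

/-- A closed polynomial form of positive degree is exact for the Koszul differential. -/
theorem alt_fderiv_totalDegreeInv {k r : ℕ} {H : E → CForm E (k + 1)}
    (hH : IsHomogeneousPoly (r + 1) H) (hd : ∀ y, alternatizeUncurryFin (fderiv ℝ H y) = 0)
    (y : E) :
    alternatizeUncurryFin (fderiv ℝ
      (fun y => CForm.totalDegreeInv k (r + 2) (CForm.contract y (H y))) y) = H y := by
  have hc : IsHomogeneousPoly (r + 2) fun y => CForm.contract y (H y) :=
    koszulHomotopy_isHomogeneousPoly hH
  have hK := hc.clm_comp (CForm.totalDegreeInv k (r + 2))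
  set K := fun y => CForm.totalDegreeInv k (r + 2) (CForm.contract y (H y)) with hKdef
  have h1 : alternatizeUncurryFin (fderiv ℝ (fun y => CForm.contract y (H y)) y) =
      CForm.totalDegree (k + 1) (r + 1) (H y) := by
    -- `H` is viewed as a section concentrated in one weight, so that the Cartan formula applies;
    -- `δH = 0` leaves only one composition.
    let a : WeylFibre E (k + 1) := fun q => if q = r + 1 then H else 0
    have ha : ∀ q, IsHomogeneousPoly q (a q) := by
      intro q
      by_cases hq : q = r + 1
      · subst hq; simpa [a] using hH
      · simpa [a, hq] using IsHomogeneousPoly.zero (E := E) q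
    have ha1 : a (r + 1) = H := if_pos rfl
    have h2 := koszulDelta_koszulHomotopy ha (r + 1) y
    have h3 : koszulHomotopy (koszulDelta a) (r + 1) y = 0 := by
      change - CForm.contract y (alternatizeUncurryFin (fderiv ℝ (a (r + 1)) y)) = 0
      rw [ha1, hd, map_zero, neg_zero]
    have h4 : koszulDelta (koszulHomotopy a) (r + 1) y =
        - alternatizeUncurryFin (fderiv ℝ (fun y => CForm.contract y (H y)) y) := by
      change alternatizeUncurryFin (fderiv ℝ (fun y => - CForm.contract y (a (r + 1) y)) y) = _
      rw [ha1, fderiv_fun_neg, ← CForm.altCLM_apply, ← CForm.altCLM_apply, map_neg]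
    rw [h3, h4, neg_neg, sub_zero, ha1] at h2
    rw [h2, CForm.totalDegree_succ_apply r.succ_ne_zero]
  -- The operator `δ` raises `p` by one and lowers `r` by one, so it commutes with the total degree,
  -- and dividing by it before or after `δ` is the same.
  apply totalDegree_injective (k + 1) (r + 1)
  rw [← h1, CForm.totalDegree_succ_apply r.succ_ne_zero,
    holDegree_alt _ fun u => hK.fderiv_apply_smul y u Complex.I]
  have h5 : fderiv ℝ (fun y => CForm.contract y (H y)) y =
      compR (CForm.holDegree k) (fderiv ℝ K y) + ((r + 2 : ℕ) : ℂ) • fderiv ℝ K y := by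
    have h6 : (fun y => CForm.contract y (H y)) =
        fun y => CForm.totalDegree k (r + 2) (K y) :=
      funext fun y => (totalDegree_totalDegreeInv _).symm
    have h7 := (((CForm.totalDegree k (r + 2)).restrictScalars ℝ).hasFDerivAt.comp y
      (hK.differentiableAt_real y).hasFDerivAt).fderiv
    rw [h6]
    refine h7.trans (ContinuousLinearMap.ext fun v => ?_)
    exact CForm.totalDegree_succ_apply (r + 1).succ_ne_zero _
  rw [h5, alt_add, alt_smul]
  push_cast
  module

/-- The defining property of a Hamiltonian field. The factor two is that of the commutator of the
Weyl product. -/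
theorem hamField_form {B M : Matrix (Fin (Module.finrank ℂ E)) (Fin (Module.finrank ℂ E)) ℂ}
    (hBM : B * M = 1) {b : E →L[ℂ] E →L[ℂ] ℂ}
    (hM : ∀ i j, M i j = b (Module.finBasis ℂ E i) (Module.finBasis ℂ E j))
    {P : E → CForm E 1} {r : ℕ} (hP : IsHomogeneousPoly r P) (y v u : E) :
    b (hamField B P y v) u = 2 * fderiv ℝ P y u fun _ => v := by
  have h1 : ∀ l, b (hamField B P y v) (Module.finBasis ℂ E l) =
      2 * fderiv ℝ P y (Module.finBasis ℂ E l) fun _ => v := by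
    intro l
    rw [hamField_apply]
    simp only [map_sum, map_smul, sum_apply, smul_apply, smul_eq_mul, ← hM]
    have h2 : ∀ i, ∑ j, 2 * B i j * (fderiv ℝ P y (Module.finBasis ℂ E i) fun _ => v) * M j l =
        2 * (fderiv ℝ P y (Module.finBasis ℂ E i) fun _ => v) * (B * M) i l := by
      intro i
      rw [Matrix.mul_apply, Finset.mul_sum]
      exact Finset.sum_congr rfl fun j _ => by ring
    simp only [h2, hBM, Matrix.one_apply]
    simp
  rw [hP.fderiv_apply_eq_sum y u]
  conv_lhs => rw [← sum_coord u, map_sum]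
  simp only [map_smul, h1, ContinuousAlternatingMap.sum_apply, ContinuousAlternatingMap.smul_apply,
    smul_eq_mul, Finset.mul_sum]
  exact Finset.sum_congr rfl fun i _ => by ring

/-- Evaluation of forms. -/
noncomputable def CForm.eval {k : ℕ} (v : Fin k → E) : CForm E k →L[ℂ] ℂ :=
  LinearMap.toContinuousLinearMap
    { toFun := fun a => a v
      map_add' := fun _ _ => rfl
      map_smul' := fun _ _ => rfl }

theorem isHomogeneousPoly_hamField
    {B : Matrix (Fin (Module.finrank ℂ E)) (Fin (Module.finrank ℂ E)) ℂ}
    {P : E → CForm E 1} {r : ℕ} (hP : IsHomogeneousPoly (r + 1) P) (v : E) :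
    IsHomogeneousPoly r fun y => hamField B P y v := by
  simp only [hamField_apply]
  refine IsHomogeneousPoly.fun_sum fun i _ => IsHomogeneousPoly.fun_sum fun j _ => ?_
  have h1 := (hP.fderiv_apply (Module.finBasis ℂ E i)).clm_comp (CForm.eval fun _ : Fin 1 => v)
  exact h1.clm_comp ((ContinuousLinearMap.smulRight (1 : ℂ →L[ℂ] ℂ)
    (Module.finBasis ℂ E j)).comp ((2 * B i j) • (1 : ℂ →L[ℂ] ℂ)))

variable (E) in
/-- Functions as forms of degree zero. -/
noncomputable def CForm.ofScalar : ℂ →L[ℂ] CForm E 0 :=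
  LinearMap.toContinuousLinearMap
    { toFun := fun c => ContinuousAlternatingMap.constOfIsEmpty ℝ E (Fin 0) c
      map_add' := fun _ _ => rfl
      map_smul' := fun _ _ => rfl }

/-- A complex bilinear form as a real one. -/
noncomputable def realForm (b : E →L[ℂ] E →L[ℂ] ℂ) : E →L[ℝ] E →L[ℝ] ℂ :=
  (ContinuousLinearMap.restrictScalarsL ℂ E ℂ ℝ ℝ).comp (b.restrictScalars ℝ)

theorem realForm_apply (b : E →L[ℂ] E →L[ℂ] ℂ) (u v : E) : realForm b u v = b u v := rfl

theorem contDiffAt_clm {W V : Type*} [NormedAddCommGroup W] [NormedSpace ℝ W]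
    [NormedAddCommGroup V] [NormedSpace ℝ V] {f : W → E →L[ℝ] V} {p : W} {n : WithTop ℕ∞}
    (h : ∀ v, ContDiffAt ℝ n (fun p => f p v) p) : ContDiffAt ℝ n f p := by
  have h1 : f = fun p => ∑ i, (LinearMap.toContinuousLinearMap
      ((Module.finBasis ℝ E).coord i)).smulRight (f p (Module.finBasis ℝ E i)) := by
    funext p
    refine ContinuousLinearMap.ext fun v => ?_
    rw [sum_apply]
    conv_lhs => rw [← (Module.finBasis ℝ E).sum_repr v, map_sum]
    exact Finset.sum_congr rfl fun i _ => map_smul _ _ _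
  rw [h1]
  refine ContDiffAt.sum fun i _ => ?_
  exact (ContinuousLinearMap.smulRightL ℝ E V (LinearMap.toContinuousLinearMap
    ((Module.finBasis ℝ E).coord i))).contDiff.contDiffAt.comp p (h _)

theorem fderiv_clm_apply_const {V W : Type*} [NormedAddCommGroup W] [NormedSpace ℝ W]
    [NormedAddCommGroup V] [NormedSpace ℝ V] {f : W → E →L[ℝ] V} {p : W}
    (h : DifferentiableAt ℝ f p) (v : W) (w : E) :
    fderiv ℝ f p v w = fderiv ℝ (fun p => f p w) p v := by
  have h1 := h.hasFDerivAt.clm_apply (hasFDerivAt_const w p)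
  rw [h1.fderiv]
  simp

variable {A A' : ℕ → E → E → E →L[ℝ] E} {z : E}

theorem covNabla_clm_apply {V : Type} [NormedAddCommGroup V] [NormedSpace ℝ V]
    {S : ℕ → E → E → E →L[ℝ] V} {y : E}
    (hS : ∀ p v, ContDiffAt ℝ ∞ (fun q : E × E => S p q.1 q.2 v) (z, y)) (m : ℕ) (v w : E) :
    covNabla A S m z y v w = covNabla A (fun p z y => S p z y w) m z y v := by
  have h : ∀ p, ContDiffAt ℝ ∞ (fun q : E × E => S p q.1 q.2) (z, y) := fun p =>
    contDiffAt_clm (hS p)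
  have h1 : DifferentiableAt ℝ (fun z => S m z y) z :=
    (ContDiffAt.comp (g := fun q : E × E => S m q.1 q.2) (f := fun z => (z, y)) z (h m)
      (contDiffAt_id.prodMk contDiffAt_const)).differentiableAt (by simp)
  have h2 : ∀ q, DifferentiableAt ℝ (S q z) y := fun q =>
    (ContDiffAt.comp (g := fun q' : E × E => S q q'.1 q'.2) (f := fun y => (z, y)) y (h q)
      (contDiffAt_const.prodMk contDiffAt_id)).differentiableAt (by simp)
  rw [covNabla_apply, covNabla_apply, FunLike.coe_add, Pi.add_apply, sum_apply,
    fderiv_clm_apply_const h1]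
  congr 1
  exact Finset.sum_congr rfl fun x _ => fderiv_clm_apply_const (h2 x.1) _ _

/-- The two-form with values in Hamiltonian functions defined by the component of weight `m` of the
curvature. -/
noncomputable def curvatureForm (b : E →L[ℂ] E →L[ℂ] ℂ) (A : ℕ → E → E → E →L[ℝ] E) (m : ℕ)
    (z y : E) : CForm E 2 :=
  (((m + 1 : ℕ) : ℂ)⁻¹) • alternatizeUncurryFin (alternatizeUncurryFinCLM ℝ E ℂ ∘L
    (ContinuousLinearMap.compL ℝ E E (CForm E 0)
      (((CForm.ofScalar E).comp (b.flip y)).restrictScalars ℝ)) ∘L covNabla A A m z y)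

theorem curvatureForm_apply (b : E →L[ℂ] E →L[ℂ] ℂ) {y : E}
    (hA : ∀ p v, ContDiffAt ℝ ∞ (fun q : E × E => A p q.1 q.2 v) (z, y)) (m : ℕ) (v w : E) :
    curvatureForm b A m z y ![v, w] = ((m + 1 : ℕ) : ℂ)⁻¹ * b (curvature A m z y v w) y := by
  have h1 : ∀ (L : E →L[ℝ] CForm E 0) (u : E),
      alternatizeUncurryFin L (fun _ => u) = L u Fin.elim0 := by
    intro L u
    rw [alternatizeUncurryFin_apply, Fin.sum_univ_one]
    simp only [Fin.val_zero, pow_zero, one_smul]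
    exact congrArg _ (Subsingleton.elim _ _)
  have h2 : ∀ v w, alternatizeUncurryFin ((((CForm.ofScalar E).comp (b.flip y)).restrictScalars ℝ)
      ∘L covNabla A A m z y v) (fun _ => w) =
      b (covNabla A (fun p z y => A p z y w) m z y v) y := by
    intro v w
    rw [h1, ContinuousLinearMap.comp_apply, covNabla_clm_apply hA]
    rfl
  rw [curvatureForm, ContinuousAlternatingMap.smul_apply, alt_apply_two, smul_eq_mul, curvature,
    map_sub, sub_apply, ← h2 v w, ← h2 w v]
  rfl

theorem curvatureForm_isHomogeneousPoly (b : E →L[ℂ] E →L[ℂ] ℂ)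
    (hA : ∀ᶠ z' in 𝓝 z, ∀ v, IsWeylExpr (fun p z y => A p z y v) z') (m : ℕ) :
    IsHomogeneousPoly (m + 1) (curvatureForm b A m z) := by
  refine IsHomogeneousPoly.fun_smul _ (IsHomogeneousPoly.alt fun v => IsHomogeneousPoly.alt
    fun w => ?_)
  have h1 : (fun y => CForm.ofScalar E (b (covNabla A A m z y v w) y)) = fun y =>
      CForm.ofScalar E (b (covNabla A (fun p z y => A p z y w) m z y v) y) := by
    funext y
    rw [covNabla_clm_apply fun p v => (hA.self_of_nhds v p).2 y]
  change IsHomogeneousPoly (m + 1) fun y => CForm.ofScalar E (b (covNabla A A m z y v w) y)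
  rw [h1]
  exact (((isWeylExpr_covNabla (hA.mono fun _ h => h w) hA.self_of_nhds v m).1).bilin
    (IsHomogeneousPoly.clm (ContinuousLinearMap.id ℂ E)) b).clm_comp _

theorem contDiffAt_curvatureForm {b : E → E →L[ℂ] E →L[ℂ] ℂ}
    (hb : ContDiffAt ℝ ∞ (fun z => realForm (b z)) z)
    (hA : ∀ᶠ z' in 𝓝 z, ∀ v, IsWeylExpr (fun p z y => A p z y v) z') (m : ℕ) (y : E) :
    ContDiffAt ℝ ∞ (fun p : E × E => curvatureForm (b p.1) A m p.1 p.2) (z, y) := by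
  refine ContDiffAt.const_smul _ (contDiffAt_alt fun v => contDiffAt_alt fun w => ?_)
  have h1 : (fun p : E × E => CForm.ofScalar E (b p.1 (covNabla A A m p.1 p.2 v w) p.2))
      =ᶠ[𝓝 (z, y)] fun p => CForm.ofScalar E
        (realForm (b p.1) (covNabla A (fun p z y => A p z y w) m p.1 p.2 v) p.2) := by
    filter_upwards [(continuous_fst.tendsto (z, y)).eventually hA] with p hp
    rw [covNabla_clm_apply fun q v => (hp v q).2 p.2]
    rfl
  refine ContDiffAt.congr_of_eventuallyEq ?_ h1
  refine ((CForm.ofScalar E).restrictScalars ℝ).contDiff.contDiffAt.comp (z, y) ?_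
  exact ((ContDiffAt.comp (g := fun z => realForm (b z)) (f := Prod.fst) (z, y) hb
    contDiffAt_fst).clm_apply ((isWeylExpr_covNabla (hA.mono fun _ h => h w) hA.self_of_nhds v m).2
      y)).clm_apply contDiffAt_snd

/-- The component of weight `m` pairs components of `A` of total weight `m + 1`. -/
theorem curvature_congr {m : ℕ} (h : ∀ p ≤ m + 1, A p = A' p) (z y v w : E) :
    curvature A m z y v w = curvature A' m z y v w := by
  have h1 : ∀ v w, covNabla A (fun p z y => A p z y w) m z y v =
      covNabla A' (fun p z y => A' p z y w) m z y v := by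
    intro v w
    rw [covNabla_apply, covNabla_apply, h m m.le_succ]
    congr 1
    refine Finset.sum_congr rfl fun x hx => ?_
    rw [Finset.HasAntidiagonal.mem_antidiagonal] at hx
    rw [h x.1 (by omega), h x.2 (by omega)]
  rw [curvature, curvature, h1, h1]

/-- A new component of weight `m + 1` meets only `A 0 = -id` in weight `m`, so it changes the
curvature by a Koszul differential and no quadratic term appears. -/
theorem curvature_add_top {m : ℕ} (h : ∀ p ≤ m, A p = A' p) (hA0 : ∀ y v, A 0 z y v = - v)
    (htop : ∀ y, A (m + 1) z y = 0) (y v w : E) :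
    curvature A' m z y v w = curvature A m z y v w -
      fderiv ℝ (fun y => A' (m + 1) z y w) y v + fderiv ℝ (fun y => A' (m + 1) z y v) y w := by
  have h0 : ∀ (w u : E), fderiv ℝ (fun y => A 0 z y w) y u = 0 := by
    intro w u
    rw [funext fun y => hA0 y w, fderiv_fun_const]
    rfl
  have h1 : ∀ v w, covNabla A' (fun p z y => A' p z y w) m z y v =
      covNabla A (fun p z y => A p z y w) m z y v - fderiv ℝ (fun y => A' (m + 1) z y w) y v := by
    intro v w
    rw [covNabla_apply, covNabla_apply, ← h m le_rfl, add_sub_assoc]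
    congr 1
    rw [eq_sub_iff_add_eq, ← eq_sub_iff_add_eq', ← Finset.sum_sub_distrib,
      Finset.sum_eq_single (m + 1, 0)]
    · have h2 : fderiv ℝ (fun y => A (m + 1) z y w) y = 0 := by
        have : (fun y => A (m + 1) z y w) = fun _ => 0 := funext fun y => by rw [htop]; rfl
        rw [this, fderiv_fun_const]
        rfl
      simp only [h2, ← h 0 m.zero_le, hA0, map_neg]
      simp
    · intro x hx hx'
      rw [Finset.HasAntidiagonal.mem_antidiagonal] at hx
      by_cases hx0 : x.1 = 0
      · simp only [hx0, ← h 0 m.zero_le, h0, sub_self]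
      · have h2 : x.2 ≠ 0 := fun h2 => hx' (Prod.ext (by change x.1 = m + 1; omega) h2)
        rw [h x.1 (by omega), h x.2 (by omega), sub_self]
    · simp
  rw [curvature, curvature, h1, h1]
  abel

theorem fderiv_eval {k r : ℕ} {P : E → CForm E k} (hP : IsHomogeneousPoly r P) (y u : E)
    (x : Fin k → E) : fderiv ℝ (fun y => P y x) y u = fderiv ℝ P y u x :=
  DFunLike.congr_fun (((CForm.eval x).restrictScalars ℝ).hasFDerivAt.comp y
    (hP.differentiableAt_real y).hasFDerivAt).fderiv u

theorem fderiv_fderiv_eval_comm {k r : ℕ} {P : E → CForm E k} (hP : IsHomogeneousPoly (r + 1) P)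
    (y v u : E) (x : Fin k → E) : fderiv ℝ (fun y => fderiv ℝ P y u x) y v =
      fderiv ℝ (fun y => fderiv ℝ P y v x) y u := by
  have hd : DifferentiableAt ℝ (fderiv ℝ P) y :=
    (contDiffAt_fderiv (hP.contDiff_real (n := ∞)).contDiffAt).differentiableAt (by simp)
  have h1 : ∀ u v, fderiv ℝ (fun y => fderiv ℝ P y u x) y v =
      fderiv ℝ (fderiv ℝ P) y v u x := by
    intro u v
    rw [fderiv_eval (hP.fderiv_apply u), ← fderiv_clm_apply_const hd]
  rw [h1, h1]
  refine congrArg (fun a : CForm E k => a x) ?_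
  exact ContDiffAt.isSymmSndFDerivAt (n := ∞) (hP.contDiff_real).contDiffAt (by
    rw [minSmoothness_of_isRCLikeNormedField]
    exact WithTop.coe_le_coe.2 (le_top : (2 : ℕ∞) ≤ ⊤)) v u

theorem form_fderiv_hamField
    {B M : Matrix (Fin (Module.finrank ℂ E)) (Fin (Module.finrank ℂ E)) ℂ} (hBM : B * M = 1)
    {b : E →L[ℂ] E →L[ℂ] ℂ}
    (hM : ∀ i j, M i j = b (Module.finBasis ℂ E i) (Module.finBasis ℂ E j))
    {P : E → CForm E 1} {r : ℕ} (hP : IsHomogeneousPoly (r + 1) P) (y w v u : E) :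
    b (fderiv ℝ (fun y => hamField B P y w) y v) u =
      2 * fderiv ℝ (fun y => fderiv ℝ P y u fun _ => w) y v := by
  have h1 := ((realForm b).hasFDerivAt.comp y
    ((isHomogeneousPoly_hamField (B := B) hP w).differentiableAt_real y).hasFDerivAt).clm_apply
      (hasFDerivAt_const u y)
  have h2 := DFunLike.congr_fun h1.fderiv v
  have h3 : (fun y => realForm b (hamField B P y w) u) =
      fun y => 2 * fderiv ℝ P y u fun _ => w :=
    funext fun y => hamField_form hBM hM hP y w u
  have h4 : DifferentiableAt ℝ (fun y => fderiv ℝ P y u fun _ => w) y :=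
    ((hP.fderiv_apply u).clm_comp (CForm.eval fun _ => w)).differentiableAt_real y
  have h5 := DFunLike.congr_fun (fderiv_const_mul h4 (2 : ℂ)) v
  rw [← h3] at h5
  refine Eq.trans ?_ (h2.symm.trans h5)
  simp [realForm_apply]

/-- Second derivatives of the Hamiltonian are symmetric, so the linearization of its field is
infinitesimally symplectic. -/
theorem hamField_fderiv_symm
    {B M : Matrix (Fin (Module.finrank ℂ E)) (Fin (Module.finrank ℂ E)) ℂ} (hBM : B * M = 1)
    {b : E →L[ℂ] E →L[ℂ] ℂ}
    (hM : ∀ i j, M i j = b (Module.finBasis ℂ E i) (Module.finBasis ℂ E j))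
    {P : E → CForm E 1} {r : ℕ} (hP : IsHomogeneousPoly (r + 1) P) (y w v u : E) :
    b (fderiv ℝ (fun y => hamField B P y w) y v) u =
      b (fderiv ℝ (fun y => hamField B P y w) y u) v := by
  rw [form_fderiv_hamField hBM hM hP, form_fderiv_hamField hBM hM hP, fderiv_fderiv_eval_comm hP]

/-- The correction of a connection that removes the lowest nonvanishing component of its
curvature. -/
theorem curvature_correction {b : E → E →L[ℂ] E →L[ℂ] ℂ} {m : ℕ}
    {B M : Matrix (Fin (Module.finrank ℂ E)) (Fin (Module.finrank ℂ E)) ℂ} (hBM : B * M = 1)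
    (hM : ∀ i j, M i j = b z (Module.finBasis ℂ E i) (Module.finBasis ℂ E j))
    (hnd : ∀ a, (∀ u, b z a u = 0) → a = 0)
    (hA : ∀ᶠ z' in 𝓝 z, ∀ v, IsWeylExpr (fun p z y => A p z y v) z')
    (hA0 : ∀ᶠ z' in 𝓝 z, ∀ y v, A 0 z' y v = - v)
    (hb : ContDiffAt ℝ ∞ (fun z => realForm (b z)) z) (hb' : ∀ u u', b z u u' = - b z u' u)
    (hσ : ∀ᶠ z' in 𝓝 z, ∀ p y w u' u, b z' (fderiv ℝ (fun y => A p z' y w) y u') u -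
      b z' (fderiv ℝ (fun y => A p z' y w) y u) u' =
        (if p = 1 then -1 else 0) * fderiv ℝ (fun z => b z u' u) z' w)
    (hF : ∀ᶠ z' in 𝓝 z, ∀ q ≤ m, ∀ y v w, curvature A q z' y v w = 0)
    (htop : ∀ y, A (m + 2) z y = 0) (h : ∀ p ≤ m + 1, A p = A' p)
    (hA' : ∀ y, A' (m + 2) z y = hamField B (fun y => (1 / 2 : ℂ) • CForm.totalDegreeInv 1 (m + 3)
      (CForm.contract y (curvatureForm (b z) A (m + 1) z y))) y) (y v w : E) :
    curvature A' (m + 1) z y v w = 0 := by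
  set H := curvatureForm (b z) A (m + 1) z with hH
  set F : E → E → E → E := fun v w y => curvature A (m + 1) z y v w with hFdef
  have hFh : ∀ v w, IsHomogeneousPoly (m + 1) (F v w) := fun v w =>
    (isWeylExpr_curvature hA v w (m + 1)).1
  have hHh : IsHomogeneousPoly (m + 2) H := curvatureForm_isHomogeneousPoly (b z) hA (m + 1)
  have hHv : ∀ y v w, H y ![v, w] = ((m + 2 : ℕ) : ℂ)⁻¹ * b z (F v w y) y := fun y v w =>
    curvatureForm_apply (b z) (fun p v => (hA.self_of_nhds v p).2 y) (m + 1) v w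
  have hham : ∀ y v w u u', b z (fderiv ℝ (F v w) y u') u = b z (fderiv ℝ (F v w) y u) u' :=
    fun y v w u u' => curvature_hamiltonian (fun p v => (hA.self_of_nhds v p).2 y) hb hb' hσ
      (m + 1) v w u u'
  -- `H` is the Hamiltonian of the curvature: the linearization of `F` is infinitesimally symplectic
  -- and `F` has degree `m + 1`, so differentiating `b(F, y)` gives `b(F, u)` once plus `m + 1`
  -- times. This explains the normalization by `m + 2`.
  have hdH : ∀ y u v w, fderiv ℝ H y u ![v, w] = b z (F v w y) u := by
    intro y u v w
    rw [← fderiv_eval hHh]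
    have h1 : (fun y => H y ![v, w]) = fun y => ((m + 2 : ℕ) : ℂ)⁻¹ * realForm (b z) (F v w y) y :=
      funext fun y => hHv y v w
    have h2 := (((realForm (b z)).hasFDerivAt.comp y
      ((hFh v w).differentiableAt_real y).hasFDerivAt).clm_apply (hasFDerivAt_id y)).const_mul
        (((m + 2 : ℕ) : ℂ)⁻¹)
    rw [h1]
    refine (DFunLike.congr_fun h2.fderiv u).trans ?_
    change ((m + 2 : ℕ) : ℂ)⁻¹ * (b z (F v w y) u + b z (fderiv ℝ (F v w) y u) y) = _
    rw [← hham y v w u y, (hFh v w).fderiv_apply_self, map_smul, smul_apply, smul_eq_mul]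
    have : ((m + 2 : ℕ) : ℂ) ≠ 0 := Nat.cast_ne_zero.2 (by omega)
    field_simp
    push_cast
    ring
  have hclosed : ∀ y, alternatizeUncurryFin (fderiv ℝ H y) = 0 := by
    intro y
    refine CForm.ext_three fun u v w => ?_
    rw [alt_apply_three, CForm.apply_swap (fderiv ℝ H y v), hdH, hdH, hdH, sub_neg_eq_add]
    -- Euler's identity trades the values of `F` for its derivatives, for which the Bianchi identity
    -- is available.
    have h1 : ∀ u v w, ((m + 1 : ℕ) : ℂ) * b z (F v w y) u = b z (fderiv ℝ (F v w) y u) y := by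
      intro u v w
      rw [← hham y v w u y, (hFh v w).fderiv_apply_self, map_smul, smul_apply, smul_eq_mul]
    have h2 := congrArg (fun a => b z a y) (fderiv_curvature_cyclic hA hA0 hF y u v w)
    simp only [map_add, FunLike.coe_add, Pi.add_apply, map_zero] at h2
    have h3 : ((m + 1 : ℕ) : ℂ) ≠ 0 := Nat.cast_ne_zero.2 (by omega)
    apply mul_left_cancel₀ h3
    rw [mul_add, mul_add, h1, h1, h1]
    refine h2.trans ?_
    simp
  set K : E → CForm E 1 := fun y => CForm.totalDegreeInv 1 (m + 3) (CForm.contract y (H y)) with hK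
  have hKh : IsHomogeneousPoly (m + 3) K :=
    (koszulHomotopy_isHomogeneousPoly hHh).clm_comp (CForm.totalDegreeInv 1 (m + 3))
  have hdK : ∀ y v w, fderiv ℝ K y v (fun _ => w) - fderiv ℝ K y w (fun _ => v) = H y ![v, w] := by
    intro y v w
    rw [← alt_apply_two]
    exact DFunLike.congr_fun (alt_fderiv_totalDegreeInv hHh hclosed y) _
  have hJh := hKh.fun_smul (1 / 2 : ℂ)
  -- The factor one half in the correction offsets the factor two in `hamField`.
  have hfield' : ∀ v w u, b z (fderiv ℝ (fun y => A' (m + 2) z y w) y v) u =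
      fderiv ℝ (fun y => fderiv ℝ K y v fun _ => w) y u := by
    intro v w u
    have h1 : ∀ y u, fderiv ℝ (fun y => (1 / 2 : ℂ) • K y) y u = (1 / 2 : ℂ) • fderiv ℝ K y u := by
      intro y u
      rw [fderiv_fun_const_smul (hKh.differentiableAt_real y)]
      rfl
    have h2 : DifferentiableAt ℝ (fun y => fderiv ℝ K y v fun _ => w) y :=
      ((hKh.fderiv_apply v).clm_comp (CForm.eval fun _ => w)).differentiableAt_real y
    have h3 := DFunLike.congr_fun (fderiv_const_mul h2 (1 / 2 : ℂ)) u
    simp only [hA']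
    rw [form_fderiv_hamField hBM hM hJh, fderiv_fderiv_eval_comm hJh]
    simp only [h1, ContinuousAlternatingMap.smul_apply, smul_eq_mul]
    rw [h3]
    rw [smul_apply, smul_eq_mul]
    ring
  rw [curvature_add_top h hA0.self_of_nhds htop]
  -- Paired with `u`, the change of the curvature is the derivative along `u` of `δK = H`, which
  -- equals that of the old curvature. Nondegeneracy concludes.
  refine hnd _ fun u => ?_
  rw [map_add, map_sub, FunLike.coe_add, Pi.add_apply, FunLike.coe_sub, Pi.sub_apply, hfield',
    hfield']
  have h1 : ∀ v w, DifferentiableAt ℝ (fun y => fderiv ℝ K y v fun _ => w) y := fun v w =>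
    (((hKh.fderiv_apply v).clm_comp (CForm.eval fun _ => w))).differentiableAt_real y
  have h2 := fderiv_fun_sub (h1 v w) (h1 w v)
  have h3 : (fun y => (fderiv ℝ K y v fun _ => w) - fderiv ℝ K y w fun _ => v) =
      fun y => H y ![v, w] := funext fun y => hdK y v w
  rw [h3] at h2
  have h4 := DFunLike.congr_fun h2 u
  rw [fderiv_eval hHh, hdH] at h4
  rw [sub_add]
  refine sub_eq_zero.2 (h4.trans ?_)
  rfl

end Correction
end HolWeyl

namespace HolWeyl
open ContinuousAlternatingMap (alternatizeUncurryFin alternatizeUncurryFinCLM alternatizeUncurryFin_apply)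
open Finset.HasAntidiagonal (antidiagonal)

/-! ### The square of a graded connection on forms. -/

section Square

variable {E : Type} [NormedAddCommGroup E] [NormedSpace ℂ E]
  {V : Type} [NormedAddCommGroup V] [NormedSpace ℝ V] {A : ℕ → E → E → E →L[ℝ] E}

theorem covNabla_congr {S T : ℕ → E → E → V} {z : E}
    (h : ∀ᶠ z' in 𝓝 z, ∀ q y, S q z' y = T q z' y) (r : ℕ) (y : E) :
    covNabla A S r z y = covNabla A T r z y := by
  have h1 : (fun z => S r z y) =ᶠ[𝓝 z] fun z => T r z y := h.mono fun _ h => h r y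
  have h2 : ∀ q, S q z = T q z := fun q => funext fun y => h.self_of_nhds q y
  rw [covNabla, covNabla, h1.fderiv_eq]
  simp only [h2]

theorem covNabla_clm_comp {W : Type} [NormedAddCommGroup W] [NormedSpace ℝ W]
    {S : ℕ → E → E → V} {z y : E}
    (hS : ∀ q, ContDiffAt ℝ ∞ (fun p : E × E => S q p.1 p.2) (z, y)) (L : V →L[ℝ] W) (r : ℕ) :
    covNabla A (fun r z y => L (S r z y)) r z y = L.comp (covNabla A S r z y) := by
  have h1 : DifferentiableAt ℝ (fun z => S r z y) z :=
    (ContDiffAt.comp (g := fun q : E × E => S r q.1 q.2) (f := fun z => (z, y)) z (hS r)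
      (contDiffAt_id.prodMk contDiffAt_const)).differentiableAt (by simp)
  have h2 : ∀ q, DifferentiableAt ℝ (S q z) y := fun q =>
    (ContDiffAt.comp (g := fun q' : E × E => S q q'.1 q'.2) (f := fun y => (z, y)) y (hS q)
      (contDiffAt_const.prodMk contDiffAt_id)).differentiableAt (by simp)
  have h3 : fderiv ℝ (fun z => L (S r z y)) z = L.comp (fderiv ℝ (fun z => S r z y) z) :=
    (L.hasFDerivAt.comp z h1.hasFDerivAt).fderiv
  have h4 : ∀ q, fderiv ℝ (fun y => L (S q z y)) y = L.comp (fderiv ℝ (S q z) y) := fun q =>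
    (L.hasFDerivAt.comp y (h2 q).hasFDerivAt).fderiv
  refine ContinuousLinearMap.ext fun v => ?_
  rw [covNabla_apply, ContinuousLinearMap.comp_apply, covNabla_apply, map_add, map_sum, h3]
  simp only [h4]
  rfl

variable [FiniteDimensional ℂ E]

/-- Alternatization is a constant linear map, so it passes through `covNabla`; the square becomes a
double alternatization, which sees only the commutator. -/
theorem alt_covNabla_alt {k : ℕ} {S : ℕ → E → E → CForm E k} {z y : E}
    (hS : ∀ q, ContDiffAt ℝ ∞ (fun p : E × E => S q p.1 p.2) (z, y))
    (hA : ∀ p v, ContDiffAt ℝ ∞ (fun q : E × E => A p q.1 q.2 v) (z, y)) (r : ℕ) :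
    alternatizeUncurryFin (covNabla A (fun r z y => alternatizeUncurryFin (covNabla A S r z y))
      r z y) = alternatizeUncurryFin (alternatizeUncurryFinCLM ℝ E ℂ ∘L
        covNabla A (covNabla A S) r z y) := by
  refine congrArg alternatizeUncurryFin ?_
  exact covNabla_clm_comp (S := covNabla A S)
    (fun q => contDiffAt_clm fun v => contDiffAt_covNabla hS (fun p => hA p v) q)
    (alternatizeUncurryFinCLM ℝ E ℂ) r

theorem covNabla_covNabla_sub {S : ℕ → E → E → V} {z y : E}
    (hS : ∀ q, ContDiffAt ℝ ∞ (fun p : E × E => S q p.1 p.2) (z, y))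
    (hA : ∀ p v, ContDiffAt ℝ ∞ (fun q : E × E => A p q.1 q.2 v) (z, y))
    (hS0 : ∀ᶠ p in 𝓝 (z, y), fderiv ℝ (S 0 p.1) p.2 = 0) (hA0 : ∀ y', A 0 z y' = A 0 z 0)
    (r : ℕ) (v w : E) :
    covNabla A (covNabla A S) r z y v w - covNabla A (covNabla A S) r z y w v =
      ∑ u ∈ antidiagonal (r + 1), fderiv ℝ (S u.1 z) y (curvature A u.2 z y v w) := by
  have h : ∀ p v, ContDiffAt ℝ ∞ (fun q : E × E => covNabla A S p q.1 q.2 v) (z, y) :=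
    fun p v => contDiffAt_covNabla hS (fun q => hA q v) p
  rw [covNabla_clm_apply h, covNabla_clm_apply h, covNabla_commutator hS hA hS0 hA0]

end Square

/-! ### The operator `D` modulo `ħ` as a graded connection. -/

section WeylConnection

variable {E : Type} [NormedAddCommGroup E] [NormedSpace ℂ E] [FiniteDimensional ℂ E]
  {X : Type} [TopologicalSpace X] [ChartedSpace E X] [IsManifold 𝓘(ℂ, E) ω X]
  (Ω : HolomorphicSymplecticForm E X) (cov : TangentConnection E X)

/-- The connection on the fibres given by the operator `∇ - δ + (1/ħ) [I, -]` modulo `ħ`, in the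
coordinates `chartAt E x₀`. -/
noncomputable def weylConnection (I : X → QuantumWeylFibre E 1) (x₀ : X) :
    ℕ → E → E → E →L[ℝ] E
  | 0, _, _ => - ContinuousLinearMap.id ℝ E
  | 1, z, y => - connectionForm cov x₀ z y
  | p + 2, z, y => hamField (Ω.poisson x₀ z) (weylInChart (fun x => I x 0) x₀ (p + 3) z) y

variable {Ω cov} {I : X → QuantumWeylFibre E 1}

theorem isWeylExpr_of_target {k : ℕ} {s : X → WeylFibre E k} {x₀ : X} {z : E}
    (hz : z ∈ (chartAt E x₀).target) (hs : IsWeylSectionAt s ((chartAt E x₀).symm z)) :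
    IsWeylExpr (weylInChart s x₀) z := by
  have := (isWeylSectionAt_iff_of_mem s ((chartAt E x₀).map_target hz)).1 hs
  rwa [(chartAt E x₀).right_inv hz] at this

theorem eventually_target {x₀ : X} {z : E} (hz : z ∈ (chartAt E x₀).target) :
    ∀ᶠ z' in 𝓝 z, z' ∈ (chartAt E x₀).target := (chartAt E x₀).open_target.mem_nhds hz

section

variable [T2Space X]

theorem isWeylExpr_weylConnection (hc : IsSymplecticConnection Ω cov)
    (hI : IsInteraction I) {x₀ : X} {z : E} (hz : z ∈ (chartAt E x₀).target) (v : E) :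
    IsWeylExpr (fun p z y => weylConnection Ω cov I x₀ p z y v) z := by
  have hP := isWeylExpr_of_target hz (hI.1 _ 0)
  rintro (_ | _ | p)
  · exact ⟨IsHomogeneousPoly.const (- v), fun y => contDiffAt_const⟩
  · refine ⟨?_, fun y => (hc.contDiffAt_connectionForm hz y v).neg⟩
    obtain ⟨T, hT⟩ := hc.connectionForm_clm hz v
    change IsHomogeneousPoly 1 fun y => - connectionForm cov x₀ z y v
    simp only [hT]
    exact (IsHomogeneousPoly.clm T).fun_neg
  · refine ⟨isHomogeneousPoly_hamField (hP (p + 3)).1 v, fun y => ?_⟩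
    change ContDiffAt ℝ ∞ (fun q : E × E => hamField (Ω.poisson x₀ q.1)
      (weylInChart (fun x => I x 0) x₀ (p + 3) q.1) q.2 v) (z, y)
    simp only [hamField_apply]
    refine ContDiffAt.sum fun i _ => ContDiffAt.sum fun j _ =>
      ContDiffAt.fun_smul (𝕜 := ℝ) ((contDiffAt_const.mul ?_).mul ?_) contDiffAt_const
    · exact ContDiffAt.comp (g := fun z => Ω.poisson x₀ z i j) (f := Prod.fst) (z, y)
        (Ω.contDiffAt_poisson hz i j) contDiffAt_fst
    · exact ((CForm.eval fun _ : Fin 1 => v).restrictScalars ℝ).contDiff.contDiffAt.comp (z, y)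
        (contDiffAt_fderiv_snd ((hP (p + 3)).2 y) contDiffAt_const)

theorem contDiffAt_weylConnection (hc : IsSymplecticConnection Ω cov)
    (hI : IsInteraction I) {x₀ : X} {z : E} (hz : z ∈ (chartAt E x₀).target) (y : E) (p : ℕ)
    (v : E) : ContDiffAt ℝ ∞ (fun q : E × E => weylConnection Ω cov I x₀ p q.1 q.2 v) (z, y) :=
  (isWeylExpr_weylConnection hc hI hz v p).2 y

/-- The terms `-δ`, `-Γ` and the Poisson bracket with `I` are all derivations along fibre vector
fields, hence fit into one graded connection. -/
theorem weylInChart_classicalD (hI : IsInteraction I) {k : ℕ} {s : X → WeylFibre E k} {x₀ : X}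
    {z : E} (hz : z ∈ (chartAt E x₀).target) (hs : IsWeylSectionAt s ((chartAt E x₀).symm z))
    (r : ℕ) (y : E) : weylInChart (classicalD Ω cov I k s) x₀ r z y =
      alternatizeUncurryFin (covNabla (weylConnection Ω cov I x₀) (weylInChart s x₀) r z y) := by
  have h := weylInChart_fedosovD Ω cov hz (hI.1 _) (constInHbar_holds hs) 0 r y
  have hS := isWeylExpr_of_target hz hs
  set P := weylInChart (fun x => I x 0) x₀ with hP
  have hP0 : ∀ q < 3, P q z = 0 := by
    intro q hq
    funext y
    rw [hP, weylInChart, hI.2 _ 0 q (by omega)]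
    rfl
  set S := weylInChart s x₀ with hSdef
  have h1 : weylInChart (classicalD Ω cov I k s) x₀ r z y =
      alternatizeUncurryFin (fderiv ℝ (fun z => S r z y) z -
        (fderiv ℝ (S r z) y).comp (connectionForm cov x₀ z y)) -
      alternatizeUncurryFin (fderiv ℝ (S (r + 1) z) y) + ∑ w ∈ antidiagonal (r + 2),
        (2 : ℂ) • poissonTerm (Ω.poisson x₀ z) 1 (P w.1 z) (S w.2 z) y := by
    refine h.trans ?_
    rw [Finset.sum_range_succ, Finset.sum_range_one]
    simp
    norm_num
    rfl
  have h2 : ∑ w ∈ antidiagonal (r + 2), (2 : ℂ) • poissonTerm (Ω.poisson x₀ z) 1 (P w.1 z)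
      (S w.2 z) y = alternatizeUncurryFin (∑ w ∈ antidiagonal (r + 2),
        (fderiv ℝ (S w.2 z) y).comp (hamField (Ω.poisson x₀ z) (P w.1 z) y)) := by
    rw [← CForm.altCLM_apply, map_sum]
    exact Finset.sum_congr rfl fun w _ => poissonTerm_one _ _ (hS w.2).1 y
  have hham : ∀ q < 3, hamField (Ω.poisson x₀ z) (P q z) y = 0 := by
    intro q hq
    rw [hP0 q hq]
    refine ContinuousLinearMap.ext fun v => ?_
    rw [hamField_apply]
    have : fderiv ℝ (0 : E → CForm E 1) y = 0 := fderiv_const_apply _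
    rw [this]
    simp
  rw [h1, h2, ← alt_sub, ← alt_add, covNabla]
  refine congrArg alternatizeUncurryFin ?_
  rw [sub_sub, sub_add, sub_eq_add_neg]
  congr 1
  -- Matching of indices: the weights of `A` zero and one are split off on one side, and the
  -- vanishing weights zero, one and two of `I` on the other. What is left agrees after a shift by
  -- three.
  rw [Finset.Nat.sum_antidiagonal_succ' (n := r), Finset.Nat.sum_antidiagonal_succ (n := r + 1),
    hham 0 (by omega), Finset.Nat.sum_antidiagonal_succ (n := r), zero_add, hham 1 (by omega)]
  cases r with
  | zero =>
    simp only [Finset.HasAntidiagonal.antidiagonal_zero, Finset.sum_singleton]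
    simp only [zero_add, hham 2 (by omega)]
    simp only [weylConnection]
    refine ContinuousLinearMap.ext fun v => ?_
    simp
  | succ r =>
    rw [Finset.Nat.sum_antidiagonal_succ (n := r), Finset.Nat.sum_antidiagonal_succ' (n := r),
      zero_add, hham 2 (by omega), ← Finset.Nat.sum_antidiagonal_swap (n := r)]
    simp only [weylConnection, Prod.fst_swap, Prod.snd_swap]
    refine ContinuousLinearMap.ext fun v => ?_
    simp [add_assoc]
    abel

theorem weylInChart_classicalD_classicalD (hc : IsSymplecticConnection Ω cov)
    (hI : IsInteraction I) {k : ℕ} {s : X → WeylFibre E k} {x₀ : X}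
    {z : E} (hz : z ∈ (chartAt E x₀).target)
    (hs : ∀ᶠ x' in 𝓝 ((chartAt E x₀).symm z), IsWeylSectionAt s x') (r : ℕ) (y : E) :
    weylInChart (classicalD Ω cov I (k + 1) (classicalD Ω cov I k s)) x₀ r z y =
      alternatizeUncurryFin (alternatizeUncurryFinCLM ℝ E ℂ ∘L
        covNabla (weylConnection Ω cov I x₀) (covNabla (weylConnection Ω cov I x₀)
          (weylInChart s x₀)) r z y) := by
  have hS := isWeylExpr_of_target hz hs.self_of_nhds
  rw [weylInChart_classicalD hI hz ((isLocalOperator_classicalD hc hI.1 k).holds hs),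
    ← alt_covNabla_alt (fun q => (hS q).2 y)
      (fun p v => contDiffAt_weylConnection hc hI hz y p v)]
  refine congrArg alternatizeUncurryFin (covNabla_congr ?_ r y)
  have h1 := (chartAt E x₀).continuousAt_symm hz
  filter_upwards [eventually_target hz, h1.eventually hs] with z' hz' hs' q y'
  exact weylInChart_classicalD hI hz' hs' q y'

theorem weylInChart_fderiv_zero {k : ℕ} {s : X → WeylFibre E k} {x₀ : X} {z : E}
    (hz : z ∈ (chartAt E x₀).target)
    (hs : ∀ᶠ x' in 𝓝 ((chartAt E x₀).symm z), IsWeylSectionAt s x') (y : E) :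
    ∀ᶠ p in 𝓝 (z, y), fderiv ℝ (weylInChart s x₀ 0 p.1) p.2 = 0 := by
  have h1 := (chartAt E x₀).continuousAt_symm hz
  filter_upwards [(continuous_fst.tendsto (z, y)).eventually ((eventually_target hz).and
    (h1.eventually hs))] with p hp
  exact ContinuousLinearMap.ext fun v =>
    (isWeylExpr_of_target hp.1 hp.2 0).1.fderiv_apply_zero _ _

/-- The operator of a connection without curvature is flat. -/
theorem isFlatModHbar_of_curvature_eq_zero (hc : IsSymplecticConnection Ω cov)
    (hI : IsInteraction I) (h : ∀ (x₀ : X), ∀ z ∈ (chartAt E x₀).target, ∀ m y v w,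
      curvature (weylConnection Ω cov I x₀) m z y v w = 0) : IsFlatModHbar Ω cov I := by
  intro k s x hs
  have h0 : (fun x' => fedosovD Ω cov I s x' 0) = classicalD Ω cov I k fun x' => s x' 0 :=
    funext fun x' => fedosovD_zero_eq_classicalD Ω cov I s x'
  have hs0 : ∀ᶠ x' in 𝓝 x, IsWeylSectionAt (fun x' => s x' 0) x' := hs.mono fun _ h => h 0
  have hz := mem_chart_target E x
  rw [fedosovD_zero_eq_classicalD, h0]
  funext r y
  rw [← weylInChart_self (classicalD Ω cov I (k + 1) _) x r y]
  rw [← (chartAt E x).left_inv (mem_chart_source E x)] at hs0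
  rw [weylInChart_classicalD_classicalD hc hI hz hs0]
  have hS := isWeylExpr_of_target hz hs0.self_of_nhds
  -- Vanishing curvature makes the iterated covariant derivative symmetric in its two directions,
  -- and a double alternatization kills it.
  refine ContinuousAlternatingMap.alternatizeUncurryFin_alternatizeUncurryFinCLM_comp_of_symmetric
    fun v w => ?_
  rw [← sub_eq_zero, covNabla_covNabla_sub (fun q => (hS q).2 y)
    (fun p v => contDiffAt_weylConnection hc hI hz y p v) (weylInChart_fderiv_zero hz hs0 y)
    fun _ => rfl]
  exact Finset.sum_eq_zero fun u _ => by rw [h x _ hz, map_zero]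

end

end WeylConnection
end HolWeyl

namespace HolWeyl
open ContinuousAlternatingMap (alternatizeUncurryFin alternatizeUncurryFinCLM alternatizeUncurryFin_apply)
open Finset.HasAntidiagonal (antidiagonal)

/-! ### Independence of the curvature from coordinates. -/

section Naturality

variable {E : Type} [NormedAddCommGroup E] [NormedSpace ℂ E] [FiniteDimensional ℂ E]
  {X : Type} [TopologicalSpace X] [ChartedSpace E X] [IsManifold 𝓘(ℂ, E) ω X]

/-- The section of weight one, near `x₀`, given by a linear functional in the coordinates
`chartAt E x₀`. -/
noncomputable def linearSection (x₀ : X) (f : E →L[ℂ] ℂ) (x : X) : WeylFibre E 0 :=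
  fun r y => if r = 1 then CForm.ofScalar E (f (jacInv x₀ x y)) else 0

theorem weylInChart_linearSection {x₀ : X} (f : E →L[ℂ] ℂ) {z : E}
    (hz : z ∈ (chartAt E x₀).target) (r : ℕ) (y : E) :
    weylInChart (linearSection x₀ f) x₀ r z y =
      if r = 1 then CForm.ofScalar E (f y) else 0 := by
  rw [weylInChart, linearSection]
  by_cases hr : r = 1
  · rw [if_pos hr, if_pos hr, jacInv_jac ((chartAt E x₀).map_target hz)]
    rfl
  · rw [if_neg hr, if_neg hr]
    rfl

theorem isWeylSectionAt_linearSection {x₀ x : X} (f : E →L[ℂ] ℂ)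
    (hx : x ∈ (chartAt E x₀).source) : IsWeylSectionAt (linearSection x₀ f) x := by
  rw [isWeylSectionAt_iff_of_mem _ hx]
  have h1 : IsWeylExpr (fun r (_ : E) y => if r = 1 then CForm.ofScalar E (f y) else 0)
      (chartAt E x₀ x) := by
    intro r
    by_cases hr : r = 1
    · subst hr
      simp only [if_true]
      exact ⟨IsHomogeneousPoly.clm ((CForm.ofScalar E).comp f), fun y =>
        (((CForm.ofScalar E).comp f).restrictScalars ℝ).contDiff.contDiffAt.comp _ contDiffAt_snd⟩
    · simp only [if_neg hr]
      exact ⟨IsHomogeneousPoly.zero r, fun y => contDiffAt_const⟩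
  refine isWeylExpr_of_eventually h1 ?_
  filter_upwards [eventually_target ((chartAt E x₀).map_source hx)] with z hz r y
  exact weylInChart_linearSection f hz r y

variable [T2Space X] {Ω : HolomorphicSymplecticForm E X} {cov : TangentConnection E X}
  {I : X → QuantumWeylFibre E 1}

/-- `D²` is the derivation along the curvature; on a function linear in `y`, which lives in weight
one only, it returns that function applied to the curvature. Since `D²` is defined globally, this
tests the curvature in any chart. -/
theorem classicalD_classicalD_linearSection (hc : IsSymplecticConnection Ω cov)
    (hI : IsInteraction I) {x₀ x₁ : X} (f : E →L[ℂ] ℂ) {z : E}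
    (hz : z ∈ (chartAt E x₁).target) (hz' : (chartAt E x₁).symm z ∈ (chartAt E x₀).source)
    {g : E →L[ℂ] ℂ} (hg : ∀ y, weylInChart (linearSection x₀ f) x₁ 1 z y = CForm.ofScalar E (g y))
    (r : ℕ) (y v w : E) :
    weylInChart (classicalD Ω cov I 1 (classicalD Ω cov I 0 (linearSection x₀ f))) x₁ r z y ![v, w]
      = g (curvature (weylConnection Ω cov I x₁) r z y v w) := by
  have hs : ∀ᶠ x' in 𝓝 ((chartAt E x₁).symm z), IsWeylSectionAt (linearSection x₀ f) x' := by
    filter_upwards [(chartAt E x₀).open_source.mem_nhds hz'] with x' hx'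
    exact isWeylSectionAt_linearSection f hx'
  have hS := isWeylExpr_of_target hz hs.self_of_nhds
  rw [weylInChart_classicalD_classicalD hc hI hz hs, alt_apply_two]
  have h1 : ∀ (L : E →L[ℝ] CForm E 0) (u : E),
      alternatizeUncurryFin L (fun _ => u) = L u Fin.elim0 := by
    intro L u
    rw [alternatizeUncurryFin_apply, Fin.sum_univ_one]
    simp only [Fin.val_zero, pow_zero, one_smul]
    exact congrArg _ (Subsingleton.elim _ _)
  have h2 := covNabla_covNabla_sub (fun q => (hS q).2 y)
    (fun p v => contDiffAt_weylConnection hc hI hz y p v) (weylInChart_fderiv_zero hz hs y)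
    (fun _ => rfl) r v w
  refine ((congrArg₂ (· - ·) (h1 _ w) (h1 _ v)).trans
    (congrArg (fun a : CForm E 0 => a Fin.elim0) h2)).trans ?_
  rw [Finset.sum_eq_single (1, r)]
  · have h3 : weylInChart (linearSection x₀ f) x₁ 1 z = fun y => (CForm.ofScalar E).comp g y :=
      funext hg
    have h4 := (((CForm.ofScalar E).comp g).restrictScalars ℝ).hasFDerivAt (x := y)
    change fderiv ℝ (weylInChart (linearSection x₀ f) x₁ 1 z) y _ _ = _
    rw [h3]
    exact congrArg (fun a : E →L[ℝ] CForm E 0 => a _ Fin.elim0) h4.fderiv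
  · intro u hu hu'
    rw [Finset.HasAntidiagonal.mem_antidiagonal] at hu
    have h3 : u.1 ≠ 1 := fun h => hu' (Prod.ext h (by change u.2 = r; omega))
    have h4 : weylInChart (linearSection x₀ f) x₁ u.1 z = fun _ => 0 := by
      funext y
      rw [weylInChart, linearSection, if_neg h3]
      rfl
    rw [h4, fderiv_fun_const]
    rfl
  · intro h
    exact absurd (Finset.HasAntidiagonal.mem_antidiagonal.2 (Nat.add_comm 1 r)) h

/-- The curvature is a tensor. -/
theorem jac_curvature (hc : IsSymplecticConnection Ω cov) (hI : IsInteraction I) {x₀ x : X}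
    (hx : x ∈ (chartAt E x₀).source) (r : ℕ) (y v w : E) :
    jac x₀ x (curvature (weylConnection Ω cov I x₀) r (chartAt E x₀ x) y v w) =
      curvature (weylConnection Ω cov I x) r (chartAt E x x) (jac x₀ x y) (jac x₀ x v)
        (jac x₀ x w) := by
  have hz := (chartAt E x₀).map_source hx
  have h0 := (chartAt E x₀).left_inv hx
  -- The same form, `D²` of the section given by `f`, is computed in the chart at `x₀` and in the
  -- chart at `x`.
  have key : ∀ f : E →L[ℂ] ℂ, f (curvature (weylConnection Ω cov I x₀) r (chartAt E x₀ x) y v w) =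
      f (jacInv x₀ x (curvature (weylConnection Ω cov I x) r (chartAt E x x) (jac x₀ x y)
        (jac x₀ x v) (jac x₀ x w))) := by
    intro f
    have h1 := classicalD_classicalD_linearSection hc hI (x₁ := x₀) f hz (by rwa [h0]) (g := f)
      (fun y => weylInChart_linearSection f hz 1 y) r y v w
    have h2 := classicalD_classicalD_linearSection hc hI (x₀ := x₀) (x₁ := x) f
      (mem_chart_target E x) (by rwa [(chartAt E x).left_inv (mem_chart_source E x)])
      (g := f.comp (jacInv x₀ x)) (fun y => weylInChart_self _ _ _ _) r (jac x₀ x y) (jac x₀ x v)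
      (jac x₀ x w)
    refine h1.symm.trans (Eq.trans ?_ h2)
    rw [weylInChart_self, weylInChart, h0]
    have hv : jac (E := E) x₀ x ∘ ![v, w] = ![jac x₀ x v, jac x₀ x w] := by
      funext i
      fin_cases i <;> rfl
    rw [← hv]
    rfl
  have h3 : curvature (weylConnection Ω cov I x₀) r (chartAt E x₀ x) y v w =
      jacInv x₀ x (curvature (weylConnection Ω cov I x) r (chartAt E x x) (jac x₀ x y)
        (jac x₀ x v) (jac x₀ x w)) := by
    rw [← sum_coord (curvature (weylConnection Ω cov I x₀) r (chartAt E x₀ x) y v w),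
      ← sum_coord (jacInv x₀ x _)]
    exact Finset.sum_congr rfl fun i _ => by rw [key]
  rw [h3, jac_jacInv hx]

theorem curvatureForm_pullback (hc : IsSymplecticConnection Ω cov) (hI : IsInteraction I)
    {x₀ x : X} (hx : x ∈ (chartAt E x₀).source) (m : ℕ) (y : E) :
    curvatureForm (Ω.bilin x₀ (chartAt E x₀ x)) (weylConnection Ω cov I x₀) m (chartAt E x₀ x) y =
      (curvatureForm (Ω.bilin x (chartAt E x x)) (weylConnection Ω cov I x) m (chartAt E x x)
        (jac x₀ x y)).pullback (jac x₀ x) := by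
  refine CForm.ext_two fun v w => ?_
  have h1 : (curvatureForm (Ω.bilin x (chartAt E x x)) (weylConnection Ω cov I x) m
      (chartAt E x x) (jac x₀ x y)).pullback (jac x₀ x) ![v, w] =
      curvatureForm (Ω.bilin x (chartAt E x x)) (weylConnection Ω cov I x) m (chartAt E x x)
        (jac x₀ x y) ![jac x₀ x v, jac x₀ x w] := by
    rw [CForm.pullback_apply]
    congr 1
    funext i
    fin_cases i <;> rfl
  rw [h1, curvatureForm_apply _ fun p v => contDiffAt_weylConnection hc hI
      ((chartAt E x₀).map_source hx) y p v,
    curvatureForm_apply _ fun p v => contDiffAt_weylConnection hc hI (mem_chart_target E x) _ p v,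
    ← jac_curvature hc hI hx, Ω.bilin_chart hx, Ω.bilin_self]

end Naturality

/-! ### Recursive solution of the flatness equation. -/

section Existence

variable {E : Type} [NormedAddCommGroup E] [NormedSpace ℂ E] [FiniteDimensional ℂ E]
  {X : Type} [TopologicalSpace X] [ChartedSpace E X] [IsManifold 𝓘(ℂ, E) ω X]
  (Ω : HolomorphicSymplecticForm E X) (cov : TangentConnection E X)

/-- The correction of weight `m + 3` that removes the component of weight `m + 1` of the
curvature. -/
noncomputable def correctionTerm (I : X → QuantumWeylFibre E 1) (m : ℕ) (x : X) (y : E) :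
    CForm E 1 :=
  (1 / 2 : ℂ) • CForm.totalDegreeInv 1 (m + 3) (CForm.contract y
    (curvatureForm (Ω.bilin x (chartAt E x x)) (weylConnection Ω cov I x) (m + 1)
      (chartAt E x x) y))

/-- The approximations, up to weight `m + 2`, to a solution of the Fedosov equation. -/
noncomputable def approxInteraction : ℕ → X → QuantumWeylFibre E 1
  | 0 => 0
  | m + 1 => fun x j r => if j = 0 ∧ r = m + 3 then correctionTerm Ω cov (approxInteraction m) m x
      else approxInteraction m x j r

/-- A solution of the Fedosov equation. -/
noncomputable def flatInteraction (x : X) : QuantumWeylFibre E 1 :=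
  fun j r => if j = 0 then approxInteraction Ω cov r x 0 r else 0

variable {Ω cov}

theorem approxInteraction_of_le (m : ℕ) (x : X) (j r : ℕ) (h : m + 3 ≤ r) :
    approxInteraction Ω cov m x j r = 0 := by
  induction m with
  | zero => rfl
  | succ m ih =>
    exact (if_neg (by omega : ¬ (j = 0 ∧ r = m + 3))).trans (ih (by omega))

theorem approxInteraction_stable {m r : ℕ} (h : r ≤ m) (x : X) (j : ℕ) :
    approxInteraction Ω cov m x j r = approxInteraction Ω cov r x j r := by
  induction m, h using Nat.le_induction with
  | base => rfl
  | succ m hm ih => exact (if_neg (by omega : ¬ (j = 0 ∧ r = m + 3))).trans ih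

theorem weylConnection_congr {I I' : X → QuantumWeylFibre E 1} {p : ℕ}
    (h : ∀ x, I x 0 (p + 1) = I' x 0 (p + 1)) (x₀ : X) :
    weylConnection Ω cov I x₀ p = weylConnection Ω cov I' x₀ p := by
  funext z y
  rcases p with _ | _ | p
  · rfl
  · rfl
  · have : weylInChart (fun x => I x 0) x₀ (p + 3) z =
        weylInChart (fun x => I' x 0) x₀ (p + 3) z := by
      funext y
      rw [weylInChart, weylInChart, h]
    rw [weylConnection, weylConnection, this]

theorem contDiffAt_realForm_bilin {x₀ : X} {z : E} (hz : z ∈ (chartAt E x₀).target) :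
    ContDiffAt ℝ ∞ (fun z => realForm (Ω.bilin x₀ z)) z :=
  contDiffAt_clm fun u => contDiffAt_clm fun v => Ω.contDiffAt_bilin_apply hz u v

variable [T2Space X] {I : X → QuantumWeylFibre E 1}

/-- The compatibility required by `curvature_hamiltonian`: constants in weight zero, `∇ω = 0` in
weight one, Hamiltonian fields in the higher weights. -/
theorem weylConnection_form_symm (hc : IsSymplecticConnection Ω cov) (hI : IsInteraction I)
    {x₀ : X} {z : E} (hz : z ∈ (chartAt E x₀).target) (p : ℕ) (y w u' u : E) :
    Ω.bilin x₀ z (fderiv ℝ (fun y => weylConnection Ω cov I x₀ p z y w) y u') u -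
      Ω.bilin x₀ z (fderiv ℝ (fun y => weylConnection Ω cov I x₀ p z y w) y u) u' =
        (if p = 1 then -1 else 0) * fderiv ℝ (fun z => Ω.bilin x₀ z u' u) z w := by
  rcases p with _ | _ | p
  · have h1 : (fun y => weylConnection Ω cov I x₀ 0 z y w) = fun _ => - w := rfl
    rw [h1, fderiv_fun_const]
    simp
  · obtain ⟨T, hT⟩ := hc.connectionForm_clm hz w
    have h1 : (fun y => weylConnection Ω cov I x₀ 1 z y w) = fun y => (- T) y :=
      funext fun y => congrArg (- ·) (hT y)
    have h2 : fderiv ℝ (fun y => (- T) y) y = (- T).restrictScalars ℝ :=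
      ((- T).restrictScalars ℝ).hasFDerivAt.fderiv
    rw [if_pos rfl, hc.fderiv_bilin hz, Ω.bilin_swap x₀ z u' (connectionForm cov x₀ z u w), hT, hT]
    change Ω.bilin x₀ z (fderiv ℝ (fun y => weylConnection Ω cov I x₀ 1 z y w) y u') u -
      Ω.bilin x₀ z (fderiv ℝ (fun y => weylConnection Ω cov I x₀ 1 z y w) y u) u' = _
    rw [h1, h2]
    simp
    ring
  · rw [if_neg (by omega), zero_mul, sub_eq_zero]
    exact hamField_fderiv_symm (Matrix.nonsing_inv_mul _ (Ω.isUnit_matrix_det hz))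
      (fun _ _ => rfl) (isWeylExpr_of_target hz (hI.1 _ 0) (p + 3)).1 y w u' u

/-- Contraction, division by the total degree and the curvature form are all natural, so the
pointwise definition in centred charts has the same shape in any fixed chart. In particular it is
smooth. -/
theorem weylInChart_correctionTerm (hc : IsSymplecticConnection Ω cov) (hI : IsInteraction I)
    {s : X → WeylFibre E 1} {m : ℕ} (hs : ∀ x, s x (m + 3) = correctionTerm Ω cov I m x) {x₀ : X}
    {z : E} (hz : z ∈ (chartAt E x₀).target) (y : E) :
    weylInChart s x₀ (m + 3) z y = (1 / 2 : ℂ) • CForm.totalDegreeInv 1 (m + 3)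
      (CForm.contract y (curvatureForm (Ω.bilin x₀ z) (weylConnection Ω cov I x₀) (m + 1) z y)) := by
  have h1 := curvatureForm_pullback hc hI ((chartAt E x₀).map_target hz) (m + 1) y
  rw [(chartAt E x₀).right_inv hz] at h1
  rw [h1, contract_pullback, totalDegreeInv_pullback, weylInChart, hs, correctionTerm]
  rfl

theorem isInteraction_approx_succ (hc : IsSymplecticConnection Ω cov) {m : ℕ}
    (hI : IsInteraction (approxInteraction Ω cov m)) :
    IsInteraction (approxInteraction Ω cov (m + 1)) := by
  refine ⟨fun x j => ?_, fun x j r h => ?_⟩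
  · intro r
    by_cases h : j = 0 ∧ r = m + 3
    · obtain ⟨rfl, rfl⟩ := h
      have hs : ∀ x, approxInteraction Ω cov (m + 1) x 0 (m + 3) =
          correctionTerm Ω cov (approxInteraction Ω cov m) m x := fun x => if_pos ⟨rfl, rfl⟩
      have hz := mem_chart_target E x
      have hA : ∀ᶠ z' in 𝓝 (chartAt E x x), ∀ v, IsWeylExpr (fun p z y =>
          weylConnection Ω cov (approxInteraction Ω cov m) x p z y v) z' := by
        filter_upwards [eventually_target hz] with z' hz' v
        exact isWeylExpr_weylConnection hc hI hz' v
      refine ⟨?_, fun y => ?_⟩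
      · change IsHomogeneousPoly (m + 3) (approxInteraction Ω cov (m + 1) x 0 (m + 3))
        rw [hs]
        exact ((koszulHomotopy_isHomogeneousPoly (curvatureForm_isHomogeneousPoly _ hA
          (m + 1))).clm_comp (CForm.totalDegreeInv 1 (m + 3))).fun_smul _
      · have h1 : (fun p : E × E => weylInChart (fun x' => approxInteraction Ω cov (m + 1) x' 0) x
            (m + 3) p.1 p.2) =ᶠ[𝓝 (chartAt E x x, y)] fun p => (1 / 2 : ℂ) •
              CForm.totalDegreeInv 1 (m + 3) (CForm.contract p.2 (curvatureForm (Ω.bilin x p.1)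
                (weylConnection Ω cov (approxInteraction Ω cov m) x) (m + 1) p.1 p.2)) := by
          filter_upwards [(continuous_fst.tendsto (chartAt E x x, y)).eventually
            (eventually_target hz)] with p hp
          exact weylInChart_correctionTerm hc hI
            (s := fun x' => approxInteraction Ω cov (m + 1) x' 0) hs hp p.2
        refine ContDiffAt.congr_of_eventuallyEq (ContDiffAt.const_smul _ ?_) h1
        refine ((CForm.totalDegreeInv (E := E) 1
          (m + 3)).restrictScalars ℝ).contDiff.contDiffAt.comp _ ?_
        exact contDiffAt_contract contDiffAt_snd
          (contDiffAt_curvatureForm (contDiffAt_realForm_bilin hz) hA (m + 1) y)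
    · have h1 : ∀ x, approxInteraction Ω cov (m + 1) x j r = approxInteraction Ω cov m x j r :=
        fun x => if_neg h
      have h2 : weylInChart (fun x' => approxInteraction Ω cov (m + 1) x' j) x r =
          weylInChart (fun x' => approxInteraction Ω cov m x' j) x r := by
        funext z y
        rw [weylInChart, weylInChart, h1]
      change IsHomogeneousPoly r (approxInteraction Ω cov (m + 1) x j r) ∧ _
      rw [h1, h2]
      exact hI.1 x j r
  · exact (if_neg (by omega)).trans (hI.2 x j r h)

/-- In weight zero only `A 0 = -id` and `A 1 = -Γ` enter, and the result is the torsion. -/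
theorem curvature_weylConnection_zero (hc : IsSymplecticConnection Ω cov) {x₀ : X} {z : E}
    (hz : z ∈ (chartAt E x₀).target) (y v w : E) :
    curvature (weylConnection Ω cov I x₀) 0 z y v w = 0 := by
  have h1 : ∀ v w, covNabla (weylConnection Ω cov I x₀)
      (fun p z y => weylConnection Ω cov I x₀ p z y w) 0 z y v = connectionForm cov x₀ z v w := by
    intro v w
    obtain ⟨T, hT⟩ := hc.connectionForm_clm hz w
    have h1 : (fun y => weylConnection Ω cov I x₀ 1 z y w) = fun y => (- T) y :=
      funext fun y => congrArg (- ·) (hT y)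
    have h2 : fderiv ℝ (fun y => (- T) y) y = (- T).restrictScalars ℝ :=
      ((- T).restrictScalars ℝ).hasFDerivAt.fderiv
    have h3 : (fun z => weylConnection Ω cov I x₀ 0 z y w) = fun _ => - w := rfl
    have h4 : (fun y => weylConnection Ω cov I x₀ 0 z y w) = fun _ => - w := rfl
    rw [covNabla_apply, h3, fderiv_fun_const, Finset.Nat.sum_antidiagonal_succ,
      Finset.HasAntidiagonal.antidiagonal_zero, Finset.sum_singleton]
    simp only [zero_add]
    rw [h1, h2, h4, fderiv_fun_const, hT]
    simp [weylConnection]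
  rw [curvature, h1, h1, hc.connectionForm_symm hz, sub_self]

/-- One step of the recursion adds a term of weight `m + 3` to `I`, that is, the component `A (m +
2)`; it cannot disturb the curvature below weight `m + 1` and is chosen to cancel it in that weight.
-/
theorem approxInteraction_spec (hc : IsSymplecticConnection Ω cov) (m : ℕ) :
    IsInteraction (approxInteraction Ω cov m) ∧ ∀ (x₀ : X), ∀ z ∈ (chartAt E x₀).target,
      ∀ q ≤ m, ∀ y v w,
        curvature (weylConnection Ω cov (approxInteraction Ω cov m) x₀) q z y v w = 0 := by
  induction m with
  | zero =>
    refine ⟨⟨fun x j => (weylSections E X 1).zero x, fun x j r _ => rfl⟩,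
      fun x₀ z hz q hq y v w => ?_⟩
    rw [Nat.le_zero.1 hq]
    exact curvature_weylConnection_zero hc hz y v w
  | succ m ih =>
    obtain ⟨hI, hF⟩ := ih
    have hA : ∀ (x₀ : X) p, p ≤ m + 1 → weylConnection Ω cov (approxInteraction Ω cov m) x₀ p =
        weylConnection Ω cov (approxInteraction Ω cov (m + 1)) x₀ p := fun x₀ p hp =>
      weylConnection_congr (fun x => (if_neg (by omega)).symm) x₀
    refine ⟨isInteraction_approx_succ hc hI, fun x₀ z hz q hq y v w => ?_⟩
    rcases Nat.lt_or_ge q (m + 1) with hq' | hq'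
    · rw [← curvature_congr fun p hp => hA x₀ p (by omega)]
      exact hF x₀ z hz q (by omega) y v w
    · obtain rfl : q = m + 1 := le_antisymm hq hq'
      have hev := eventually_target hz
      refine curvature_correction (b := Ω.bilin x₀) (Matrix.nonsing_inv_mul _
        (Ω.isUnit_matrix_det hz)) (fun _ _ => rfl) (fun a ha => Ω.nondegenerate_bilin hz ha)
        (hev.mono fun z' hz' v => isWeylExpr_weylConnection hc hI hz' v)
        (hev.mono fun z' hz' y v => rfl) (contDiffAt_realForm_bilin hz)
        (fun u u' => Ω.bilin_swap x₀ z u u')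
        (hev.mono fun z' hz' => weylConnection_form_symm hc hI hz')
        (hev.mono fun z' hz' q hq => hF x₀ z' hz' q hq) (fun y => ?_) (hA x₀) (fun y => ?_) y v w
      -- The previous approximation stops at weight `m + 2`, so its connection has no component of
      -- weight `m + 2`.
      · have h1 : weylInChart (fun x => approxInteraction Ω cov m x 0) x₀ (m + 3) z = 0 := by
          funext y
          rw [weylInChart, approxInteraction_of_le m _ _ _ le_rfl]
          rfl
        have h2 : fderiv ℝ (0 : E → CForm E 1) y = 0 := fderiv_const_apply _
        change hamField _ (weylInChart (fun x => approxInteraction Ω cov m x 0) x₀ (m + 3) z) y = 0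
        refine ContinuousLinearMap.ext fun v => ?_
        rw [h1, hamField_apply, h2]
        simp
      · refine congrArg (fun P => hamField (Ω.poisson x₀ z) P y) (funext fun y => ?_)
        exact weylInChart_correctionTerm hc hI
          (s := fun x => approxInteraction Ω cov (m + 1) x 0)
          (fun x => if_pos ⟨rfl, rfl⟩) hz y

theorem isInteraction_flatInteraction (hc : IsSymplecticConnection Ω cov) :
    IsInteraction (flatInteraction Ω cov) := by
  refine ⟨fun x j r => ?_, fun x j r h => ?_⟩
  · by_cases hj : j = 0
    · subst hj
      exact (approxInteraction_spec hc r).1.1 x 0 r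
    · have : (fun x' => flatInteraction Ω cov x' j) = 0 := by
        funext x' r
        exact if_neg hj
      rw [this]
      exact (weylSections E X 1).zero x r
  · by_cases hj : j = 0
    · subst hj
      exact (approxInteraction_spec hc r).1.2 x 0 r h
    · exact if_neg hj

/-- The Fedosov equation modulo `ħ` has a solution. -/
theorem exists_flat_interaction (hc : IsSymplecticConnection Ω cov) :
    ∃ I : X → QuantumWeylFibre E 1, IsInteraction I ∧ IsFlatModHbar Ω cov I := by
  have hI := isInteraction_flatInteraction hc
  refine ⟨_, hI, isFlatModHbar_of_curvature_eq_zero hc hI fun x₀ z hz m y v w => ?_⟩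
  -- The curvature in weight `m` involves `A p` for `p ≤ m + 1`, hence `I` up to weight `m + 2`,
  -- where the limit agrees with the approximation of that index.
  have h : ∀ p ≤ m + 1, weylConnection Ω cov (flatInteraction Ω cov) x₀ p =
      weylConnection Ω cov (approxInteraction Ω cov (m + 2)) x₀ p := by
    intro p hp
    refine weylConnection_congr (fun x => ?_) x₀
    have h1 : flatInteraction Ω cov x 0 (p + 1) = approxInteraction Ω cov (p + 1) x 0 (p + 1) :=
      if_pos rfl
    rw [h1]
    exact (approxInteraction_stable (by omega) x 0).symm
  rw [curvature_congr h]
  exact (approxInteraction_spec hc (m + 2)).2 x₀ z hz m (by omega) y v w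

end Existence
end HolWeyl

namespace HolWeyl
open ContinuousAlternatingMap (alternatizeUncurryFin alternatizeUncurryFinCLM alternatizeUncurryFin_apply)
open Finset.HasAntidiagonal (antidiagonal)
-- Torsion-free symplectic connections in a chart.
section LocalConnection

variable {E : Type} [NormedAddCommGroup E] [NormedSpace ℂ E] [FiniteDimensional ℂ E]
  {X : Type} [TopologicalSpace X] [ChartedSpace E X] [IsManifold 𝓘(ℂ, E) ω X]
  (Ω : HolomorphicSymplecticForm E X)

/-- The Christoffel symbols, in the coordinates `chartAt E x₀`, of a torsion-free connection that
preserves the symplectic form. -/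
noncomputable def symplecticChristoffel (x₀ : X) (z : E) : E →L[ℂ] E →L[ℂ] E :=
  (1 / 3 : ℂ) • (ContinuousLinearMap.compL ℂ E (E →L[ℂ] ℂ) E (Ω.bilin x₀ z).inverse).comp
    (fderiv ℂ (Ω.bilin x₀) z + (fderiv ℂ (Ω.bilin x₀) z).flip)

variable {Ω}

theorem exists_equiv_bilin {x₀ : X} {z : E} (hz : z ∈ (chartAt E x₀).target) :
    ∃ e : E ≃L[ℂ] (E →L[ℂ] ℂ), (e : E →L[ℂ] E →L[ℂ] ℂ) = Ω.bilin x₀ z := by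
  have h1 : Function.Injective (Ω.bilin x₀ z : E →ₗ[ℂ] E →L[ℂ] ℂ) := by
    rw [← LinearMap.ker_eq_bot, LinearMap.ker_eq_bot']
    exact fun a ha => Ω.nondegenerate_bilin hz fun b => DFunLike.congr_fun ha b
  have h2 : Module.finrank ℂ E = Module.finrank ℂ (E →L[ℂ] ℂ) := by
    rw [← (LinearMap.toContinuousLinearMap (𝕜 := ℂ) (E := E) (F' := ℂ)).finrank_eq]
    exact (Subspace.dual_finrank_eq (K := ℂ) (V := E)).symm
  exact ⟨(LinearEquiv.ofInjectiveOfFinrankEq _ h1 h2).toContinuousLinearEquiv, by ext; rfl⟩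

theorem contDiffAt_symplecticChristoffel {x₀ : X} {z : E} (hz : z ∈ (chartAt E x₀).target) :
    ContDiffAt ℂ ∞ (symplecticChristoffel Ω x₀) z := by
  obtain ⟨e, he⟩ := exists_equiv_bilin (Ω := Ω) hz
  have h1 : ContDiffAt ℂ ∞ (fun z => (Ω.bilin x₀ z).inverse) z := by
    have h := contDiffAt_map_inverse (𝕜 := ℂ) (n := ∞) e
    rw [he] at h
    exact h.comp z ((Ω.contDiffAt_bilin hz).of_le le_top)
  have h2 : ContDiffAt ℂ ∞ (fderiv ℂ (Ω.bilin x₀)) z :=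
    (Ω.contDiffAt_bilin hz).fderiv_right (m := ∞) le_top
  refine ContDiffAt.const_smul _ (ContDiffAt.clm_comp ?_ (h2.add ?_))
  · exact (ContinuousLinearMap.compL ℂ E (E →L[ℂ] ℂ) E).contDiff.contDiffAt.comp z h1
  · exact (ContinuousLinearMap.flipₗᵢ ℂ E E (E →L[ℂ] ℂ)).contDiff.contDiffAt.comp z h2

theorem bilin_symplecticChristoffel {x₀ : X} {z : E} (hz : z ∈ (chartAt E x₀).target)
    (a v b : E) : Ω.bilin x₀ z (symplecticChristoffel Ω x₀ z a v) b =
      (1 / 3) * (fderiv ℂ (Ω.bilin x₀) z a v b + fderiv ℂ (Ω.bilin x₀) z v a b) := by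
  obtain ⟨e, he⟩ := exists_equiv_bilin (Ω := Ω) hz
  have h1 : ∀ f, Ω.bilin x₀ z ((Ω.bilin x₀ z).inverse f) = f := by
    intro f
    rw [← he, ContinuousLinearMap.inverse_equiv]
    exact e.apply_symm_apply f
  change Ω.bilin x₀ z ((1 / 3 : ℂ) • (Ω.bilin x₀ z).inverse
    (fderiv ℂ (Ω.bilin x₀) z a v + fderiv ℂ (Ω.bilin x₀) z v a)) b = _
  rw [map_smul, h1]
  rfl

theorem symplecticChristoffel_symm (x₀ : X) (z a v : E) :
    symplecticChristoffel Ω x₀ z a v = symplecticChristoffel Ω x₀ z v a := by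
  change (1 / 3 : ℂ) • (Ω.bilin x₀ z).inverse
    (fderiv ℂ (Ω.bilin x₀) z a v + fderiv ℂ (Ω.bilin x₀) z v a) = (1 / 3 : ℂ) •
      (Ω.bilin x₀ z).inverse (fderiv ℂ (Ω.bilin x₀) z v a + fderiv ℂ (Ω.bilin x₀) z a v)
  rw [add_comm]

/-- The right side is one third of `2 ∂_v ω(a, b) + ∂_a ω(v, b) - ∂_b ω(v, a)`, and `dω = 0`
identifies the last two terms with a third copy of `∂_v ω(a, b)`. This is the origin of the factor
`1/3`. -/
theorem fderiv_bilin_eq_symplecticChristoffel {x₀ : X} {z : E} (hz : z ∈ (chartAt E x₀).target)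
    (v a b : E) : fderiv ℂ (Ω.bilin x₀) z v a b =
      Ω.bilin x₀ z (symplecticChristoffel Ω x₀ z a v) b +
        Ω.bilin x₀ z a (symplecticChristoffel Ω x₀ z b v) := by
  have hs : ∀ u a b, fderiv ℂ (Ω.bilin x₀) z u a b = - fderiv ℂ (Ω.bilin x₀) z u b a := by
    intro u a b
    rw [← Ω.fderiv_bilin_apply hz, ← Ω.fderiv_bilin_apply hz]
    have h1 : (fun z => Ω.bilin x₀ z a b) = - fun z => Ω.bilin x₀ z b a :=
      funext fun z => Ω.bilin_swap x₀ z a b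
    rw [h1, fderiv_neg]
    rfl
  rw [Ω.bilin_swap x₀ z a, bilin_symplecticChristoffel hz, bilin_symplecticChristoffel hz]
  have h1 := Ω.fderiv_bilin_cyclic hz v a b
  rw [hs v b a]
  linear_combination (1 / 3 : ℂ) * h1

variable (Ω) in
/-- The torsion-free connection preserving the symplectic form, over the domain of the chart
`chartAt E x₀`, with the given Christoffel symbols. -/
noncomputable def localConnection (x₀ : X) (σ : ∀ x : X, TangentSpace 𝓘(ℝ, E) x) (x : X) :
    TangentSpace 𝓘(ℝ, E) x →L[ℝ] TangentSpace 𝓘(ℝ, E) x :=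
  (((jac x₀ x).restrictScalars ℝ).comp ((fderiv ℝ (fieldInChart σ x₀) (chartAt E x₀ x) +
    (symplecticChristoffel Ω x₀ (chartAt E x₀ x)
      (jacInv x₀ x (components (σ x)))).restrictScalars ℝ).comp
    ((jacInv x₀ x).restrictScalars ℝ)) : E →L[ℝ] E)

theorem localConnection_apply {x₀ x : X} (h : x ∈ (chartAt E x₀).source)
    (σ : ∀ x : X, TangentSpace 𝓘(ℝ, E) x) (v : TangentSpace 𝓘(ℝ, E) x) :
    components (localConnection Ω x₀ σ x v) = jac x₀ x
      (fderiv ℝ (fieldInChart σ x₀) (chartAt E x₀ x) (jacInv x₀ x (components v)) +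
        symplecticChristoffel Ω x₀ (chartAt E x₀ x) (fieldInChart σ x₀ (chartAt E x₀ x))
          (jacInv x₀ x (components v))) := by
  rw [fieldInChart_chart σ h]
  rfl

theorem localConnection_eq (x₀ : X) (σ : ∀ x : X, TangentSpace 𝓘(ℝ, E) x) (x : X)
    (v : TangentSpace 𝓘(ℝ, E) x) :
    components (localConnection Ω x₀ σ x v) = components (flatConnection x₀ σ x v) +
      jac x₀ x (symplecticChristoffel Ω x₀ (chartAt E x₀ x) (jacInv x₀ x (components (σ x)))
        (jacInv x₀ x (components v))) :=
  map_add (jac (E := E) x₀ x) _ _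

theorem isCovariantDerivativeOn_localConnection (x₀ : X) :
    IsCovariantDerivativeOn E (localConnection Ω x₀) (chartAt E x₀).source where
  add {σ σ' x} hσ hσ' hx := by
    have h1 := (flatConnection_isCovariantDerivativeOn (E := E) x₀).add hσ hσ' hx
    refine ContinuousLinearMap.ext fun v => ?_
    refine (localConnection_eq x₀ (σ + σ') x v).trans ?_
    rw [h1]
    refine Eq.trans ?_ (congrArg₂ (· + ·) (localConnection_eq x₀ σ x v)
      (localConnection_eq x₀ σ' x v)).symm
    have h2 : components ((σ + σ') x) = components (σ x) + components (σ' x) := rfl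
    rw [h2, map_add, map_add, FunLike.coe_add, Pi.add_apply, FunLike.coe_add, Pi.add_apply,
      map_add]
    exact add_add_add_comm _ _ _ _
  leibniz {σ g x} hσ hg hx := by
    have h1 := (flatConnection_isCovariantDerivativeOn (E := E) x₀).leibniz hσ hg hx
    refine ContinuousLinearMap.ext fun v => ?_
    refine (localConnection_eq x₀ (g • σ) x v).trans ?_
    rw [h1]
    refine Eq.trans ?_ (congrArg (fun w : E => g x • w + _) (localConnection_eq x₀ σ x v)).symm
    have h2 : components ((g • σ) x) = ((g x : ℝ) : ℂ) • components (σ x) := rfl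
    have h3 : ∀ F S : TangentSpace 𝓘(ℝ, E) x →L[ℝ] TangentSpace 𝓘(ℝ, E) x,
        components ((g x • F + S) v) = g x • components (F v) + components (S v) := fun _ _ => rfl
    rw [h2, map_smul, map_smul, FunLike.coe_smul, Pi.smul_apply, map_smul, h3, smul_add,
      Complex.coe_smul]
    exact add_right_comm _ _ _

theorem fieldInChart_mulI (σ : ∀ x : X, TangentSpace 𝓘(ℝ, E) x) (x₀ : X) :
    fieldInChart (mulI σ) x₀ = fun z => Complex.I • fieldInChart σ x₀ z :=
  funext fun _ => (jacInv x₀ _).map_smul _ _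

theorem localConnection_mulI {x₀ x : X} (h : x ∈ (chartAt E x₀).source)
    {σ : ∀ x : X, TangentSpace 𝓘(ℝ, E) x} (hσ : DifferentiableFieldAt σ x)
    (v : TangentSpace 𝓘(ℝ, E) x) : components (localConnection Ω x₀ (mulI σ) x v) =
      Complex.I • components (localConnection Ω x₀ σ x v) := by
  rw [localConnection_apply h, localConnection_apply h, fieldInChart_mulI,
    fderiv_fun_const_smul ((differentiableFieldAt_iff h).1 hσ), ← map_smul, smul_add, map_smul]
  rfl

theorem localConnection_torsion {x₀ x : X} (h : x ∈ (chartAt E x₀).source)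
    {σ τ : ∀ x : X, TangentSpace 𝓘(ℝ, E) x} (hσ : DifferentiableFieldAt σ x)
    (hτ : DifferentiableFieldAt τ x) :
    components (localConnection Ω x₀ τ x (σ x)) - components (localConnection Ω x₀ σ x (τ x)) =
      components (VectorField.mlieBracket 𝓘(ℝ, E) σ τ x) := by
  rw [localConnection_apply h, localConnection_apply h, mlieBracket_inChart h hσ hτ,
    fieldInChart_chart σ h, fieldInChart_chart τ h, symplecticChristoffel_symm, ← map_sub,
    add_sub_add_right_eq_sub]

/-- Product rule in the chart: differentiating the arguments gives the flat part of the connection,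
differentiating the coefficients gives the Christoffel part. -/
theorem mfderiv_form {x₀ x : X} (h : x ∈ (chartAt E x₀).source)
    {σ τ : ∀ x : X, TangentSpace 𝓘(ℝ, E) x} (hσ : DifferentiableFieldAt σ x)
    (hτ : DifferentiableFieldAt τ x) (v : TangentSpace 𝓘(ℝ, E) x) :
    (mfderiv 𝓘(ℝ, E) 𝓘(ℝ, ℂ) (fun x' => Ω.toFun x' ![components (σ x'), components (τ x')])
      x v : ℂ) =
      Ω.toFun x ![components (localConnection Ω x₀ σ x v), components (τ x)] +
        Ω.toFun x ![components (σ x), components (localConnection Ω x₀ τ x v)] := by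
  have hz := (chartAt E x₀).map_source h
  have hσ' := (differentiableFieldAt_iff h).1 hσ
  have hτ' := (differentiableFieldAt_iff h).1 hτ
  have hev : (fun x' => Ω.toFun x' ![components (σ x'), components (τ x')]) ∘
      (chartAt E x₀).symm =ᶠ[𝓝 (chartAt E x₀ x)]
      fun z => realForm (Ω.bilin x₀ z) (fieldInChart σ x₀ z) (fieldInChart τ x₀ z) := by
    filter_upwards [(chartAt E x₀).open_target.mem_nhds hz] with z' hz'
    have hx' := (chartAt E x₀).map_target hz'
    have h1 := Ω.bilin_chart hx' (fieldInChart σ x₀ z') (fieldInChart τ x₀ z')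
    have h2 := jac_fieldInChart σ hx'
    have h3 := jac_fieldInChart τ hx'
    rw [(chartAt E x₀).right_inv hz'] at h1 h2 h3
    rw [realForm_apply, h1, h2, h3]
    rfl
  have hb : DifferentiableAt ℝ (fun z => realForm (Ω.bilin x₀ z)) (chartAt E x₀ x) :=
    (contDiffAt_realForm_bilin hz).differentiableAt (by simp)
  have hd := (hb.hasFDerivAt.clm_apply hσ'.hasFDerivAt).clm_apply hτ'.hasFDerivAt
  have hm : MDifferentiableAt 𝓘(ℝ, E) 𝓘(ℝ, ℂ)
      (fun x' => Ω.toFun x' ![components (σ x'), components (τ x')]) x :=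
    (mdifferentiableAt_iff_inChart h).2 (hd.differentiableAt.congr_of_eventuallyEq hev)
  have hB : ∀ u a b, fderiv ℝ (fun z => realForm (Ω.bilin x₀ z)) (chartAt E x₀ x) u a b =
      fderiv ℂ (Ω.bilin x₀) (chartAt E x₀ x) u a b := by
    intro u a b
    have hb' : DifferentiableAt ℝ (fun z => realForm (Ω.bilin x₀ z) a) (chartAt E x₀ x) :=
      hb.clm_apply (differentiableAt_const a)
    rw [fderiv_clm_apply_const hb, fderiv_clm_apply_const hb']
    exact Ω.fderiv_bilin_apply hz a b u
  have hj : ∀ ρ : ∀ x : X, TangentSpace 𝓘(ℝ, E) x,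
      components (ρ x) = jac x₀ x (fieldInChart ρ x₀ (chartAt E x₀ x)) :=
    fun ρ => (jac_fieldInChart ρ h).symm
  rw [localConnection_apply h, localConnection_apply h, hj σ, hj τ]
  simp only [← Ω.bilin_chart h]
  refine (mfderiv_inChart h hm v).trans ?_
  rw [hev.fderiv_eq, hd.fderiv]
  simp only [FunLike.coe_add, Pi.add_apply, ContinuousLinearMap.comp_apply,
    ContinuousLinearMap.flip_apply, hB, map_add]
  rw [fderiv_bilin_eq_symplecticChristoffel hz]
  exact (by intros; ring : ∀ p q r s : ℂ, p + (q + (r + s)) = q + r + (p + s)) _ _ _ _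

end LocalConnection
end HolWeyl

namespace HolWeyl
open ContinuousAlternatingMap (alternatizeUncurryFin alternatizeUncurryFinCLM alternatizeUncurryFin_apply)
open Finset.HasAntidiagonal (antidiagonal)
-- Smoothness of local connections as endomorphism-valued fields.
section HomBundle

variable {E : Type} [NormedAddCommGroup E] [NormedSpace ℂ E] [FiniteDimensional ℂ E]
  {X : Type} [TopologicalSpace X] [ChartedSpace E X] [IsManifold 𝓘(ℂ, E) ω X]
  {Ω : HolomorphicSymplecticForm E X}

/-- Relates the tangent bundle trivializations, in which smoothness is formulated, to the Jacobians
used throughout. -/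
theorem trivialization_symmL {x₀ x : X} (h : x ∈ (chartAt E x₀).source) (v : E) :
    components ((trivializationAt E (TangentSpace 𝓘(ℝ, E)) x₀).symmL ℝ x v) = jac x₀ x v := by
  have h1 := (trivializationAt E (TangentSpace 𝓘(ℝ, E)) x₀).continuousLinearMapAt_symmL
    (R := ℝ) (b := x) h v
  set w := (trivializationAt E (TangentSpace 𝓘(ℝ, E)) x₀).symmL ℝ x v
  have h2 : (trivializationAt E (TangentSpace 𝓘(ℝ, E)) x₀).continuousLinearMapAt ℝ x w =
      jacInv x₀ x (components w) := by
    rw [Bundle.Trivialization.continuousLinearMapAt_apply,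
      Bundle.Trivialization.linearMapAt_apply]
    refine (if_pos h).trans ?_
    exact trivialization_snd (fun y => (components w : E)) x₀ x h
  rw [h2] at h1
  rw [← h1, jac_jacInv h]

/-- Smoothness, in a chart, of a field of endomorphisms of the tangent bundle. -/
theorem contMDiffAt_hom {φ : ∀ x : X, TangentSpace 𝓘(ℝ, E) x →L[ℝ] TangentSpace 𝓘(ℝ, E) x}
    {x₀ x : X} (h : x ∈ (chartAt E x₀).source) {g : E → E →L[ℝ] E}
    (hg : ContDiffAt ℝ ∞ g (chartAt E x₀ x))
    (hφ : ∀ x ∈ (chartAt E x₀).source, ∀ v : E,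
      jacInv x₀ x (components (φ x (jac x₀ x v : E))) = g (chartAt E x₀ x) v) :
    ContMDiffAt 𝓘(ℝ, E) (𝓘(ℝ, E).prod 𝓘(ℝ, E →L[ℝ] E)) ∞
      (fun x => (⟨x, φ x⟩ : Bundle.TotalSpace (E →L[ℝ] E)
        fun x : X => TangentSpace 𝓘(ℝ, E) x →L[ℝ] TangentSpace 𝓘(ℝ, E) x)) x := by
  rw [(trivializationAt (E →L[ℝ] E)
    (fun x : X => TangentSpace 𝓘(ℝ, E) x →L[ℝ] TangentSpace 𝓘(ℝ, E) x)
    x₀).contMDiffAt_section_iff ⟨h, h⟩, contMDiffAt_iff_inChart h]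
  refine hg.congr_of_eventuallyEq ?_
  filter_upwards [(chartAt E x₀).open_target.mem_nhds ((chartAt E x₀).map_source h)] with z hz
  have hx := (chartAt E x₀).map_target hz
  refine ContinuousLinearMap.ext fun v => ?_
  have h1 := hφ _ hx v
  rw [(chartAt E x₀).right_inv hz] at h1
  rw [← h1]
  simp only [Function.comp, hom_trivializationAt_apply]
  set x' := (chartAt E x₀).symm z
  have h2 : (trivializationAt E (TangentSpace 𝓘(ℝ, E)) x₀).symmL ℝ x' v = (jac x₀ x' v : E) :=
    trivialization_symmL hx v
  have h3 : ∀ w : TangentSpace 𝓘(ℝ, E) x',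
      (trivializationAt E (TangentSpace 𝓘(ℝ, E)) x₀).continuousLinearMapAt ℝ x' w =
        jacInv x₀ x' (components w) := by
    intro w
    rw [Bundle.Trivialization.continuousLinearMapAt_apply,
      Bundle.Trivialization.linearMapAt_apply]
    exact (if_pos hx).trans (trivialization_snd (fun y => (components w : E)) x₀ x' hx)
  refine (h3 _).trans ?_
  exact congrArg (fun w : TangentSpace 𝓘(ℝ, E) x' => jacInv x₀ x' (components (φ x' w))) h2

theorem contMDiffAt_localConnection {x₀ x : X} (h : x ∈ (chartAt E x₀).source)
    {σ : ∀ x : X, TangentSpace 𝓘(ℝ, E) x}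
    (hσ : ContMDiffAt 𝓘(ℝ, E) (𝓘(ℝ, E).prod 𝓘(ℝ, E)) ∞
      (fun x => (⟨x, σ x⟩ : TangentBundle 𝓘(ℝ, E) X)) x) :
    ContMDiffAt 𝓘(ℝ, E) (𝓘(ℝ, E).prod 𝓘(ℝ, E →L[ℝ] E)) ∞
      (fun x => (⟨x, localConnection Ω x₀ σ x⟩ : Bundle.TotalSpace (E →L[ℝ] E)
        fun x : X => TangentSpace 𝓘(ℝ, E) x →L[ℝ] TangentSpace 𝓘(ℝ, E) x)) x := by
  have hz := (chartAt E x₀).map_source h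
  have hσ' := (contMDiffAt_field_iff h).1 hσ
  refine contMDiffAt_hom h (g := fun z => fderiv ℝ (fieldInChart σ x₀) z +
    (symplecticChristoffel Ω x₀ z (fieldInChart σ x₀ z)).restrictScalars ℝ) ?_ fun x hx v => ?_
  · refine (hσ'.fderiv_right (m := ∞) le_rfl).add (contDiffAt_clm fun v => ?_)
    have h1 : ContDiffAt ℝ ∞ (fun p : E × E => symplecticChristoffel Ω x₀ p.1 p.2 v)
        (chartAt E x₀ x, fieldInChart σ x₀ (chartAt E x₀ x)) := by
      refine ContDiffAt.restrict_scalars ℝ (𝕜' := ℂ) ?_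
      exact (((contDiffAt_symplecticChristoffel hz).comp (_, _) contDiffAt_fst).clm_apply
        contDiffAt_snd).clm_apply contDiffAt_const
    exact ContDiffAt.comp (g := fun p : E × E => symplecticChristoffel Ω x₀ p.1 p.2 v)
      (f := fun z => (z, fieldInChart σ x₀ z)) (chartAt E x₀ x) h1 (contDiffAt_id.prodMk hσ')
  · have h1 : jacInv x₀ x (components (x := x) (jac x₀ x v : E)) = v := jacInv_jac hx v
    refine (congrArg (fun w : E => jacInv x₀ x w)
      (localConnection_apply hx σ (jac x₀ x v : E))).trans ?_
    rw [jacInv_jac hx, h1]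
    rfl

end HomBundle

/-! ### Gluing by a partition of unity. -/

section Gluing

variable {E : Type} [NormedAddCommGroup E] [NormedSpace ℂ E] [FiniteDimensional ℂ E]
  {X : Type} [TopologicalSpace X] [ChartedSpace E X] [IsManifold 𝓘(ℂ, E) ω X]
  (Ω : HolomorphicSymplecticForm E X) (f : SmoothPartitionOfUnity X 𝓘(ℝ, E) X Set.univ)

/-- The local connections glued by a partition of unity. -/
noncomputable def gluedConnection (σ : ∀ x : X, TangentSpace 𝓘(ℝ, E) x) (x : X) :
    TangentSpace 𝓘(ℝ, E) x →L[ℝ] TangentSpace 𝓘(ℝ, E) x :=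
  ∑ c ∈ f.finsupport x, f c x • localConnection Ω c σ x

variable {Ω f}

theorem gluedConnection_apply (σ : ∀ x : X, TangentSpace 𝓘(ℝ, E) x) (x : X)
    (v : TangentSpace 𝓘(ℝ, E) x) : components (gluedConnection Ω f σ x v) =
      ∑ c ∈ f.finsupport x, (f c x : ℂ) • components (localConnection Ω c σ x v) :=
  sum_apply _ _ _

theorem mem_source_of_mem_finsupport (hf : f.IsSubordinate fun c => (chartAt E c).source)
    {x c : X} (hc : c ∈ f.finsupport x) : x ∈ (chartAt E c).source :=
  hf c (subset_tsupport _ ((f.mem_finsupport x).1 hc))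

theorem sum_finsupport_complex (x : X) : ∑ c ∈ f.finsupport x, (f c x : ℂ) = 1 := by
  rw [← Complex.ofReal_sum, f.sum_finsupport x (Set.mem_univ x), Complex.ofReal_one]

/-- The Leibniz term is not linear in the connection but is the same for all of them, so it is
reproduced because the weights sum to one. Subordination ensures that only charts containing `x`
contribute. -/
theorem isCovariantDerivativeOn_gluedConnection
    (hf : f.IsSubordinate fun c => (chartAt E c).source) :
    IsCovariantDerivativeOn E (gluedConnection Ω f) Set.univ where
  add {σ σ' x} hσ hσ' _ := by
    rw [gluedConnection, gluedConnection, gluedConnection, ← Finset.sum_add_distrib]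
    refine Finset.sum_congr rfl fun c hc => ?_
    rw [(isCovariantDerivativeOn_localConnection c).add hσ hσ'
      (mem_source_of_mem_finsupport hf hc), smul_add]
  leibniz {σ g x} hσ hg _ := by
    rw [gluedConnection, gluedConnection, Finset.smul_sum]
    refine (Finset.sum_congr rfl fun c hc => ?_).trans (Finset.sum_add_distrib.trans (congrArg _
      ((Finset.sum_smul (f := fun c => f c x)).symm.trans
        ((congrArg (· • _) (f.sum_finsupport x (Set.mem_univ x))).trans (one_smul ℝ _)))))
    rw [(isCovariantDerivativeOn_localConnection c).leibniz hσ hg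
      (mem_source_of_mem_finsupport hf hc), smul_add, smul_comm]

variable (Ω) in
/-- The glued connection. -/
noncomputable def symplecticConnection (hf : f.IsSubordinate fun c => (chartAt E c).source) :
    TangentConnection E X :=
  ⟨gluedConnection Ω f, isCovariantDerivativeOn_gluedConnection hf⟩

theorem contMDiffAt_gluedConnection (hf : f.IsSubordinate fun c => (chartAt E c).source) {x : X}
    {σ : ∀ x : X, TangentSpace 𝓘(ℝ, E) x}
    (hσ : ContMDiffAt 𝓘(ℝ, E) (𝓘(ℝ, E).prod 𝓘(ℝ, E)) ∞
      (fun x => (⟨x, σ x⟩ : TangentBundle 𝓘(ℝ, E) X)) x) :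
    ContMDiffAt 𝓘(ℝ, E) (𝓘(ℝ, E).prod 𝓘(ℝ, E →L[ℝ] E)) ∞
      (fun x => (⟨x, gluedConnection Ω f σ x⟩ : Bundle.TotalSpace (E →L[ℝ] E)
        fun x : X => TangentSpace 𝓘(ℝ, E) x →L[ℝ] TangentSpace 𝓘(ℝ, E) x)) x := by
  have h1 : ContMDiffAt 𝓘(ℝ, E) (𝓘(ℝ, E).prod 𝓘(ℝ, E →L[ℝ] E)) ∞
      (fun y => (⟨y, ∑ c ∈ f.fintsupport x, f c y • localConnection Ω c σ y⟩ :
        Bundle.TotalSpace (E →L[ℝ] E)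
        fun x : X => TangentSpace 𝓘(ℝ, E) x →L[ℝ] TangentSpace 𝓘(ℝ, E) x)) x := by
    refine ContMDiffAt.sum_section fun c hc => ContMDiffAt.smul_section ?_
      (contMDiffAt_localConnection (hf c ?_) hσ)
    · exact (f c).contMDiff.contMDiffAt
    · exact (f.mem_fintsupport_iff x c).1 hc
  refine h1.congr_of_eventuallyEq ?_
  filter_upwards [f.eventually_finsupport_subset x] with y hy
  refine congrArg (Bundle.TotalSpace.mk y) (Finset.sum_subset hy fun c _ hc => ?_)
  have h2 : f c y = 0 := by
    by_contra h
    exact hc ((f.mem_finsupport y).2 h)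
  rw [h2, zero_smul]

/-- Compatibility with `i` is linear; vanishing torsion and `∇ω = 0` are affine, so a combination
with weights of sum one inherits them. -/
theorem isSymplecticConnection_symplecticConnection
    (hf : f.IsSubordinate fun c => (chartAt E c).source) :
    IsSymplecticConnection Ω (symplecticConnection Ω hf) where
  smooth := ⟨⟨fun hσ x _ => (contMDiffAt_gluedConnection hf
    ((hσ x (Set.mem_univ x)).contMDiffAt Filter.univ_mem)).contMDiffWithinAt⟩⟩
  complex σ x hσ v := by
    refine (gluedConnection_apply (mulI σ) x v).trans
      (Eq.trans ?_ (congrArg (Complex.I • ·) (gluedConnection_apply σ x v)).symm)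
    simp only [Finset.smul_sum]
    refine Finset.sum_congr rfl fun c hc => ?_
    rw [localConnection_mulI (mem_source_of_mem_finsupport hf hc) hσ, smul_comm]
  torsionFree σ τ x hσ hτ := by
    refine (congrArg₂ (fun a b : E => a - b) (gluedConnection_apply τ x (σ x))
      (gluedConnection_apply σ x (τ x))).trans ?_
    refine (Finset.sum_sub_distrib _ _).symm.trans ?_
    refine (Finset.sum_congr rfl fun c hc => (smul_sub _ _ _).symm.trans (congrArg _
      (localConnection_torsion (mem_source_of_mem_finsupport hf hc) hσ hτ))).trans ?_
    rw [← Finset.sum_smul, sum_finsupport_complex, one_smul]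
    rfl
  symplectic σ τ x hσ hτ v := by
    have h1 : components (symplecticConnection Ω hf σ x v) = _ := gluedConnection_apply σ x v
    have h2 : components (symplecticConnection Ω hf τ x v) = _ := gluedConnection_apply τ x v
    rw [h1, h2]
    have h3 : ∀ D : ℂ, (∀ c ∈ f.finsupport x, D =
        Ω.toFun x ![components (localConnection Ω c σ x v), components (τ x)] +
          Ω.toFun x ![components (σ x), components (localConnection Ω c τ x v)]) → D =
        Ω.toFun x ![∑ c ∈ f.finsupport x, (f c x : ℂ) • components (localConnection Ω c σ x v),
          components (τ x)] + Ω.toFun x ![components (σ x),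
            ∑ c ∈ f.finsupport x, (f c x : ℂ) • components (localConnection Ω c τ x v)] := by
      intro D hD
      simp only [← Ω.bilin_self] at hD ⊢
      simp only [map_sum, map_smul, sum_apply, smul_apply]
      rw [← Finset.sum_add_distrib]
      refine Eq.trans ?_ (Finset.sum_congr rfl fun c hc =>
        (congrArg ((f c x : ℂ) • ·) (hD c hc)).trans (smul_add _ _ _))
      rw [← Finset.sum_smul, sum_finsupport_complex, one_smul]
    exact h3 _ fun c hc => mfderiv_form (mem_source_of_mem_finsupport hf hc) hσ hτ v

variable (Ω) in
theorem exists_symplecticConnection [T2Space X] [SecondCountableTopology X] :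
    ∃ cov : TangentConnection E X, IsSymplecticConnection Ω cov := by
  have : FiniteDimensional ℝ E := FiniteDimensional.complexToReal E
  have : LocallyCompactSpace X := ChartedSpace.locallyCompactSpace E X
  obtain ⟨f, hf⟩ := SmoothPartitionOfUnity.exists_isSubordinate_chartAt_source 𝓘(ℝ, E) X
  exact ⟨_, isSymplecticConnection_symplecticConnection hf⟩

end Gluing
end HolWeyl

set_option maxSynthPendingDepth 1

theorem mainTheorem7 {E : Type} [NormedAddCommGroup E] [NormedSpace ℂ E] [FiniteDimensional ℂ E]
    {X : Type} [TopologicalSpace X] [T2Space X] [SecondCountableTopology X] [ChartedSpace E X]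
    [IsManifold 𝓘(ℂ, E) ω X] (Ω : HolWeyl.HolomorphicSymplecticForm E X) :
    (∃ cov : HolWeyl.TangentConnection E X, HolWeyl.IsSymplecticConnection Ω cov) ∧
    ∀ cov : HolWeyl.TangentConnection E X, HolWeyl.IsSymplecticConnection Ω cov →
      (∃ I : X → HolWeyl.QuantumWeylFibre E 1, HolWeyl.IsInteraction I ∧
        HolWeyl.IsFlatModHbar Ω cov I) ∧
      ∀ I : X → HolWeyl.QuantumWeylFibre E 1, HolWeyl.IsInteraction I →
        HolWeyl.IsWeylConnection (fun _ => HolWeyl.fedosovD Ω cov I) ∧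
        (∀ (k : ℕ) (s : X → HolWeyl.QuantumWeylFibre E k) (x : X),
          HolWeyl.weylBracket Ω x (I x) (s x) 0 = 0 ∧
          HolWeyl.fedosovD Ω cov I s x 0 =
            HolWeyl.classicalD Ω cov I k (fun x' => s x' 0) x) ∧
        (HolWeyl.IsFlatModHbar Ω cov I →
          ∃ (hD : ∀ k, HolWeyl.IsLocalOperator (HolWeyl.weylSections E X k)
              (HolWeyl.weylSections E X (k + 1)) (HolWeyl.classicalD Ω cov I k))
            (hDD : HolWeyl.SquaresToZero (HolWeyl.weylSections E X)
              (HolWeyl.classicalD Ω cov I))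
            (hdbar : ∀ k, HolWeyl.IsLocalOperator (HolWeyl.dolbeaultForms E X k)
              (HolWeyl.dolbeaultForms E X (k + 1)) (HolWeyl.dbar k))
            (hdbar2 : HolWeyl.SquaresToZero (HolWeyl.dolbeaultForms E X)
              HolWeyl.dbar)
            (hπ : ∀ k, HolWeyl.IsLocalOperator (HolWeyl.weylSections E X k)
              (HolWeyl.dolbeaultForms E X k) (HolWeyl.weylProjection k))
            (hπD : HolWeyl.Intertwines (HolWeyl.weylSections E X)
              (HolWeyl.classicalD Ω cov I) HolWeyl.dbar HolWeyl.weylProjection),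
            QuasiIso (HolWeyl.complexHomOf hD hDD hdbar hdbar2 hπ hπD)) := by
  refine ⟨HolWeyl.exists_symplecticConnection Ω, fun cov hc =>
    ⟨HolWeyl.exists_flat_interaction hc, fun I hI =>
      ⟨HolWeyl.isWeylConnection_fedosovD hc hI.1, fun k s x =>
        ⟨HolWeyl.weylBracket_zero Ω x (I x) (s x),
          HolWeyl.fedosovD_zero_eq_classicalD Ω cov I s x⟩, fun hflat => ?_⟩⟩⟩
  exact ⟨HolWeyl.isLocalOperator_classicalD hc hI.1, HolWeyl.squaresToZero_classicalD hflat,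
    HolWeyl.isLocalOperator_dbar hc hI, HolWeyl.squaresToZero_dbar hc hI hflat,
    HolWeyl.isLocalOperator_weylProjection, HolWeyl.intertwines_weylProjection hI,
    HolWeyl.quasiIso_weylProjection hc hI hflat⟩
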